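/- **Setting.** Let $\mathbb K=\mathbb R$ or $\mathbb C$, $G$ an abelian group and $\rho\colon G\times G\to\mathbb K$ a commutation factor: $\rho(i,j)\rho(j,i)=1$ and $\rho(i+j,k)=\rho(i,k)\rho(j,k)$. Then $\rho(i,i)=\pm1$; $i$ is called even if $\rho(i,i)=1$ and odd if $\rho(i,i)=-1$. A $\rho$-manifold $M$ is a connected $n$-dimensional manifold (smooth, real analytic or holomorphic) with a sheaf $\mathscr O_\rho$ of $G$-graded $\mathbb K$-algebras (each homogeneous component is a sheaf) and an atlas of coordinate neighbourhoods $U$ on which $\mathscr O_\rho\cong\mathscr O[[x^{n+1},\dots,x^{n+m}]]_\bullet$. Here $x^1,\dots,x^n$ are coordinates on $U$ (of degree $0$), $\mathscr O$ is the sheaf of $\mathbb K$-valued functions of the given regularity, $x^{n+1},\dots,x^{n+m}$ are indeterminates of fixed degrees in $G$ with $x^ax^b=\rho(|x^a|,|x^b|)x^bx^a$, and $(\ )_\bullet$ means that only finitely many homogeneous components are nonzero. All sums over $a,b$ run over $1,\dots,n+m$, and $\partial/\partial x^a$ is the $\rho$-derivation of degree $-|x^a|$ with $\partial x^b/\partial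 x^a=\delta_{a,b}$. A vector field of degree $|X|$ is a $\rho$-derivation of the sheaf $\mathscr O_\rho$, that is, $X(fg)=X(f)g+\rho(|X|,|f|)fX(g)$; locally $X=\sum_aX^a\,\partial/\partial x^a$ with $X^a=X(x^a)$. It is homological if $\rho(|X|,|X|)=-1$ and $[X,X]_\rho=2X\circ X=0$. **Volume forms and divergence.** Let $F=(f_{k,l})$ be a square matrix with $|f_{k,l}|=i_k-i_l$. If all $i_k$ are even or all are odd, its $\rho$-determinant is defined by $\rho\mathrm{det}(F)\,t_1\cdots t_r=\sum_{\sigma}f_{1,\sigma(1)}t_{\sigma(1)}\cdots f_{r,\sigma(r)}t_{\sigma(r)}$, with indeterminates $t_k$ of degree $i_k$ such that $t_kf=\rho(i_k,|f|)ft_k$, and $t_kt_l=-\rho(i_k,i_l)t_lt_k$ for $k\ne l$ in the even case, $t_kt_l=\rho(i_k,i_l)t_lt_k$ in the odd case. In general, decompose $F$ into the blocks $F_{00},F_{01},F_{10},F_{11}$ of even and odd indices and put $\rho\mathrm{Ber}(F)=\rho\mathrm{det}(F_{00}-F_{01}F_{11}^{-1}F_{10})\,\rho\mathrm{det}(F_{11})^{-1}$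 if $F_{00}$ and $F_{11}$ are invertible, and $\rho\mathrm{Ber}(F)=0$ otherwise. A volume form $\mathrm{vol}$ on $M$ is given by local expressions $\mathrm{vol}=D(x)s(x)$, with $s(x)$ invertible of degree $0$, where the local frames satisfy $D(y)=D(x)\,\rho\mathrm{Ber}(\partial y/\partial x)$; here $\partial y/\partial x$ is the Jacobian matrix with entry $\partial y^a/\partial x^b$ in row $b$ and column $a$. The divergence $\mathrm{Div}_{\mathrm{vol}}X\in\mathscr O_\rho(M)$ is defined by $\mathrm{vol}\cdot\mathrm{Div}_{\mathrm{vol}}X=L_X\mathrm{vol}$, that is, in every coordinate system $$s\cdot\mathrm{Div}_{\mathrm{vol}}X=\sum_a\rho(|x^a|,|x^a|+|X|)\,\frac{\partial}{\partial x^a}(X^as).$$ For a homological vector field $Q$ let $H_Q^k(M)$ be the cohomology of the complex with terms $\mathscr O_\rho(M)_{k|Q|}$, $k\in\mathbb Z$, and differential $Q$, and let $\mathrm{Mod}_Q(M;\mathrm{vol})=[\mathrm{Div}_{\mathrm{vol}}Q]\in H^1_Q(M)$. **The shifted cotangent bundle.** Let $i\in G$. The degree-$i$ shifted cotangent bundle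 $[-i]T^*M$ is the $\rho$-manifold over the same underlying manifold with coordinates $(x^a,x_a^*)$, $|x_a^*|=-|x^a|-i$, whose functions are locally the elements of $\mathscr O[[x^{n+1},\dots,x^{n+m},x_1^*,\dots,x_{n+m}^*]]_\bullet$, with the coordinate changes of $M$ and $y_a^*=\sum_b\frac{\partial x^b}{\partial y^a}x_b^*$. Let $\pi^*\colon\mathscr O_\rho(M)\to\mathscr O_\rho([-i]T^*M)$ be the pullback along the projection. The degree-$i$ Schouten bracket is $$[\![f,g]\!]=\sum_a\Big(\rho(|f|+|x^a|+i,|x^a|+i)\frac{\partial f}{\partial x_a^*}\frac{\partial g}{\partial x^a}-\rho(|x^a|,|f|+i)\frac{\partial f}{\partial x^a}\frac{\partial g}{\partial x_a^*}\Big).$$ **Statement.** Let $M$ be a $\rho$-manifold with a homological vector field $Q$ and a volume form $\mathrm{vol}$, and let $i\in G$. Then $[-i]T^*M$ is a $\rho$-manifold, and the following objects on it exist and are uniquely determined: the function $f_Q$ of degree $|Q|-i$ with local expression $\sum_aQ^ax_a^*$; the vector field $\widetilde Q=[\![f_Q,-]\!]$, which is homological of degree $|Q|$ and satisfies $\widetilde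 Q\circ\pi^*=\pi^*\circ Q$; and the volume form $\widetilde{\mathrm{vol}}$ induced by $\mathrm{vol}$, namely $\widetilde{\mathrm{vol}}=D(x,x^*)$ if $i$ is even and $\widetilde{\mathrm{vol}}=D(x,x^*)s(x)^2$ if $i$ is odd, where $\mathrm{vol}=D(x)s(x)$. The divergences and modular classes of $Q$ and $\widetilde Q$ are well defined, and $$\mathrm{Div}_{\widetilde{\mathrm{vol}}}\widetilde Q=(1-\rho(i,i))\,\pi^*\mathrm{Div}_{\mathrm{vol}}Q,\qquad \mathrm{Mod}_{\widetilde Q}([-i]T^*M;\widetilde{\mathrm{vol}})=(1-\rho(i,i))\,\pi^*\mathrm{Mod}_Q(M;\mathrm{vol}),$$ where in the second equation $\pi^*\colon H^1_Q(M)\to H^1_{\widetilde Q}([-i]T^*M)$ is the induced map. -/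

import Mathlib

open scoped Manifold ContDiff

set_option linter.unusedSectionVars false
set_option linter.checkUnivs false

noncomputable section

open Function TopologicalSpace

namespace RhoGeometry

open scoped Classical in
/-- Auxiliary: the (finite) product over all ordered pairs `l < k` of a linearly ordered type. -/
def pairProd {J K : Type*} [Fintype J] [LinearOrder J] [CommMonoid K] (φ : J → J → K) : K :=
  ∏ l : J, ∏ k : J, if l < k then φ l k else 1

/-- A commutation factor on the abelian group `G` with values in `K`. -/
structure CommutationFactor (G K : Type*) [AddCommGroup G] [Field K] where
  toFun : G → G → K
  mul_swap : ∀ i j, toFun i j * toFun j i = 1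
  add_left : ∀ i j k, toFun (i + j) k = toFun i k * toFun j k

instance {G K : Type*} [AddCommGroup G] [Field K] :
    CoeFun (CommutationFactor G K) (fun _ => G → G → K) := ⟨CommutationFactor.toFun⟩

namespace CommutationFactor

variable {G K : Type*} [AddCommGroup G] [Field K] (ρ : CommutationFactor G K)

lemma ne_zero (i j : G) : ρ i j ≠ 0 := left_ne_zero_of_mul_eq_one (ρ.mul_swap i j)

lemma zero_left (j : G) : ρ 0 j = 1 := by
  have h := ρ.add_left 0 0 j
  rw [add_zero] at h
  exact (mul_eq_left₀ (ρ.ne_zero 0 j)).1 h.symm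

/-- `i` is odd if `ρ(i,i) = -1` (otherwise `ρ(i,i) = 1` and `i` is even). -/
def IsOdd (i : G) : Prop := ρ i i = -1

end CommutationFactor

/-! ### Formal power series in graded indeterminates -/

section Series

variable {G K : Type*} [AddCommGroup G] [Field K] (ρ : CommutationFactor G K)
variable {ι : Type*} [Fintype ι] [LinearOrder ι] (d : ι → G)

/-- The degree of the monomial `x ^ w`. -/
def wdeg (w : ι →₀ ℕ) : G := ∑ b, w b • d b

lemma wdeg_add (u v : ι →₀ ℕ) : wdeg d (u + v) = wdeg d u + wdeg d v := by
  simp [wdeg, add_smul, Finset.sum_add_distrib]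

/-- The exponents `w` for which the ordered monomial `x ^ w` is nonzero: the square of an odd
indeterminate vanishes. -/
def IsGood (w : ι →₀ ℕ) : Prop := ∀ b, ρ.IsOdd (d b) → w b ≤ 1

variable {ρ d} in
lemma IsGood.mono {u v : ι →₀ ℕ} (h : IsGood ρ d v) (huv : u ≤ v) : IsGood ρ d u :=
  fun b hb => (huv b).trans (h b hb)

/-- The scalar `c(u, v)` in `x ^ u * x ^ v = c(u, v) x ^ (u + v)`, coming from moving `x_b`
(in the second factor) to the left of `x_a` (in the first factor) for `b < a`. -/
def tw (u v : ι →₀ ℕ) : K := pairProd fun b a => ρ (d a) (d b) ^ (u a * v b)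

lemma tw_add_left (u u' v : ι →₀ ℕ) : tw ρ d (u + u') v = tw ρ d u v * tw ρ d u' v := by
  simp only [tw, pairProd, ← Finset.prod_mul_distrib]
  refine Finset.prod_congr rfl fun b _ => Finset.prod_congr rfl fun a _ => ?_
  split_ifs <;> simp [add_mul, pow_add]

lemma tw_add_right (u v v' : ι →₀ ℕ) : tw ρ d u (v + v') = tw ρ d u v * tw ρ d u v' := by
  simp only [tw, pairProd, ← Finset.prod_mul_distrib]
  refine Finset.prod_congr rfl fun b _ => Finset.prod_congr rfl fun a _ => ?_
  split_ifs <;> simp [mul_add, pow_add]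

@[simp] lemma tw_zero_left (v : ι →₀ ℕ) : tw ρ d 0 v = 1 := by simp [tw, pairProd]

@[simp] lemma tw_zero_right (u : ι →₀ ℕ) : tw ρ d u 0 = 1 := by simp [tw, pairProd]

variable (R : Type*) [CommRing R] [Algebra K R]

/-- The coefficient families of the elements of `R[[x_b : b ∈ ι]]_•`: formal power series
`∑ f_w x ^ w`, with `f_w = 0` whenever `x ^ w = 0`, having only finitely many nonzero homogeneous
components. -/
def seriesSubmodule : Submodule K ((ι →₀ ℕ) → R) where
  carrier := {f | (∀ w, ¬ IsGood ρ d w → f w = 0) ∧ ∃ S : Finset G, ∀ w, f w ≠ 0 → wdeg d w ∈ S}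
  zero_mem' := ⟨fun _ _ => rfl, ∅, fun _ h => absurd rfl h⟩
  add_mem' := by
    classical
    rintro f g ⟨hf, S, hS⟩ ⟨hg, T, hT⟩
    refine ⟨fun w hw => by simp [hf w hw, hg w hw], S ∪ T, fun w hw => ?_⟩
    by_cases h : f w = 0
    · refine Finset.mem_union_right _ (hT w fun h' => hw (by simp [h, h']))
    · exact Finset.mem_union_left _ (hS w h)
  smul_mem' := by
    rintro c f ⟨hf, S, hS⟩
    exact ⟨fun w hw => by simp [hf w hw], S, fun w hw => hS w fun h => hw (by simp [h])⟩

/-- The `ρ`-commutative algebra `R[[x_b : b ∈ ι]]_•`. -/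
def Series : Type _ := seriesSubmodule ρ d R

variable {ρ d R}

namespace Series

instance : AddCommGroup (Series ρ d R) := inferInstanceAs (AddCommGroup (seriesSubmodule ρ d R))
instance : Module K (Series ρ d R) := inferInstanceAs (Module K (seriesSubmodule ρ d R))

/-- The coefficient of `x ^ w`. -/
def coeff (f : Series ρ d R) (w : ι →₀ ℕ) : R := f.1 w

@[ext] lemma ext {f g : Series ρ d R} (h : ∀ w, f.coeff w = g.coeff w) : f = g :=
  Subtype.ext (funext h)

lemma coeff_of_not_good (f : Series ρ d R) {w : ι →₀ ℕ} (h : ¬ IsGood ρ d w) : f.coeff w = 0 :=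
  f.2.1 w h

@[simp] lemma coeff_zero (w : ι →₀ ℕ) : (0 : Series ρ d R).coeff w = 0 := rfl
@[simp] lemma coeff_add (f g : Series ρ d R) (w : ι →₀ ℕ) :
    (f + g).coeff w = f.coeff w + g.coeff w := rfl
@[simp] lemma coeff_smul (c : K) (f : Series ρ d R) (w : ι →₀ ℕ) :
    (c • f).coeff w = c • f.coeff w := rfl

open scoped Classical in
/-- The monomial `r x ^ w` (which is zero if `x ^ w = 0`). -/
def monomial (w : ι →₀ ℕ) (r : R) : Series ρ d R :=
  ⟨fun u => if u = w ∧ IsGood ρ d w then r else 0, fun u hu => if_neg fun h => hu (by rw [h.1]; exact h.2),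
    {wdeg d w}, fun u hu => by
      by_cases h : u = w
      · simp [h]
      · exact absurd (if_neg fun h' => h h'.1) hu⟩

open scoped Classical in
lemma coeff_monomial (w u : ι →₀ ℕ) (r : R) :
    (monomial w r : Series ρ d R).coeff u = if u = w ∧ IsGood ρ d w then r else 0 := rfl

lemma isGood_zero : IsGood ρ d 0 := fun _ _ => Nat.zero_le _

instance : One (Series ρ d R) := ⟨monomial 0 1⟩

open scoped Classical in
lemma coeff_one (u : ι →₀ ℕ) : (1 : Series ρ d R).coeff u = if u = 0 then 1 else 0 := by
  change (monomial 0 1 : Series ρ d R).coeff u = _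
  simp [coeff_monomial, isGood_zero]

open scoped Classical in
instance : Mul (Series ρ d R) where
  mul f g := ⟨fun w => if IsGood ρ d w then
      ∑ p ∈ Finset.HasAntidiagonal.antidiagonal w, tw ρ d p.1 p.2 • (f.coeff p.1 * g.coeff p.2) else 0,
    fun w hw => if_neg hw, by
      obtain ⟨_, S, hS⟩ := f.2
      obtain ⟨_, T, hT⟩ := g.2
      refine ⟨Finset.image₂ (· + ·) S T, fun w hw => ?_⟩
      have h1 : ∑ p ∈ Finset.HasAntidiagonal.antidiagonal w, tw ρ d p.1 p.2 • (f.coeff p.1 * g.coeff p.2) ≠ 0 := by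
        intro h
        apply hw
        simp [h]
      obtain ⟨p, hp, hne⟩ := Finset.exists_ne_zero_of_sum_ne_zero h1
      rw [← Finset.HasAntidiagonal.mem_antidiagonal.1 hp, wdeg_add]
      exact Finset.mem_image₂_of_mem (hS _ fun h => hne (by simp [coeff, h]))
        (hT _ fun h => hne (by simp [coeff, h]))⟩

open scoped Classical in
lemma coeff_mul' (f g : Series ρ d R) (w : ι →₀ ℕ) :
    (f * g).coeff w = if IsGood ρ d w then
      ∑ p ∈ Finset.HasAntidiagonal.antidiagonal w, tw ρ d p.1 p.2 • (f.coeff p.1 * g.coeff p.2) else 0 := rfl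

lemma coeff_mul (f g : Series ρ d R) {w : ι →₀ ℕ} (hw : IsGood ρ d w) :
    (f * g).coeff w =
      ∑ p ∈ Finset.HasAntidiagonal.antidiagonal w, tw ρ d p.1 p.2 • (f.coeff p.1 * g.coeff p.2) := by
  rw [coeff_mul', if_pos hw]

/-- Two series agree if their coefficients at the admissible exponents do. -/
lemma ext_good {f g : Series ρ d R} (h : ∀ w, IsGood ρ d w → f.coeff w = g.coeff w) : f = g := by
  ext w
  by_cases hw : IsGood ρ d w
  · exact h w hw
  · rw [coeff_of_not_good _ hw, coeff_of_not_good _ hw]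

lemma good_fst {w : ι →₀ ℕ} (hw : IsGood ρ d w) {p : (ι →₀ ℕ) × (ι →₀ ℕ)}
    (hp : p ∈ Finset.HasAntidiagonal.antidiagonal w) : IsGood ρ d p.1 :=
  hw.mono (by rw [← Finset.HasAntidiagonal.mem_antidiagonal.1 hp]; exact le_self_add)

lemma good_snd {w : ι →₀ ℕ} (hw : IsGood ρ d w) {p : (ι →₀ ℕ) × (ι →₀ ℕ)}
    (hp : p ∈ Finset.HasAntidiagonal.antidiagonal w) : IsGood ρ d p.2 :=
  hw.mono (by rw [← Finset.HasAntidiagonal.mem_antidiagonal.1 hp]; exact le_add_self)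

protected lemma mul_assoc (f g h : Series ρ d R) : f * g * h = f * (g * h) := by
  refine ext_good fun w hw => ?_
  rw [coeff_mul _ _ hw, coeff_mul _ _ hw]
  have e1 : ∀ p ∈ Finset.HasAntidiagonal.antidiagonal w, tw ρ d p.1 p.2 • ((f * g).coeff p.1 * h.coeff p.2) =
      ∑ q ∈ Finset.HasAntidiagonal.antidiagonal p.1, (tw ρ d p.1 p.2 * tw ρ d q.1 q.2) •
        (f.coeff q.1 * g.coeff q.2 * h.coeff p.2) := fun p hp => by
    rw [coeff_mul _ _ (good_fst hw hp), Finset.sum_mul, Finset.smul_sum]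
    exact Finset.sum_congr rfl fun q _ => by rw [smul_mul_assoc, smul_smul]
  have e2 : ∀ p ∈ Finset.HasAntidiagonal.antidiagonal w, tw ρ d p.1 p.2 • (f.coeff p.1 * (g * h).coeff p.2) =
      ∑ q ∈ Finset.HasAntidiagonal.antidiagonal p.2, (tw ρ d p.1 p.2 * tw ρ d q.1 q.2) •
        (f.coeff p.1 * g.coeff q.1 * h.coeff q.2) := fun p hp => by
    rw [coeff_mul _ _ (good_snd hw hp), Finset.mul_sum, Finset.smul_sum]
    exact Finset.sum_congr rfl fun q _ => by rw [mul_smul_comm, smul_smul, mul_assoc]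
  rw [Finset.sum_congr rfl e1, Finset.sum_congr rfl e2, Finset.sum_sigma', Finset.sum_sigma']
  refine Finset.sum_nbij' (fun x => ⟨(x.2.1, x.2.2 + x.1.2), (x.2.2, x.1.2)⟩)
    (fun x => ⟨(x.1.1 + x.2.1, x.2.2), (x.1.1, x.2.1)⟩) ?_ ?_ ?_ ?_ ?_
  · rintro ⟨⟨a, b⟩, ⟨c, e⟩⟩ hx
    simp only [Finset.mem_sigma, Finset.HasAntidiagonal.mem_antidiagonal] at hx ⊢
    obtain ⟨h1, h2⟩ := hx
    subst h2
    exact ⟨by rw [← h1, add_assoc], trivial⟩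
  · rintro ⟨⟨a, b⟩, ⟨c, e⟩⟩ hx
    simp only [Finset.mem_sigma, Finset.HasAntidiagonal.mem_antidiagonal] at hx ⊢
    obtain ⟨h1, h2⟩ := hx
    subst h2
    exact ⟨by rw [← h1, add_assoc], trivial⟩
  · rintro ⟨⟨a, b⟩, ⟨c, e⟩⟩ hx
    simp only [Finset.mem_sigma, Finset.HasAntidiagonal.mem_antidiagonal] at hx ⊢
    obtain ⟨h1, h2⟩ := hx
    subst h2
    rfl
  · rintro ⟨⟨a, b⟩, ⟨c, e⟩⟩ hx
    simp only [Finset.mem_sigma, Finset.HasAntidiagonal.mem_antidiagonal] at hx ⊢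
    obtain ⟨h1, h2⟩ := hx
    subst h2
    rfl
  · rintro ⟨⟨a, b⟩, ⟨c, e⟩⟩ hx
    simp only [Finset.mem_sigma, Finset.HasAntidiagonal.mem_antidiagonal] at hx ⊢
    obtain ⟨h1, h2⟩ := hx
    subst h2
    congr 1
    rw [tw_add_left, tw_add_right]
    ring

protected lemma one_mul (f : Series ρ d R) : 1 * f = f := by
  classical
  refine ext_good fun w hw => ?_
  rw [coeff_mul _ _ hw, Finset.sum_eq_single (0, w)]
  · simp [coeff_one]
  · rintro ⟨a, b⟩ hp hne
    have : a ≠ 0 := by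
      rintro rfl
      apply hne
      rw [Finset.HasAntidiagonal.mem_antidiagonal] at hp
      simpa using hp
    simp [coeff_one, this]
  · simp

protected lemma mul_one (f : Series ρ d R) : f * 1 = f := by
  classical
  refine ext_good fun w hw => ?_
  rw [coeff_mul _ _ hw, Finset.sum_eq_single (w, 0)]
  · simp [coeff_one]
  · rintro ⟨a, b⟩ hp hne
    have : b ≠ 0 := by
      rintro rfl
      apply hne
      rw [Finset.HasAntidiagonal.mem_antidiagonal] at hp
      simpa using hp
    simp [coeff_one, this]
  · simp

instance : Ring (Series ρ d R) where
  __ := (inferInstance : AddCommGroup (Series ρ d R))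
  left_distrib f g h := ext_good fun w hw => by
    simp [coeff_mul _ _ hw, mul_add, Finset.sum_add_distrib]
  right_distrib f g h := ext_good fun w hw => by
    simp [coeff_mul _ _ hw, add_mul, Finset.sum_add_distrib]
  zero_mul f := ext_good fun w hw => by simp [coeff_mul _ _ hw]
  mul_zero f := ext_good fun w hw => by simp [coeff_mul _ _ hw]
  mul_assoc := Series.mul_assoc
  one_mul := Series.one_mul
  mul_one := Series.mul_one

instance : Algebra K (Series ρ d R) := Algebra.ofModule
  (fun c f g => ext_good fun w hw => by
    simp only [coeff_mul _ _ hw, coeff_smul, Finset.smul_sum]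
    exact Finset.sum_congr rfl fun p _ => by rw [smul_mul_assoc, smul_comm])
  (fun c f g => ext_good fun w hw => by
    simp only [coeff_mul _ _ hw, coeff_smul, Finset.smul_sum]
    exact Finset.sum_congr rfl fun p _ => by rw [mul_smul_comm, smul_comm])

/-- The homogeneous series of degree `j`. -/
def grade (j : G) : Submodule K (Series ρ d R) where
  carrier := {f | ∀ w, f.coeff w ≠ 0 → wdeg d w = j}
  zero_mem' := fun _ h => absurd rfl h
  add_mem' := by
    intro f g hf hg w hw
    by_cases h : f.coeff w = 0
    · exact hg w fun h' => hw (by simp [h, h'])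
    · exact hf w h
  smul_mem' := fun c f hf w hw => hf w fun h => hw (by simp [h])

lemma one_mem_grade : (1 : Series ρ d R) ∈ grade (ρ := ρ) (d := d) (R := R) 0 := by
  classical
  intro w hw
  rw [coeff_one] at hw
  have : w = 0 := by
    by_contra h
    simp [h] at hw
  simp [this, wdeg]

lemma exists_of_coeff_mul_ne_zero {f g : Series ρ d R} {w : ι →₀ ℕ} (hw : (f * g).coeff w ≠ 0) :
    ∃ u v, u + v = w ∧ f.coeff u ≠ 0 ∧ g.coeff v ≠ 0 := by
  have hgood : IsGood ρ d w := by
    by_contra h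
    exact hw (coeff_of_not_good _ h)
  rw [coeff_mul _ _ hgood] at hw
  obtain ⟨p, hp, hne⟩ := Finset.exists_ne_zero_of_sum_ne_zero hw
  exact ⟨p.1, p.2, Finset.HasAntidiagonal.mem_antidiagonal.1 hp, fun h => hne (by simp [h]),
    fun h => hne (by simp [h])⟩

lemma mul_mem_grade {i j : G} {f g : Series ρ d R} (hf : f ∈ grade i) (hg : g ∈ grade j) :
    f * g ∈ grade (i + j) := by
  intro w hw
  obtain ⟨u, v, rfl, hu, hv⟩ := exists_of_coeff_mul_ne_zero hw
  rw [wdeg_add, hf u hu, hg v hv]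

/-- Applying a map of coefficients that preserves zero. -/
def mapCoeff {R' : Type*} [CommRing R'] [Algebra K R'] (φ : R → R') (hφ : φ 0 = 0)
    (f : Series ρ d R) : Series ρ d R' :=
  ⟨fun w => φ (f.coeff w), fun w hw => by
    change φ (f.coeff w) = 0
    rw [coeff_of_not_good _ hw, hφ], by
    obtain ⟨_, S, hS⟩ := f.2
    exact ⟨S, fun w hw => hS w fun h => hw (by simp [coeff, h, hφ])⟩⟩

/-- The change of coefficients along a homomorphism of `K`-algebras. -/
def map {R' : Type*} [CommRing R'] [Algebra K R'] (φ : R →ₐ[K] R') :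
    Series ρ d R →ₐ[K] Series ρ d R' :=
  AlgHom.ofLinearMap
    { toFun := mapCoeff φ (map_zero φ)
      map_add' := fun f g => ext fun w => map_add φ _ _
      map_smul' := fun c f => ext fun w => map_smul φ c _ }
    (ext fun w => by
      classical
      change φ ((1 : Series ρ d R).coeff w) = _
      rw [coeff_one, coeff_one]
      split_ifs <;> simp)
    (fun f g => ext_good fun w hw => by
      change φ ((f * g).coeff w) = _
      rw [coeff_mul _ _ hw, coeff_mul _ _ hw, map_sum]
      exact Finset.sum_congr rfl fun p _ => by
        rw [map_smul, map_mul]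
        rfl)

@[simp] lemma coeff_map {R' : Type*} [CommRing R'] [Algebra K R'] (φ : R →ₐ[K] R')
    (f : Series ρ d R) (w : ι →₀ ℕ) : (map φ f).coeff w = φ (f.coeff w) := rfl

lemma map_mem_grade {R' : Type*} [CommRing R'] [Algebra K R'] (φ : R →ₐ[K] R') {j : G}
    {f : Series ρ d R} (hf : f ∈ grade j) : map φ f ∈ grade j :=
  fun w hw => hf w fun h => hw (by simp [h])

/-- The indeterminate `x_b`. -/
def X (b : ι) : Series ρ d R := monomial (Finsupp.single b 1) 1

/-- The partial derivative `∂/∂x_b`, that is, the `ρ`-derivation of degree `-|x_b|` with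
`∂x_c/∂x_b = δ_{b c}` that kills the coefficients:
`∂_b x ^ v = (∏_{c < b} ρ(-|x_b|, |x_c|) ^ v_c) v_b x ^ (v - e_b)`. -/
def pd (b : ι) (f : Series ρ d R) : Series ρ d R :=
  ⟨fun w => (((w b + 1 : ℕ) : K) * ∏ c : ι, if c < b then ρ (-d b) (d c) ^ w c else 1) •
      f.coeff (w + Finsupp.single b 1),
    fun w hw => by
      have h0 : f.coeff (w + Finsupp.single b 1) = 0 :=
        coeff_of_not_good f fun h => hw (h.mono le_self_add)
      simp [h0], by
    classical
    obtain ⟨_, S, hS⟩ := f.2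
    refine ⟨S.image fun j => j - d b, fun w hw => ?_⟩
    have h1 := hS (w + Finsupp.single b 1) fun h => hw (by simp [coeff, h])
    refine Finset.mem_image.2 ⟨_, h1, ?_⟩
    rw [wdeg_add]
    simp [wdeg, Finsupp.single_apply, ite_smul]⟩

end Series

end Series

/-! ### The algebra of functions of the underlying manifold -/

/-- The regularity of the underlying manifold: smooth or analytic. -/
inductive Regularity where
  | smooth
  | analytic

/-- The corresponding differentiability order in Mathlib. -/
def Regularity.order : Regularity → WithTop ℕ∞
  | .smooth => ∞
  | .analytic => ω

lemma Regularity.order_add_one_le (r : Regularity) : r.order + 1 ≤ r.order := by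
  cases r <;> simp [Regularity.order]

lemma Regularity.one_le_order (r : Regularity) : 1 ≤ r.order :=
  le_trans (by simp) r.order_add_one_le

section Body

variable (𝕜 K : Type*) [RCLike 𝕜] [RCLike K] [NormedAlgebra 𝕜 K] (n : ℕ) (r : Regularity)
variable {X : Type*} [TopologicalSpace X] [ChartedSpace (EuclideanSpace 𝕜 (Fin n)) X]

/-- The algebra `𝒪(W)` of `K`-valued functions on `W` of the given regularity over `𝕜`. -/
def bodyFun (W : Opens X) : Subalgebra K (W → K) where
  carrier := {f | ContMDiff 𝓘(𝕜, EuclideanSpace 𝕜 (Fin n)) 𝓘(𝕜, K) r.order f}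
  mul_mem' := fun {f g} hf hg => by
    have : ContDiff 𝕜 r.order (fun p : K × K => p.1 * p.2) := contDiff_fst.mul contDiff_snd
    exact this.contMDiff.comp (hf.prodMk_space hg)
  add_mem' := fun {f g} hf hg => by
    have : ContDiff 𝕜 r.order (fun p : K × K => p.1 + p.2) := contDiff_fst.add contDiff_snd
    exact this.contMDiff.comp (hf.prodMk_space hg)
  algebraMap_mem' := fun c => contMDiff_const

/-- Restriction of functions. -/
def bodyRes {V W : Opens X} (h : V ≤ W) : bodyFun 𝕜 K n r W →ₐ[K] bodyFun 𝕜 K n r V where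
  toFun f := ⟨fun p => f.1 ⟨p.1, h p.2⟩, fun p => by
    have h1 : ContMDiffAt 𝓘(𝕜, EuclideanSpace 𝕜 (Fin n)) 𝓘(𝕜, K) r.order
        (fun q : W => extend Subtype.val f.1 0 q.1) ⟨p.1, h p.2⟩ := by
      simpa only [Subtype.val_injective.extend_apply] using f.2 ⟨p.1, h p.2⟩
    have h2 := contMDiffAt_subtype_iff (U := V) (x := p) |>.2
      ((contMDiffAt_subtype_iff (U := W)).1 h1)
    refine h2.congr_of_eventuallyEq (Filter.Eventually.of_forall fun q => ?_)
    exact (Subtype.val_injective.extend_apply f.1 0 (⟨q.1, h q.2⟩ : W)).symm⟩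
  map_one' := rfl
  map_mul' _ _ := rfl
  map_zero' := rfl
  map_add' _ _ := rfl
  commutes' _ := rfl

variable {𝕜 K n r}
variable {e : OpenPartialHomeomorph X (EuclideanSpace 𝕜 (Fin n))}

/-- The coordinate function `x^a` of the chart `e`. -/
def bodyCoord (he : e ∈ IsManifold.maximalAtlas 𝓘(𝕜, EuclideanSpace 𝕜 (Fin n)) r.order X)
    (W : Opens X) (hW : (W : Set X) ⊆ e.source) (a : Fin n) : bodyFun 𝕜 K n r W :=
  ⟨fun p => algebraMap 𝕜 K (e p.1 a), fun p => by
    have h1 := contMDiffAt_of_mem_maximalAtlas he (hW p.2)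
    have h2 : ContDiff 𝕜 r.order
        (fun v : EuclideanSpace 𝕜 (Fin n) => algebraMap 𝕜 K (v a)) :=
      (Algebra.linearMap 𝕜 K).toContinuousLinearMap.contDiff.comp
        (EuclideanSpace.proj (𝕜 := 𝕜) a).contDiff
    exact contMDiffAt_subtype_iff.2 (h2.contMDiff.contMDiffAt.comp p.1 h1)⟩

/-- The partial derivative `∂f/∂x^a` in the chart `e`, for a function `f` on `W ⊆ e.source`. -/
def bodyPd (he : e ∈ IsManifold.maximalAtlas 𝓘(𝕜, EuclideanSpace 𝕜 (Fin n)) r.order X)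
    {W : Opens X} (hW : (W : Set X) ⊆ e.source) (a : Fin n) (f : bodyFun 𝕜 K n r W) :
    bodyFun 𝕜 K n r W :=
  ⟨fun p => fderiv 𝕜 (extend Subtype.val f.1 0 ∘ e.symm) (e p.1) (EuclideanSpace.single a 1),
    fun p => by
    have hp := hW p.2
    have h1 : ContMDiffAt 𝓘(𝕜, EuclideanSpace 𝕜 (Fin n)) 𝓘(𝕜, K) r.order
        (extend Subtype.val f.1 (0 : X → K)) p.1 := by
      refine contMDiffAt_subtype_iff.1 ?_
      simpa only [Subtype.val_injective.extend_apply] using f.2 p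
    have h2 := contMDiffAt_symm_of_mem_maximalAtlas he (e.map_source hp)
    have h3 : ContDiffAt 𝕜 r.order (extend Subtype.val f.1 (0 : X → K) ∘ e.symm) (e p.1) :=
      (ContMDiffAt.comp (e p.1) (by rwa [e.left_inv hp]) h2).contDiffAt
    have h4 := (h3.fderiv_right r.order_add_one_le).clm_apply
      (contDiffAt_const (c := (EuclideanSpace.single a 1 : EuclideanSpace 𝕜 (Fin n))))
    exact contMDiffAt_subtype_iff.2
      (h4.contMDiffAt.comp p.1 (contMDiffAt_of_mem_maximalAtlas he hp))⟩

lemma bodyPd_zero (he : e ∈ IsManifold.maximalAtlas 𝓘(𝕜, EuclideanSpace 𝕜 (Fin n)) r.order X)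
    {W : Opens X} (hW : (W : Set X) ⊆ e.source) (a : Fin n) :
    bodyPd he hW a (0 : bodyFun 𝕜 K n r W) = 0 := by
  apply Subtype.ext
  funext p
  have : extend Subtype.val (fun _ : W => (0 : K)) (0 : X → K) = 0 := by
    funext q
    by_cases h : q ∈ W
    · exact Subtype.val_injective.extend_apply _ _ (⟨q, h⟩ : W)
    · exact extend_apply' _ _ _ fun ⟨y, hy⟩ => h (hy ▸ y.2)
  change fderiv 𝕜 (extend Subtype.val (fun _ : W => (0 : K)) (0 : X → K) ∘ e.symm) (e p.1)
    (EuclideanSpace.single a 1) = 0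
  rw [this]
  have h0 : ((0 : X → K) ∘ e.symm) = fun _ : EuclideanSpace 𝕜 (Fin n) => (0 : K) := rfl
  rw [h0]
  simp

end Body

/-! ### Graded matrices, the `ρ`-determinant and the `ρ`-Berezinian -/

section Berezinian

variable {G K : Type*} [AddCommGroup G] [Field K] (ρ : CommutationFactor G K)
variable {A : Type*} [Ring A] [Algebra K A]
variable {J : Type*} [Fintype J] [LinearOrder J]

/-- The `ρ`-determinant of a matrix `F` of degree `0`, with `|F k l| = I k - I l`, where the `I k`
are all even or all odd. It is characterized by
`ρdet(F) t_1 ⋯ t_n = ∑ σ, F_{1 σ(1)} t_{σ(1)} ⋯ F_{n σ(n)} t_{σ(n)}`,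
where the indeterminates `t_k` of degree `I k` satisfy `t_l t_k = ∓ ρ(I l, I k) t_k t_l`, with the
sign `-` if all `I k` are even and `+` if all `I k` are odd (that is, `∓ = -ρ(I l, I l)`),
and `t_l F = ρ(I l, |F|) F t_l` for homogeneous `F`. In the formula below, the first factor
moves the entries to the left of the `t_l`, the second one sorts `t_{σ(1)} ⋯ t_{σ(n)}`. -/
def rhoDet (I : J → G) (F : Matrix J J A) : A :=
  ∑ σ : Equiv.Perm J,
    ((pairProd fun l k => ρ (I (σ l)) (I k - I (σ k))) *
      (pairProd fun l k => if σ k < σ l then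
        -(ρ (I (σ l)) (I (σ l)) * ρ (I (σ l)) (I (σ k))) else 1)) •
    (((Finset.univ : Finset J).sort (· ≤ ·)).map fun k => F k (σ k)).prod

open scoped Classical in
/-- The `ρ`-Berezinian of a matrix `F` of degree `0`, with `|F k l| = I k - I l`:
`ρdet(F₀₀ - F₀₁ F₁₁⁻¹ F₁₀) ρdet(F₁₁)⁻¹` if `F₀₀` and `F₁₁` are invertible, and `0` otherwise.
The blocks are those of the even and odd indices. -/
def rhoBer (I : J → G) (F : Matrix J J A) : A :=
  let ev : {k : J // ¬ ρ.IsOdd (I k)} → J := Subtype.val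
  let od : {k : J // ρ.IsOdd (I k)} → J := Subtype.val
  if IsUnit (F.submatrix ev ev) ∧ IsUnit (F.submatrix od od) then
    rhoDet ρ (I ∘ ev) (F.submatrix ev ev -
        F.submatrix ev od * Ring.inverse (F.submatrix od od) * F.submatrix od ev) *
      Ring.inverse (rhoDet ρ (I ∘ od) (F.submatrix od od))
  else 0

end Berezinian

/-! ### `ρ`-manifolds -/

section Manifolds

/-- The index set of a coordinate system `x^1, …, x^n, (x_b)_{b ∈ ι}`. -/
abbrev CoordIdx (n : ℕ) (ι : Type*) := Fin n ⊕ₗ ι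

/-- The degrees of the coordinates; the coordinates of the underlying manifold have degree `0`. -/
def coordDeg {G : Type*} [AddCommGroup G] {ι : Type*} (n : ℕ) (d : ι → G) (a : CoordIdx n ι) : G :=
  Sum.elim (fun _ => 0) d (ofLex a)

universe u v w

variable {G K : Type*} [AddCommGroup G] [RCLike K]
variable (𝕜 : Type*) [RCLike 𝕜] [NormedAlgebra 𝕜 K] (n : ℕ) (r : Regularity)
variable (X : Type u) [TopologicalSpace X] [ChartedSpace (EuclideanSpace 𝕜 (Fin n)) X]
variable (ρ : CommutationFactor G K)
variable {ι : Type*} [Fintype ι] [LinearOrder ι] (d : ι → G)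

variable {X} in
/-- The local model `𝒪(W)[[x_b : b ∈ ι]]_•`. -/
abbrev Model (W : Opens X) := Series ρ d (bodyFun 𝕜 K n r W)

namespace Model

variable {𝕜 n r X ρ d}

/-- Restriction to a smaller open set. -/
abbrev res {V W : Opens X} (h : V ≤ W) : Model 𝕜 n r ρ d W →ₐ[K] Model 𝕜 n r ρ d V :=
  Series.map (bodyRes 𝕜 K n r h)

variable {e : OpenPartialHomeomorph X (EuclideanSpace 𝕜 (Fin n))}

/-- The coordinate functions: those of the chart `e` and the indeterminates. -/
def coord (he : e ∈ IsManifold.maximalAtlas 𝓘(𝕜, EuclideanSpace 𝕜 (Fin n)) r.order X)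
    (W : Opens X) (hW : (W : Set X) ⊆ e.source) (a : CoordIdx n ι) : Model 𝕜 n r ρ d W :=
  Sum.elim (fun k => Series.monomial 0 (bodyCoord he W hW k)) (fun b => Series.X b) (ofLex a)

/-- The partial derivatives with respect to these coordinate functions. -/
def pd (he : e ∈ IsManifold.maximalAtlas 𝓘(𝕜, EuclideanSpace 𝕜 (Fin n)) r.order X)
    {W : Opens X} (hW : (W : Set X) ⊆ e.source) (a : CoordIdx n ι) (f : Model 𝕜 n r ρ d W) :
    Model 𝕜 n r ρ d W :=
  Sum.elim (fun k => f.mapCoeff (bodyPd he hW k) (bodyPd_zero he hW k)) (fun b => Series.pd b f) (ofLex a)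

end Model

/-- A presheaf of `G`-graded algebras on the manifold `X`, together with a family of charts
`α` of `X` and homomorphisms to the local model over the domains of these charts ("expression in
the coordinates `α`"). It is a `ρ`-manifold if `RhoSpace.IsRhoManifold` holds. -/
structure RhoSpace where
  /-- The algebra of sections over an open set. -/
  sec : Opens X → Type v
  [ring : ∀ U, Ring (sec U)]
  [algebra : ∀ U, Algebra K (sec U)]
  /-- The homogeneous sections of a given degree. -/
  grade : ∀ U, G → Submodule K (sec U)
  one_mem : ∀ U, (1 : sec U) ∈ grade U 0
  mul_mem : ∀ {U i j} {f g : sec U}, f ∈ grade U i → g ∈ grade U j → f * g ∈ grade U (i + j)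
  /-- Restriction of sections. -/
  res : ∀ {U V : Opens X}, V ≤ U → sec U →ₐ[K] sec V
  res_mem : ∀ {U V : Opens X} (h : V ≤ U) {j} {f : sec U}, f ∈ grade U j → res h f ∈ grade V j
  res_self : ∀ {U : Opens X} (h : U ≤ U) (f : sec U), res h f = f
  res_res : ∀ {U V W : Opens X} (h : V ≤ U) (h' : W ≤ V) (f : sec U),
    res h' (res h f) = res (h'.trans h) f
  /-- The index set of the atlas. -/
  Idx : Type w
  /-- The underlying charts. -/
  chart : Idx → OpenPartialHomeomorph X (EuclideanSpace 𝕜 (Fin n))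
  chart_mem : ∀ α,
    chart α ∈ IsManifold.maximalAtlas 𝓘(𝕜, EuclideanSpace 𝕜 (Fin n)) r.order X
  /-- The expression of a section in coordinates. -/
  expr : ∀ (α : Idx) (V : Opens X), V ≤ ⟨(chart α).source, (chart α).open_source⟩ →
    sec V →ₐ[K] Model 𝕜 n r ρ d V
  expr_res : ∀ (α : Idx) {U V : Opens X} (h : V ≤ U)
    (hU : U ≤ ⟨(chart α).source, (chart α).open_source⟩)
    (hV : V ≤ ⟨(chart α).source, (chart α).open_source⟩) (f : sec U),
    expr α V hV (res h f) = Model.res h (expr α U hU f)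

attribute [instance] RhoSpace.ring RhoSpace.algebra

namespace RhoSpace

variable {𝕜 n r X ρ d}
variable (M : RhoSpace.{u, v, w} 𝕜 n r X ρ d)

/-- The coordinate neighbourhood `U_α`. -/
abbrev dom (α : M.Idx) : Opens X := ⟨(M.chart α).source, (M.chart α).open_source⟩

open scoped Classical in
/-- The axioms of a `ρ`-manifold: the coordinate neighbourhoods cover `X`, the algebras of sections
are graded, the homogeneous sections of each degree form a sheaf, and over each coordinate
neighbourhood the sheaf is isomorphic, as a sheaf of graded algebras, to the local model. -/
structure IsRhoManifold : Prop where
  cover : ∀ p : X, ∃ α, p ∈ M.dom α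
  isInternal : ∀ U, DirectSum.IsInternal (M.grade U)
  glue : ∀ (j : G) {T : Type u} (U : T → Opens X) (f : ∀ t, M.sec (U t)),
    (∀ t, f t ∈ M.grade (U t) j) →
    (∀ s t, M.res (inf_le_left : U s ⊓ U t ≤ U s) (f s) = M.res inf_le_right (f t)) →
    ∃! g : M.sec (⨆ t, U t), g ∈ M.grade (⨆ t, U t) j ∧ ∀ t, M.res (le_iSup U t) g = f t
  bijective : ∀ α V (hV : V ≤ M.dom α), Bijective (M.expr α V hV)
  expr_mem_iff : ∀ α V (hV : V ≤ M.dom α) j (f : M.sec V),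
    M.expr α V hV f ∈ Series.grade j ↔ f ∈ M.grade V j

/-- The coordinate functions `x_α^a` on `U_α`: the sections whose expressions in the coordinates
`α` are the coordinate functions of the local model. -/
def coordFn (α : M.Idx) (a : CoordIdx n ι) : M.sec (M.dom α) :=
  invFun (M.expr α (M.dom α) le_rfl) (Model.coord (M.chart_mem α) _ subset_rfl a)

/-- The partial derivatives `∂/∂x_α^a` on the sections over `V ⊆ U_α`, obtained by transport of
structure from the local model. -/
def pd (α : M.Idx) {V : Opens X} (hV : V ≤ M.dom α) (a : CoordIdx n ι) (f : M.sec V) : M.sec V :=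
  invFun (M.expr α V hV) (Model.pd (M.chart_mem α) hV a (M.expr α V hV f))

/-- The Jacobian matrix of a change of coordinates from `x = x_α` to `y = x_β` over `V`, with the
row index `b` and the column index `a` for `∂y^a/∂x^b`. With this placement the chain rule
`∂z^c/∂x^b = ∑ a, ∂y^a/∂x^b * ∂z^c/∂y^a` is the multiplication of matrices, and the entries have
the degrees `(-|x^b|) - (-|y^a|)`. -/
def jacobian (α β : M.Idx) {V : Opens X} (hα : V ≤ M.dom α) (hβ : V ≤ M.dom β) :
    Matrix (CoordIdx n ι) (CoordIdx n ι) (M.sec V) :=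
  Matrix.of fun b a => M.pd α hα b (M.res hβ (M.coordFn β a))

/-- A `ρ`-Berezin volume form: an invertible section of degree `0` of the `ρ`-Berezinian bundle.
It is given by local functions `s α` with `vol = D(x_α) s α` on `U_α`, where the local frames are
related by `D(x_β) = D(x_α) ρBer(∂x_β/∂x_α)`. -/
@[ext] structure VolumeForm where
  s : ∀ α, M.sec (M.dom α)
  mem : ∀ α, s α ∈ M.grade (M.dom α) 0
  isUnit : ∀ α, IsUnit (s α)
  compat : ∀ α β, M.res (inf_le_left : M.dom α ⊓ M.dom β ≤ M.dom α) (s α) =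
    rhoBer ρ (fun b => -coordDeg n d b) (M.jacobian α β inf_le_left inf_le_right) *
      M.res inf_le_right (s β)

/-- A (homogeneous) vector field of degree `q`: a `ρ`-derivation of degree `q` of the sheaf of
functions. -/
@[ext] structure VectorField (q : G) where
  app : ∀ V, M.sec V →ₗ[K] M.sec V
  app_res : ∀ {U V : Opens X} (h : V ≤ U) (f : M.sec U), app V (M.res h f) = M.res h (app U f)
  app_mem : ∀ V {j} {f : M.sec V}, f ∈ M.grade V j → app V f ∈ M.grade V (q + j)
  leibniz : ∀ V {j} {f : M.sec V} (g : M.sec V), f ∈ M.grade V j →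
    app V (f * g) = app V f * g + ρ q j • (f * app V g)

variable {M} {q : G}

/-- The vector field `Q` is homological: `ρ(|Q|,|Q|) = -1` and `[Q, Q]_ρ = 0`. -/
def VectorField.IsHomological (Q : M.VectorField q) : Prop :=
  ρ q q = -1 ∧ ∀ V (f : M.sec V), Q.app V (Q.app V f) - ρ q q • Q.app V (Q.app V f) = 0

/-- The component `Q^a = Q(x^a)` of `Q` in the coordinates `x = x_α`. -/
def VectorField.comp (Q : M.VectorField q) (α : M.Idx) (a : CoordIdx n ι) : M.sec (M.dom α) :=
  Q.app _ (M.coordFn α a)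

/-- The local function of the Lie derivative of a section of the `ρ`-Berezinian bundle:
`L_Q (D(x) s) = D(x) ∑ a, ρ(|x^a|, |x^a| + |Q|) ∂/∂x^a (Q^a s)`. -/
def VectorField.lie (Q : M.VectorField q) (α : M.Idx) (s : M.sec (M.dom α)) : M.sec (M.dom α) :=
  ∑ a : CoordIdx n ι, ρ (coordDeg n d a) (coordDeg n d a + q) • M.pd α le_rfl a (Q.comp α a * s)

/-- The global function `f` is the divergence of `Q` with respect to `vol`, that is,
`vol · f = L_Q vol`. -/
def IsDivergence (vol : M.VolumeForm) (Q : M.VectorField q) (f : M.sec ⊤) : Prop :=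
  ∀ α, vol.s α * M.res le_top f = Q.lie α (vol.s α)

/-- The cocycles of degree `k` of the complex `⊕ k, 𝒪(M)_{k|Q|}` with the differential `Q`. -/
def VectorField.cocycles (Q : M.VectorField q) (k : ℤ) : Submodule K (M.sec ⊤) :=
  M.grade ⊤ (k • q) ⊓ LinearMap.ker (Q.app ⊤)

/-- The coboundaries of degree `k`. -/
def VectorField.coboundaries (Q : M.VectorField q) (k : ℤ) : Submodule K (M.sec ⊤) :=
  (M.grade ⊤ ((k - 1) • q)).map (Q.app ⊤)

/-- The cohomology `H_Q^k(M)`. -/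
abbrev VectorField.Cohomology (Q : M.VectorField q) (k : ℤ) : Type _ :=
  Q.cocycles k ⧸ (Q.coboundaries k).submoduleOf (Q.cocycles k)

/-- `μ` is the modular class of `(M, Q)` with respect to `vol`: the class in `H_Q^1(M)` of the
divergence of `Q`. -/
def IsModularClass (vol : M.VolumeForm) (Q : M.VectorField q) (μ : Q.Cohomology 1) : Prop :=
  ∃ (f : M.sec ⊤) (hf : f ∈ Q.cocycles 1),
    IsDivergence vol Q f ∧ μ = Submodule.Quotient.mk ⟨f, hf⟩

end RhoSpace

/-! ### The degree-`i` shifted cotangent bundle -/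

/-- The index set of the graded coordinates on the cotangent bundle: the graded coordinates of
the base, followed by the linear coordinates `x_a^*`. -/
abbrev CotIdx (n : ℕ) (ι : Type*) := ι ⊕ₗ CoordIdx n ι

/-- The degrees of the graded coordinates: `|x_a^*| = -|x^a| - i`. -/
def cotDeg (n : ℕ) (i : G) (b : CotIdx n ι) : G :=
  Sum.elim d (fun a => -coordDeg n d a - i) (ofLex b)

/-- The position of the base coordinate `x^a` among all coordinates on the cotangent bundle. -/
def baseIdx {n : ℕ} (a : CoordIdx n ι) : CoordIdx n (CotIdx n ι) :=
  toLex (Sum.map id (fun b => toLex (Sum.inl b)) (ofLex a))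

/-- The position of `x_a^*` among all coordinates on the cotangent bundle. -/
def fibreIdx {n : ℕ} (a : CoordIdx n ι) : CoordIdx n (CotIdx n ι) :=
  toLex (Sum.inr (toLex (Sum.inr a)))

/-- The exponents of the base coordinates. -/
def basePart {n : ℕ} (w : CotIdx n ι →₀ ℕ) : ι →₀ ℕ :=
  Finsupp.equivFunOnFinite.symm fun b => w (toLex (Sum.inl b))

@[simp] lemma basePart_apply {n : ℕ} (w : CotIdx n ι →₀ ℕ) (b : ι) :
    basePart w b = w (toLex (Sum.inl b)) := rfl

/-- The monomial contains no linear coordinate. -/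
def NoFibre {n : ℕ} (w : CotIdx n ι →₀ ℕ) : Prop := ∀ a, w (toLex (Sum.inr a)) = 0

lemma wdeg_basePart {n : ℕ} (i : G) {w : CotIdx n ι →₀ ℕ} (hw : NoFibre w) :
    wdeg (cotDeg d n i) w = wdeg d (basePart w) := by
  unfold wdeg
  rw [← Equiv.sum_comp (toLex : ι ⊕ CoordIdx n ι ≃ CotIdx n ι), Fintype.sum_sum_type]
  simp [hw _, cotDeg]

variable {d} in
lemma isGood_of_basePart {n : ℕ} (i : G) {w : CotIdx n ι →₀ ℕ} (hw : NoFibre w)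
    (h : IsGood ρ d (basePart w)) : IsGood ρ (cotDeg d n i) w := by
  intro b hb
  obtain ⟨b | b, rfl⟩ := toLex.surjective b
  · exact h b hb
  · rw [hw b]
    exact Nat.zero_le _

variable {ρ d n}

open scoped Classical in
/-- The inclusion `R[[x]]_• → R[[x, x^*]]_•`. -/
def Series.incl {R : Type*} [CommRing R] [Algebra K R] (i : G) :
    Series ρ d R →ₗ[K] Series ρ (cotDeg d n i) R where
  toFun f := ⟨fun w => if NoFibre w then f.coeff (basePart w) else 0, fun w hw => by
      by_cases h : NoFibre w
      · refine (if_pos h).trans ?_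
        exact Series.coeff_of_not_good f fun h' => hw (isGood_of_basePart ρ i h h')
      · exact if_neg h, by
      obtain ⟨_, S, hS⟩ := f.2
      refine ⟨S, fun w hw => ?_⟩
      by_cases h : NoFibre w
      · rw [wdeg_basePart d i h]
        exact hS _ fun h' => hw ((if_pos h).trans h')
      · exact absurd (if_neg h) hw⟩
  map_add' f g := Series.ext fun w => by
    change (if NoFibre w then (f + g).coeff (basePart w) else 0) =
      (if NoFibre w then f.coeff (basePart w) else 0) +
        (if NoFibre w then g.coeff (basePart w) else 0)
    split_ifs <;> simp
  map_smul' c f := Series.ext fun w => by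
    change (if NoFibre w then (c • f).coeff (basePart w) else 0) =
      c • (if NoFibre w then f.coeff (basePart w) else 0)
    split_ifs <;> simp

open scoped Classical in
lemma Series.coeff_incl {R : Type*} [CommRing R] [Algebra K R] (i : G) (f : Series ρ d R)
    (w : CotIdx n ι →₀ ℕ) : (Series.incl (n := n) i f).coeff w =
      if NoFibre w then f.coeff (basePart w) else 0 := rfl

namespace RhoSpace

variable {𝕜 r X}
variable (M : RhoSpace.{u, v, w} 𝕜 n r X ρ d) (i : G)

/-- The algebra homomorphism `τ` is the change of coordinates from `(y, y^*)` to `(x, x^*)` over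
`W`, where `x = x_α` and `y = x_β`: it is the one of `M` on the functions of `y`, and
`y_a^* = ∑ b, ∂x^b/∂y^a x_b^*`. If `M` is a `ρ`-manifold, there is exactly one such `τ`. -/
def IsTransition (α β : M.Idx) {W : Opens X} (hα : W ≤ M.dom α) (hβ : W ≤ M.dom β)
    (τ : Model 𝕜 n r ρ (cotDeg d n i) W →ₐ[K] Model 𝕜 n r ρ (cotDeg d n i) W) : Prop :=
  (∀ f : M.sec W, τ (Series.incl i (M.expr β W hβ f)) = Series.incl i (M.expr α W hα f)) ∧
  ∀ a : CoordIdx n ι, τ (Series.X (toLex (Sum.inr a))) =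
    ∑ b : CoordIdx n ι, Series.incl i (M.expr α W hα (M.jacobian β α hβ hα a b)) *
      Series.X (toLex (Sum.inr b))

/-- The functions on `[-i]T^*M` over `V`: the families of local functions `f α` in the coordinates
`(x_α, x_α^*)` over `V ∩ U_α` which are compatible with the changes of coordinates and involve
only finitely many degrees. -/
def cotSec (V : Opens X) : Subalgebra K (∀ α : M.Idx, Model 𝕜 n r ρ (cotDeg d n i) (V ⊓ M.dom α)) where
  carrier := {f | (∃ S : Finset G, ∀ α w, (f α).coeff w ≠ 0 → wdeg (cotDeg d n i) w ∈ S) ∧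
    ∀ α β (W : Opens X) (hα : W ≤ V ⊓ M.dom α) (hβ : W ≤ V ⊓ M.dom β)
      (τ : Model 𝕜 n r ρ (cotDeg d n i) W →ₐ[K] Model 𝕜 n r ρ (cotDeg d n i) W),
      M.IsTransition i α β (hα.trans inf_le_right) (hβ.trans inf_le_right) τ →
      τ (Model.res hβ (f β)) = Model.res hα (f α)}
  mul_mem' := by
    classical
    rintro f g ⟨⟨S, hS⟩, hf⟩ ⟨⟨T, hT⟩, hg⟩
    refine ⟨⟨Finset.image₂ (· + ·) S T, fun α w hw => ?_⟩, fun α β W hα hβ τ hτ => ?_⟩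
    · obtain ⟨u, v, rfl, hu, hv⟩ := Series.exists_of_coeff_mul_ne_zero hw
      rw [wdeg_add]
      exact Finset.mem_image₂_of_mem (hS α u hu) (hT α v hv)
    · simp only [Pi.mul_apply, map_mul, hf α β W hα hβ τ hτ, hg α β W hα hβ τ hτ]
  add_mem' := by
    classical
    rintro f g ⟨⟨S, hS⟩, hf⟩ ⟨⟨T, hT⟩, hg⟩
    refine ⟨⟨S ∪ T, fun α w hw => ?_⟩, fun α β W hα hβ τ hτ => ?_⟩
    · by_cases h : (f α).coeff w = 0
      · exact Finset.mem_union_right _ (hT α w fun h' => hw (by simp [h, h']))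
      · exact Finset.mem_union_left _ (hS α w h)
    · simp only [Pi.add_apply, map_add, hf α β W hα hβ τ hτ, hg α β W hα hβ τ hτ]
  algebraMap_mem' := fun c => by
    refine ⟨⟨{0}, fun α w hw => ?_⟩, fun α β W hα hβ τ hτ => ?_⟩
    · rw [Finset.mem_singleton]
      refine Series.one_mem_grade (ρ := ρ) (d := cotDeg d n i)
        (R := bodyFun 𝕜 K n r (V ⊓ M.dom α)) w fun h => hw ?_
      change (algebraMap K (Model 𝕜 n r ρ (cotDeg d n i) (V ⊓ M.dom α)) c).coeff w = 0
      rw [Algebra.algebraMap_eq_smul_one, Series.coeff_smul, h, smul_zero]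
    · simp only [Pi.algebraMap_apply, AlgHom.commutes]

/-- The degree-`i` shifted cotangent bundle `[-i]T^*M`, with the coordinates `(x_α, x_α^*)`. -/
def cotangent : RhoSpace 𝕜 n r X ρ (cotDeg d n i) where
  sec V := M.cotSec i V
  grade V j :=
    { carrier := {f | ∀ α, f.1 α ∈ Series.grade j}
      zero_mem' := fun α => zero_mem _
      add_mem' := fun hf hg α => add_mem (hf α) (hg α)
      smul_mem' := fun c f hf α => Submodule.smul_mem _ c (hf α) }
  one_mem V α := Series.one_mem_grade
  mul_mem hf hg α := Series.mul_mem_grade (hf α) (hg α)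
  res {U V} h :=
    { toFun := fun f => ⟨fun α => Model.res (inf_le_inf_right _ h) (f.1 α), by
        obtain ⟨⟨S, hS⟩, hf⟩ := f.2
        refine ⟨⟨S, fun α w hw => hS α w fun h' => hw (by simp [h'])⟩,
          fun α β W hα hβ τ hτ => ?_⟩
        exact hf α β W (hα.trans (inf_le_inf_right _ h)) (hβ.trans (inf_le_inf_right _ h)) τ hτ⟩
      map_one' := Subtype.ext (funext fun α => map_one _)
      map_mul' := fun f g => Subtype.ext (funext fun α => map_mul _ _ _)
      map_zero' := Subtype.ext (funext fun α => map_zero _)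
      map_add' := fun f g => Subtype.ext (funext fun α => map_add _ _ _)
      commutes' := fun c => Subtype.ext (funext fun α => AlgHom.commutes _ c) }
  res_mem h _ f hf α := Series.map_mem_grade _ (hf α)
  res_self h f := rfl
  res_res h h' f := rfl
  Idx := M.Idx
  chart := M.chart
  chart_mem := M.chart_mem
  expr α V hV :=
    { toFun := fun f => Model.res (le_inf le_rfl hV) (f.1 α)
      map_one' := map_one _
      map_mul' := fun f g => map_mul _ _ _
      map_zero' := map_zero _
      map_add' := fun f g => map_add _ _ _
      commutes' := fun c => AlgHom.commutes _ c }
  expr_res α U V h hU hV f := rfl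

variable {M}

lemma IsRhoManifold.exists_degrees (hM : M.IsRhoManifold) {V : Opens X} (f : M.sec V) :
    ∃ S : Finset G, ∀ (α : M.Idx) (W : Opens X) (hV : W ≤ V) (hW : W ≤ M.dom α) (w : ι →₀ ℕ),
      (M.expr α W hW (M.res hV f)).coeff w ≠ 0 → wdeg d w ∈ S := by
  classical
  have hf : f ∈ ⨆ j, M.grade V j := by
    have h := (hM.isInternal V).submodule_iSup_eq_top
    rw [h]
    trivial
  induction hf using Submodule.iSup_induction' with
  | mem j f hf =>
    refine ⟨{j}, fun α W hV hW w hw => Finset.mem_singleton.2 ?_⟩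
    exact (hM.expr_mem_iff α W hW j _).2 (M.res_mem hV hf) w hw
  | zero => exact ⟨∅, fun α W hV hW w hw => absurd (by simp) hw⟩
  | add f g _ _ hf hg =>
    obtain ⟨S, hS⟩ := hf
    obtain ⟨T, hT⟩ := hg
    refine ⟨S ∪ T, fun α W hV hW w hw => ?_⟩
    by_cases h : (M.expr α W hW (M.res hV f)).coeff w = 0
    · exact Finset.mem_union_right _ (hT α W hV hW w fun h' => hw (by simp [h, h']))
    · exact Finset.mem_union_left _ (hS α W hV hW w h)

/-- The expression of a function on `M` in the coordinates `(x_α, x_α^*)`. -/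
def pullbackFun (M : RhoSpace.{u, v, w} 𝕜 n r X ρ d) (i : G) (α : M.Idx) {V : Opens X}
    (hV : V ≤ M.dom α) : M.sec V →ₗ[K] Model 𝕜 n r ρ (cotDeg d n i) V :=
  Series.incl i ∘ₗ (M.expr α V hV).toLinearMap

open scoped Classical in
lemma coeff_pullbackFun (i : G) (α : M.Idx) {V : Opens X} (hV : V ≤ M.dom α) (f : M.sec V)
    (w : CotIdx n ι →₀ ℕ) : (M.pullbackFun i α hV f).coeff w =
      if NoFibre w then (M.expr α V hV f).coeff (basePart w) else 0 := rfl

lemma res_pullbackFun (i : G) (α : M.Idx) {V W : Opens X} (h : W ≤ V) (hV : V ≤ M.dom α)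
    (hW : W ≤ M.dom α) (f : M.sec V) :
    Model.res h (M.pullbackFun i α hV f) = M.pullbackFun i α hW (M.res h f) := by
  classical
  ext1 w
  rw [Series.coeff_map, coeff_pullbackFun, coeff_pullbackFun, M.expr_res α h hV hW,
    Series.coeff_map]
  split_ifs
  · rfl
  · rw [map_zero]

lemma pullback_mem_cotSec (hM : M.IsRhoManifold) (i : G) {V : Opens X} (f : M.sec V) :
    (fun α => M.pullbackFun i α (inf_le_right : V ⊓ M.dom α ≤ M.dom α) (M.res inf_le_left f)) ∈
      M.cotSec i V := by
  classical
  refine ⟨?_, fun α β W hα hβ τ hτ => ?_⟩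
  · obtain ⟨S, hS⟩ := hM.exists_degrees f
    refine ⟨S, fun α w hw => ?_⟩
    rw [coeff_pullbackFun] at hw
    by_cases h : NoFibre w
    · rw [if_pos h] at hw
      rw [wdeg_basePart d i h]
      exact hS α _ _ _ _ hw
    · exact absurd (if_neg h) hw
  · have hα' := res_pullbackFun i α hα inf_le_right (hα.trans inf_le_right)
      (M.res inf_le_left f)
    have hβ' := res_pullbackFun i β hβ inf_le_right (hβ.trans inf_le_right)
      (M.res inf_le_left f)
    rw [M.res_res] at hα' hβ'
    change τ (Model.res hβ (M.pullbackFun i β _ _)) = Model.res hα (M.pullbackFun i α _ _)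
    rw [hα', hβ']
    exact hτ.1 _

/-- The pullback of functions along the projection `[-i]T^*M → M`. -/
def pullback (hM : M.IsRhoManifold) (i : G) (V : Opens X) :
    M.sec V →ₗ[K] (M.cotangent i).sec V where
  toFun f := ⟨fun α => M.pullbackFun i α inf_le_right (M.res inf_le_left f),
    pullback_mem_cotSec hM i f⟩
  map_add' f g := Subtype.ext (funext fun α => by
    change M.pullbackFun i α _ (M.res _ (f + g)) =
      M.pullbackFun i α _ (M.res _ f) + M.pullbackFun i α _ (M.res _ g)
    rw [map_add, map_add])
  map_smul' c f := Subtype.ext (funext fun α => by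
    change M.pullbackFun i α _ (M.res _ (c • f)) = c • M.pullbackFun i α _ (M.res _ f)
    rw [map_smul, map_smul])

lemma pullback_mem (hM : M.IsRhoManifold) (i : G) {V : Opens X} {j : G} {f : M.sec V}
    (hf : f ∈ M.grade V j) : pullback hM i V f ∈ (M.cotangent i).grade V j := by
  classical
  intro α w hw
  change (M.pullbackFun i α inf_le_right (M.res inf_le_left f)).coeff w ≠ 0 at hw
  rw [coeff_pullbackFun] at hw
  by_cases h : NoFibre w
  · rw [if_pos h] at hw
    rw [wdeg_basePart d i h]
    exact (hM.expr_mem_iff α _ _ j _).2 (M.res_mem _ hf) _ hw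
  · exact absurd (if_neg h) hw

/-- The coordinate function `x_a^*` in the coordinates `(x_α, x_α^*)`. -/
def fibreFn (M : RhoSpace.{u, v, w} 𝕜 n r X ρ d) (i : G) (α : M.Idx) (a : CoordIdx n ι) :
    (M.cotangent i).sec (M.dom α) :=
  (M.cotangent i).coordFn α (fibreIdx a)

/-- The derivative `∂/∂x^a` in the coordinates `(x_α, x_α^*)`. -/
def pdBase (M : RhoSpace.{u, v, w} 𝕜 n r X ρ d) (i : G) (α : M.Idx) {V : Opens X}
    (hV : V ≤ M.dom α) (a : CoordIdx n ι) (f : (M.cotangent i).sec V) : (M.cotangent i).sec V :=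
  (M.cotangent i).pd α hV (baseIdx a) f

/-- The derivative `∂/∂x_a^*` in the coordinates `(x_α, x_α^*)`. -/
def pdFibre (M : RhoSpace.{u, v, w} 𝕜 n r X ρ d) (i : G) (α : M.Idx) {V : Opens X}
    (hV : V ≤ M.dom α) (a : CoordIdx n ι) (f : (M.cotangent i).sec V) : (M.cotangent i).sec V :=
  (M.cotangent i).pd α hV (fibreIdx a) f

/-- The degree-`i` Schouten bracket `⟦f, g⟧` in the coordinates `(x_α, x_α^*)`, for `f` homogeneous
of degree `p`. -/
def schouten (M : RhoSpace.{u, v, w} 𝕜 n r X ρ d) (i : G) (α : M.Idx) {V : Opens X}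
    (hV : V ≤ M.dom α) (p : G) (f g : (M.cotangent i).sec V) : (M.cotangent i).sec V :=
  ∑ a : CoordIdx n ι,
    (ρ (p + coordDeg n d a + i) (coordDeg n d a + i) •
        (M.pdFibre i α hV a f * M.pdBase i α hV a g) -
      ρ (coordDeg n d a) (p + i) • (M.pdBase i α hV a f * M.pdFibre i α hV a g))

variable {q : G}

/-- `F` is the function `f_Q` of degree `|Q| - i` on `[-i]T^*M` corresponding to the vector field
`Q` under `∂/∂x^a ↦ x_a^*`: it is locally `∑ a, Q^a x_a^*`. -/
def IsSymbol (hM : M.IsRhoManifold) (i : G) (Q : M.VectorField q) (F : (M.cotangent i).sec ⊤) :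
    Prop :=
  F ∈ (M.cotangent i).grade ⊤ (q - i) ∧
  ∀ α, (M.cotangent i).res (le_top : M.dom α ≤ ⊤) F =
    ∑ a, pullback hM i _ (Q.comp α a) * M.fibreFn i α a

/-- `Q'` is the vector field `⟦F, -⟧` on `[-i]T^*M`, where `|F| = |Q'| - i`. -/
def IsHamiltonian (i : G) (F : (M.cotangent i).sec ⊤) (Q' : (M.cotangent i).VectorField q) : Prop :=
  ∀ (α : M.Idx) (V : Opens X) (hV : V ≤ M.dom α) (g : (M.cotangent i).sec V),
    Q'.app V g = M.schouten i α hV (q - i) ((M.cotangent i).res le_top F) g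

open scoped Classical in
/-- `vol'` is the volume form on `[-i]T^*M` induced by the volume form `vol` on `M`: if
`vol = D(x) s(x)`, then `vol'` is `D(x, x^*)` if `i` is even and `D(x, x^*) s(x) ^ 2` if `i` is
odd. -/
def IsInducedVolume (hM : M.IsRhoManifold) (i : G) (vol : M.VolumeForm)
    (vol' : (M.cotangent i).VolumeForm) : Prop :=
  ∀ α : M.Idx, vol'.s α = if ρ.IsOdd i then pullback hM i (M.dom α) (vol.s α) ^ 2 else 1

/-- The homomorphism `H_Q^k(M) → H_{Q'}^k([-i]T^*M)` induced by the projection `[-i]T^*M → M`, if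
`Q'` extends `Q`. -/
def cohomologyPullback (hM : M.IsRhoManifold) (i : G) (Q : M.VectorField q)
    (Q' : (M.cotangent i).VectorField q)
    (h : ∀ f, Q'.app ⊤ (pullback hM i ⊤ f) = pullback hM i ⊤ (Q.app ⊤ f)) (k : ℤ) :
    Q.Cohomology k →ₗ[K] Q'.Cohomology k :=
  Submodule.mapQ _ _
    ((pullback hM i ⊤).restrict (p := Q.cocycles k) (q := Q'.cocycles k) fun f hf =>
      ⟨pullback_mem hM i hf.1, LinearMap.mem_ker.2
        ((h f).trans (by rw [LinearMap.mem_ker.1 hf.2, map_zero]))⟩)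
    (by
      rintro ⟨f, hf⟩ ⟨g, hg, hgf⟩
      exact ⟨pullback hM i ⊤ g, pullback_mem hM i hg, (h g).trans (congrArg _ hgf)⟩)

end RhoSpace

end Manifolds

end RhoGeometry

end

noncomputable section

open Function TopologicalSpace

namespace RhoGeometry

/-! ### Commutation factors -/

namespace CommutationFactor

variable {G K : Type*} [AddCommGroup G] [Field K] (ρ : CommutationFactor G K)

/-! In coordinates with density `s` the divergence of `Q` is the coordinate divergence `∑
ρ(|x^a|,|x^a|+|Q|) ∂_a Q^a` plus the logarithmic derivative `s⁻¹ Q(s)`. The vector field `⟦f_Q,-⟧`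
has the components `Q^a` along the base and `-ρ(|x^a|,|Q|) ∑_b ∂_a Q^b x_b^*` along the fibre.
Differentiating the latter with respect to `x_a^*` and collecting signs gives `-ρ(i,i)` times the
contribution of `x^a`. Hence the coordinate divergence is multiplied by `1 - ρ(i,i)`
(`IsHamiltonian.coordDiv`). The density does the same: for odd `i` it is `s²`, whose logarithmic
derivative is twice that of `s`, and for even `i` it is `1`, with derivative zero
(`IsInducedVolume.exists_eq`). Together this is `IsDivergence.hamiltonian`; the modular classes are
the classes of the divergences and follow from it.

The larger part of the work is that all the objects exist. Three tools carry it.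

Determinants. On the free group generated by the matrix indices there is a bicharacter by which the
product can be rescaled so that homogeneous elements commute. In the resulting commutative ring the
`ρ`-determinant becomes an ordinary determinant (`Twist.det_hat`), which yields multiplicativity,
block triangular matrices and transposes. The `ρ`-Berezinian inherits the properties needed from
Schur complements. Its logarithmic derivative is the `ρ`-supertrace (`RhoDerivation.apply_rhoBer`),
obtained by evaluating it on dual numbers, where a derivation is an algebra homomorphism. On the
cotangent bundle the Jacobian matrix is block triangular, with the Jacobian of the base and the
`ρ`-transpose of its inverse on the diagonal. The shift by `i` exchanges the parities if `i` is odd,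
so the Berezinian is the square of that of the base for odd `i`, and `1` for even `i`
(`rhoBer_cotangent`). This is why `D(x,x^*)s²`, respectively `D(x,x^*)`, is well defined.

Derivations. A `ρ`-derivation that vanishes on the coordinates vanishes
(`ModelDerivation.app_eq_zero`): near a point Hadamard's lemma writes a function as a constant plus
multiples of `x^k - x^k(p)`, and a series as its constant coefficient plus multiples of the
indeterminates. The chain rule, the commutator `[Q,∂_a]`, the independence of `⟦f_Q,-⟧` of the
coordinates (`hamLocal_compat`) and the fact that it is homological (`IsHamiltonian.isHomological`)
all reduce to checks on coordinates.

Substitutions. A degree-preserving homomorphism on the base and linear images of the `x_a^*` of the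
right degrees determine exactly one homomorphism of the local models of the cotangent bundle
(`Series.subst`, `Series.algHom_ext_cot`). Uniqueness gives the cocycle condition for the changes of
coordinates, and with it `isRhoManifold_cotangent`.

The divergence is glued from its local expressions; these agree because the logarithmic derivative
of the Berezinian is the difference of the coordinate divergences (`exists_isDivergence`). It is a
cocycle because a homological vector field annihilates its coordinate divergence
(`IsDivergence.app_eq_zero`). -/

lemma swap (i j : G) : ρ j i = (ρ i j)⁻¹ := eq_inv_of_mul_eq_one_left (ρ.mul_swap j i)

lemma add_right (i j k : G) : ρ i (j + k) = ρ i j * ρ i k := by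
  rw [ρ.swap (j + k) i, ρ.add_left, mul_inv, ← ρ.swap, ← ρ.swap]

lemma zero_right (i : G) : ρ i 0 = 1 := by rw [ρ.swap 0 i, ρ.zero_left, inv_one]

lemma neg_left (i j : G) : ρ (-i) j = (ρ i j)⁻¹ := by
  refine eq_inv_of_mul_eq_one_left ?_
  rw [← ρ.add_left, neg_add_cancel, ρ.zero_left]

lemma neg_right (i j : G) : ρ i (-j) = (ρ i j)⁻¹ := by
  rw [ρ.swap (-j) i, ρ.neg_left, ← ρ.swap]

lemma sub_left (i j k : G) : ρ (i - j) k = ρ i k * (ρ j k)⁻¹ := by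
  rw [sub_eq_add_neg, ρ.add_left, ρ.neg_left]

lemma sub_right (i j k : G) : ρ i (j - k) = ρ i j * (ρ i k)⁻¹ := by
  rw [sub_eq_add_neg, ρ.add_right, ρ.neg_right]

lemma self_mul_self (i : G) : ρ i i * ρ i i = 1 := ρ.mul_swap i i

lemma self_inv (i : G) : (ρ i i)⁻¹ = ρ i i := (ρ.swap i i).symm

lemma self_of_not_isOdd {i : G} (h : ¬ ρ.IsOdd i) : ρ i i = 1 :=
  (mul_self_eq_one_iff.1 (ρ.self_mul_self i)).resolve_right h

lemma nsmul_left (n : ℕ) (i j : G) : ρ (n • i) j = ρ i j ^ n := by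
  induction n with
  | zero => simp [ρ.zero_left]
  | succ n ih => rw [succ_nsmul, ρ.add_left, ih, pow_succ]

lemma nsmul_right (n : ℕ) (i j : G) : ρ i (n • j) = ρ i j ^ n := by
  rw [ρ.swap (n • j) i, ρ.nsmul_left, ← inv_pow, ← ρ.swap]

lemma zsmul_left (n : ℤ) (i j : G) : ρ (n • i) j = ρ i j ^ n := by
  cases n with
  | ofNat n => simp [ρ.nsmul_left]
  | negSucc n => simp [ρ.nsmul_left, ρ.neg_left, negSucc_zsmul, zpow_negSucc]

lemma zsmul_right (n : ℤ) (i j : G) : ρ i (n • j) = ρ i j ^ n := by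
  rw [ρ.swap (n • j) i, ρ.zsmul_left, ← inv_zpow, ← ρ.swap]

lemma sum_left {J : Type*} (s : Finset J) (f : J → G) (j : G) :
    ρ (∑ a ∈ s, f a) j = ∏ a ∈ s, ρ (f a) j := by
  classical
  induction s using Finset.induction_on with
  | empty => simp [ρ.zero_left]
  | insert a s ha ih => rw [Finset.sum_insert ha, Finset.prod_insert ha, ρ.add_left, ih]

lemma sum_right {J : Type*} (s : Finset J) (f : J → G) (i : G) :
    ρ i (∑ a ∈ s, f a) = ∏ a ∈ s, ρ i (f a) := by
  classical
  induction s using Finset.induction_on with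
  | empty => simp [ρ.zero_right]
  | insert a s ha ih => rw [Finset.sum_insert ha, Finset.prod_insert ha, ρ.add_right, ih]

end CommutationFactor

/-! ### Products over pairs and sorted lists -/

section PairProd

variable {J K : Type*} [Fintype J] [LinearOrder J] [CommMonoid K]

lemma pairProd_eq (φ : J → J → K) : pairProd φ = ∏ l : J, ∏ k : J, if l < k then φ l k else 1 := by
  unfold pairProd
  refine Finset.prod_congr rfl fun l _ => Finset.prod_congr rfl fun k _ => ?_
  congr

lemma pairProd_mul (φ ψ : J → J → K) :
    pairProd (fun l k => φ l k * ψ l k) = pairProd φ * pairProd ψ := by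
  simp only [pairProd_eq, ← Finset.prod_mul_distrib]
  refine Finset.prod_congr rfl fun l _ => Finset.prod_congr rfl fun k _ => ?_
  split_ifs <;> simp

lemma pairProd_congr {φ ψ : J → J → K} (h : ∀ l k, l < k → φ l k = ψ l k) :
    pairProd φ = pairProd ψ := by
  simp only [pairProd_eq]
  refine Finset.prod_congr rfl fun l _ => Finset.prod_congr rfl fun k _ => ?_
  split_ifs with hlk
  · exact h l k hlk
  · rfl

lemma prod_prod_eq_pairProd (φ : J → J → K) :
    ∏ l, ∏ k, φ l k = (∏ k, φ k k) * pairProd φ * pairProd (fun l k => φ k l) := by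
  have e : (∏ k, φ k k) = ∏ l, ∏ k, if l = k then φ l k else 1 :=
    Finset.prod_congr rfl fun l _ => by simp
  have e2 : pairProd (fun l k => φ k l) = ∏ l, ∏ k, if k < l then φ l k else 1 := by
    rw [pairProd_eq, Finset.prod_comm]
  rw [e, e2, pairProd_eq]
  simp only [← Finset.prod_mul_distrib]
  refine Finset.prod_congr rfl fun l _ => Finset.prod_congr rfl fun k _ => ?_
  rcases lt_trichotomy l k with h | rfl | h
  · simp [h, h.ne, h.not_gt]
  · simp
  · simp [h, h.ne', h.not_gt]

/-- Reindexing a product over pairs by a permutation. -/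
lemma pairProd_perm (σ : Equiv.Perm J) (φ : J → J → K) :
    pairProd (fun l k => if σ k < σ l then φ (σ k) (σ l) else φ (σ l) (σ k)) = pairProd φ := by
  -- Every pair of positions contributes its image, listed in increasing order; the two factors
  -- separate the pairs that keep their order from the inversions.
  have h1 : pairProd (fun l k => if σ k < σ l then φ (σ k) (σ l) else φ (σ l) (σ k)) =
      ∏ l, ∏ k, (if l < k ∧ σ l < σ k then φ (σ l) (σ k) else 1) *
        (if k < l ∧ σ l < σ k then φ (σ l) (σ k) else 1) := by
    simp only [Finset.prod_mul_distrib]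
    rw [Finset.prod_comm (f := fun l k => if k < l ∧ σ l < σ k then φ (σ l) (σ k) else 1),
      pairProd_eq]
    simp only [← Finset.prod_mul_distrib]
    refine Finset.prod_congr rfl fun l _ => Finset.prod_congr rfl fun k _ => ?_
    by_cases h : l < k
    · have hne : σ l ≠ σ k := σ.injective.ne h.ne
      rcases lt_or_gt_of_ne hne with h' | h'
      · simp [h, h', h'.not_gt]
      · simp [h, h', h'.not_gt]
    · simp [h]
  rw [h1, pairProd_eq]
  conv_rhs => rw [← Equiv.prod_comp σ]
  refine Finset.prod_congr rfl fun l _ => ?_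
  conv_rhs => rw [← Equiv.prod_comp σ]
  refine Finset.prod_congr rfl fun k _ => ?_
  rcases lt_trichotomy l k with h | rfl | h
  · simp [h, h.not_gt]
  · simp
  · simp [h, h.not_gt]

lemma prod_univ_sort_map (f : J → K) :
    (((Finset.univ : Finset J).sort (· ≤ ·)).map f).prod = ∏ k, f k := by
  rw [← Finset.prod_map_toList]
  exact (((Finset.sort_perm_toList (Finset.univ : Finset J) (· ≤ ·)).map f)).prod_eq

/-- The product of `φ l k` over the pairs such that `l` precedes `k` in a list. -/
def listPairProd (φ : J → J → K) : List J → K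
  | [] => 1
  | a :: l => (l.map (φ a)).prod * listPairProd φ l

lemma listPairProd_eq {l : List J} (hl : l.Pairwise (· < ·)) (φ : J → J → K) :
    listPairProd φ l = (l.map fun b => (l.map fun a => if b < a then φ b a else 1).prod).prod := by
  induction l with
  | nil => simp [listPairProd]
  | cons b l ih =>
    rw [List.pairwise_cons] at hl
    rw [listPairProd, ih hl.2, List.map_cons, List.prod_cons]
    congr 1
    · rw [List.map_cons, List.prod_cons, if_neg (lt_irrefl b), one_mul]
      congr 1
      exact List.map_congr_left fun a ha => (if_pos (hl.1 a ha)).symm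
    · congr 1
      refine List.map_congr_left fun c hc => ?_
      rw [List.map_cons, List.prod_cons, if_neg (hl.1 c hc).not_gt, one_mul]

lemma listPairProd_sort (φ : J → J → K) :
    listPairProd φ ((Finset.univ : Finset J).sort (· ≤ ·)) = pairProd φ := by
  rw [listPairProd_eq (Finset.sortedLT_sort _).pairwise, prod_univ_sort_map, pairProd_eq]
  exact Finset.prod_congr rfl fun b _ => prod_univ_sort_map _

end PairProd

lemma map_pairProd {J K L : Type*} [Fintype J] [LinearOrder J] [CommMonoid K] [CommMonoid L]
    (f : K →* L) (φ : J → J → K) : f (pairProd φ) = pairProd fun l k => f (φ l k) := by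
  simp only [pairProd_eq, map_prod]
  refine Finset.prod_congr rfl fun l _ => Finset.prod_congr rfl fun k _ => ?_
  split_ifs <;> simp

/-- The sign counts inversions. The formula on `Fin` is carried over along an order isomorphism. -/
lemma sign_eq_pairProd {J : Type*} [Fintype J] [LinearOrder J] (σ : Equiv.Perm J) :
    (Equiv.Perm.sign σ : ℤˣ) = pairProd fun l k => if σ k < σ l then -1 else 1 := by
  let e : Fin (Fintype.card J) ≃o J := Fintype.orderIsoFinOfCardEq J rfl
  have h := Equiv.Perm.sign_eq_prod_prod_Ioi (e.toEquiv.symm.permCongr σ)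
  rw [Equiv.Perm.sign_permCongr] at h
  rw [h, pairProd_eq, ← Equiv.prod_comp e.toEquiv]
  refine Finset.prod_congr rfl fun l _ => ?_
  have e2 : Finset.Ioi l = Finset.univ.filter fun x => l < x := by ext; simp
  rw [← Equiv.prod_comp e.toEquiv, e2, Finset.prod_filter]
  refine Finset.prod_congr rfl fun x _ => ?_
  change (if l < x then (if e.symm (σ (e l)) < e.symm (σ (e x)) then (1 : ℤˣ) else -1) else 1) =
    if e l < e x then (if σ (e x) < σ (e l) then -1 else 1) else 1
  simp only [OrderIso.lt_iff_lt]
  split_ifs with h1 h2 h3 h3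
  · exact absurd h2 h3.not_gt
  · rfl
  · rfl
  · exact absurd (le_antisymm (not_lt.1 h3) (not_lt.1 h2)) (σ.injective.ne (e.injective.ne h1.ne))
  · rfl

/-! ### `ρ`-commutative algebras -/

/-- The submodules `𝒜 j` form a `ρ`-commutative grading (not assumed to be exhaustive). -/
structure IsRhoComm {G K A : Type*} [AddCommGroup G] [Field K] (ρ : CommutationFactor G K)
    [Ring A] [Algebra K A] (𝒜 : G → Submodule K A) : Prop where
  one_mem : (1 : A) ∈ 𝒜 0
  mul_mem : ∀ {i j} {f g : A}, f ∈ 𝒜 i → g ∈ 𝒜 j → f * g ∈ 𝒜 (i + j)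
  comm : ∀ {i j} {f g : A}, f ∈ 𝒜 i → g ∈ 𝒜 j → f * g = ρ i j • (g * f)

namespace IsRhoComm

variable {G K A : Type*} [AddCommGroup G] [Field K] {ρ : CommutationFactor G K}
  [Ring A] [Algebra K A] {𝒜 : G → Submodule K A} (h : IsRhoComm ρ 𝒜)
include h

lemma commute_zero {i : G} {f g : A} (hf : f ∈ 𝒜 0) (hg : g ∈ 𝒜 i) : f * g = g * f := by
  rw [h.comm hf hg, ρ.zero_left, one_smul]

lemma mem_of_eq {i j : G} {f : A} (hf : f ∈ 𝒜 i) (e : i = j) : f ∈ 𝒜 j := e ▸ hf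

lemma list_prod_mem {J : Type*} (l : List J) (a : J → A) (g : J → G) (ha : ∀ k, a k ∈ 𝒜 (g k)) :
    (l.map a).prod ∈ 𝒜 (l.map g).sum := by
  induction l with
  | nil => exact h.one_mem
  | cons k l ih => simpa using h.mul_mem (ha k) ih

lemma pow_mem {g : G} {a : A} (ha : a ∈ 𝒜 g) (n : ℕ) : a ^ n ∈ 𝒜 (n • g) := by
  induction n with
  | zero => simpa using h.one_mem
  | succ n ih => rw [pow_succ, succ_nsmul]; exact h.mul_mem ih ha

end IsRhoComm

/-! ### The commutative ring of twisted homogeneous elements -/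

section Twist

variable {G K : Type*} [AddCommGroup G] [Field K]

/-- A bicharacter on `Γ` that makes the elements of `⨁ m, 𝒜 (deg m)` commute. -/
structure Twist (ρ : CommutationFactor G K) (Γ : Type*) [AddCommGroup Γ] (deg : Γ →+ G) where
  toFun : Γ → Γ → K
  zero_left : ∀ n, toFun 0 n = 1
  zero_right : ∀ n, toFun n 0 = 1
  add_left : ∀ l m n, toFun (l + m) n = toFun l n * toFun m n
  add_right : ∀ l m n, toFun l (m + n) = toFun l m * toFun l n
  swap : ∀ m n, toFun m n * ρ (deg m) (deg n) = toFun n m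

namespace Twist

variable {ρ : CommutationFactor G K} {Γ : Type*} [AddCommGroup Γ] {deg : Γ →+ G}

instance : CoeFun (Twist ρ Γ deg) (fun _ => Γ → Γ → K) := ⟨Twist.toFun⟩

variable (c : Twist ρ Γ deg)

lemma ne_zero (m n : Γ) : c m n ≠ 0 := by
  have h := c.add_left m (-m) n
  rw [add_neg_cancel, c.zero_left] at h
  exact left_ne_zero_of_mul_eq_one h.symm

lemma neg_left (m n : Γ) : c (-m) n = (c m n)⁻¹ := by
  refine eq_inv_of_mul_eq_one_left ?_
  rw [← c.add_left, neg_add_cancel, c.zero_left]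

lemma neg_right (m n : Γ) : c m (-n) = (c m n)⁻¹ := by
  refine eq_inv_of_mul_eq_one_left ?_
  rw [← c.add_right, neg_add_cancel, c.zero_right]

lemma sub_left (l m n : Γ) : c (l - m) n = c l n * (c m n)⁻¹ := by
  rw [sub_eq_add_neg, c.add_left, c.neg_left]

lemma sub_right (l m n : Γ) : c l (m - n) = c l m * (c l n)⁻¹ := by
  rw [sub_eq_add_neg, c.add_right, c.neg_right]

variable {A : Type*} [Ring A] [Algebra K A] {𝒜 : G → Submodule K A}

/-- The homogeneous component of degree `deg m`, as a piece of the twisted ring. -/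
@[nolint unusedArguments]
def Piece (_ : Twist ρ Γ deg) (_ : IsRhoComm ρ 𝒜) (m : Γ) : Type _ := 𝒜 (deg m)

variable (h : IsRhoComm ρ 𝒜)

instance (m : Γ) : AddCommGroup (c.Piece h m) := inferInstanceAs (AddCommGroup (𝒜 (deg m)))

include h in
lemma piece_mul_mem {m n : Γ} (a : 𝒜 (deg m)) (b : 𝒜 (deg n)) :
    c m n • (a.1 * b.1) ∈ 𝒜 (deg (m + n)) := by
  rw [map_add]
  exact Submodule.smul_mem _ _ (h.mul_mem a.2 b.2)

instance : GradedMonoid.GMul (c.Piece h) where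
  mul {m n} a b := ⟨c m n • (a.1 * b.1), c.piece_mul_mem h a b⟩

instance : GradedMonoid.GOne (c.Piece h) where
  one := ⟨1, by rw [map_zero]; exact h.one_mem⟩

lemma piece_ext {m n : Γ} {a : c.Piece h m} {b : c.Piece h n} (e : m = n) (hab : a.1 = b.1) :
    GradedMonoid.mk m a = GradedMonoid.mk n b := by
  subst e
  exact congrArg (GradedMonoid.mk m) (Subtype.ext hab)

/-- Rescaling the product by the twist keeps associativity, because the twist is a bicharacter, and
turns `ρ`-commutativity into commutativity, because of `c.swap`. -/
instance : DirectSum.GCommRing (c.Piece h) where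
  one_mul a := c.piece_ext h (zero_add _) (by
    change c 0 a.1 • (1 * a.2.1) = a.2.1
    rw [c.zero_left, one_smul, one_mul])
  mul_one a := c.piece_ext h (add_zero _) (by
    change c a.1 0 • (a.2.1 * 1) = a.2.1
    rw [c.zero_right, one_smul, mul_one])
  mul_assoc x y z := c.piece_ext h (add_assoc _ _ _) (by
    change c (x.1 + y.1) z.1 • (c x.1 y.1 • (x.2.1 * y.2.1) * z.2.1) =
      c x.1 (y.1 + z.1) • (x.2.1 * c y.1 z.1 • (y.2.1 * z.2.1))
    rw [c.add_left, c.add_right, smul_mul_assoc, mul_smul_comm, smul_smul, smul_smul]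
    congr 1
    · ring
    · exact mul_assoc _ _ _)
  mul_comm x y := c.piece_ext h (add_comm _ _) (by
    change c x.1 y.1 • (x.2.1 * y.2.1) = c y.1 x.1 • (y.2.1 * x.2.1)
    rw [h.comm x.2.2 y.2.2, smul_smul, c.swap])
  mul_zero {m n} a := Subtype.ext (by
    change c m n • (a.1 * 0) = 0
    rw [mul_zero, smul_zero])
  zero_mul {m n} a := Subtype.ext (by
    change c m n • (0 * a.1) = 0
    rw [zero_mul, smul_zero])
  mul_add {m n} x y z := Subtype.ext (by
    change c m n • (x.1 * (y.1 + z.1)) = c m n • (x.1 * y.1) + c m n • (x.1 * z.1)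
    rw [mul_add, smul_add])
  add_mul {m n} x y z := Subtype.ext (by
    change c m n • ((x.1 + y.1) * z.1) = c m n • (x.1 * z.1) + c m n • (y.1 * z.1)
    rw [add_mul, smul_add])
  natCast n := n • (GradedMonoid.GOne.one : c.Piece h 0)
  natCast_zero := zero_smul _ _
  natCast_succ n := succ_nsmul _ _
  intCast n := n • (GradedMonoid.GOne.one : c.Piece h 0)
  intCast_ofNat n := natCast_zsmul _ _
  intCast_negSucc_ofNat n := negSucc_zsmul _ _

open scoped DirectSum

open scoped Classical in
/-- The commutative ring `⨁ m, 𝒜 (deg m)` with the product twisted by `c`. -/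
def TwRing : Type _ := ⨁ m, c.Piece h m

open scoped Classical in
instance : CommRing (c.TwRing h) := inferInstanceAs (CommRing (⨁ m, c.Piece h m))

open scoped Classical in
/-- The inclusion of a piece. -/
def piece (m : Γ) : c.Piece h m →+ c.TwRing h := DirectSum.of (c.Piece h) m

open scoped Classical in
/-- The element `a` of degree `deg m`, in the twisted ring. -/
def emb (m : Γ) (a : A) : c.TwRing h :=
  -- The value zero outside the homogeneous component is only a default.
  if ha : a ∈ 𝒜 (deg m) then c.piece h m ⟨a, ha⟩ else 0

variable {h}

lemma emb_mul {m n : Γ} {a b : A} (ha : a ∈ 𝒜 (deg m)) (hb : b ∈ 𝒜 (deg n)) :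
    c.emb h m a * c.emb h n b = c.emb h (m + n) (c m n • (a * b)) := by
  classical
  have hab := c.piece_mul_mem h ⟨a, ha⟩ ⟨b, hb⟩
  unfold emb
  rw [dif_pos ha, dif_pos hb, dif_pos hab]
  exact DirectSum.of_mul_of _ _

lemma emb_zero_one : c.emb h 0 1 = 1 := by
  classical
  have h1 : (1 : A) ∈ 𝒜 (deg 0) := by rw [map_zero]; exact h.one_mem
  unfold emb
  rw [dif_pos h1]
  rfl

lemma emb_add {m : Γ} {a b : A} (ha : a ∈ 𝒜 (deg m)) (hb : b ∈ 𝒜 (deg m)) :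
    c.emb h m (a + b) = c.emb h m a + c.emb h m b := by
  classical
  unfold emb
  rw [dif_pos ha, dif_pos hb, dif_pos (add_mem ha hb)]
  exact map_add (c.piece h m) ⟨a, ha⟩ ⟨b, hb⟩

lemma emb_zero (m : Γ) : c.emb h m 0 = 0 := by
  classical
  unfold emb
  rw [dif_pos (zero_mem _)]
  exact map_zero (c.piece h m)

lemma emb_neg {m : Γ} {a : A} (ha : a ∈ 𝒜 (deg m)) : c.emb h m (-a) = -c.emb h m a := by
  rw [eq_neg_iff_add_eq_zero, ← c.emb_add (neg_mem ha) ha, neg_add_cancel, emb_zero]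

lemma emb_sum {J : Type*} (s : Finset J) {m : Γ} {f : J → A} (hf : ∀ k ∈ s, f k ∈ 𝒜 (deg m)) :
    c.emb h m (∑ k ∈ s, f k) = ∑ k ∈ s, c.emb h m (f k) := by
  classical
  induction s using Finset.induction_on with
  | empty => simp [emb_zero]
  | insert a s ha ih =>
    rw [Finset.sum_insert ha, Finset.sum_insert ha, c.emb_add, ih]
    · exact fun k hk => hf k (Finset.mem_insert_of_mem hk)
    · exact hf a (Finset.mem_insert_self _ _)
    · exact sum_mem fun k hk => hf k (Finset.mem_insert_of_mem hk)

lemma emb_injOn {m : Γ} {a b : A} (ha : a ∈ 𝒜 (deg m)) (hb : b ∈ 𝒜 (deg m))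
    (e : c.emb h m a = c.emb h m b) : a = b := by
  classical
  unfold emb at e
  rw [dif_pos ha, dif_pos hb] at e
  exact congrArg Subtype.val (DirectSum.of_injective m e)

/-- Each factor is twisted against the total degree of the later ones; by bimultiplicativity this is
one factor for every pair in the order of the list. -/
lemma emb_list_prod {J : Type*} (l : List J) (m : J → Γ) (a : J → A)
    (ha : ∀ k, a k ∈ 𝒜 (deg (m k))) :
    (l.map fun k => c.emb h (m k) (a k)).prod =
      c.emb h (l.map m).sum (listPairProd (fun j k => c (m j) (m k)) l • (l.map a).prod) := by
  induction l with
  | nil => simp [listPairProd, emb_zero_one]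
  | cons k l ih =>
    have hl : (l.map a).prod ∈ 𝒜 (deg (l.map m).sum) := by
      have := h.list_prod_mem l a (fun k => deg (m k)) ha
      rwa [map_list_sum, List.map_map]
    simp only [List.map_cons, List.prod_cons, List.sum_cons]
    rw [ih, c.emb_mul (ha k) (Submodule.smul_mem _ _ hl), mul_smul_comm, smul_smul]
    congr 2
    rw [listPairProd]
    congr 1
    clear ih hl
    induction l with
    | nil => simp [c.zero_right]
    | cons j l ih => simp only [List.map_cons, List.prod_cons, List.sum_cons, c.add_right, ih]

end Twist

open scoped Classical in
/-- The standard twist, on `J → ℤ`. -/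
lemma exists_twist (ρ : CommutationFactor G K) {J : Type*} [Fintype J] [LinearOrder J] (g : J → G)
    (hg : ∀ k, ρ (g k) (g k) = 1) :
    ∃ (deg : (J → ℤ) →+ G) (δ : J → J → ℤ), (∀ k, deg (δ k) = g k) ∧ Nonempty (Twist ρ (J → ℤ) deg) := by
  let deg : (J → ℤ) →+ G :=
    { toFun := fun m => ∑ k, m k • g k
      map_zero' := by simp
      map_add' := fun m n => by simp [add_smul, Finset.sum_add_distrib] }
  -- The free group has ordered generators, so the factors with `b < a` alone can be put into the
  -- twist. The quotient of the twists of `(n, m)` and `(m, n)` is then `ρ (deg m) (deg n)` without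
  -- its diagonal factors, and these are `1` by `hg`. On `G` itself such a bicharacter need not be
  -- available.
  refine ⟨deg, fun k => Pi.single k 1, fun k => ?_, ⟨{
    toFun := fun m n => pairProd fun b a => ρ (g b) (g a) ^ (m a * n b)
    zero_left := fun n => by simp [pairProd_eq]
    zero_right := fun n => by simp [pairProd_eq]
    add_left := fun l m n => by
      rw [← pairProd_mul]
      exact pairProd_congr fun b a _ => by
        rw [Pi.add_apply, add_mul, zpow_add₀ (ρ.ne_zero _ _)]
    add_right := fun l m n => by
      rw [← pairProd_mul]
      exact pairProd_congr fun b a _ => by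
        rw [Pi.add_apply, mul_add, zpow_add₀ (ρ.ne_zero _ _)]
    swap := fun m n => ?_ }⟩⟩
  · change ∑ j, (Pi.single k 1 : J → ℤ) j • g j = g k
    simp [Pi.single_apply, ite_smul]
  · have e : ρ (deg m) (deg n) = ∏ a, ∏ b, ρ (g a) (g b) ^ (m a * n b) := by
      change ρ (∑ a, m a • g a) (∑ b, n b • g b) = _
      rw [ρ.sum_left]
      refine Finset.prod_congr rfl fun a _ => ?_
      rw [ρ.sum_right]
      exact Finset.prod_congr rfl fun b _ => by rw [ρ.zsmul_left, ρ.zsmul_right, ← zpow_mul, mul_comm]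
    rw [e, prod_prod_eq_pairProd]
    simp only [hg, one_zpow, Finset.prod_const_one, one_mul]
    rw [mul_comm (pairProd fun l k => ρ (g l) (g k) ^ (m l * n k)), ← mul_assoc, ← pairProd_mul,
      ← pairProd_mul]
    refine pairProd_congr fun b a _ => ?_
    rw [ρ.swap (g b) (g a), inv_zpow, mul_inv_cancel₀ (zpow_ne_zero _ (ρ.ne_zero _ _)), one_mul,
      mul_comm]

end Twist

/-! ### Properties of the `ρ`-determinant -/

section RhoDet

variable {G K : Type*} [AddCommGroup G] [Field K] {ρ : CommutationFactor G K}
variable {A : Type*} [Ring A] [Algebra K A] {𝒜 : G → Submodule K A}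

/-- The matrix `F` has degree `0` with respect to the row degrees `I` and the column degrees `I'`. -/
def GradedMatrix (𝒜 : G → Submodule K A) {J J' : Type*} (I : J → G) (I' : J' → G)
    (F : Matrix J J' A) : Prop := ∀ k l, F k l ∈ 𝒜 (I k - I' l)

namespace GradedMatrix

variable {J J' J'' : Type*} {I : J → G} {I' : J' → G} {I'' : J'' → G}

lemma add {F F' : Matrix J J' A} (hF : GradedMatrix 𝒜 I I' F) (hF' : GradedMatrix 𝒜 I I' F') :
    GradedMatrix 𝒜 I I' (F + F') := fun k l => add_mem (hF k l) (hF' k l)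

lemma sub {F F' : Matrix J J' A} (hF : GradedMatrix 𝒜 I I' F) (hF' : GradedMatrix 𝒜 I I' F') :
    GradedMatrix 𝒜 I I' (F - F') := fun k l => sub_mem (hF k l) (hF' k l)

lemma mul (h : IsRhoComm ρ 𝒜) [Fintype J'] {F : Matrix J J' A} {F' : Matrix J' J'' A}
    (hF : GradedMatrix 𝒜 I I' F)
    (hF' : GradedMatrix 𝒜 I' I'' F') : GradedMatrix 𝒜 I I'' (F * F') := fun k l =>
  sum_mem fun m _ => h.mem_of_eq (h.mul_mem (hF k m) (hF' m l)) (by abel)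

lemma one (h : IsRhoComm ρ 𝒜) [DecidableEq J] : GradedMatrix 𝒜 I I (1 : Matrix J J A) := fun k l => by
  by_cases e : k = l
  · subst e
    rw [Matrix.one_apply_eq, sub_self]
    exact h.one_mem
  · rw [Matrix.one_apply_ne e]
    exact zero_mem _

lemma submatrix {L L' : Type*} {F : Matrix J J' A} (hF : GradedMatrix 𝒜 I I' F) (e : L → J)
    (e' : L' → J') : GradedMatrix 𝒜 (I ∘ e) (I' ∘ e') (F.submatrix e e') :=
  fun k l => hF (e k) (e' l)

end GradedMatrix

variable {Γ : Type*} [AddCommGroup Γ] {deg : Γ →+ G} (c : Twist ρ Γ deg) {h : IsRhoComm ρ 𝒜}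
variable {J : Type*} {I : J → G} {δ : J → Γ} {g : G}

/-- The matrix of degree `0` with entries in the twisted ring which corresponds to `F`. -/
def Twist.hat (c : Twist ρ Γ deg) (h : IsRhoComm ρ 𝒜) {J : Type*} (δ : J → Γ) (η : J → K)
    (F : Matrix J J A) : Matrix J J (c.TwRing h) :=
  Matrix.of fun k l => c.emb h (δ k - δ l) ((c (δ k - δ l) (-δ l) * (η k * (η l)⁻¹)) • F k l)

lemma Twist.hat_apply (η : J → K) (F : Matrix J J A) (k l : J) : c.hat h δ η F k l =
    c.emb h (δ k - δ l) ((c (δ k - δ l) (-δ l) * (η k * (η l)⁻¹)) • F k l) := rfl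

lemma GradedMatrix.mem_deg {F : Matrix J J A} (hF : GradedMatrix 𝒜 I I F)
    (hδ : ∀ k, deg (δ k) = I k - g) (k l : J) : F k l ∈ 𝒜 (deg (δ k - δ l)) := by
  rw [map_sub, hδ, hδ, sub_sub_sub_cancel_right]
  exact hF k l

/-- The scalar in `hat` is chosen for this: by bimultiplicativity `c(δ k - δ l, -δ l) c(δ l - δ m,
-δ m) c(δ k - δ l, δ l - δ m) = c(δ k - δ m, -δ m)`. The factors `η` telescope, since they only
conjugate by a diagonal matrix. -/
lemma Twist.hat_mul [Fintype J] {η : J → K} (hη : ∀ k, η k ≠ 0) (hδ : ∀ k, deg (δ k) = I k - g)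
    {F F' : Matrix J J A} (hF : GradedMatrix 𝒜 I I F) (hF' : GradedMatrix 𝒜 I I F') :
    c.hat h δ η (F * F') = c.hat h δ η F * c.hat h δ η F' := by
  refine Matrix.ext fun k m => ?_
  rw [Matrix.mul_apply, c.hat_apply, Matrix.mul_apply, Finset.smul_sum, c.emb_sum Finset.univ]
  · refine Finset.sum_congr rfl fun l _ => ?_
    rw [c.hat_apply, c.hat_apply, c.emb_mul (Submodule.smul_mem _ _ (hF.mem_deg hδ k l))
      (Submodule.smul_mem _ _ (hF'.mem_deg hδ l m)), sub_add_sub_cancel, smul_mul_assoc,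
      mul_smul_comm, smul_smul, smul_smul]
    congr 2
    simp only [c.sub_left, c.sub_right, c.neg_right]
    have h1 := hη l
    have h2 := c.ne_zero (δ k) (δ l)
    have h3 := c.ne_zero (δ l) (δ l)
    have h4 := c.ne_zero (δ l) (δ m)
    field_simp
  · intro l _
    refine Submodule.smul_mem _ _ (h.mem_of_eq (h.mul_mem (hF.mem_deg hδ k l) (hF'.mem_deg hδ l m)) ?_)
    rw [← map_add, sub_add_sub_cancel]

lemma GradedMatrix.list_prod_mem [Fintype J] [LinearOrder J] (h : IsRhoComm ρ 𝒜) {F : Matrix J J A}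
    (hF : GradedMatrix 𝒜 I I F) (σ : Equiv.Perm J) :
    (((Finset.univ : Finset J).sort (· ≤ ·)).map fun k => F k (σ k)).prod ∈ 𝒜 0 := by
  have h1 := h.list_prod_mem ((Finset.univ : Finset J).sort (· ≤ ·)) (fun k => F k (σ k)) _
    fun k => hF k (σ k)
  refine h.mem_of_eq h1 ?_
  have h2 : ∀ f : J → G, (((Finset.univ : Finset J).sort (· ≤ ·)).map f).sum = ∑ k, f k :=
    fun f => prod_univ_sort_map (K := Multiplicative G) f
  rw [h2, Finset.sum_sub_distrib, Equiv.sum_comp σ, sub_self]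

lemma rhoDet_mem [Fintype J] [LinearOrder J] (h : IsRhoComm ρ 𝒜) {F : Matrix J J A}
    (hF : GradedMatrix 𝒜 I I F) : rhoDet ρ I F ∈ 𝒜 0 :=
  sum_mem fun σ _ => Submodule.smul_mem _ _ (hF.list_prod_mem h σ)

/-- The twisted determinant computes the `ρ`-determinant. -/
lemma Twist.det_hat [Fintype J] [LinearOrder J] {η : J → K} (hη : ∀ k, η k ≠ 0)
    (hδ : ∀ k, deg (δ k) = I k - g) (hg : ∀ k, ρ (I k) (I k) = ρ g g)
    {F : Matrix J J A} (hF : GradedMatrix 𝒜 I I F) :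
    (c.hat h δ η F).det = c.emb h 0 (rhoDet ρ I F) := by
  have hmem : ∀ (σ : Equiv.Perm J),
      (((Finset.univ : Finset J).sort (· ≤ ·)).map fun k => F k (σ k)).prod ∈ 𝒜 (deg 0) :=
    fun σ => by rw [map_zero]; exact hF.list_prod_mem h σ
  unfold rhoDet
  -- Transposing pairs row `k` with column `σ k`, as in `rhoDet`.
  rw [c.emb_sum _ fun σ _ => Submodule.smul_mem _ _ (hmem σ), ← Matrix.det_transpose,
    Matrix.det_apply]
  refine Finset.sum_congr rfl fun σ _ => ?_
  have e1 : ∏ k, (c.hat h δ η F).transpose (σ k) k =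
      (((Finset.univ : Finset J).sort (· ≤ ·)).map fun k => c.emb h (δ k - δ (σ k))
        ((c (δ k - δ (σ k)) (-δ (σ k)) * (η k * (η (σ k))⁻¹)) • F k (σ k))).prod := by
    rw [prod_univ_sort_map]
    rfl
  rw [e1, c.emb_list_prod _ _ _ fun k => Submodule.smul_mem _ _ (hF.mem_deg hδ k (σ k))]
  have e2 : (((Finset.univ : Finset J).sort (· ≤ ·)).map fun k => δ k - δ (σ k)).sum = 0 := by
    have h2 : ∀ f : J → Γ, (((Finset.univ : Finset J).sort (· ≤ ·)).map f).sum = ∑ k, f k :=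
      fun f => prod_univ_sort_map (K := Multiplicative Γ) f
    rw [h2, Finset.sum_sub_distrib, Equiv.sum_comp σ, sub_self]
  have e3 : ∀ (l : List J) (φ : J → K) (f : J → A),
      (l.map fun k => φ k • f k).prod = (l.map φ).prod • (l.map f).prod := by
    intro l φ f
    induction l with
    | nil => simp
    | cons k l ih => simp only [List.map_cons, List.prod_cons, ih, smul_mul_smul_comm]
  -- The product of `η k / η (σ k)` over all `k` is `1`, so `η` has no influence on the determinant.
  rw [e2, e3, smul_smul, listPairProd_sort, prod_univ_sort_map, Finset.prod_mul_distrib,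
    Finset.prod_mul_distrib, Finset.prod_inv_distrib, Equiv.prod_comp σ,
    mul_inv_cancel₀ (Finset.prod_ne_zero_iff.2 fun k _ => hη k), mul_one]
  have e4 : ∀ a ∈ 𝒜 (deg 0), Equiv.Perm.sign σ • c.emb h 0 a =
      c.emb h 0 ((((Equiv.Perm.sign σ : ℤˣ) : ℤ) : K) • a) := by
    intro a ha
    rcases Int.units_eq_one_or (Equiv.Perm.sign σ) with e | e
    · rw [e]; simp
    · rw [e]
      simp only [Units.neg_smul, one_smul, Units.val_neg, Units.val_one, Int.cast_neg, Int.cast_one,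
        neg_smul]
      rw [c.emb_neg ha]
  rw [e4 _ (Submodule.smul_mem _ _ (hmem σ)), smul_smul]
  congr 2
  -- the identity of the scalar factors
  have hs : (((Equiv.Perm.sign σ : ℤˣ) : ℤ) : K) =
      pairProd fun l k => if σ k < σ l then (-1 : K) else 1 := by
    rw [sign_eq_pairProd]
    have := map_pairProd (((Int.castRingHom K : ℤ →* K)).comp (Units.coeHom ℤ))
      (fun l k => if σ k < σ l then (-1 : ℤˣ) else 1)
    refine this.trans (pairProd_congr fun l k _ => ?_)
    split_ifs <;> simp
  -- The swap rule of the twist, solved for `ρ (I a) (I b)`. The shift of the degrees by `g` leaves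
  -- the factors `ρ(·, g)` and `ρ(g, g)`, which cancel later.
  have hρ : ∀ a b, ρ (I a) (I b) = ρ g g * (c (δ b) (δ a) * (c (δ a) (δ b))⁻¹) *
      (ρ (I a) g * (ρ (I b) g)⁻¹) := by
    intro a b
    have h1 := c.swap (δ a) (δ b)
    rw [hδ, hδ, ρ.sub_left, ρ.sub_right, ρ.sub_right, ρ.swap (I b) g] at h1
    rw [← h1]
    have n1 := c.ne_zero (δ a) (δ b)
    have n2 := ρ.ne_zero (I a) g
    have n3 := ρ.ne_zero (I b) g
    have n4 := ρ.ne_zero g g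
    field_simp
    rw [pow_two, ρ.self_mul_self, mul_one]
  have hinv : ∀ φ : J → J → K, pairProd (fun l k => (φ l k)⁻¹) = (pairProd φ)⁻¹ := fun φ =>
    (map_pairProd (invMonoidWithZeroHom : K →*₀ K).toMonoidHom φ).symm
  have hne : ∀ φ : J → J → K, (∀ l k, φ l k ≠ 0) → pairProd φ ≠ 0 := by
    intro φ hφ
    rw [pairProd_eq]
    refine Finset.prod_ne_zero_iff.2 fun l _ => Finset.prod_ne_zero_iff.2 fun k _ => ?_
    split_ifs
    exacts [hφ l k, one_ne_zero]
  have n1 : ∀ a b, c (δ a) (δ b) ≠ 0 := fun a b => c.ne_zero _ _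
  have n2 : ∀ a, ρ (I a) g ≠ 0 := fun a => ρ.ne_zero _ _
  have ha := pairProd_perm σ fun a b => c (δ b) (δ a) * (ρ (I b) g)⁻¹
  -- The full double product of `c (δ k) (δ (σ l))` does not depend on `σ`. Splitting it into
  -- diagonal, upper and lower part, with and without `σ`, gives the only identity needed beyond
  -- cancellation.
  have hb := prod_prod_eq_pairProd fun l k => c (δ k) (δ (σ l))
  have hc := prod_prod_eq_pairProd fun l k => c (δ k) (δ l)
  rw [Equiv.prod_comp σ fun l => ∏ k, c (δ k) (δ l), hc] at hb
  have hL : pairProd (fun j k => c (δ j - δ (σ j)) (δ k - δ (σ k))) =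
      pairProd (fun l k => c (δ l) (δ k)) * pairProd (fun l k => c (δ (σ l)) (δ (σ k))) *
      (pairProd (fun l k => c (δ l) (δ (σ k))))⁻¹ * (pairProd (fun l k => c (δ (σ l)) (δ k)))⁻¹ := by
    rw [← hinv, ← hinv, ← pairProd_mul, ← pairProd_mul, ← pairProd_mul]
    refine pairProd_congr fun l k _ => ?_
    rw [c.sub_left, c.sub_right, c.sub_right, mul_inv, inv_inv]
    ring
  have hD : ∏ k, c (δ k - δ (σ k)) (-δ (σ k)) = (∏ k, c (δ k) (δ k)) *
      (∏ k, c (δ k) (δ (σ k)))⁻¹ := by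
    rw [← Equiv.prod_comp σ fun k => c (δ k) (δ k), ← Finset.prod_inv_distrib,
      ← Finset.prod_mul_distrib]
    refine Finset.prod_congr rfl fun k _ => ?_
    rw [c.sub_left, c.neg_right, c.neg_right, inv_inv, mul_comm]
  have hR : pairProd (fun l k => ρ (I (σ l)) (I k - I (σ k))) =
      pairProd (fun l k => c (δ k) (δ (σ l))) * pairProd (fun l k => c (δ (σ l)) (δ (σ k))) *
      (pairProd (fun l k => c (δ (σ l)) (δ k)))⁻¹ *
      (pairProd (fun l k => c (δ (σ k)) (δ (σ l)) * (ρ (I (σ k)) g)⁻¹))⁻¹ *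
      (pairProd (fun _ k => ρ (I k) g))⁻¹ := by
    rw [← hinv, ← hinv, ← hinv, ← pairProd_mul, ← pairProd_mul, ← pairProd_mul, ← pairProd_mul]
    refine pairProd_congr fun l k _ => ?_
    rw [ρ.sub_right, hρ (σ l) k, hρ (σ l) (σ k)]
    have m1 := n1 k (σ l)
    have m2 := n1 (σ l) k
    have m3 := n1 (σ k) (σ l)
    have m4 := n1 (σ l) (σ k)
    have m5 := n2 (σ l)
    have m6 := n2 (σ k)
    have m7 := n2 k
    have m8 := ρ.ne_zero g g
    field_simp
  have hI : pairProd (fun l k => if σ k < σ l then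
      -(ρ (I (σ l)) (I (σ l)) * ρ (I (σ l)) (I (σ k))) else 1) =
      (pairProd fun l k => if σ k < σ l then (-1 : K) else 1) *
      (pairProd (fun l k => c (δ (σ k)) (δ (σ l)) * (ρ (I (σ k)) g)⁻¹)) *
      (pairProd (fun a b => c (δ b) (δ a)))⁻¹ * pairProd (fun _ k => ρ (I k) g) := by
    have e5 : pairProd (fun _ k => ρ (I k) g) = (pairProd fun _ k => (ρ (I k) g)⁻¹)⁻¹ := by
      rw [hinv, inv_inv]
    rw [e5, mul_assoc _ (_)⁻¹, ← mul_inv, ← pairProd_mul (fun a b => c (δ b) (δ a)), ← ha, ← hinv, ← pairProd_mul,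
      ← pairProd_mul]
    refine pairProd_congr fun l k _ => ?_
    have m3 := n1 (σ k) (σ l)
    have m4 := n1 (σ l) (σ k)
    have m5 := n2 (σ l)
    have m6 := n2 (σ k)
    split_ifs
    · rw [hρ (σ l) (σ k), hg]
      have m8 := ρ.self_mul_self g
      field_simp
      rw [pow_two, m8]
    · field_simp
  rw [hs, hL, hD, hR, hI]
  have m1 := hne _ fun l k => n1 l (σ k)
  have m2 := hne _ fun l k => n1 (σ l) k
  have m3 := hne (fun l k => c (δ (σ k)) (δ (σ l)) * (ρ (I (σ k)) g)⁻¹) fun l k =>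
    mul_ne_zero (n1 _ _) (inv_ne_zero (n2 _))
  have m4 := hne (fun a b => c (δ b) (δ a)) fun l k => n1 k l
  have m5 := hne (fun _ k => ρ (I k) g) fun _ k => n2 k
  have m6 : ∏ k, c (δ k) (δ (σ k)) ≠ 0 := Finset.prod_ne_zero_iff.2 fun k _ => n1 _ _
  generalize pairProd (fun l k => c (δ (σ k)) (δ (σ l)) * (ρ (I (σ k)) g)⁻¹) = P at m3 ⊢
  field_simp
  linear_combination (pairProd (fun l k => if σ k < σ l then (-1 : K) else 1)) *
    (pairProd fun l k => c (δ (σ l)) (δ (σ k))) * hb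

/-- All degrees have the same parity. -/
def SameParity (ρ : CommutationFactor G K) (I : J → G) : Prop :=
  ∀ k l, ρ (I k) (I k) = ρ (I l) (I l)

/-- Subtracting one of the degrees, `g`, makes all of them even: `ρ(I k - g, I k - g) = ρ(I k, I k)
ρ(g, g) = 1`. Thus the even and the odd case are treated at once by the standard twist. -/
lemma SameParity.exists_twist [Fintype J] [LinearOrder J] (hI : SameParity ρ I) :
    ∃ (g : G) (deg : (J → ℤ) →+ G) (δ : J → J → ℤ), (∀ k, ρ (I k) (I k) = ρ g g) ∧
      (∀ k, deg (δ k) = I k - g) ∧ Nonempty (Twist ρ (J → ℤ) deg) := by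
  obtain ⟨g, hg⟩ : ∃ g, ∀ k, ρ (I k) (I k) = ρ g g := by
    rcases isEmpty_or_nonempty J with hJ | ⟨⟨k⟩⟩
    · exact ⟨0, fun k => hJ.elim k⟩
    · exact ⟨I k, fun l => hI l k⟩
  obtain ⟨deg, δ, h1, h2⟩ := RhoGeometry.exists_twist ρ (fun k => I k - g) fun k => by
    rw [ρ.sub_left, ρ.sub_right, ρ.sub_right, hg, ρ.swap (I k) g, mul_inv, inv_inv, inv_inv]
    have h1 := ρ.self_mul_self g
    have h2 := ρ.ne_zero (I k) g
    field_simp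
    rw [pow_two, h1]
  exact ⟨g, deg, δ, hg, h1, h2⟩

variable [Fintype J] [LinearOrder J]

/-- Multiplicativity of the ordinary determinant in the twisted ring, read back through the
injective inclusion of the degree-zero part. -/
lemma rhoDet_mul (h : IsRhoComm ρ 𝒜) (hI : SameParity ρ I) {F F' : Matrix J J A}
    (hF : GradedMatrix 𝒜 I I F) (hF' : GradedMatrix 𝒜 I I F') :
    rhoDet ρ I (F * F') = rhoDet ρ I F * rhoDet ρ I F' := by
  classical
  obtain ⟨g, deg, δ, hg, hδ, ⟨c⟩⟩ := hI.exists_twist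
  have hm : ∀ {F : Matrix J J A}, GradedMatrix 𝒜 I I F → rhoDet ρ I F ∈ 𝒜 (deg 0) := fun hF => by
    rw [map_zero]; exact rhoDet_mem h hF
  refine c.emb_injOn (h := h) (m := 0) (hm (hF.mul h hF'))
    (by rw [map_zero]; simpa using h.mul_mem (rhoDet_mem h hF) (rhoDet_mem h hF')) ?_
  have hη : ∀ k : J, (1 : K) ≠ 0 := fun _ => one_ne_zero
  rw [← c.det_hat (η := fun _ => 1) hη hδ hg (hF.mul h hF'), c.hat_mul hη hδ hF hF', Matrix.det_mul,
    c.det_hat hη hδ hg hF, c.det_hat hη hδ hg hF', c.emb_mul (hm hF) (hm hF'), c.zero_left, one_smul,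
    add_zero]

/-- The ordinary determinant in the twisted ring ignores the order of the indices, so the orders on
the two blocks need not be related to that on `J`. -/
lemma rhoDet_of_blockTriangular (h : IsRhoComm ρ 𝒜) (hI : SameParity ρ I) {F : Matrix J J A}
    (hF : GradedMatrix 𝒜 I I F) {J₁ J₂ : Type*} [Fintype J₁] [LinearOrder J₁] [Fintype J₂]
    [LinearOrder J₂] (e : J₁ ⊕ J₂ ≃ J) (h0 : ∀ a b, F (e (Sum.inr a)) (e (Sum.inl b)) = 0) :
    rhoDet ρ I F = rhoDet ρ (I ∘ e ∘ Sum.inl) (F.submatrix (e ∘ Sum.inl) (e ∘ Sum.inl)) *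
      rhoDet ρ (I ∘ e ∘ Sum.inr) (F.submatrix (e ∘ Sum.inr) (e ∘ Sum.inr)) := by
  obtain ⟨g, deg, δ, hg, hδ, ⟨c⟩⟩ := hI.exists_twist
  have hη : ∀ k : J, (1 : K) ≠ 0 := fun _ => one_ne_zero
  have hF1 := hF.submatrix (e ∘ Sum.inl) (e ∘ Sum.inl)
  have hF2 := hF.submatrix (e ∘ Sum.inr) (e ∘ Sum.inr)
  have m1 := rhoDet_mem h hF1
  have m2 := rhoDet_mem h hF2
  refine c.emb_injOn (h := h) (m := 0) (by rw [map_zero]; exact rhoDet_mem h hF)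
    (by rw [map_zero]; simpa using h.mul_mem m1 m2) ?_
  have d1 := c.det_hat (h := h) (I := I ∘ e ∘ Sum.inl) (η := fun _ => 1) (δ := fun k => δ (e (Sum.inl k)))
    (fun _ => one_ne_zero) (fun k => hδ _) (fun k => hg _) hF1
  have d2 := c.det_hat (h := h) (I := I ∘ e ∘ Sum.inr) (η := fun _ => 1) (δ := fun k => δ (e (Sum.inr k)))
    (fun _ => one_ne_zero) (fun k => hδ _) (fun k => hg _) hF2
  have hz : deg 0 = 0 := map_zero _
  rw [← c.det_hat (η := fun _ => 1) hη hδ hg hF, ← Matrix.det_submatrix_equiv_self e]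
  have hb : (c.hat h δ (fun _ => 1) F).submatrix e e = Matrix.fromBlocks
      (c.hat h (fun k => δ (e (Sum.inl k))) (fun _ => 1)
        (F.submatrix (e ∘ Sum.inl) (e ∘ Sum.inl)))
      (Matrix.of fun a b => c.hat h δ (fun _ => 1) F (e (Sum.inl a))
        (e (Sum.inr b))) 0
      (c.hat h (fun k => δ (e (Sum.inr k))) (fun _ => 1)
        (F.submatrix (e ∘ Sum.inr) (e ∘ Sum.inr))) := by
    refine Matrix.ext fun a b => ?_
    rcases a with a | a <;> rcases b with b | b
    · rw [Matrix.submatrix_apply, Matrix.fromBlocks_apply₁₁, c.hat_apply, c.hat_apply]; rfl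
    · rw [Matrix.submatrix_apply, Matrix.fromBlocks_apply₁₂, Matrix.of_apply]
    · rw [Matrix.submatrix_apply, Matrix.fromBlocks_apply₂₁, Matrix.zero_apply, c.hat_apply, h0, smul_zero, c.emb_zero]
    · rw [Matrix.submatrix_apply, Matrix.fromBlocks_apply₂₂, c.hat_apply, c.hat_apply]; rfl
  rw [hb, Matrix.det_fromBlocks_zero₂₁, d1, d2, c.emb_mul (by rw [hz]; exact m1)
    (by rw [hz]; exact m2), c.zero_left, one_smul, add_zero]

/-- The `ρ`-determinant of the `ρ`-transpose, with respect to shifted degrees. -/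
lemma rhoDet_transpose (h : IsRhoComm ρ 𝒜) (hI : SameParity ρ I) {F F' : Matrix J J A}
    (hF : GradedMatrix 𝒜 I I F) (i : G)
    (hF' : ∀ b a, F' b a = ρ (i - I b) (I a - I b) • F a b) :
    rhoDet ρ (fun k => i - I k) F' = rhoDet ρ I F := by
  classical
  obtain ⟨g, deg, δ, hg, hδ, ⟨c⟩⟩ := hI.exists_twist
  have hg1 : GradedMatrix 𝒜 (fun k => i - I k) (fun k => i - I k) F' := fun b a => by
    rw [hF']
    exact Submodule.smul_mem _ _ (h.mem_of_eq (hF a b) (sub_sub_sub_cancel_left _ _ _).symm)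
  have hz : deg 0 = 0 := map_zero _
  refine c.emb_injOn (h := h) (m := 0) (by rw [hz]; exact rhoDet_mem h hg1)
    (by rw [hz]; exact rhoDet_mem h hF) ?_
  -- The same twist serves for the degrees `i - I k`, with `-δ` in place of `δ` and base point `i -
  -- g`. The diagonal rescaling `η` is chosen so that the twisted matrix of the `ρ`-transpose
  -- becomes the transpose of the twisted matrix of `F`.
  let η : J → K := fun k => c (δ k) (δ k) * (ρ (I k) g * ρ i (I k))
  have hη : ∀ k, η k ≠ 0 := fun k =>
    mul_ne_zero (c.ne_zero _ _) (mul_ne_zero (ρ.ne_zero _ _) (ρ.ne_zero _ _))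
  rw [← c.det_hat (η := fun _ => 1) (fun _ => one_ne_zero) hδ hg hF,
    ← c.det_hat (δ := fun k => -δ k) (g := i - g) (I := fun k => i - I k) hη
      (fun k => by rw [map_neg, hδ]; abel)
      (fun k => ?_) hg1, ← Matrix.det_transpose]
  · congr 1
    refine Matrix.ext fun a b => ?_
    rw [Matrix.transpose_apply, c.hat_apply, c.hat_apply, hF', smul_smul, neg_sub_neg, neg_neg]
    congr 2
    have h1 := c.swap (δ a) (δ b)
    rw [hδ, hδ, ρ.sub_left, ρ.sub_right, ρ.sub_right, ρ.swap (I b) g] at h1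
    simp only [c.sub_left, c.neg_right, ρ.sub_left, ρ.sub_right, η, ← h1]
    rw [ρ.swap (I a) (I b), hg b]
    have n1 := c.ne_zero (δ a) (δ b)
    have n2 := c.ne_zero (δ a) (δ a)
    have n3 := c.ne_zero (δ b) (δ b)
    have n4 := ρ.ne_zero (I a) g
    have n5 := ρ.ne_zero (I b) g
    have n6 := ρ.ne_zero g g
    have n7 := ρ.ne_zero i (I a)
    have n8 := ρ.ne_zero i (I b)
    have n9 := ρ.ne_zero (I a) (I b)
    have n10 := ρ.self_mul_self g
    field_simp
  · rw [ρ.sub_left, ρ.sub_right, ρ.sub_right, ρ.sub_left i g, ρ.sub_right, ρ.sub_right, hg k,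
      ρ.swap i (I k), ρ.swap i g]
    have n1 := ρ.ne_zero i (I k)
    have n2 := ρ.ne_zero i g
    field_simp

lemma map_rhoDet {B : Type*} [Ring B] [Algebra K B] (f : A →ₐ[K] B) (I : J → G) (F : Matrix J J A) :
    f (rhoDet ρ I F) = rhoDet ρ I (F.map f) := by
  simp only [rhoDet, map_sum, map_smul, map_list_prod, List.map_map]
  rfl

/-- The expansion to first order of the `ρ`-determinant. -/
lemma rhoDet_one_add [D : DecidableEq J] (I : J → G) {N : Matrix J J A}
    (hN : ∀ k l k' l', N k l * N k' l' = 0) : rhoDet ρ I (1 + N) = 1 + ∑ k, N k k := by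
  obtain rfl : D = LinearOrder.toDecidableEq := Subsingleton.elim _ _
  have hmul : ∀ a b k l, N a b * (1 + N) k l = if k = l then N a b else 0 := by
    intro a b k l
    rw [Matrix.add_apply, mul_add, hN, add_zero, Matrix.one_apply]
    split_ifs <;> simp
  -- An entry of `N` absorbs the diagonal entries that follow and is annihilated by the next
  -- off-diagonal one.
  have h1 : ∀ (σ : Equiv.Perm J) (l : List J) (a b : J), (∃ k ∈ l, σ k ≠ k) →
      N a b * (l.map fun k => (1 + N) k (σ k)).prod = 0 := by
    intro σ l
    induction l with
    | nil => simp
    | cons k l ih =>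
      rintro a b ⟨m, hm, hσ⟩
      rw [List.map_cons, List.prod_cons, ← mul_assoc, hmul]
      split_ifs with hk
      · refine ih a b ⟨m, ?_, hσ⟩
        rcases List.mem_cons.1 hm with rfl | h'
        · exact absurd hk.symm hσ
        · exact h'
      · exact zero_mul _
  have h2 : ∀ (σ : Equiv.Perm J) (l : List J), (∃ k ∈ l, ∃ k' ∈ l, k ≠ k' ∧ σ k ≠ k ∧ σ k' ≠ k') →
      (l.map fun k => (1 + N) k (σ k)).prod = 0 := by
    intro σ l
    induction l with
    | nil => simp
    | cons m l ih =>
      rintro ⟨k, hk, k', hk', hne, h1', h2'⟩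
      have hoff : ∀ m, σ m ≠ m → (1 + N) m (σ m) = N m (σ m) := fun m hm => by
        rw [Matrix.add_apply, Matrix.one_apply_ne hm.symm, zero_add]
      rw [List.map_cons, List.prod_cons]
      rcases List.mem_cons.1 hk with rfl | hk2
      · rw [hoff k h1']
        exact h1 σ l _ _ ⟨k', (List.mem_cons.1 hk').resolve_left hne.symm, h2'⟩
      · rcases List.mem_cons.1 hk' with rfl | hk2'
        · rw [hoff k' h2']
          exact h1 σ l _ _ ⟨k, hk2, h1'⟩
        · rw [ih ⟨k, hk2, k', hk2', hne, h1', h2'⟩, mul_zero]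
  unfold rhoDet
  rw [Finset.sum_eq_single 1]
  · have e1 : pairProd (fun l k => ρ (I ((1 : Equiv.Perm J) l)) (I k - I ((1 : Equiv.Perm J) k))) = 1 := by
      simp [pairProd_eq, ρ.zero_right]
    have e2 : (pairProd fun l k => if (1 : Equiv.Perm J) k < (1 : Equiv.Perm J) l then
        -(ρ (I ((1 : Equiv.Perm J) l)) (I ((1 : Equiv.Perm J) l)) *
          ρ (I ((1 : Equiv.Perm J) l)) (I ((1 : Equiv.Perm J) k))) else 1) = 1 := by
      rw [pairProd_congr (ψ := fun _ _ => 1)]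
      · simp [pairProd_eq]
      · exact fun l k hlk => if_neg hlk.not_gt
    rw [e1, e2, one_mul, one_smul]
    have h3 : ∀ l : List J, (l.map fun k => (1 + N) k ((1 : Equiv.Perm J) k)).prod =
        1 + (l.map fun k => N k k).sum := by
      intro l
      induction l with
      | nil => simp
      | cons k l ih =>
        rw [List.map_cons, List.prod_cons, ih, List.map_cons, List.sum_cons, Equiv.Perm.one_apply,
          Matrix.add_apply, Matrix.one_apply_eq, add_mul, one_mul, mul_add, mul_one]
        have : N k k * (l.map fun k => N k k).sum = 0 := by
          rw [← List.sum_map_mul_left]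
          refine List.sum_eq_zero fun x hx => ?_
          obtain ⟨m, _, rfl⟩ := List.mem_map.1 hx
          exact hN _ _ _ _
        rw [this, add_zero]
        abel
    rw [h3]
    congr 1
    exact prod_univ_sort_map (K := Multiplicative A) fun k => N k k
  · intro σ _ hσ
    obtain ⟨k, hk⟩ : ∃ k, σ k ≠ k := by
      by_contra! hcon
      exact hσ (Equiv.ext hcon)
    -- A permutation that moves `k` also moves `σ k`, so its product contains two entries of `N`.
    rw [h2 σ _ ⟨k, ?_, σ k, ?_, hk.symm, hk, σ.injective.ne hk⟩, smul_zero]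
    all_goals exact (Finset.mem_sort _).2 (Finset.mem_univ _)
  · simp

end RhoDet

/-! ### Properties of the `ρ`-Berezinian -/

section RhoBer

variable {G K : Type*} [AddCommGroup G] [Field K] {ρ : CommutationFactor G K}
variable {A : Type*} [Ring A] [Algebra K A] {𝒜 : G → Submodule K A}
variable {J : Type*} {I : J → G}

/-- The inverse of a graded matrix is graded. -/
lemma GradedMatrix.of_mul_eq_one [DecidableEq G] (h : IsRhoComm ρ 𝒜) (hint : DirectSum.IsInternal 𝒜)
    [Fintype J] [DecidableEq J] {F V : Matrix J J A} (hF : GradedMatrix 𝒜 I I F) (h1 : F * V = 1)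
    (h2 : V * F = 1) : GradedMatrix 𝒜 I I V := by
  let _ : DirectSum.Decomposition 𝒜 := hint.chooseDecomposition
  let _ : GradedRing 𝒜 := { one_mem := h.one_mem, mul_mem := fun _ _ _ _ ha hb => h.mul_mem ha hb }
  -- The components of `V` in the expected degrees. Comparing the degree `I k - I m` parts in `F * V
  -- = 1` shows that they already form a right inverse, which must be `V`.
  let V' : Matrix J J A := Matrix.of fun k l => (DirectSum.decompose 𝒜 (V k l) (I k - I l) : A)
  have e : F * V' = 1 := by
    refine Matrix.ext fun k m => ?_
    have e1 : (1 : Matrix J J A) k m =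
        (DirectSum.decompose 𝒜 ((1 : Matrix J J A) k m) (I k - I m) : A) :=
      (DirectSum.decompose_of_mem_same 𝒜 (GradedMatrix.one h k m)).symm
    rw [e1, ← h1, Matrix.mul_apply, Matrix.mul_apply, DirectSum.decompose_sum, DFinsupp.finsetSum_apply,
      AddSubmonoidClass.coe_finsetSum]
    refine Finset.sum_congr rfl fun l _ => ?_
    rw [← sub_add_sub_cancel (I k) (I l) (I m), DirectSum.coe_decompose_mul_add_of_left_mem 𝒜 (hF k l)]
    rfl
  have e2 : V = V' := by rw [← mul_one V, ← e, ← mul_assoc, h2, one_mul]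
  intro k l
  rw [e2]
  exact SetLike.coe_mem _

variable (ρ I) in
/-- The even indices. -/
abbrev EvIdx := {k : J // ¬ ρ.IsOdd (I k)}

variable (ρ I) in
/-- The odd indices. -/
abbrev OdIdx := {k : J // ρ.IsOdd (I k)}

variable (ρ I) in
/-- The inclusion of the even indices. -/
abbrev evVal : EvIdx ρ I → J := Subtype.val

variable (ρ I) in
/-- The inclusion of the odd indices. -/
abbrev odVal : OdIdx ρ I → J := Subtype.val

lemma sameParity_ev : SameParity ρ (I ∘ evVal ρ I) := fun k l =>
  (ρ.self_of_not_isOdd k.2).trans (ρ.self_of_not_isOdd l.2).symm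

lemma sameParity_od : SameParity ρ (I ∘ odVal ρ I) := fun k l =>
  Eq.trans k.2 (Eq.symm l.2)

lemma rhoDet_one [Fintype J] [LinearOrder J] [DecidableEq J] (I : J → G) : rhoDet ρ I (1 : Matrix J J A) = 1 := by
  simpa using rhoDet_one_add (ρ := ρ) I (N := (0 : Matrix J J A)) (by simp)

open scoped Classical in
lemma sum_ev_add_sum_od [Fintype J] {B : Type*} [AddCommMonoid B] (f : J → B) :
    ∑ k, f k = ∑ k : EvIdx ρ I, f k + ∑ k : OdIdx ρ I, f k := by
  rw [add_comm]
  exact (Fintype.sum_subtype_add_sum_subtype (fun k => ρ.IsOdd (I k)) f).symm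

open scoped Classical in
lemma submatrix_mul_blocks [Fintype J] {L L' : Type*} (F F' : Matrix J J A) (e : L → J) (e' : L' → J) :
    (F * F').submatrix e e' =
      F.submatrix e (evVal ρ I) * F'.submatrix (evVal ρ I) e' +
      F.submatrix e (odVal ρ I) * F'.submatrix (odVal ρ I) e' := by
  refine Matrix.ext fun k l => ?_
  rw [Matrix.submatrix_apply, Matrix.mul_apply, sum_ev_add_sum_od (ρ := ρ) (I := I)]
  rfl

lemma Ring.inverse_eq_of_mul_eq_one {a b : A} (h1 : a * b = 1) (h2 : b * a = 1) :
    Ring.inverse a = b :=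
  Ring.inverse_unit (⟨a, b, h1, h2⟩ : Aˣ)

variable [Fintype J] [LinearOrder J]

lemma rhoDet_mul_rhoDet (h : IsRhoComm ρ 𝒜) (hI : SameParity ρ I) {F V : Matrix J J A}
    (hF : GradedMatrix 𝒜 I I F) (hV : GradedMatrix 𝒜 I I V) (h1 : F * V = 1) :
    rhoDet ρ I F * rhoDet ρ I V = 1 := by
  rw [← rhoDet_mul h hI hF hV, h1, rhoDet_one]

-- This replaces `Ring.inverse` by given inverses of the blocks. The inverse of the determinant of
-- the odd block is the determinant of `V`, by multiplicativity.
open scoped Classical in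
lemma rhoBer_eq (h : IsRhoComm ρ 𝒜) {F : Matrix J J A} (hF : GradedMatrix 𝒜 I I F)
    {E : Matrix (EvIdx ρ I) (EvIdx ρ I) A} {V : Matrix (OdIdx ρ I) (OdIdx ρ I) A}
    (hE1 : F.submatrix (evVal ρ I) (evVal ρ I) * E = 1)
    (hE2 : E * F.submatrix (evVal ρ I) (evVal ρ I) = 1)
    (hV : GradedMatrix 𝒜 (I ∘ odVal ρ I) (I ∘ odVal ρ I) V)
    (hV1 : F.submatrix (odVal ρ I) (odVal ρ I) * V = 1)
    (hV2 : V * F.submatrix (odVal ρ I) (odVal ρ I) = 1) :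
    rhoBer ρ I F = rhoDet ρ (I ∘ evVal ρ I)
      (F.submatrix (evVal ρ I) (evVal ρ I) -
        F.submatrix (evVal ρ I) (odVal ρ I) * V * F.submatrix (odVal ρ I) (evVal ρ I)) *
      rhoDet ρ (I ∘ odVal ρ I) V := by
  have u1 : IsUnit (F.submatrix (evVal ρ I) (evVal ρ I)) :=
    ⟨⟨_, E, hE1, hE2⟩, rfl⟩
  have u2 : IsUnit (F.submatrix (odVal ρ I) (odVal ρ I)) :=
    ⟨⟨_, V, hV1, hV2⟩, rfl⟩
  have hF1 := hF.submatrix (odVal ρ I) (odVal ρ I)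
  have e1 := Ring.inverse_eq_of_mul_eq_one hV1 hV2
  have e2 := Ring.inverse_eq_of_mul_eq_one (rhoDet_mul_rhoDet h sameParity_od hF1 hV hV1)
    (rhoDet_mul_rhoDet h sameParity_od hV hF1 hV2)
  unfold rhoBer
  dsimp only
  rw [if_pos ⟨u1, u2⟩, e1, e2]

/-! ### The algebra homomorphism of a derivation -/

/-- A `ρ`-derivation of degree `q` of the `ρ`-commutative algebra `A`; the algebra homomorphism `θ`
is the multiplication by `ρ(q,j)` on the elements of degree `j`. -/
structure RhoDerivation (ρ : CommutationFactor G K) (𝒜 : G → Submodule K A) (q : G) where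
  D : A →ₗ[K] A
  θ : A →ₐ[K] A
  θ_apply : ∀ {j f}, f ∈ 𝒜 j → θ f = ρ q j • f
  mem : ∀ {j f}, f ∈ 𝒜 j → D f ∈ 𝒜 (q + j)
  leibniz : ∀ f g, D (f * g) = D f * g + θ f * D g

namespace RhoDerivation

variable {q : G} (Q : RhoDerivation ρ 𝒜 q)

/-- The homomorphism `f ↦ f + η Q(f)` of `A` to its dual numbers, represented by triangular
matrices. -/
def graph : A →ₐ[K] Matrix (Fin 2) (Fin 2) A :=
  AlgHom.ofLinearMap
    { toFun := fun f => !![Q.θ f, Q.D f; 0, f]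
      map_add' := fun f g => by
        ext i j
        fin_cases i <;> fin_cases j <;> simp
      map_smul' := fun c f => by
        ext i j
        fin_cases i <;> fin_cases j <;> simp }
    (by
      have h1 : Q.D 1 = 0 := by
        have := Q.leibniz 1 1
        simpa using this
      ext i j
      fin_cases i <;> fin_cases j <;> simp [h1])
    (fun f g => by
      ext i j
      fin_cases i <;> fin_cases j <;>
        simp [Matrix.mul_apply, Fin.sum_univ_two, Q.leibniz, add_comm])

lemma graph_apply (f : A) : Q.graph f = !![Q.θ f, Q.D f; 0, f] := rfl

/-- The inclusion of `A` into its dual numbers. -/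
def zeroSection : A →ₐ[K] Matrix (Fin 2) (Fin 2) A :=
  AlgHom.ofLinearMap
    { toFun := fun f => !![Q.θ f, 0; 0, f]
      map_add' := fun f g => by
        ext i j
        fin_cases i <;> fin_cases j <;> simp
      map_smul' := fun c f => by
        ext i j
        fin_cases i <;> fin_cases j <;> simp }
    (by
      ext i j
      fin_cases i <;> fin_cases j <;> simp)
    (fun f g => by
      ext i j
      fin_cases i <;> fin_cases j <;> simp [Matrix.mul_apply, Fin.sum_univ_two])

lemma zeroSection_apply (f : A) : Q.zeroSection f = !![Q.θ f, 0; 0, f] := rfl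

variable (ρ 𝒜 q) in
/-- The grading of the dual numbers. -/
def dualGrade (j : G) : Submodule K (Matrix (Fin 2) (Fin 2) A) where
  carrier := {M | M 1 1 ∈ 𝒜 j ∧ M 0 1 ∈ 𝒜 (q + j) ∧ M 1 0 = 0 ∧ M 0 0 = ρ q j • M 1 1}
  zero_mem' := ⟨zero_mem _, zero_mem _, rfl, by simp⟩
  add_mem' := by
    rintro M N ⟨h1, h2, h3, h4⟩ ⟨h1', h2', h3', h4'⟩
    exact ⟨add_mem h1 h1', add_mem h2 h2', by simp [h3, h3'], by simp [h4, h4']⟩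
  smul_mem' := by
    rintro c M ⟨h1, h2, h3, h4⟩
    exact ⟨Submodule.smul_mem _ _ h1, Submodule.smul_mem _ _ h2, by simp [h3], by
      simp [h4, smul_comm c]⟩

/-- The matrix stands for `x + η y` with `η` of degree `-q`: the upper right entry is `y`, and the
upper left entry carries the sign of moving `η` past `x`. Since these dual numbers are again
`ρ`-commutative, the results on determinants apply to matrices of dual numbers. -/
lemma isRhoComm_dual (h : IsRhoComm ρ 𝒜) (q : G) : IsRhoComm ρ (dualGrade ρ 𝒜 q) where
  one_mem := ⟨h.one_mem, by simp, by simp, by simp [ρ.zero_right]⟩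
  mul_mem := by
    rintro i j f g ⟨h1, h2, h3, h4⟩ ⟨h1', h2', h3', h4'⟩
    refine ⟨?_, ?_, ?_, ?_⟩
    · rw [Matrix.mul_apply, Fin.sum_univ_two, h3, zero_mul, zero_add]
      exact h.mul_mem h1 h1'
    · rw [Matrix.mul_apply, Fin.sum_univ_two, h4, smul_mul_assoc]
      exact add_mem (Submodule.smul_mem _ _ (h.mem_of_eq (h.mul_mem h1 h2') (by abel)))
        (h.mem_of_eq (h.mul_mem h2 h1') (by abel))
    · rw [Matrix.mul_apply, Fin.sum_univ_two, h3, h3', zero_mul, mul_zero, add_zero]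
    · rw [Matrix.mul_apply, Matrix.mul_apply, Fin.sum_univ_two, Fin.sum_univ_two, h3, h3', h4, h4',
        mul_zero, zero_mul, add_zero, zero_add, smul_mul_smul_comm, ρ.add_right]
  comm := by
    rintro i j f g ⟨h1, h2, h3, h4⟩ ⟨h1', h2', h3', h4'⟩
    have n1 := ρ.ne_zero i j
    have n2 := ρ.ne_zero q i
    have n3 := ρ.ne_zero q j
    ext a b
    rw [Matrix.smul_apply, Matrix.mul_apply, Matrix.mul_apply, Fin.sum_univ_two, Fin.sum_univ_two]
    fin_cases a <;> fin_cases b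
    · change f 0 0 * g 0 0 + f 0 1 * g 1 0 = ρ i j • (g 0 0 * f 0 0 + g 0 1 * f 1 0)
      rw [h3, h3', h4, h4', mul_zero, mul_zero, add_zero, add_zero, smul_mul_smul_comm,
        smul_mul_smul_comm, h.comm h1 h1', smul_smul, smul_smul]
      congr 1
      ring
    · change f 0 0 * g 0 1 + f 0 1 * g 1 1 = ρ i j • (g 0 0 * f 0 1 + g 0 1 * f 1 1)
      rw [h4, h4', smul_mul_assoc, smul_mul_assoc, h.comm h1 h2', h.comm h2 h1', smul_add,
        smul_smul, smul_smul, add_comm, ρ.add_left, ρ.add_right, ρ.swap q i]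
      congr 2
      · ring
      · field_simp
    · change f 1 0 * g 0 0 + f 1 1 * g 1 0 = ρ i j • (g 1 0 * f 0 0 + g 1 1 * f 1 0)
      rw [h3, h3']
      simp
    · change f 1 0 * g 0 1 + f 1 1 * g 1 1 = ρ i j • (g 1 0 * f 0 1 + g 1 1 * f 1 1)
      rw [h3, h3', zero_mul, zero_mul, zero_add, zero_add, h.comm h1 h1']

lemma graph_mem {j : G} {f : A} (hf : f ∈ 𝒜 j) : Q.graph f ∈ dualGrade ρ 𝒜 q j :=
  ⟨hf, Q.mem hf, rfl, Q.θ_apply hf⟩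

lemma zeroSection_mem {j : G} {f : A} (hf : f ∈ 𝒜 j) : Q.zeroSection f ∈ dualGrade ρ 𝒜 q j :=
  ⟨hf, zero_mem _, rfl, Q.θ_apply hf⟩

/-- The entries of the matrix are nilpotent dual numbers. -/
def IsNil {L L' : Type*} (P : Matrix L L' (Matrix (Fin 2) (Fin 2) A)) : Prop :=
  ∀ k l, P k l 0 0 = 0 ∧ P k l 1 0 = 0 ∧ P k l 1 1 = 0

/-- The entries of the matrix are triangular. -/
def IsTri {L L' : Type*} (P : Matrix L L' (Matrix (Fin 2) (Fin 2) A)) : Prop := ∀ k l, P k l 1 0 = 0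

section Nil

variable {L L' L'' : Type*}

lemma IsNil.add {P P' : Matrix L L' (Matrix (Fin 2) (Fin 2) A)} (hP : IsNil P) (hP' : IsNil P') :
    IsNil (P + P') := fun k l => by simp [hP k l, hP' k l]

lemma IsNil.neg {P : Matrix L L' (Matrix (Fin 2) (Fin 2) A)} (hP : IsNil P) :
    IsNil (-P) := fun k l => by simp [hP k l]

lemma IsNil.submatrix {N N' : Type*} {P : Matrix L L' (Matrix (Fin 2) (Fin 2) A)} (hP : IsNil P)
    (e : N → L) (e' : N' → L') : IsNil (P.submatrix e e') := fun k l => hP (e k) (e' l)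

lemma IsNil.mul_tri [Fintype L'] {P : Matrix L L' (Matrix (Fin 2) (Fin 2) A)}
    {P' : Matrix L' L'' (Matrix (Fin 2) (Fin 2) A)} (hP : IsNil P) (hP' : IsTri P') :
    IsNil (P * P') := fun k l => by
  simp only [Matrix.mul_apply, Matrix.sum_apply, Fin.sum_univ_two, (hP _ _).1, (hP _ _).2.1,
    (hP _ _).2.2, hP' _ _]
  simp

lemma IsTri.mul_nil [Fintype L'] {P : Matrix L L' (Matrix (Fin 2) (Fin 2) A)}
    {P' : Matrix L' L'' (Matrix (Fin 2) (Fin 2) A)} (hP : IsTri P) (hP' : IsNil P') :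
    IsNil (P * P') := fun k l => by
  simp only [Matrix.mul_apply, Matrix.sum_apply, Fin.sum_univ_two, (hP' _ _).1, (hP' _ _).2.1,
    (hP' _ _).2.2, hP _ _]
  simp

lemma nil_mul_nil {x y : Matrix (Fin 2) (Fin 2) A} (hx : x 0 0 = 0 ∧ x 1 0 = 0 ∧ x 1 1 = 0)
    (hy : y 0 0 = 0 ∧ y 1 0 = 0 ∧ y 1 1 = 0) : x * y = 0 := by
  ext i j
  rw [Matrix.mul_apply, Fin.sum_univ_two]
  fin_cases i <;> fin_cases j <;> simp [hx, hy]

lemma IsNil.mul_nil [Fintype L'] {P : Matrix L L' (Matrix (Fin 2) (Fin 2) A)}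
    {P' : Matrix L' L'' (Matrix (Fin 2) (Fin 2) A)} (hP : IsNil P) (hP' : IsNil P') :
    P * P' = 0 := by
  refine Matrix.ext fun k l => ?_
  rw [Matrix.mul_apply]
  exact Finset.sum_eq_zero fun m _ => nil_mul_nil (hP _ _) (hP' _ _)

end Nil

open scoped Classical in
/-- The logarithmic derivative of the `ρ`-Berezinian is the `ρ`-supertrace. -/
theorem apply_rhoBer (h : IsRhoComm ρ 𝒜) {F F' : Matrix J J A} (hF : GradedMatrix 𝒜 I I F)
    (hF' : GradedMatrix 𝒜 I I F') (hFF' : F * F' = 1)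
    {E : Matrix (EvIdx ρ I) (EvIdx ρ I) A} {V : Matrix (OdIdx ρ I) (OdIdx ρ I) A}
    (hE1 : F.submatrix (evVal ρ I) (evVal ρ I) * E = 1)
    (hE2 : E * F.submatrix (evVal ρ I) (evVal ρ I) = 1)
    (hV : GradedMatrix 𝒜 (I ∘ odVal ρ I) (I ∘ odVal ρ I) V)
    (hV1 : F.submatrix (odVal ρ I) (odVal ρ I) * V = 1)
    (hV2 : V * F.submatrix (odVal ρ I) (odVal ρ I) = 1) :
    Q.D (rhoBer ρ I F) = rhoBer ρ I F *
      ∑ k, ρ (I k) (I k) • ∑ l, ρ q (I k - I l) • (F' k l * Q.D (F l k)) := by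
  have h₂ := isRhoComm_dual h q
  set ev := evVal ρ I with hev
  set od := odVal ρ I with hod
  set f := F.map Q.zeroSection with hf
  set f' := F'.map Q.zeroSection with hf'
  set v := V.map Q.zeroSection with hv
  set g := F.map Q.graph with hg
  set w := V.map Q.graph with hw
  -- The derivation enters as a perturbation: the image of `F` under the graph is `f (1 + N)`, where
  -- `N` is the nilpotent matrix of the terms `F' Q(F)` and products of two nilpotent entries
  -- vanish.
  set N := f' * (g - f) with hN
  have ff' : f * f' = 1 := by
    rw [hf, hf', ← Matrix.map_mul, hFF', Matrix.map_one _ (map_zero _) (map_one _)]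
  have gN : g = f + f * N := by
    rw [hN, ← mul_assoc, ff', one_mul, add_sub_cancel]
  have tri : ∀ {L L' : Type _} (P : Matrix L L' A), IsTri (P.map Q.zeroSection) :=
    fun P k l => by simp [zeroSection_apply]
  have nilD : IsNil (g - f) := fun k l => by
    simp [hg, hf, graph_apply, zeroSection_apply]
  have nilN : IsNil N := (tri F').mul_nil nilD
  have gf : GradedMatrix (dualGrade ρ 𝒜 q) I I f := fun k l => Q.zeroSection_mem (hF k l)
  have gf' : GradedMatrix (dualGrade ρ 𝒜 q) I I f' := fun k l => Q.zeroSection_mem (hF' k l)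
  have gg : GradedMatrix (dualGrade ρ 𝒜 q) I I g := fun k l => Q.graph_mem (hF k l)
  have gv : GradedMatrix (dualGrade ρ 𝒜 q) (I ∘ od) (I ∘ od) v := fun k l =>
    Q.zeroSection_mem (hV k l)
  have grN : GradedMatrix (dualGrade ρ 𝒜 q) I I N := gf'.mul h₂ (gg.sub gf)
  set N00 := N.submatrix ev ev with hN00
  set N01 := N.submatrix ev od with hN01
  set N10 := N.submatrix od ev with hN10
  set N11 := N.submatrix od od with hN11
  set f00 := f.submatrix ev ev with hf00
  set f01 := f.submatrix ev od with hf01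
  set f10 := f.submatrix od ev with hf10
  set f11 := f.submatrix od od with hf11
  have g00 : g.submatrix ev ev = f00 + (f00 * N00 + f01 * N10) := by
    rw [gN, hf00, hN00, hf01, hN10, ← submatrix_mul_blocks]
    rfl
  have g01 : g.submatrix ev od = f01 + (f00 * N01 + f01 * N11) := by
    rw [gN, hf00, hN01, hf01, hN11, ← submatrix_mul_blocks]
    rfl
  have g10 : g.submatrix od ev = f10 + (f10 * N00 + f11 * N10) := by
    rw [gN, hf10, hN00, hf11, hN10, ← submatrix_mul_blocks]
    rfl
  have g11 : g.submatrix od od = f11 + (f10 * N01 + f11 * N11) := by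
    rw [gN, hf10, hN01, hf11, hN11, ← submatrix_mul_blocks]
    rfl
  have n00 : IsNil N00 := nilN.submatrix _ _
  have n01 : IsNil N01 := nilN.submatrix _ _
  have n10 : IsNil N10 := nilN.submatrix _ _
  have n11 : IsNil N11 := nilN.submatrix _ _
  have t00 : IsTri f00 := fun k l => tri F k.1 l.1
  have t01 : IsTri f01 := fun k l => tri F k.1 l.1
  have t10 : IsTri f10 := fun k l => tri F k.1 l.1
  have t11 : IsTri f11 := fun k l => tri F k.1 l.1
  have tv : IsTri v := tri V
  have fv : f11 * v = 1 := by
    have := congrArg (fun P => P.map Q.zeroSection) hV1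
    simp only [Matrix.map_mul] at this
    rw [Matrix.map_one _ (map_zero _) (map_one _)] at this
    exact this
  have vf : v * f11 = 1 := by
    have := congrArg (fun P => P.map Q.zeroSection) hV2
    simp only [Matrix.map_mul] at this
    rw [Matrix.map_one _ (map_zero _) (map_one _)] at this
    exact this
  have wg : w * g.submatrix od od = 1 := by
    have := congrArg (fun P => P.map Q.graph) hV2
    simp only [Matrix.map_mul] at this
    rw [Matrix.map_one _ (map_zero _) (map_one _)] at this
    exact this
  -- the inverse of the odd block
  set X := v * f10 with hX
  have tX : IsTri X := fun k l => by
    have : X = (V * F.submatrix od ev).map Q.zeroSection := by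
      rw [Matrix.map_mul]
      rfl
    rw [this]
    exact tri _ _ _
  set M := N11 + X * N01 with hM
  have nM : IsNil M := n11.add (tX.mul_nil n01)
  have hfX : f11 * X = f10 := by
    rw [hX, ← Matrix.mul_assoc, fv, Matrix.one_mul]
  -- The perturbed odd block is `f11 (1 + M)`, and `1 - M` inverts `1 + M` because `M * M = 0`.
  have hwv : w = (1 + -M) * v := by
    have e1 : g.submatrix od od * ((1 + -M) * v) = 1 := by
      have e2 : g.submatrix od od = f11 * (1 + M) := by
        rw [g11, hM, mul_add, mul_add, mul_one, ← Matrix.mul_assoc, hfX, add_comm (f10 * N01)]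
      have e3 : (1 + M) * (1 + -M) = 1 := by
        rw [mul_add, mul_one, add_mul, one_mul, mul_neg, nM.mul_nil nM]
        abel
      rw [e2, mul_assoc, ← mul_assoc (1 + M), e3, one_mul, fv]
    calc w = w * (g.submatrix od od * ((1 + -M) * v)) := by rw [e1, mul_one]
      _ = (1 + -M) * v := by rw [← mul_assoc, wg, one_mul]
  -- the Schur complement
  set S := F.submatrix ev ev - F.submatrix ev od * V * F.submatrix od ev with hS
  set s := S.map Q.zeroSection with hs
  set L := N00 + -(N01 * X) with hL
  have nL : IsNil L := n00.add (n01.mul_tri tX).neg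
  have hsf : s = f00 - f01 * X := by
    rw [hs, hS, Matrix.map_sub _ (map_sub _), Matrix.map_mul, Matrix.map_mul, Matrix.mul_assoc]
    rfl
  -- To first order the Schur complement is multiplied by `1 + L`; all terms with two nilpotent
  -- factors drop out.
  have hSg : S.map Q.graph = s * (1 + L) := by
    have e1 : S.map Q.graph = g.submatrix ev ev - g.submatrix ev od * w * g.submatrix od ev := by
      rw [hS, Matrix.map_sub _ (map_sub _), Matrix.map_mul, Matrix.map_mul]
      rfl
    have nP : IsNil (f00 * N01 + f01 * N11) := (t00.mul_nil n01).add (t01.mul_nil n11)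
    have nR : IsNil (f10 * N00 + f11 * N10) := (t10.mul_nil n00).add (t11.mul_nil n10)
    have e2 : g.submatrix ev od * (1 + -M) = f01 + (f00 * N01 + f01 * N11) + -(f01 * M) := by
      rw [g01, Matrix.mul_add, Matrix.mul_one, Matrix.mul_neg, Matrix.add_mul, nP.mul_nil nM,
        add_zero]
    have nT : IsNil ((f00 * N01 + f01 * N11) + -(f01 * M)) := nP.add (t01.mul_nil nM).neg
    have nvR : IsNil (v * (f10 * N00 + f11 * N10)) := tv.mul_nil nR
    have e3 : (f01 + ((f00 * N01 + f01 * N11) + -(f01 * M))) * (X + v * (f10 * N00 + f11 * N10)) =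
        f01 * X + f01 * (v * (f10 * N00 + f11 * N10)) +
          ((f00 * N01 + f01 * N11) + -(f01 * M)) * X := by
      rw [Matrix.add_mul, Matrix.mul_add, Matrix.mul_add _ X, nT.mul_nil nvR, add_zero]
    have e4 : v * (f10 * N00 + f11 * N10) = X * N00 + N10 := by
      rw [Matrix.mul_add v, ← Matrix.mul_assoc v, ← Matrix.mul_assoc v, vf, ← hX, Matrix.one_mul]
    rw [e1, hwv, ← Matrix.mul_assoc, e2, g10, g00, Matrix.mul_assoc, Matrix.mul_add v f10, add_assoc f01,
      ← hX, e3, e4, hsf, hL, hM]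
    simp only [Matrix.mul_add, Matrix.add_mul, Matrix.sub_mul, Matrix.mul_one, Matrix.one_mul,
      Matrix.neg_mul, Matrix.mul_neg, Matrix.mul_assoc]
    abel
  -- the determinants
  have gS : GradedMatrix 𝒜 (I ∘ ev) (I ∘ ev) S :=
    (hF.submatrix ev ev).sub (((hF.submatrix ev od).mul h hV).mul h (hF.submatrix od ev))
  have gs : GradedMatrix (dualGrade ρ 𝒜 q) (I ∘ ev) (I ∘ ev) s := fun k l =>
    Q.zeroSection_mem (gS k l)
  have gX : GradedMatrix (dualGrade ρ 𝒜 q) (I ∘ od) (I ∘ ev) X :=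
    gv.mul h₂ (gf.submatrix od ev)
  have gNX : GradedMatrix (dualGrade ρ 𝒜 q) (I ∘ ev) (I ∘ ev) (N01 * X) :=
    (grN.submatrix ev od).mul h₂ gX
  have gXN : GradedMatrix (dualGrade ρ 𝒜 q) (I ∘ od) (I ∘ od) (X * N01) :=
    gX.mul h₂ (grN.submatrix ev od)
  have gL : GradedMatrix (dualGrade ρ 𝒜 q) (I ∘ ev) (I ∘ ev) L :=
    (grN.submatrix ev ev).add fun k l => neg_mem (gNX k l)
  have gM : GradedMatrix (dualGrade ρ 𝒜 q) (I ∘ od) (I ∘ od) (-M) := fun k l =>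
    neg_mem (((grN.submatrix od od).add gXN) k l)
  have hB : rhoBer ρ I F = rhoDet ρ (I ∘ ev) S * rhoDet ρ (I ∘ od) V :=
    rhoBer_eq h hF hE1 hE2 hV hV1 hV2
  have hBmem : rhoBer ρ I F ∈ 𝒜 0 := by
    rw [hB]
    simpa using h.mul_mem (rhoDet_mem h gS) (rhoDet_mem h hV)
  have d1 : rhoDet ρ (I ∘ ev) (S.map Q.graph) =
      Q.zeroSection (rhoDet ρ (I ∘ ev) S) * (1 + ∑ k, L k k) := by
    rw [hSg, rhoDet_mul h₂ sameParity_ev gs ((GradedMatrix.one h₂).add gL), map_rhoDet,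
      rhoDet_one_add (ρ := ρ) _ fun k l k' l' => nil_mul_nil (nL k l) (nL k' l')]
  have d2 : rhoDet ρ (I ∘ od) w = (1 + ∑ k, (-M) k k) * Q.zeroSection (rhoDet ρ (I ∘ od) V) := by
    rw [hwv, rhoDet_mul h₂ sameParity_od ((GradedMatrix.one h₂).add gM) gv, map_rhoDet,
      rhoDet_one_add (ρ := ρ) _ fun k l k' l' => nil_mul_nil (nM.neg k l) (nM.neg k' l')]
  -- The cyclicity of the trace acquires the sign `-1`, since the entries have degrees differing by
  -- an even minus an odd index.
  have hcross : ∑ k, (N01 * X) k k + ∑ k, (X * N01) k k = 0 := by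
    simp only [Matrix.mul_apply]
    rw [Finset.sum_comm, ← Finset.sum_add_distrib]
    refine Finset.sum_eq_zero fun l _ => ?_
    rw [← Finset.sum_add_distrib]
    refine Finset.sum_eq_zero fun k _ => ?_
    rw [h₂.comm (grN.submatrix ev od k l) (gX l k)]
    have e1 : ρ (I (ev k)) (I (ev k)) = 1 := ρ.self_of_not_isOdd k.2
    have e2 : ρ (I (od l)) (I (od l)) = -1 := l.2
    have e3 : ρ ((I ∘ ev) k - (I ∘ od) l) ((I ∘ od) l - (I ∘ ev) k) = -1 := by
      simp only [Function.comp_apply, ρ.sub_left, ρ.sub_right, e1, e2]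
      rw [ρ.swap (I (ev k)) (I (od l))]
      have n1 := ρ.ne_zero (I (ev k)) (I (od l))
      field_simp
    rw [e3, neg_one_smul, neg_add_cancel]
  -- The even block contributes its trace and the inverse of the odd block minus its trace; the
  -- mixed terms cancel by `hcross`. What is left is the supertrace of `N`.
  have hT : (1 + ∑ k, L k k) * (1 + ∑ k, (-M) k k) = 1 + ∑ k, ρ (I k) (I k) • N k k := by
    have z : (∑ k, L k k) * (∑ k, (-M) k k) = 0 := by
      rw [Finset.sum_mul_sum]
      exact Finset.sum_eq_zero fun k _ => Finset.sum_eq_zero fun l _ =>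
        nil_mul_nil (nL k k) (nM.neg l l)
    rw [mul_add, mul_one, add_mul, one_mul, z, add_zero, add_assoc, sum_ev_add_sum_od (ρ := ρ) (I := I)
      fun k => ρ (I k) (I k) • N k k]
    congr 1
    have e1 : ∑ k : EvIdx ρ I, ρ (I k) (I k) • N k k = ∑ k, N00 k k :=
      Finset.sum_congr rfl fun k _ => by
        rw [ρ.self_of_not_isOdd k.2, one_smul]
        rfl
    have e2 : ∑ k : OdIdx ρ I, ρ (I k) (I k) • N k k = -∑ k, N11 k k := by
      rw [← Finset.sum_neg_distrib]
      refine Finset.sum_congr rfl fun k _ => ?_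
      rw [show ρ (I k) (I k) = -1 from k.2, neg_one_smul]
      rfl
    rw [e1, e2, hL, hM]
    simp only [Matrix.add_apply, Matrix.neg_apply, Finset.sum_add_distrib, Finset.sum_neg_distrib,
      neg_add]
    rw [eq_neg_of_add_eq_zero_left hcross]
    abel
  have key : Q.graph (rhoBer ρ I F) =
      Q.zeroSection (rhoBer ρ I F) * (1 + ∑ k, ρ (I k) (I k) • N k k) := by
    have c1 : (1 + ∑ k, (-M) k k) ∈ dualGrade ρ 𝒜 q 0 :=
      add_mem h₂.one_mem (sum_mem fun k _ => h₂.mem_of_eq (gM k k) (sub_self _))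
    have c2 := Q.zeroSection_mem (rhoDet_mem h hV)
    rw [hB, map_mul, map_mul, map_rhoDet Q.graph, map_rhoDet Q.graph, d1, d2, ← hT,
      h₂.commute_zero c1 c2]
    have c3 : (1 + ∑ k, L k k) ∈ dualGrade ρ 𝒜 q 0 :=
      add_mem h₂.one_mem (sum_mem fun k _ => h₂.mem_of_eq (gL k k) (sub_self _))
    rw [mul_assoc, ← mul_assoc (1 + _), h₂.commute_zero c3 c2, mul_assoc, mul_assoc]
  -- The upper right entry is the coefficient of the infinitesimal parameter, that is, the
  -- derivative.
  have e01 := congrFun (congrFun key 0) 1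
  rw [graph_apply, zeroSection_apply, Q.θ_apply hBmem, ρ.zero_right, one_smul, Matrix.mul_apply,
    Fin.sum_univ_two] at e01
  simp only [Matrix.of_apply, Matrix.cons_val', Matrix.cons_val_zero, Matrix.cons_val_one,
    Matrix.cons_val_fin_one, zero_mul, add_zero, Matrix.add_apply, Matrix.sum_apply,
    Matrix.smul_apply, Matrix.one_apply_ne (show (0 : Fin 2) ≠ 1 by decide), zero_add] at e01
  rw [e01]
  congr 1
  refine Finset.sum_congr rfl fun k _ => ?_
  congr 1
  rw [hN, Matrix.mul_apply, Matrix.sum_apply]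
  refine Finset.sum_congr rfl fun l _ => ?_
  rw [hf', hg, hf, Matrix.sub_apply, Matrix.map_apply, Matrix.map_apply, Matrix.map_apply,
    graph_apply, zeroSection_apply, zeroSection_apply, Q.θ_apply (hF' k l), Matrix.mul_apply,
    Fin.sum_univ_two]
  simp

end RhoDerivation

end RhoBer

/-! ### The `ρ`-commutative algebra of power series -/

/-- Applying `π k` to a finite sum of homogeneous elements reads off its component of degree `k`,
which gives injectivity; `hsum` gives surjectivity. -/
lemma isInternal_of_proj {G K A : Type*} [AddCommGroup G] [DecidableEq G] [Field K] [AddCommGroup A]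
    [Module K A] {𝒜 : G → Submodule K A} (π : G → A →ₗ[K] A) (hmem : ∀ j f, π j f ∈ 𝒜 j)
    (hself : ∀ j, ∀ f ∈ 𝒜 j, π j f = f) (hne : ∀ j k, k ≠ j → ∀ f ∈ 𝒜 j, π k f = 0)
    (hsum : ∀ f, ∃ S : Finset G, ∑ j ∈ S, π j f = f) : DirectSum.IsInternal 𝒜 := by
  refine ⟨?_, fun f => ?_⟩
  · refine (injective_iff_map_eq_zero _).2 fun x hx => ?_
    ext k
    have h1 : ∀ y : DirectSum G fun i => 𝒜 i,
        π k (DirectSum.coeAddMonoidHom 𝒜 y) = (y k : A) := by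
      intro y
      induction y using DirectSum.induction_on with
      | zero => simp
      | of i y =>
        rw [DirectSum.coeAddMonoidHom_of]
        by_cases hik : i = k
        · subst hik
          rw [hself _ _ y.2, DirectSum.of_eq_same]
        · rw [hne i k (Ne.symm hik) _ y.2, DirectSum.of_eq_of_ne _ _ _ (Ne.symm hik)]
          rfl
      | add y z hy hz => rw [map_add, map_add, hy, hz]; rfl
    rw [← h1, hx, map_zero]
    rfl
  · obtain ⟨S, hS⟩ := hsum f
    refine ⟨∑ j ∈ S, DirectSum.of (fun i => 𝒜 i) j ⟨π j f, hmem j f⟩, ?_⟩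
    rw [map_sum]
    conv_rhs => rw [← hS]
    exact Finset.sum_congr rfl fun j _ => DirectSum.coeAddMonoidHom_of _ _ _

section SeriesLemmas

variable {G K : Type*} [AddCommGroup G] [Field K] {ρ : CommutationFactor G K}
variable {ι : Type*} [Fintype ι] [LinearOrder ι] {d : ι → G}

lemma wdeg_zero : wdeg d 0 = 0 := by simp [wdeg]

lemma wdeg_single (b : ι) (n : ℕ) : wdeg d (Finsupp.single b n) = n • d b := by
  simp [wdeg, Finsupp.single_apply, ite_smul]

lemma IsGood.mul_eq_zero {u v : ι →₀ ℕ} (h : IsGood ρ d (u + v)) {b : ι} (hb : ρ.IsOdd (d b)) :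
    u b * v b = 0 := by
  have := h b hb
  rw [Finsupp.add_apply] at this
  rcases Nat.eq_zero_or_pos (u b) with h0 | h0
  · rw [h0, zero_mul]
  · rw [show v b = 0 by omega, mul_zero]

lemma rho_wdeg (u v : ι →₀ ℕ) :
    ρ (wdeg d u) (wdeg d v) = ∏ a, ∏ b, ρ (d a) (d b) ^ (u a * v b) := by
  unfold wdeg
  rw [ρ.sum_left]
  refine Finset.prod_congr rfl fun a _ => ?_
  rw [ρ.sum_right]
  exact Finset.prod_congr rfl fun b _ => by rw [ρ.nsmul_left, ρ.nsmul_right, ← pow_mul, mul_comm]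

/-- The twist records only the pairs out of order, while `ρ` of the degrees records all pairs. The
diagonal factors of the latter are `1`, because an odd indeterminate cannot occur in both monomials
if `u + v` is admissible. -/
lemma tw_swap {u v : ι →₀ ℕ} (h : IsGood ρ d (u + v)) :
    tw ρ d u v = ρ (wdeg d u) (wdeg d v) * tw ρ d v u := by
  rw [rho_wdeg, prod_prod_eq_pairProd]
  have e1 : ∏ k, ρ (d k) (d k) ^ (u k * v k) = 1 := Finset.prod_eq_one fun k _ => by
    by_cases hk : ρ.IsOdd (d k)
    · rw [h.mul_eq_zero hk, pow_zero]
    · rw [ρ.self_of_not_isOdd hk, one_pow]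
  have e2 : (pairProd fun l k => ρ (d l) (d k) ^ (u l * v k)) * tw ρ d v u = 1 := by
    unfold tw
    rw [← pairProd_mul, pairProd_congr (ψ := fun _ _ => 1)]
    · simp [pairProd_eq]
    · intro l k _
      rw [mul_comm (v k), ← mul_pow, ρ.mul_swap, one_pow]
  rw [e1, one_mul, mul_right_comm, e2, one_mul]
  rfl

/-- The sign in the formula of the partial derivative. -/
def pdSign (ρ : CommutationFactor G K) (d : ι → G) (b : ι) (w : ι →₀ ℕ) : K :=
  ∏ c : ι, if c < b then ρ (-d b) (d c) ^ w c else 1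

lemma pdSign_add (b : ι) (u v : ι →₀ ℕ) :
    pdSign ρ d b (u + v) = pdSign ρ d b u * pdSign ρ d b v := by
  unfold pdSign
  rw [← Finset.prod_mul_distrib]
  refine Finset.prod_congr rfl fun c _ => ?_
  split_ifs
  · rw [Finsupp.add_apply, pow_add]
  · rw [one_mul]

/-- Sorting `x_b x^v` moves `x_b` across the earlier indeterminates, and `∂/∂x_b` has the opposite
degree, so the two signs are inverse to each other. -/
lemma tw_single_left (b : ι) (v : ι →₀ ℕ) :
    tw ρ d (Finsupp.single b 1) v * pdSign ρ d b v = 1 := by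
  have e : tw ρ d (Finsupp.single b 1) v = ∏ c : ι, if c < b then ρ (d b) (d c) ^ v c else 1 := by
    unfold tw
    rw [pairProd_eq]
    refine Finset.prod_congr rfl fun c _ => ?_
    rw [Finset.prod_eq_single b]
    · simp
    · intro k _ hk
      simp [Finsupp.single_eq_of_ne hk]
    · simp
  rw [e, pdSign, ← Finset.prod_mul_distrib]
  refine Finset.prod_eq_one fun c _ => ?_
  split_ifs
  · rw [← mul_pow, ρ.neg_left, mul_inv_cancel₀ (ρ.ne_zero _ _), one_pow]
  · rw [one_mul]

/-- Factor by factor: the indices below `b` give `pdSign`, the index `b` gives the diagonal factor,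
and those above `b` give the twist. -/
lemma tw_single_right (b : ι) (u : ι →₀ ℕ) : ρ (-d b) (wdeg d u) =
    ρ (d b) (d b) ^ u b * pdSign ρ d b u * tw ρ d u (Finsupp.single b 1) := by
  have e : tw ρ d u (Finsupp.single b 1) = ∏ a : ι, if b < a then ρ (d a) (d b) ^ u a else 1 := by
    unfold tw
    rw [pairProd_eq, Finset.prod_eq_single b]
    · simp
    · intro k _ hk
      exact Finset.prod_eq_one fun a _ => by simp [Finsupp.single_eq_of_ne hk]
    · simp
  have e2 : ρ (d b) (d b) ^ u b = ∏ a : ι, if a = b then ρ (d a) (d b) ^ u a else 1 := by simp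
  rw [e, e2, pdSign, ← Finset.prod_mul_distrib, ← Finset.prod_mul_distrib]
  unfold wdeg
  rw [ρ.sum_right]
  refine Finset.prod_congr rfl fun a _ => ?_
  rw [ρ.nsmul_right]
  rcases lt_trichotomy a b with h | rfl | h
  · simp [h, h.ne, h.not_gt]
  · simp [ρ.neg_left, ρ.self_inv]
  · simp [h, h.ne', h.not_gt, ρ.neg_left, ← ρ.swap]

lemma sum_antidiagonal_swap' {B : Type*} [AddCommMonoid B] (w : ι →₀ ℕ)
    (φ : (ι →₀ ℕ) → (ι →₀ ℕ) → B) :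
    ∑ p ∈ Finset.HasAntidiagonal.antidiagonal w, φ p.2 p.1 =
      ∑ p ∈ Finset.HasAntidiagonal.antidiagonal w, φ p.1 p.2 :=
  Finset.sum_equiv (Equiv.prodComm _ _)
    (fun p => by simp [Finset.HasAntidiagonal.mem_antidiagonal, add_comm]) (fun p _ => rfl)

namespace Series

variable {R : Type*} [CommRing R] [Algebra K R]

lemma isRhoComm : IsRhoComm ρ (grade : G → Submodule K (Series ρ d R)) where
  one_mem := one_mem_grade
  mul_mem := mul_mem_grade
  comm {i j f g} hf hg := by
    refine ext_good fun w hw => ?_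
    rw [coeff_smul, coeff_mul _ _ hw, coeff_mul _ _ hw, Finset.smul_sum,
      ← sum_antidiagonal_swap' w fun u v => ρ i j • tw ρ d u v • (g.coeff u * f.coeff v)]
    refine Finset.sum_congr rfl fun p hp => ?_
    rw [Finset.HasAntidiagonal.mem_antidiagonal] at hp
    by_cases h1 : f.coeff p.1 = 0
    · simp [h1]
    by_cases h2 : g.coeff p.2 = 0
    · simp [h2]
    rw [smul_smul, ← hf _ h1, ← hg _ h2, ← tw_swap (hp ▸ hw), mul_comm (g.coeff _)]

open scoped Classical in
/-- The homogeneous component of degree `j`. -/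
def proj (j : G) : Series ρ d R →ₗ[K] Series ρ d R where
  toFun f := ⟨fun w => if wdeg d w = j then f.coeff w else 0, fun w hw => by
      simp [coeff_of_not_good f hw], by
      obtain ⟨S, hS⟩ := f.2.2
      exact ⟨S, fun w hw => hS w fun h => hw (by simp [coeff, h])⟩⟩
  map_add' f g := ext fun w => by
    change (if wdeg d w = j then (f + g).coeff w else 0) =
      (if wdeg d w = j then f.coeff w else 0) + (if wdeg d w = j then g.coeff w else 0)
    split_ifs <;> simp
  map_smul' c f := ext fun w => by
    change (if wdeg d w = j then (c • f).coeff w else 0) =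
      c • (if wdeg d w = j then f.coeff w else 0)
    split_ifs <;> simp

open scoped Classical in
lemma coeff_proj (j : G) (f : Series ρ d R) (w : ι →₀ ℕ) :
    (proj j f).coeff w = if wdeg d w = j then f.coeff w else 0 := rfl

lemma proj_mem (j : G) (f : Series ρ d R) : proj j f ∈ grade j := by
  classical
  intro w hw
  rw [coeff_proj] at hw
  by_contra h
  exact hw (if_neg h)

lemma proj_of_mem {j : G} {f : Series ρ d R} (hf : f ∈ grade j) : proj j f = f := by
  classical
  ext w
  rw [coeff_proj]
  by_cases h : f.coeff w = 0
  · simp [h]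
  · rw [if_pos (hf w h)]

lemma proj_of_mem_ne {j k : G} (hk : k ≠ j) {f : Series ρ d R} (hf : f ∈ grade j) :
    proj k f = 0 := by
  classical
  ext w
  rw [coeff_proj, coeff_zero]
  by_cases h : f.coeff w = 0
  · simp [h]
  · rw [if_neg fun h' => hk (h'.symm.trans (hf w h))]

@[simp] lemma coeff_sum {J : Type*} (s : Finset J) (f : J → Series ρ d R) (w : ι →₀ ℕ) :
    (∑ k ∈ s, f k).coeff w = ∑ k ∈ s, (f k).coeff w := by
  classical
  induction s using Finset.induction_on with
  | empty => simp
  | insert a s ha ih => rw [Finset.sum_insert ha, Finset.sum_insert ha, coeff_add, ih]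

lemma sum_proj {f : Series ρ d R} {S : Finset G} (hS : ∀ w, f.coeff w ≠ 0 → wdeg d w ∈ S) :
    ∑ j ∈ S, proj j f = f := by
  classical
  ext w
  rw [coeff_sum]
  simp only [coeff_proj]
  rw [Finset.sum_ite_eq]
  by_cases h : f.coeff w = 0
  · simp [h]
  · rw [if_pos (hS w h)]

lemma exists_sum_proj (f : Series ρ d R) : ∃ S : Finset G, ∑ j ∈ S, proj j f = f := by
  obtain ⟨S, hS⟩ := f.2.2
  exact ⟨S, sum_proj hS⟩

/-- Two linear maps agree if they agree on homogeneous series. -/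
lemma linearMap_ext {B : Type*} [AddCommGroup B] [Module K B] {φ ψ : Series ρ d R →ₗ[K] B}
    (h : ∀ j, ∀ f ∈ grade j, φ f = ψ f) (f : Series ρ d R) : φ f = ψ f := by
  obtain ⟨S, hS⟩ := exists_sum_proj f
  rw [← hS, map_sum, map_sum]
  exact Finset.sum_congr rfl fun j _ => h j _ (proj_mem j f)

/-- The multiplication by `ρ(q,j)` in degree `j`. -/
def theta (q : G) : Series ρ d R →ₐ[K] Series ρ d R :=
  AlgHom.ofLinearMap
    { toFun := fun f => ⟨fun w => ρ q (wdeg d w) • f.coeff w, fun w hw => by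
        simp [coeff_of_not_good f hw], by
        obtain ⟨S, hS⟩ := f.2.2
        exact ⟨S, fun w hw => hS w fun h => hw (by simp [coeff, h])⟩⟩
      map_add' := fun f g => ext fun w => by
        change ρ q (wdeg d w) • (f + g).coeff w = ρ q (wdeg d w) • f.coeff w + ρ q (wdeg d w) • g.coeff w
        rw [coeff_add, smul_add]
      map_smul' := fun c f => ext fun w => by
        change ρ q (wdeg d w) • (c • f).coeff w = c • ρ q (wdeg d w) • f.coeff w
        rw [coeff_smul, smul_comm] }
    (ext fun w => by
      classical
      change ρ q (wdeg d w) • (1 : Series ρ d R).coeff w = (1 : Series ρ d R).coeff w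
      rw [coeff_one]
      split_ifs with h
      · rw [h, wdeg_zero, ρ.zero_right, one_smul]
      · rw [smul_zero])
    (fun f g => ext_good fun w hw => by
      change ρ q (wdeg d w) • (f * g).coeff w = _
      rw [coeff_mul _ _ hw, coeff_mul _ _ hw, Finset.smul_sum]
      refine Finset.sum_congr rfl fun p hp => ?_
      change _ = tw ρ d p.1 p.2 • (ρ q (wdeg d p.1) • f.coeff p.1 * ρ q (wdeg d p.2) • g.coeff p.2)
      rw [smul_mul_smul_comm, smul_comm, ← ρ.add_right, ← wdeg_add,
        Finset.HasAntidiagonal.mem_antidiagonal.1 hp])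

lemma theta_apply (q : G) {j : G} {f : Series ρ d R} (hf : f ∈ grade j) :
    theta q f = ρ q j • f := ext fun w => by
  change ρ q (wdeg d w) • f.coeff w = _
  rw [coeff_smul]
  by_cases h : f.coeff w = 0
  · simp [h]
  · rw [hf w h]

lemma monomial_mem (w : ι →₀ ℕ) (r : R) : (monomial w r : Series ρ d R) ∈ grade (wdeg d w) := by
  classical
  intro u hu
  rw [coeff_monomial] at hu
  by_contra h
  exact hu (if_neg fun h' => h (by rw [h'.1]))

lemma X_mem (b : ι) : (X b : Series ρ d R) ∈ grade (d b) := by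
  have := monomial_mem (ρ := ρ) (d := d) (Finsupp.single b 1) (1 : R)
  rwa [wdeg_single, one_smul] at this

lemma isGood_single (b : ι) : IsGood ρ d (Finsupp.single b 1) := fun c _ => by
  classical
  rw [Finsupp.single_apply]
  split_ifs <;> omega

open scoped Classical in
lemma coeff_X_mul (b : ι) (g : Series ρ d R) {w : ι →₀ ℕ} (hw : IsGood ρ d w) :
    (X b * g).coeff w = if w b = 0 then 0 else
      tw ρ d (Finsupp.single b 1) (w - Finsupp.single b 1) • g.coeff (w - Finsupp.single b 1) := by
  rw [coeff_mul _ _ hw]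
  have h0 : ∀ p ∈ Finset.HasAntidiagonal.antidiagonal w, p.1 ≠ Finsupp.single b 1 →
      tw ρ d p.1 p.2 • ((X b : Series ρ d R).coeff p.1 * g.coeff p.2) = 0 := by
    intro p _ hp
    rw [X, coeff_monomial, if_neg fun h => hp h.1, zero_mul, smul_zero]
  split_ifs with hb
  · refine Finset.sum_eq_zero fun p hp => h0 p hp fun h => ?_
    rw [Finset.HasAntidiagonal.mem_antidiagonal] at hp
    have := DFunLike.congr_fun hp b
    rw [h, Finsupp.add_apply, Finsupp.single_eq_same] at this
    omega
  · have hle : Finsupp.single b 1 ≤ w := by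
      rw [Finsupp.single_le_iff]
      omega
    rw [Finset.sum_eq_single (Finsupp.single b 1, w - Finsupp.single b 1)]
    · rw [X, coeff_monomial, if_pos ⟨rfl, isGood_single b⟩, one_mul]
    · rintro ⟨u, v⟩ hp hne
      refine h0 _ hp fun h => hne ?_
      rw [Finset.HasAntidiagonal.mem_antidiagonal] at hp
      dsimp only at h hp
      subst h
      rw [← hp, add_tsub_cancel_left]
    · intro h
      exact absurd (Finset.HasAntidiagonal.mem_antidiagonal.2 (add_tsub_cancel_of_le hle)) h

open scoped Classical in
lemma coeff_monomial_zero_mul (r : R) (g : Series ρ d R) (w : ι →₀ ℕ) :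
    (monomial 0 r * g).coeff w = r * g.coeff w := by
  by_cases hw : IsGood ρ d w
  · rw [coeff_mul _ _ hw, Finset.sum_eq_single (0, w)]
    · rw [tw_zero_left, one_smul, coeff_monomial, if_pos ⟨rfl, isGood_zero⟩]
    · rintro ⟨u, v⟩ hp hne
      have : u ≠ 0 := by
        rintro rfl
        apply hne
        rw [Finset.HasAntidiagonal.mem_antidiagonal] at hp
        simpa using hp
      rw [coeff_monomial, if_neg fun h => this h.1, zero_mul, smul_zero]
    · simp
  · rw [coeff_of_not_good _ hw, coeff_of_not_good _ hw, mul_zero]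

/-! #### The partial derivatives -/

lemma coeff_pd (b : ι) (f : Series ρ d R) (w : ι →₀ ℕ) : (pd b f).coeff w =
    (((w b + 1 : ℕ) : K) * pdSign ρ d b w) • f.coeff (w + Finsupp.single b 1) := rfl

/-- The partial derivative as a linear map. -/
def pdLin (b : ι) : Series ρ d R →ₗ[K] Series ρ d R where
  toFun := pd b
  map_add' f g := ext fun w => by
    rw [coeff_add, coeff_pd, coeff_pd, coeff_pd, coeff_add, smul_add]
  map_smul' c f := ext fun w => by
    rw [RingHom.id_apply, coeff_smul, coeff_pd, coeff_pd, coeff_smul, smul_comm]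

lemma pd_mem (b : ι) {j : G} {f : Series ρ d R} (hf : f ∈ grade j) : pd b f ∈ grade (-d b + j) := by
  intro w hw
  rw [coeff_pd] at hw
  have h1 := hf (w + Finsupp.single b 1) fun h => hw (by rw [h, smul_zero])
  rw [wdeg_add, wdeg_single, one_smul] at h1
  rw [← h1]
  abel

/-- Raising the first exponent by `e_b` misses only the decompositions with `u b = 0`, where `ψ`
vanishes. -/
lemma sum_antidiagonal_single {B : Type*} [AddCommMonoid B] (b : ι) (w : ι →₀ ℕ)
    (ψ : (ι →₀ ℕ) → (ι →₀ ℕ) → B) (h0 : ∀ u v, u b = 0 → ψ u v = 0) :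
    ∑ p ∈ Finset.HasAntidiagonal.antidiagonal w, ψ (p.1 + Finsupp.single b 1) p.2 =
      ∑ p ∈ Finset.HasAntidiagonal.antidiagonal (w + Finsupp.single b 1), ψ p.1 p.2 := by
  classical
  refine Finset.sum_of_injOn (fun p => (p.1 + Finsupp.single b 1, p.2)) ?_ ?_ ?_ ?_
  · rintro ⟨u, v⟩ _ ⟨u', v'⟩ _ h
    simp only [Prod.mk.injEq, add_left_inj] at h
    exact Prod.ext h.1 h.2
  · intro p hp
    have hp' := Finset.HasAntidiagonal.mem_antidiagonal.1 (Finset.mem_coe.1 hp)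
    refine Finset.mem_coe.2 (Finset.HasAntidiagonal.mem_antidiagonal.2 ?_)
    change p.1 + Finsupp.single b 1 + p.2 = _
    rw [← hp', add_right_comm]
  · rintro ⟨u, v⟩ hp hn
    refine h0 u v ?_
    by_contra hb
    refine hn ⟨(u - Finsupp.single b 1, v), ?_, ?_⟩
    · have hle : Finsupp.single b 1 ≤ u := by
        rw [Finsupp.single_le_iff]
        omega
      have hp' := Finset.HasAntidiagonal.mem_antidiagonal.1 hp
      refine Finset.mem_coe.2 (Finset.HasAntidiagonal.mem_antidiagonal.2 ?_)
      dsimp only at hp' ⊢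
      refine add_right_cancel (b := Finsupp.single b 1) ?_
      rw [← hp', add_right_comm, tsub_add_cancel_of_le hle]
    · have hle : Finsupp.single b 1 ≤ u := by
        rw [Finsupp.single_le_iff]
        omega
      exact Prod.ext (tsub_add_cancel_of_le hle) rfl
  · intro p _
    rfl

lemma sum_antidiagonal_single' {B : Type*} [AddCommMonoid B] (b : ι) (w : ι →₀ ℕ)
    (ψ : (ι →₀ ℕ) → (ι →₀ ℕ) → B) (h0 : ∀ u v, v b = 0 → ψ u v = 0) :
    ∑ p ∈ Finset.HasAntidiagonal.antidiagonal w, ψ p.1 (p.2 + Finsupp.single b 1) =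
      ∑ p ∈ Finset.HasAntidiagonal.antidiagonal (w + Finsupp.single b 1), ψ p.1 p.2 := by
  have h := sum_antidiagonal_single b w (fun u v => ψ v u) fun u v => h0 v u
  have sw := sum_antidiagonal_swap' (ι := ι) (B := B)
  rw [← sw _ ψ, ← h]
  exact (sw w fun u v => ψ u (v + Finsupp.single b 1)).symm

/-- All three terms become sums over the decompositions `u + v = w + e_b` with the same twist and
sign. What remains is that `w b + 1`, or `0` if `x ^ (w + e_b)` vanishes, equals `u b + ρ(d b, d b)
^ (u b) * v b`. -/
lemma pd_mul (b : ι) {j : G} {f : Series ρ d R} (hf : f ∈ grade j) (g : Series ρ d R) :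
    pd b (f * g) = pd b f * g + ρ (-d b) j • (f * pd b g) := by
  classical
  refine ext_good fun w hw => ?_
  have L : (pd b (f * g)).coeff w = ∑ p ∈ Finset.HasAntidiagonal.antidiagonal
      (w + Finsupp.single b 1), (((w b + 1 : ℕ) : K) * pdSign ρ d b w) • (if IsGood ρ d
        (w + Finsupp.single b 1) then (1 : K) else 0) • tw ρ d p.1 p.2 • (f.coeff p.1 * g.coeff p.2) := by
    rw [coeff_pd, coeff_mul', Finset.smul_sum.symm, Finset.smul_sum.symm]
    split_ifs
    · rw [one_smul]
    · rw [zero_smul]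
  have R1 : (pd b f * g).coeff w = ∑ p ∈ Finset.HasAntidiagonal.antidiagonal
      (w + Finsupp.single b 1), ((((p.1 : ι →₀ ℕ) b : ℕ) : K) * (tw ρ d p.1 p.2 * pdSign ρ d b w)) •
        (f.coeff p.1 * g.coeff p.2) := by
    rw [coeff_mul _ _ hw, ← sum_antidiagonal_single b w (fun u v =>
      ((u b : K) * (tw ρ d u v * pdSign ρ d b w)) • (f.coeff u * g.coeff v))
      (fun u v h => by simp [h])]
    refine Finset.sum_congr rfl fun p hp => ?_
    rw [coeff_pd, smul_mul_assoc, smul_smul, Finsupp.add_apply, Finsupp.single_eq_same, tw_add_left,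
      ← Finset.HasAntidiagonal.mem_antidiagonal.1 hp, pdSign_add]
    congr 1
    have := tw_single_left (ρ := ρ) (d := d) b p.2
    linear_combination (-(tw ρ d p.1 p.2 * pdSign ρ d b p.1 * ((p.1 b + 1 : ℕ) : K))) * this
  have R2 : (ρ (-d b) j • (f * pd b g)).coeff w = ∑ p ∈ Finset.HasAntidiagonal.antidiagonal
      (w + Finsupp.single b 1), ((((p.2 : ι →₀ ℕ) b : ℕ) : K) * (ρ (d b) (d b) ^ (p.1 : ι →₀ ℕ) b *
        (tw ρ d p.1 p.2 * pdSign ρ d b w))) • (f.coeff p.1 * g.coeff p.2) := by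
    rw [coeff_smul, coeff_mul _ _ hw, ← sum_antidiagonal_single' b w (fun u v =>
      ((v b : K) * (ρ (d b) (d b) ^ u b * (tw ρ d u v * pdSign ρ d b w))) • (f.coeff u * g.coeff v))
      (fun u v h => by simp [h]), Finset.smul_sum]
    refine Finset.sum_congr rfl fun p hp => ?_
    by_cases h1 : f.coeff p.1 = 0
    · simp [h1]
    rw [coeff_pd, mul_smul_comm, smul_smul, smul_smul, Finsupp.add_apply, Finsupp.single_eq_same,
      tw_add_right, ← Finset.HasAntidiagonal.mem_antidiagonal.1 hp, pdSign_add, ← hf _ h1,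
      tw_single_right]
    congr 1
    ring
  rw [coeff_add, L, R1, R2, ← Finset.sum_add_distrib]
  refine Finset.sum_congr rfl fun p hp => ?_
  by_cases h1 : f.coeff p.1 = 0
  · simp [h1]
  by_cases h2 : g.coeff p.2 = 0
  · simp [h2]
  rw [smul_smul, smul_smul, ← add_smul]
  congr 1
  have hpw : p.1 b + p.2 b = w b + 1 := by
    have := DFunLike.congr_fun (Finset.HasAntidiagonal.mem_antidiagonal.1 hp) b
    simpa using this
  have hc : ((w b + 1 : ℕ) : K) = (p.1 b : K) + (p.2 b : K) := by
    rw [← hpw]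
    push_cast
    rfl
  by_cases hb : ρ.IsOdd (d b)
  · have g1 : p.1 b ≤ 1 := by
      by_contra h
      exact h1 (coeff_of_not_good f fun h' => h (h' b hb))
    have g2 : p.2 b ≤ 1 := by
      by_contra h
      exact h2 (coeff_of_not_good g fun h' => h (h' b hb))
    have hb' : ρ (d b) (d b) = -1 := hb
    by_cases hg : IsGood ρ d (w + Finsupp.single b 1)
    · have hwb := hg b hb
      rw [Finsupp.add_apply, Finsupp.single_eq_same] at hwb
      rw [if_pos hg, hc, hb']
      rcases Nat.eq_zero_or_pos (p.1 b) with e | e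
      · rw [e]
        ring
      · rw [show p.1 b = 1 by omega, show p.2 b = 0 by omega]
        simp [mul_comm]
    · have hwb : w b = 1 := by
        by_contra hne
        refine hg fun c hc => ?_
        by_cases hcb : c = b
        · subst hcb
          rw [Finsupp.add_apply, Finsupp.single_eq_same]
          omega
        · rw [Finsupp.add_apply, Finsupp.single_eq_of_ne hcb, add_zero]
          exact hw c hc
      -- The odd indeterminate `x_b` occurs once in each factor: the two contributions `1` and `-1`
      -- cancel, in accordance with `x_b² = 0`.
      rw [if_neg hg, hb', show p.1 b = 1 by omega, show p.2 b = 1 by omega]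
      simp
  · have hg : IsGood ρ d (w + Finsupp.single b 1) := fun c hc => by
      have hcb : c ≠ b := fun h => hb (h ▸ hc)
      rw [Finsupp.add_apply, Finsupp.single_eq_of_ne hcb, add_zero]
      exact hw c hc
    rw [if_pos hg, hc, ρ.self_of_not_isOdd hb, one_pow]
    ring

lemma map_pd {R' : Type*} [CommRing R'] [Algebra K R'] (φ : R →ₐ[K] R') (b : ι)
    (f : Series ρ d R) : map φ (pd b f) = pd b (map φ f) := ext fun w => by
  rw [coeff_map, coeff_pd, coeff_pd, coeff_map, map_smul]

open scoped Classical in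
lemma pd_X (b c : ι) : pd b (X c : Series ρ d R) = if c = b then 1 else 0 := by
  refine ext fun w => ?_
  rw [coeff_pd, X, coeff_monomial]
  by_cases h : w + Finsupp.single b 1 = Finsupp.single c 1
  · have hcb : c = b := by
      by_contra hcb
      have := DFunLike.congr_fun h b
      rw [Finsupp.add_apply, Finsupp.single_eq_same, Finsupp.single_eq_of_ne (Ne.symm hcb)] at this
      omega
    subst hcb
    have hw : w = 0 := by simpa using h
    subst hw
    simp [isGood_single, coeff_one, pdSign]
  · rw [if_neg fun h' => h h'.1, smul_zero]
    split_ifs with hcb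
    · subst hcb
      rw [coeff_one, if_neg]
      rintro rfl
      exact h (zero_add _)
    · rfl

lemma pd_monomial_zero (b : ι) (r : R) : pd b (monomial 0 r : Series ρ d R) = 0 := by
  classical
  refine ext fun w => ?_
  rw [coeff_pd, coeff_monomial, if_neg, smul_zero, coeff_zero]
  rintro ⟨h, -⟩
  have := DFunLike.congr_fun h b
  simp at this

/-- A derivation of the coefficients, applied coefficientwise. -/
lemma mapCoeff_mul (δ : R →ₗ[K] R) (hδ : ∀ r s, δ (r * s) = δ r * s + r * δ s)
    (f g : Series ρ d R) : mapCoeff δ (map_zero δ) (f * g) =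
      mapCoeff δ (map_zero δ) f * g + f * mapCoeff δ (map_zero δ) g := by
  refine ext_good fun w hw => ?_
  change δ ((f * g).coeff w) = _
  rw [coeff_add, coeff_mul _ _ hw, coeff_mul _ _ hw, coeff_mul _ _ hw, map_sum,
    ← Finset.sum_add_distrib]
  refine Finset.sum_congr rfl fun p _ => ?_
  rw [map_smul, hδ, smul_add]
  rfl

end Series

end SeriesLemmas

/-! ### Hadamard's lemma -/

section Hadamard

open MeasureTheory Metric Filter
open scoped Topology

variable {𝕜 D F : Type*} [RCLike 𝕜] [NormedAddCommGroup D] [NormedSpace 𝕜 D]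
  [FiniteDimensional 𝕜 D] [NormedAddCommGroup F] [NormedSpace 𝕜 F] [NormedSpace ℝ F]
  [IsScalarTower ℝ 𝕜 F] [CompleteSpace F]

/-- The average of `t ^ m h(t x)` over `0 ≤ t ≤ 1`. -/
def rayIntegral (𝕜 : Type*) {D F : Type*} [RCLike 𝕜] [NormedAddCommGroup D] [NormedSpace 𝕜 D]
    [NormedAddCommGroup F] [NormedSpace ℝ F] (m : ℕ) (h : D → F) (x : D) : F :=
  ∫ t in (0 : ℝ)..1, t ^ m • h ((t : 𝕜) • x)

lemma smul_mem_ball_zero {t : ℝ} (ht : t ∈ Set.uIcc (0 : ℝ) 1) {R : ℝ} {x : D}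
    (hx : x ∈ ball (0 : D) R) : (t : 𝕜) • x ∈ ball (0 : D) R := by
  rw [Set.uIcc_of_le zero_le_one] at ht
  rw [mem_ball_zero_iff] at hx ⊢
  rw [norm_smul, RCLike.norm_ofReal, abs_of_nonneg ht.1]
  exact (mul_le_of_le_one_left (norm_nonneg _) ht.2).trans_lt hx

lemma continuousOn_ray (m : ℕ) {h : D → F} {R : ℝ} (hh : ContinuousOn h (ball 0 R)) {x : D}
    (hx : x ∈ ball (0 : D) R) :
    ContinuousOn (fun t : ℝ => t ^ m • h ((t : 𝕜) • x)) (Set.uIcc (0 : ℝ) 1) := by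
  refine (continuous_pow m).continuousOn.smul (hh.comp ?_ fun t ht => smul_mem_ball_zero ht hx)
  exact (RCLike.continuous_ofReal.smul continuous_const).continuousOn

/-- Differentiation under the integral sign. The chain rule contributes a factor `t`, which is why
the weight `t ^ m` is carried along; the derivative is bounded on a slightly smaller compact ball.
-/
lemma hasFDerivAt_rayIntegral (m : ℕ) {h : D → F} {R : ℝ} (hh : ContDiffOn 𝕜 1 h (ball 0 R))
    {x : D} (hx : x ∈ ball (0 : D) R) :
    HasFDerivAt (rayIntegral 𝕜 m h) (rayIntegral 𝕜 (m + 1) (fderiv 𝕜 h) x) x := by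
  have : ProperSpace D := FiniteDimensional.proper 𝕜 D
  have hd : ∀ y ∈ ball (0 : D) R, HasFDerivAt h (fderiv 𝕜 h y) y := fun y hy =>
    ((hh.differentiableOn one_ne_zero).differentiableAt (isOpen_ball.mem_nhds hy)).hasFDerivAt
  have hc : ContinuousOn (fderiv 𝕜 h) (ball 0 R) :=
    hh.continuousOn_fderiv_of_isOpen isOpen_ball le_rfl
  obtain ⟨R', h1, h2⟩ := exists_between (mem_ball_zero_iff.1 hx)
  obtain ⟨C, hC⟩ := (isCompact_closedBall (0 : D) R').exists_bound_of_continuousOn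
    (hc.mono (closedBall_subset_ball h2))
  have hs : ball (0 : D) R' ∈ 𝓝 x := isOpen_ball.mem_nhds (mem_ball_zero_iff.2 h1)
  refine intervalIntegral.hasFDerivAt_integral_of_dominated_of_fderiv_le
    (F := fun y t => t ^ m • h ((t : 𝕜) • y)) (F' := fun y t => t ^ (m + 1) • fderiv 𝕜 h ((t : 𝕜) • y))
    (bound := fun _ => C) hs ?_ ?_ ?_ ?_ intervalIntegrable_const ?_
  · filter_upwards [isOpen_ball.mem_nhds hx] with y hy
    exact ((continuousOn_ray m hh.continuousOn hy).mono Set.uIoc_subset_uIcc).aestronglyMeasurable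
      measurableSet_uIoc
  · exact (continuousOn_ray m hh.continuousOn hx).intervalIntegrable
  · exact ((continuousOn_ray (m + 1) hc hx).mono Set.uIoc_subset_uIcc).aestronglyMeasurable
      measurableSet_uIoc
  · refine Eventually.of_forall fun t ht y hy => ?_
    have ht' := Set.uIoc_subset_uIcc ht
    rw [norm_smul]
    have := hC _ (ball_subset_closedBall (smul_mem_ball_zero (𝕜 := 𝕜) ht' hy))
    rw [Set.uIcc_of_le zero_le_one] at ht'
    rw [norm_pow, Real.norm_of_nonneg ht'.1]
    exact (mul_le_of_le_one_left (norm_nonneg _) (pow_le_one₀ ht'.1 ht'.2)).trans this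
  · refine Eventually.of_forall fun t ht y hy => ?_
    have ht' := Set.uIoc_subset_uIcc ht
    have h3 := hd _ (smul_mem_ball_zero (𝕜 := 𝕜) ht' (ball_subset_ball h2.le hy))
    have h4 := (h3.comp y ((hasFDerivAt_id y).const_smul (t : 𝕜))).const_smul (t ^ m)
    refine h4.congr_fderiv ?_
    ext z
    change t ^ m • fderiv 𝕜 h ((t : 𝕜) • y) ((t : 𝕜) • z) = t ^ (m + 1) • fderiv 𝕜 h ((t : 𝕜) • y) z
    rw [map_smul, pow_succ, mul_smul, RCLike.real_smul_eq_coe_smul (K := 𝕜) t]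

/-- Induction on the order of differentiability, for all `h` and `m` together: the derivative in a
fixed direction is again a ray integral, with `m + 1`. -/
lemma contDiffOn_rayIntegral {h : D → F} {R : ℝ} (hh : ContDiffOn 𝕜 ∞ h (ball 0 R)) (m : ℕ) :
    ContDiffOn 𝕜 ∞ (rayIntegral 𝕜 m h) (ball 0 R) := by
  rw [contDiffOn_infty]
  intro k
  induction k generalizing h m with
  | zero =>
    refine contDiffOn_zero.2 fun x hx => ?_
    exact (hasFDerivAt_rayIntegral m (hh.of_le (by exact_mod_cast le_top)) hx).continuousAt.continuousWithinAt
  | succ k ih =>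
    have h1 : ContDiffOn 𝕜 1 h (ball 0 R) := hh.of_le (by exact_mod_cast le_top)
    have hc : ContinuousOn (fderiv 𝕜 h) (ball 0 R) :=
      h1.continuousOn_fderiv_of_isOpen isOpen_ball le_rfl
    push_cast
    rw [contDiffOn_succ_iff_fderiv_apply isOpen_ball.uniqueDiffOn]
    refine ⟨fun x hx => (hasFDerivAt_rayIntegral m h1 hx).differentiableAt.differentiableWithinAt,
      fun hk => absurd hk (by simp), fun y => ?_⟩
    have h2 : ContDiffOn 𝕜 ∞ (fun x => fderiv 𝕜 h x y) (ball 0 R) :=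
      (hh.fderiv_of_isOpen isOpen_ball (by simp)).clm_apply contDiffOn_const
    refine (ih h2 (m + 1)).congr fun x hx => ?_
    rw [fderivWithin_of_isOpen isOpen_ball hx, (hasFDerivAt_rayIntegral m h1 hx).fderiv]
    unfold rayIntegral
    rw [ContinuousLinearMap.intervalIntegral_apply
      (continuousOn_ray (m + 1) hc hx).intervalIntegrable]
    rfl

/-- The fundamental theorem of calculus along the ray from `0` to `x`. Its parameter is real also
when `𝕜` is complex. -/
lemma sub_eq_rayIntegral {h : D → F} {R : ℝ} (hh : ContDiffOn 𝕜 1 h (ball 0 R)) {x : D}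
    (hx : x ∈ ball (0 : D) R) : h x - h 0 = rayIntegral 𝕜 0 (fun y => fderiv 𝕜 h y x) x := by
  have hd : ∀ y ∈ ball (0 : D) R, HasFDerivAt h (fderiv 𝕜 h y) y := fun y hy =>
    ((hh.differentiableOn one_ne_zero).differentiableAt (isOpen_ball.mem_nhds hy)).hasFDerivAt
  have hc : ContinuousOn (fun y => fderiv 𝕜 h y x) (ball 0 R) :=
    (hh.continuousOn_fderiv_of_isOpen isOpen_ball le_rfl).clm_apply continuousOn_const
  have key := intervalIntegral.integral_eq_sub_of_hasDerivAt (a := 0) (b := 1)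
    (f := fun t : ℝ => h ((t : 𝕜) • x)) (f' := fun t : ℝ => t ^ 0 • fderiv 𝕜 h ((t : 𝕜) • x) x)
    (fun t ht => ?_) (continuousOn_ray 0 hc hx).intervalIntegrable
  · rw [rayIntegral, key]
    simp
  · let _ : NormedSpace ℝ D := NormedSpace.restrictScalars ℝ 𝕜 D
    have : IsScalarTower ℝ 𝕜 D := ⟨fun a b c => by
      rw [Algebra.smul_def, mul_smul]
      rfl⟩
    have h3 := (hd _ (smul_mem_ball_zero (𝕜 := 𝕜) ht hx)).restrictScalars ℝ
    have h5 : HasDerivAt (fun t : ℝ => (t : 𝕜) • x) x t := by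
      have := (RCLike.ofRealCLM (K := 𝕜)).hasDerivAt (x := t) |>.smul_const x
      simpa using this
    have h4 := h3.comp_hasDerivAt t h5
    refine h4.congr_deriv ?_
    rw [pow_zero, one_smul]
    rfl

end Hadamard

/-! ### Hadamard's lemma for smooth and for analytic functions -/

section Hadamard

open MeasureTheory Metric Filter
open scoped Topology

/-- Splitting off one argument from each term of the power series of `f` of positive order leaves a
convergent series `L` of linear maps. In the analytic case this replaces the ray integral, for which
only smoothness is shown. -/
lemma exists_contDiffOn_apply_self {𝕜 D F : Type*} [RCLike 𝕜] [NormedAddCommGroup D]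
    [NormedSpace 𝕜 D] [NormedAddCommGroup F] [NormedSpace 𝕜 F] [CompleteSpace F] {f : D → F}
    (hf : AnalyticAt 𝕜 f 0) : ∃ R > 0, ∃ L : D → D →L[𝕜] F, ContDiffOn 𝕜 ω L (ball 0 R) ∧
      ∀ x ∈ ball (0 : D) R, f x = f 0 + L x x := by
  obtain ⟨p, R₀, hp⟩ := hf
  have hq := p.shift.hasFPowerSeriesOnBall
    (by rw [p.radius_shift]; exact hp.r_pos.trans_le hp.r_le)
  rw [p.radius_shift] at hq
  have hq' := hq.mono hp.r_pos hp.r_le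
  obtain ⟨R', hR', hRR'⟩ := Metric.isOpen_iff.1 (Metric.isOpen_eball (x := (0 : D)) (ε := R₀)) 0
    (Metric.mem_eball_self hp.r_pos)
  refine ⟨R', hR', p.shift.sum, ?_, fun x hx => ?_⟩
  · exact (hq'.analyticOnNhd.mono hRR').contDiffOn isOpen_ball.uniqueDiffOn
  · have h1 := hp.hasSum (hRR' hx)
    have h2 := hq'.hasSum (hRR' hx)
    rw [zero_add] at h1 h2
    have h3 := (ContinuousLinearMap.apply 𝕜 F x).hasSum h2
    have e : (fun k => p (k + 1) fun _ => x) = fun k => (p.shift k fun _ => x) x := by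
      funext k
      change _ = p (k + 1) (Fin.snoc (fun _ => x) x)
      congr 1
      funext j
      refine Fin.lastCases ?_ (fun j => ?_) j
      · rw [Fin.snoc_last]
      · rw [Fin.snoc_castSucc]
    have h4 : HasSum (fun k => p (k + 1) fun _ => x) (p.shift.sum x x) := by
      rw [e]
      exact h3
    rw [← hp.coeff_zero fun _ => x]
    exact h1.unique h4.zero_add

lemma eq_sum_smul_single {𝕜 : Type*} [RCLike 𝕜] {n : ℕ} (x : EuclideanSpace 𝕜 (Fin n)) :
    x = ∑ k, x k • EuclideanSpace.single k (1 : 𝕜) := by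
  ext j
  simp [Finset.sum_apply, Pi.single_apply]

lemma exists_eq_add_sum_smul {𝕜 F : Type*} [RCLike 𝕜] [NormedAddCommGroup F] [NormedSpace 𝕜 F]
    [NormedSpace ℝ F] [IsScalarTower ℝ 𝕜 F] [CompleteSpace F] {n : ℕ}
    {f : EuclideanSpace 𝕜 (Fin n) → F} {R : ℝ} (hf : ContDiffOn 𝕜 ∞ f (ball 0 R)) :
    ∃ g : Fin n → EuclideanSpace 𝕜 (Fin n) → F, (∀ k, ContDiffOn 𝕜 ∞ (g k) (ball 0 R)) ∧
      ∀ x ∈ ball (0 : EuclideanSpace 𝕜 (Fin n)) R, f x = f 0 + ∑ k, x k • g k x := by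
  have hx := eq_sum_smul_single (𝕜 := 𝕜) (n := n)
  have h1 : ContDiffOn 𝕜 1 f (ball 0 R) := hf.of_le (by exact_mod_cast le_top)
  refine ⟨fun k => rayIntegral 𝕜 0 fun y => fderiv 𝕜 f y (EuclideanSpace.single k 1),
    fun k => contDiffOn_rayIntegral ?_ 0, fun x hxR => ?_⟩
  · exact (hf.fderiv_of_isOpen isOpen_ball (by simp)).clm_apply
      contDiffOn_const
  · have h2 := sub_eq_rayIntegral h1 hxR
    rw [sub_eq_iff_eq_add'] at h2
    rw [h2]
    congr 1
    have hc (k : Fin n) : ContinuousOn (fun y => fderiv 𝕜 f y (EuclideanSpace.single k 1)) (ball 0 R) :=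
      (h1.continuousOn_fderiv_of_isOpen isOpen_ball le_rfl).clm_apply continuousOn_const
    simp only [rayIntegral]
    have e : ∀ k, x k • ∫ t in (0 : ℝ)..1,
        t ^ 0 • fderiv 𝕜 f ((t : 𝕜) • x) (EuclideanSpace.single k 1) = ∫ t in (0 : ℝ)..1,
        x k • (t ^ 0 • fderiv 𝕜 f ((t : 𝕜) • x) (EuclideanSpace.single k 1)) := fun k => by
      rw [intervalIntegral.integral_smul]
    rw [Finset.sum_congr rfl fun k _ => e k, ← intervalIntegral.integral_finsetSum]
    · refine intervalIntegral.integral_congr fun t _ => ?_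
      dsimp only
      simp only [pow_zero, one_smul]
      conv_lhs => rw [hx x, map_sum]
      refine Finset.sum_congr rfl fun k _ => ?_
      rw [map_smul, ← hx]
    · exact fun k _ => ((continuousOn_ray 0 (hc k) hxR).const_smul (x k)).intervalIntegrable

/-- The real structure used for integrating is the restriction of that over `𝕜`. It is introduced
inside the proof, so that no compatibility with another real structure on `F` has to be assumed. -/
lemma exists_eq_add_sum_smul_of_contDiffOn_infty {𝕜 F : Type*} [RCLike 𝕜] [NormedAddCommGroup F]
    [NormedSpace 𝕜 F] [CompleteSpace F] {n : ℕ}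
    {f : EuclideanSpace 𝕜 (Fin n) → F} {R : ℝ} (hf : ContDiffOn 𝕜 ∞ f (ball 0 R)) :
    ∃ g : Fin n → EuclideanSpace 𝕜 (Fin n) → F, (∀ k, ContDiffOn 𝕜 ∞ (g k) (ball 0 R)) ∧
      ∀ x ∈ ball (0 : EuclideanSpace 𝕜 (Fin n)) R, f x = f 0 + ∑ k, x k • g k x := by
  let _ : NormedSpace ℝ F := NormedSpace.restrictScalars ℝ 𝕜 F
  have : IsScalarTower ℝ 𝕜 F := ⟨fun a b c => by
    rw [Algebra.smul_def a b, mul_smul]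
    rfl⟩
  exact exists_eq_add_sum_smul hf

lemma exists_eq_add_sum_coord {𝕜 K : Type*} [RCLike 𝕜] [RCLike K] [NormedAlgebra 𝕜 K] {n : ℕ}
    {r : Regularity} {f : EuclideanSpace 𝕜 (Fin n) → K} {R : ℝ} (hR : 0 < R)
    (hf : ContDiffOn 𝕜 r.order f (ball 0 R)) :
    ∃ R' > 0, ∃ g : Fin n → EuclideanSpace 𝕜 (Fin n) → K,
      (∀ k, ContDiffOn 𝕜 r.order (g k) (ball 0 R')) ∧
      ∀ x ∈ ball (0 : EuclideanSpace 𝕜 (Fin n)) R',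
        f x = f 0 + ∑ k, algebraMap 𝕜 K (x k) * g k x := by
  have hx := eq_sum_smul_single (𝕜 := 𝕜) (n := n)
  cases r with
  | smooth =>
    obtain ⟨g, hg, hg'⟩ := exists_eq_add_sum_smul_of_contDiffOn_infty hf
    exact ⟨R, hR, g, hg, fun x hxR => by simp only [hg' x hxR, Algebra.smul_def]⟩
  | analytic =>
    obtain ⟨R', hR', L, hL, hL'⟩ := exists_contDiffOn_apply_self (f := f)
      ((hf.contDiffAt (isOpen_ball.mem_nhds (mem_ball_self hR))).analyticAt)
    refine ⟨R', hR', fun k x => L x (EuclideanSpace.single k 1),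
      fun k => hL.clm_apply contDiffOn_const, fun x hxR => ?_⟩
    rw [hL' x hxR]
    congr 1
    conv_lhs => rw [hx x, map_sum]
    refine Finset.sum_congr rfl fun k _ => ?_
    rw [map_smul, Algebra.smul_def, ← hx]

end Hadamard

/-! ### The algebra of functions on the underlying manifold -/

section BodyLemmas

open Filter Metric
open scoped Topology

variable {𝕜 K : Type*} [RCLike 𝕜] [RCLike K] [NormedAlgebra 𝕜 K] {n : ℕ} {r : Regularity}
variable {X : Type*} [TopologicalSpace X] [ChartedSpace (EuclideanSpace 𝕜 (Fin n)) X]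

lemma contMDiffAt_extend {W : Opens X} (f : bodyFun 𝕜 K n r W) {p : X} (hp : p ∈ W) :
    ContMDiffAt 𝓘(𝕜, EuclideanSpace 𝕜 (Fin n)) 𝓘(𝕜, K) r.order
      (extend Subtype.val f.1 (0 : X → K)) p := by
  refine (contMDiffAt_subtype_iff (U := W) (x := ⟨p, hp⟩)).1 ?_
  simpa only [Subtype.val_injective.extend_apply] using f.2 ⟨p, hp⟩

lemma extend_apply_of_mem {W : Opens X} (f : W → K) {p : X} (hp : p ∈ W) :
    extend Subtype.val f (0 : X → K) p = f ⟨p, hp⟩ :=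
  Subtype.val_injective.extend_apply f 0 (⟨p, hp⟩ : W)

lemma extend_apply_of_notMem {W : Opens X} (f : W → K) {p : X} (hp : p ∉ W) :
    extend Subtype.val f (0 : X → K) p = 0 :=
  extend_apply' _ _ _ fun ⟨y, hy⟩ => hp (hy ▸ y.2)

/-- The restriction to `W` of a function on `X` which is regular at the points of `W`. -/
def bodyOfFun (W : Opens X) (f : X → K) (hf : ∀ p ∈ W,
    ContMDiffAt 𝓘(𝕜, EuclideanSpace 𝕜 (Fin n)) 𝓘(𝕜, K) r.order f p) : bodyFun 𝕜 K n r W :=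
  ⟨fun p => f p.1, fun p => contMDiffAt_subtype_iff.2 (hf p.1 p.2)⟩

lemma bodyFun_ext {W : Opens X} {f g : bodyFun 𝕜 K n r W} (h : ∀ p, f.1 p = g.1 p) : f = g :=
  Subtype.ext (funext h)

lemma bodyFun_ext_of_res {W : Opens X} {f g : bodyFun 𝕜 K n r W} (h : ∀ p ∈ W, ∃ (V : Opens X)
    (hV : V ≤ W), p ∈ V ∧ bodyRes 𝕜 K n r hV f = bodyRes 𝕜 K n r hV g) : f = g :=
  bodyFun_ext fun p => by
    obtain ⟨V, hV, hp, e⟩ := h p.1 p.2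
    exact congrFun (congrArg Subtype.val e) ⟨p.1, hp⟩

lemma bodyFun_glue {T : Type*} (U : T → Opens X) (f : ∀ t, bodyFun 𝕜 K n r (U t))
    (h : ∀ s t p (hs : p ∈ U s) (ht : p ∈ U t), (f s).1 ⟨p, hs⟩ = (f t).1 ⟨p, ht⟩) :
    ∃ g : bodyFun 𝕜 K n r (⨆ t, U t), ∀ t, bodyRes 𝕜 K n r (le_iSup U t) g = f t := by
  classical
  let F : X → K := fun p => if hp : ∃ t, p ∈ U t then (f hp.choose).1 ⟨p, hp.choose_spec⟩ else 0
  have hF : ∀ t p (hp : p ∈ U t), F p = (f t).1 ⟨p, hp⟩ := fun t p hp => by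
    have h' : ∃ t, p ∈ U t := ⟨t, hp⟩
    exact (dif_pos h').trans (h _ _ _ _ _)
  refine ⟨bodyOfFun _ F fun p hp => ?_, fun t => bodyFun_ext fun p => hF t p.1 p.2⟩
  obtain ⟨t, ht⟩ := Opens.mem_iSup.1 hp
  refine (contMDiffAt_extend (f t) ht).congr_of_eventuallyEq ?_
  filter_upwards [(U t).2.mem_nhds ht] with y hy
  rw [hF t y hy, extend_apply_of_mem _ hy]

variable {e : OpenPartialHomeomorph X (EuclideanSpace 𝕜 (Fin n))}
variable (he : e ∈ IsManifold.maximalAtlas 𝓘(𝕜, EuclideanSpace 𝕜 (Fin n)) r.order X)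
variable {W : Opens X} (hW : (W : Set X) ⊆ e.source)

/-- The expression in the chart `e` of a function on `W`. -/
def bodyRep (e : OpenPartialHomeomorph X (EuclideanSpace 𝕜 (Fin n))) (f : bodyFun 𝕜 K n r W) :
    EuclideanSpace 𝕜 (Fin n) → K := extend Subtype.val f.1 (0 : X → K) ∘ e.symm

lemma contDiffAt_bodyRep
    (he : e ∈ IsManifold.maximalAtlas 𝓘(𝕜, EuclideanSpace 𝕜 (Fin n)) r.order X) (f : bodyFun 𝕜 K n r W) {y : EuclideanSpace 𝕜 (Fin n)}
    (hy : y ∈ e.target) (hyW : e.symm y ∈ W) : ContDiffAt 𝕜 r.order (bodyRep e f) y :=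
  (ContMDiffAt.comp y (contMDiffAt_extend f hyW)
    (contMDiffAt_symm_of_mem_maximalAtlas he hy)).contDiffAt

lemma hasFDerivAt_bodyRep
    (he : e ∈ IsManifold.maximalAtlas 𝓘(𝕜, EuclideanSpace 𝕜 (Fin n)) r.order X)
    (hW : (W : Set X) ⊆ e.source) (f : bodyFun 𝕜 K n r W) (p : W) :
    HasFDerivAt (bodyRep e f) (fderiv 𝕜 (bodyRep e f) (e p.1)) (e p.1) :=
  ((contDiffAt_bodyRep he f (e.map_source (hW p.2))
    (by rw [e.left_inv (hW p.2)]; exact p.2)).differentiableAt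
      (zero_lt_one.trans_le r.one_le_order).ne').hasFDerivAt

lemma bodyRep_add (f g : bodyFun 𝕜 K n r W) : bodyRep e (f + g) = bodyRep e f + bodyRep e g := by
  funext y
  change extend Subtype.val (f.1 + g.1) (0 : X → K) (e.symm y) =
    extend Subtype.val f.1 (0 : X → K) (e.symm y) + extend Subtype.val g.1 (0 : X → K) (e.symm y)
  by_cases h : e.symm y ∈ W
  · simp only [extend_apply_of_mem _ h, Pi.add_apply]
  · simp only [extend_apply_of_notMem _ h, add_zero]

lemma bodyRep_mul (f g : bodyFun 𝕜 K n r W) : bodyRep e (f * g) = bodyRep e f * bodyRep e g := by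
  funext y
  change extend Subtype.val (f.1 * g.1) (0 : X → K) (e.symm y) =
    extend Subtype.val f.1 (0 : X → K) (e.symm y) * extend Subtype.val g.1 (0 : X → K) (e.symm y)
  by_cases h : e.symm y ∈ W
  · simp only [extend_apply_of_mem _ h, Pi.mul_apply]
  · simp only [extend_apply_of_notMem _ h, mul_zero]

lemma bodyRep_smul (c : K) (f : bodyFun 𝕜 K n r W) : bodyRep e (c • f) = c • bodyRep e f := by
  funext y
  change extend Subtype.val (c • f.1) (0 : X → K) (e.symm y) =
    c • extend Subtype.val f.1 (0 : X → K) (e.symm y)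
  by_cases h : e.symm y ∈ W
  · simp only [extend_apply_of_mem _ h, Pi.smul_apply]
  · simp only [extend_apply_of_notMem _ h, smul_zero]

lemma bodyPd_apply (a : Fin n) (f : bodyFun 𝕜 K n r W) (p : W) :
    (bodyPd he hW a f).1 p = fderiv 𝕜 (bodyRep e f) (e p.1) (EuclideanSpace.single a 1) := rfl

/-- The partial derivative as a linear map. -/
def bodyPdLin (a : Fin n) : bodyFun 𝕜 K n r W →ₗ[K] bodyFun 𝕜 K n r W where
  toFun := bodyPd he hW a
  map_add' f g := bodyFun_ext fun p => by
    change _ = (bodyPd he hW a f).1 p + (bodyPd he hW a g).1 p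
    simp only [bodyPd_apply, bodyRep_add]
    rw [((hasFDerivAt_bodyRep he hW f p).add (hasFDerivAt_bodyRep he hW g p)).fderiv]
    rfl
  map_smul' c f := bodyFun_ext fun p => by
    change _ = c • (bodyPd he hW a f).1 p
    simp only [bodyPd_apply, bodyRep_smul]
    rw [((hasFDerivAt_bodyRep he hW f p).const_smul c).fderiv]
    rfl

lemma bodyPd_mul (a : Fin n) (f g : bodyFun 𝕜 K n r W) :
    bodyPd he hW a (f * g) = bodyPd he hW a f * g + f * bodyPd he hW a g :=
  bodyFun_ext fun p => by
    change _ = (bodyPd he hW a f).1 p * g.1 p + f.1 p * (bodyPd he hW a g).1 p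
    simp only [bodyPd_apply, bodyRep_mul]
    rw [((hasFDerivAt_bodyRep he hW f p).mul (hasFDerivAt_bodyRep he hW g p)).fderiv]
    have h (f : bodyFun 𝕜 K n r W) : bodyRep e f (e p.1) = f.1 p := by
      change extend Subtype.val f.1 (0 : X → K) (e.symm (e p.1)) = f.1 p
      rw [e.left_inv (hW p.2), extend_apply_of_mem _ p.2]
    simp only [add_apply, smul_apply, smul_eq_mul, h]
    ring

lemma bodyPd_res {V : Opens X} (h : V ≤ W) (a : Fin n) (f : bodyFun 𝕜 K n r W) :
    bodyPd he (Set.Subset.trans h hW) a (bodyRes 𝕜 K n r h f) = bodyRes 𝕜 K n r h (bodyPd he hW a f) :=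
  bodyFun_ext fun p => by
    change _ = (bodyPd he hW a f).1 ⟨p.1, h p.2⟩
    simp only [bodyPd_apply]
    congr 1
    refine Filter.EventuallyEq.fderiv_eq ?_
    filter_upwards [e.symm.continuousAt (e.map_source (hW (h p.2)))
      (V.2.mem_nhds (by rw [e.left_inv (hW (h p.2))]; exact p.2))] with y hy
    change extend Subtype.val _ (0 : X → K) (e.symm y) = extend Subtype.val _ (0 : X → K) (e.symm y)
    rw [extend_apply_of_mem _ hy, extend_apply_of_mem _ (h hy)]
    rfl

lemma bodyPd_coord (a b : Fin n) :
    bodyPd he hW a (bodyCoord he W hW b : bodyFun 𝕜 K n r W) = if b = a then 1 else 0 :=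
  bodyFun_ext fun p => by
    rw [bodyPd_apply]
    have h1 : bodyRep e (bodyCoord he W hW b : bodyFun 𝕜 K n r W) =ᶠ[𝓝 (e p.1)]
        fun v => algebraMap 𝕜 K (v b) := by
      filter_upwards [e.symm.continuousAt (e.map_source (hW p.2))
        (W.2.mem_nhds (by rw [e.left_inv (hW p.2)]; exact p.2)),
        e.open_target.mem_nhds (e.map_source (hW p.2))] with y hy hy'
      change extend Subtype.val _ (0 : X → K) (e.symm y) = _
      rw [extend_apply_of_mem _ hy]
      change algebraMap 𝕜 K (e (e.symm y) b) = _
      rw [e.right_inv hy']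
    have h2 := ((Algebra.linearMap 𝕜 K).toContinuousLinearMap.comp
      (EuclideanSpace.proj (𝕜 := 𝕜) b)).hasFDerivAt (x := e p.1)
    rw [h1.fderiv_eq, HasFDerivAt.fderiv (f := fun v : EuclideanSpace 𝕜 (Fin n) => algebraMap 𝕜 K (v b)) h2]
    change algebraMap 𝕜 K (EuclideanSpace.single a (1 : 𝕜) b) = _
    rw [PiLp.single_apply]
    split_ifs
    · exact map_one _
    · exact map_zero _

/-- Hadamard's lemma on the underlying manifold. -/
lemma exists_bodyRes_eq (f : bodyFun 𝕜 K n r W) {p : X} (hp : p ∈ W) :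
    ∃ (V : Opens X) (hV : V ≤ W) (g : Fin n → bodyFun 𝕜 K n r V) (c : K) (z : Fin n → K), p ∈ V ∧
      (∀ k (hp : p ∈ V), (bodyCoord he V (Set.Subset.trans hV hW) k : bodyFun 𝕜 K n r V).1 ⟨p, hp⟩ = z k) ∧
      bodyRes 𝕜 K n r hV f = algebraMap K _ c + ∑ k,
        (bodyCoord he V (Set.Subset.trans hV hW) k - algebraMap K _ (z k)) * g k := by
  have hO : IsOpen (e.target ∩ e.symm ⁻¹' W) := e.symm.isOpen_inter_preimage W.2
  have hOp : e p ∈ e.target ∩ e.symm ⁻¹' W :=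
    ⟨e.map_source (hW hp), by rw [Set.mem_preimage, e.left_inv (hW hp)]; exact hp⟩
  obtain ⟨R, hR, hRO⟩ := Metric.isOpen_iff.1 hO _ hOp
  -- The chart is translated so that `p` becomes the origin.
  have h1 : ContDiffOn 𝕜 r.order (fun y => bodyRep e f (y + e p)) (ball 0 R) := fun y hy => by
    have hy' := hRO (show y + e p ∈ ball (e p) R by simpa [dist_eq_norm] using hy)
    exact ((contDiffAt_bodyRep he f hy'.1 hy'.2).comp y
      (contDiffAt_id.add contDiffAt_const)).contDiffWithinAt
  obtain ⟨R', hR', g, hg, hgf⟩ := exists_eq_add_sum_coord hR h1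
  let V : Opens X := W ⊓ ⟨e.source ∩ e ⁻¹' ball (e p) R', e.isOpen_inter_preimage isOpen_ball⟩
  have hV : ∀ q ∈ V, e q - e p ∈ ball (0 : EuclideanSpace 𝕜 (Fin n)) R' := fun q hq => by
    simpa [dist_eq_norm] using hq.2.2
  refine ⟨V, inf_le_left, fun k => bodyOfFun V (fun q => g k (e q - e p)) fun q hq => ?_,
    f.1 ⟨p, hp⟩, fun k => algebraMap 𝕜 K (e p k), ⟨hp, hW hp, mem_ball_self hR'⟩,
    fun _ _ => rfl, bodyFun_ext fun q => ?_⟩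
  · have h2 : ContDiffAt 𝕜 r.order (fun y => g k (y - e p)) (e q) :=
      ((hg k).contDiffAt (isOpen_ball.mem_nhds (hV q hq))).comp (e q)
        (contDiffAt_id.sub contDiffAt_const)
    exact h2.contMDiffAt.comp q (contMDiffAt_of_mem_maximalAtlas he (hW hq.1))
  · have h3 := hgf _ (hV q.1 q.2)
    simp only [sub_add_cancel, zero_add] at h3
    have h4 : ∀ q (hq : q ∈ W), bodyRep e f (e q) = f.1 ⟨q, hq⟩ := fun q hq => by
      change extend Subtype.val f.1 (0 : X → K) (e.symm (e q)) = _
      rw [e.left_inv (hW hq), extend_apply_of_mem _ hq]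
    rw [h4 _ q.2.1, h4 _ hp] at h3
    refine h3.trans ?_
    simp only [AddMemClass.coe_add, Pi.add_apply, AddSubmonoidClass.coe_finsetSum, Finset.sum_apply]
    congr 1
    refine Finset.sum_congr rfl fun k _ => ?_
    rw [PiLp.sub_apply, map_sub]
    rfl

end BodyLemmas

/-! ### Derivations of the local model -/

namespace Series

variable {G K : Type*} [AddCommGroup G] [Field K] {ρ : CommutationFactor G K}
variable {ι : Type*} [Fintype ι] [LinearOrder ι] {d : ι → G}
variable {R : Type*} [CommRing R] [Algebra K R]

open scoped Classical in
/-- The quotient by `x_b` of the part of a series consisting of the multiples of `x_b` which do not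
involve the `x_c` with `c < b`. -/
def divX (b : ι) (f : Series ρ d R) : Series ρ d R :=
  ⟨fun v => if ∀ c < b, v c = 0 then f.coeff (v + Finsupp.single b 1) else 0, fun v hv => by
    have h0 : f.coeff (v + Finsupp.single b 1) = 0 :=
      coeff_of_not_good f fun h => hv (h.mono le_self_add)
    simp [h0], by
    obtain ⟨S, hS⟩ := f.2.2
    refine ⟨S.image fun j => j - d b, fun w hw => ?_⟩
    have h1 := hS (w + Finsupp.single b 1) fun h => hw (by simp [coeff, h])
    refine Finset.mem_image.2 ⟨_, h1, ?_⟩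
    rw [wdeg_add, wdeg_single, one_smul, add_sub_cancel_right]⟩

open scoped Classical in
lemma coeff_divX (b : ι) (f : Series ρ d R) (v : ι →₀ ℕ) : (divX b f).coeff v =
    if ∀ c < b, v c = 0 then f.coeff (v + Finsupp.single b 1) else 0 := rfl

/-- A nonconstant monomial is divided by the indeterminate of smallest index that occurs in it. So
every monomial is counted exactly once, and putting `x_b` in front costs no sign. -/
lemma eq_add_sum_X_mul_divX (f : Series ρ d R) :
    f = monomial 0 (f.coeff 0) + ∑ b, X b * divX b f := by
  classical
  refine ext_good fun w hw => ?_
  rw [coeff_add, coeff_sum, coeff_monomial]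
  have key : ∀ b, (X b * divX b f).coeff w =
      if w b ≠ 0 ∧ ∀ c < b, w c = 0 then f.coeff w else 0 := fun b => by
    rw [coeff_X_mul b _ hw]
    by_cases hb : w b = 0
    · rw [if_pos hb, if_neg fun h => h.1 hb]
    · have hle : Finsupp.single b 1 ≤ w := by
        rw [Finsupp.single_le_iff]
        omega
      have hc : (∀ c < b, (w - Finsupp.single b 1 : ι →₀ ℕ) c = 0) ↔ ∀ c < b, w c = 0 :=
        forall₂_congr fun c hc => by
          rw [Finsupp.tsub_apply, Finsupp.single_eq_of_ne hc.ne, tsub_zero]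
      rw [if_neg hb, coeff_divX, tsub_add_cancel_of_le hle]
      by_cases h : ∀ c < b, w c = 0
      · rw [if_pos (hc.2 h), if_pos ⟨hb, h⟩]
        have h1 : pdSign ρ d b (w - Finsupp.single b 1) = 1 := Finset.prod_eq_one fun c _ => by
          split_ifs with hcb
          · rw [hc.2 h c hcb, pow_zero]
          · rfl
        have h2 := tw_single_left (ρ := ρ) (d := d) b (w - Finsupp.single b 1)
        rw [h1, mul_one] at h2
        rw [h2, one_smul]
      · rw [if_neg fun h' => h (hc.1 h'), if_neg fun h' => h h'.2, smul_zero]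
  rw [Finset.sum_congr rfl fun b _ => key b]
  by_cases h0 : w = 0
  · subst h0
    simp [isGood_zero]
  · rw [if_neg fun h => h0 h.1, zero_add]
    have hne : (Finset.univ.filter fun b => w b ≠ 0).Nonempty := by
      by_contra h
      rw [Finset.not_nonempty_iff_eq_empty, Finset.filter_eq_empty_iff] at h
      exact h0 (Finsupp.ext fun b => by simpa using h (Finset.mem_univ b))
    set m := (Finset.univ.filter fun b => w b ≠ 0).min' hne
    have hm : w m ≠ 0 := (Finset.mem_filter.1 (Finset.min'_mem _ hne)).2
    have hlt : ∀ c < m, w c = 0 := fun c hc => by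
      by_contra h
      exact (Finset.min'_le _ c (Finset.mem_filter.2 ⟨Finset.mem_univ _, h⟩)).not_gt hc
    rw [Finset.sum_eq_single m, if_pos ⟨hm, hlt⟩]
    · intro b _ hb
      rw [if_neg]
      rintro ⟨h1, h2⟩
      rcases lt_or_gt_of_ne hb with h | h
      · exact h1 (hlt b h)
      · exact hm (h2 m h)
    · simp

/-- The coefficient of `x ^ w` as a linear map. -/
def coeffLin (w : ι →₀ ℕ) : Series ρ d R →ₗ[K] R where
  toFun f := f.coeff w
  map_add' _ _ := rfl
  map_smul' _ _ := rfl

lemma monomial_zero_mul (r s : R) :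
    (monomial 0 (r * s) : Series ρ d R) = monomial 0 r * monomial 0 s := ext fun w => by
  classical
  rw [coeff_monomial_zero_mul, coeff_monomial, coeff_monomial]
  split_ifs <;> simp

/-- The inclusion of the coefficients. -/
def C : R →ₗ[K] Series ρ d R where
  toFun := monomial 0
  map_add' r s := ext fun w => by
    classical
    rw [coeff_add, coeff_monomial, coeff_monomial, coeff_monomial]
    split_ifs <;> simp
  map_smul' c r := ext fun w => by
    classical
    rw [RingHom.id_apply, coeff_smul, coeff_monomial, coeff_monomial]
    split_ifs <;> simp

lemma C_apply (r : R) : (C r : Series ρ d R) = monomial 0 r := rfl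

lemma C_mem (r : R) : (C r : Series ρ d R) ∈ grade 0 := by
  have := monomial_mem (ρ := ρ) (d := d) 0 r
  rwa [wdeg_zero] at this

lemma C_mul (r s : R) : (C (r * s) : Series ρ d R) = C r * C s := monomial_zero_mul r s

lemma C_one : (C 1 : Series ρ d R) = 1 := rfl

lemma C_algebraMap (c : K) : (C (algebraMap K R c) : Series ρ d R) = algebraMap K _ c := by
  rw [Algebra.algebraMap_eq_smul_one, map_smul, C_one, Algebra.algebraMap_eq_smul_one]

lemma map_monomial {R' : Type*} [CommRing R'] [Algebra K R'] (φ : R →ₐ[K] R') (w : ι →₀ ℕ) (s : R) :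
    map φ (monomial w s : Series ρ d R) = monomial w (φ s) := ext fun u => by
  classical
  rw [coeff_map, coeff_monomial, coeff_monomial]
  split_ifs <;> simp

lemma map_X {R' : Type*} [CommRing R'] [Algebra K R'] (φ : R →ₐ[K] R') (b : ι) :
    map φ (X b : Series ρ d R) = X b := by
  rw [X, map_monomial, map_one]
  rfl

lemma apply_one_eq_zero {q : G} (E : Series ρ d R →ₗ[K] Series ρ d R)
    (hE : ∀ {j} {f : Series ρ d R} g, f ∈ grade j → E (f * g) = E f * g + ρ q j • (f * E g))
    (c : K) : E (algebraMap K _ c) = 0 := by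
  rw [Algebra.algebraMap_eq_smul_one, map_smul]
  have h := hE (f := 1) 1 one_mem_grade
  rw [mul_one, ρ.zero_right, one_smul, one_mul, mul_one] at h
  rw [left_eq_add.1 h, smul_zero]

/-- A step in the computation of the coefficients of a derivation `E`. -/
lemma apply_coeff_eq_zero {q : G} (E : Series ρ d R →ₗ[K] Series ρ d R)
    (hE : ∀ {j} {f : Series ρ d R} g, f ∈ grade j → E (f * g) = E f * g + ρ q j • (f * E g))
    {B : Type*} [CommRing B] [Algebra K B] (ε : R →ₐ[K] B) (hX : ∀ b, E (X b) = 0)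
    {T : Type*} [Fintype T] (s g : T → R) (c : K) {f : Series ρ d R}
    (hf : f.coeff 0 = algebraMap K R c + ∑ k, s k * g k) (hs : ∀ k, E (C (s k)) = 0)
    (hs' : ∀ k, ε (s k) = 0) {w : ι →₀ ℕ} (hw : IsGood ρ d w)
    (h : ∀ b, w b ≠ 0 → ε ((E (divX b f)).coeff (w - Finsupp.single b 1)) = 0) :
    ε ((E f).coeff w) = 0 := by
  -- In this decomposition `E` kills `c`, the `s k` and the `x_b`. By the Leibniz rule only
  -- multiples of `s k`, which vanish under `ε`, and multiples of `x_b`, governed by lower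
  -- coefficients, remain.
  have e2 : f = algebraMap K _ c + (∑ k, C (s k) * C (g k) + ∑ b, X b * divX b f) := by
    refine (eq_add_sum_X_mul_divX f).trans ?_
    rw [← add_assoc, hf, ← C_apply, map_add, map_sum, C_algebraMap]
    simp only [C_mul]
  let ψ : Series ρ d R →ₗ[K] B := ε.toLinearMap ∘ₗ coeffLin w ∘ₗ E
  have hψ1 : ∀ k, ψ (C (s k) * C (g k)) = 0 := fun k => by
    change ε ((E (C (s k) * C (g k))).coeff w) = 0
    rw [hE _ (C_mem (s k)), hs, zero_mul, zero_add, ρ.zero_right, one_smul, C_apply,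
      coeff_monomial_zero_mul, map_mul, hs', zero_mul]
  have hψ2 : ∀ b, ψ (X b * divX b f) = 0 := fun b => by
    classical
    change ε ((E (X b * divX b f)).coeff w) = 0
    rw [hE _ (X_mem b), hX, zero_mul, zero_add, coeff_smul, coeff_X_mul b _ hw]
    split_ifs with hb
    · rw [smul_zero, map_zero]
    · rw [map_smul, map_smul, h b hb, smul_zero, smul_zero]
  have hψ3 : ψ (algebraMap K _ c) = 0 := by
    change ε ((E (algebraMap K _ c)).coeff w) = 0
    rw [apply_one_eq_zero E hE, coeff_zero, map_zero]
  change ψ f = 0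
  rw [e2, map_add, map_add, map_sum, map_sum, hψ3, Finset.sum_eq_zero fun k _ => hψ1 k,
    Finset.sum_eq_zero fun b _ => hψ2 b, add_zero, add_zero]

end Series

/-! ### Partial derivatives and uniqueness of derivations on the local model -/

section ModelLemmas

variable {G K : Type*} [AddCommGroup G] [RCLike K]
variable {𝕜 : Type*} [RCLike 𝕜] [NormedAlgebra 𝕜 K] {n : ℕ} {r : Regularity}
variable {X : Type*} [TopologicalSpace X] [ChartedSpace (EuclideanSpace 𝕜 (Fin n)) X]
variable {ρ : CommutationFactor G K}
variable {ι : Type*} [Fintype ι] [LinearOrder ι] {d : ι → G}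
variable {e : OpenPartialHomeomorph X (EuclideanSpace 𝕜 (Fin n))}
variable (he : e ∈ IsManifold.maximalAtlas 𝓘(𝕜, EuclideanSpace 𝕜 (Fin n)) r.order X)

local notation "resM" => Model.res (𝕜 := 𝕜) (K := K) (n := n) (r := r) (ρ := ρ) (d := d)

namespace Model

lemma ext_of_res {W : Opens X} {f g : Model 𝕜 n r ρ d W} (h : ∀ p ∈ W, ∃ (V : Opens X)
    (hV : V ≤ W), p ∈ V ∧ resM hV f = resM hV g) : f = g :=
  Series.ext fun w => bodyFun_ext_of_res fun p hp => by
    obtain ⟨V, hV, hpV, e⟩ := h p hp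
    exact ⟨V, hV, hpV, congrArg (fun f => Series.coeff f w) e⟩

lemma res_coord {V W : Opens X} (h : V ≤ W) (hW : (W : Set X) ⊆ e.source) (a : CoordIdx n ι) :
    resM h (coord he W hW a : Model 𝕜 n r ρ d W) = coord he V (Set.Subset.trans h hW) a := by
  obtain ⟨a | a, rfl⟩ := toLex.surjective a
  · exact Series.map_monomial _ _ _
  · exact Series.map_X _ _

lemma coord_mem (W : Opens X) (hW : (W : Set X) ⊆ e.source) (a : CoordIdx n ι) :
    (coord he W hW a : Model 𝕜 n r ρ d W) ∈ Series.grade (coordDeg n d a) := by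
  obtain ⟨a | a, rfl⟩ := toLex.surjective a
  · exact Series.C_mem _
  · exact Series.X_mem _

variable {W : Opens X} (hW : (W : Set X) ⊆ e.source)

/-- The partial derivative as a linear map. -/
def pdLin (a : CoordIdx n ι) : Model 𝕜 n r ρ d W →ₗ[K] Model 𝕜 n r ρ d W where
  toFun := pd he hW a
  map_add' f g := by
    obtain ⟨a | a, rfl⟩ := toLex.surjective a
    · exact Series.ext fun w => map_add (bodyPdLin he hW a) _ _
    · exact map_add (Series.pdLin a) f g
  map_smul' c f := by
    obtain ⟨a | a, rfl⟩ := toLex.surjective a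
    · exact Series.ext fun w => map_smul (bodyPdLin he hW a) c _
    · exact map_smul (Series.pdLin a) c f

lemma pd_mem (a : CoordIdx n ι) {j : G} {f : Model 𝕜 n r ρ d W} (hf : f ∈ Series.grade j) :
    pd he hW a f ∈ Series.grade (-coordDeg n d a + j) := by
  obtain ⟨a | a, rfl⟩ := toLex.surjective a
  · intro w hw
    change bodyPd he hW a (f.coeff w) ≠ 0 at hw
    change wdeg d w = -0 + j
    rw [neg_zero, zero_add]
    exact hf w fun h => hw (by rw [h, bodyPd_zero])
  · exact Series.pd_mem a hf

lemma pd_mul (a : CoordIdx n ι) {j : G} {f : Model 𝕜 n r ρ d W} (hf : f ∈ Series.grade j)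
    (g : Model 𝕜 n r ρ d W) : pd he hW a (f * g) =
      pd he hW a f * g + ρ (-coordDeg n d a) j • (f * pd he hW a g) := by
  obtain ⟨a | a, rfl⟩ := toLex.surjective a
  · refine (Series.mapCoeff_mul (bodyPdLin he hW a) (bodyPd_mul he hW a) f g).trans ?_
    change _ = _ + ρ (-0) j • _
    rw [neg_zero, ρ.zero_left, one_smul]
    rfl
  · exact Series.pd_mul a hf g

lemma res_pd {V : Opens X} (h : V ≤ W) (a : CoordIdx n ι) (f : Model 𝕜 n r ρ d W) :
    resM h (pd he hW a f) = pd he (Set.Subset.trans h hW) a (resM h f) := by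
  obtain ⟨a | a, rfl⟩ := toLex.surjective a
  · exact Series.ext fun w => (bodyPd_res he hW h a _).symm
  · exact Series.map_pd _ a f

open scoped Classical in
lemma pd_coord (a b : CoordIdx n ι) :
    pd he hW a (coord he W hW b : Model 𝕜 n r ρ d W) = if b = a then 1 else 0 := by
  obtain ⟨a | a, rfl⟩ := toLex.surjective a <;> obtain ⟨b | b, rfl⟩ := toLex.surjective b
  · refine Series.ext fun w => ?_
    change bodyPd he hW a ((Series.monomial 0 (bodyCoord he W hW b) : Model 𝕜 n r ρ d W).coeff w) = _
    rw [Series.coeff_monomial]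
    by_cases hw : w = 0
    · subst hw
      rw [if_pos ⟨rfl, Series.isGood_zero⟩, bodyPd_coord]
      by_cases h : b = a
      · subst h
        simp [Series.coeff_one]
      · rw [if_neg h, if_neg fun h' => h (by simpa using h'), Series.coeff_zero]
    · rw [if_neg fun h => hw h.1, bodyPd_zero]
      split_ifs
      · rw [Series.coeff_one, if_neg hw]
      · rfl
  · refine Series.ext fun w => ?_
    change bodyPd he hW a ((Series.monomial (Finsupp.single b 1) 1 : Model 𝕜 n r ρ d W).coeff w) = _
    rw [Series.coeff_monomial, if_neg (by simp : ¬ toLex (Sum.inr b) = toLex (Sum.inl a))]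
    split_ifs
    · have h := bodyPd_mul he hW a (1 : bodyFun 𝕜 K n r W) 1
      rw [mul_one, mul_one, one_mul] at h
      exact left_eq_add.1 h
    · exact bodyPd_zero he hW a
  · rw [if_neg (by simp : ¬ toLex (Sum.inl b) = toLex (Sum.inr a))]
    exact Series.pd_monomial_zero a _
  · refine (Series.pd_X a b).trans ?_
    congr 1
    simp

end Model

/-- A family of `ρ`-derivations of degree `q` of the local models over the open subsets of `U`. -/
structure ModelDerivation (𝕜 : Type*) [RCLike 𝕜] [NormedAlgebra 𝕜 K] (n : ℕ) (r : Regularity)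
    [ChartedSpace (EuclideanSpace 𝕜 (Fin n)) X] (ρ : CommutationFactor G K) (d : ι → G) (U : Opens X)
    (q : G) where
  app : ∀ W ≤ U, Model 𝕜 n r ρ d W →ₗ[K] Model 𝕜 n r ρ d W
  res_app : ∀ {V W} (hVW : V ≤ W) (hV : V ≤ U) (hW : W ≤ U) f,
    Model.res (𝕜 := 𝕜) (K := K) (n := n) (r := r) (ρ := ρ) (d := d) hVW (app W hW f) =
      app V hV (Model.res (𝕜 := 𝕜) (K := K) (n := n) (r := r) (ρ := ρ) (d := d) hVW f)
  leibniz : ∀ W (hW : W ≤ U) {j} {f : Model 𝕜 n r ρ d W} g, f ∈ Series.grade j →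
    app W hW (f * g) = app W hW f * g + ρ q j • (f * app W hW g)

namespace ModelDerivation

variable {U : Opens X} {q : G} (E : ModelDerivation 𝕜 n r ρ d U q)

lemma app_algebraMap (W : Opens X) (hW : W ≤ U) (c : K) : E.app W hW (algebraMap K _ c) = 0 := by
  exact Series.apply_one_eq_zero (E.app W hW) (fun _ h => E.leibniz W hW _ h) c

/-- A `ρ`-derivation which kills the coordinate functions is zero. -/
theorem app_eq_zero (hU : (U : Set X) ⊆ e.source)
    (h0 : ∀ a W (hW : W ≤ U), E.app W hW (Model.coord he W (Set.Subset.trans hW hU) a) = 0)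
    (W : Opens X) (hW : W ≤ U) (f : Model 𝕜 n r ρ d W) : E.app W hW f = 0 := by
  classical
  -- The coefficients of `E f` are shown to vanish pointwise, by induction on the order of the
  -- monomial. At a given point, Hadamard's lemma for the constant coefficient and division by the
  -- indeterminates express the coefficient at `w` by coefficients of other functions at `w - e_b`;
  -- hence all opens and all `f` are treated simultaneously.
  suffices key : ∀ (N : ℕ) W (hW : W ≤ U) (f : Model 𝕜 n r ρ d W) (p : W) (w : ι →₀ ℕ),
      w.degree < N → ((E.app W hW f).coeff w).1 p = 0 from
    Series.ext fun w => bodyFun_ext fun p => key _ W hW f p w (Nat.lt_succ_self _)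
  intro N
  induction N with
  | zero => exact fun _ _ _ _ _ h => absurd h (Nat.not_lt_zero _)
  | succ N ih =>
    intro W hW f p w hw
    by_cases hgood : IsGood ρ d w
    swap
    · rw [Series.coeff_of_not_good _ hgood]
      rfl
    obtain ⟨V, hV, g, c, z, hpV, hz, hf⟩ :=
      exists_bodyRes_eq he (Set.Subset.trans hW hU) (f.coeff 0) p.2
    have hVU := hV.trans hW
    have e1 : ((E.app W hW f).coeff w).1 p = ((E.app V hVU (resM hV f)).coeff w).1 ⟨p.1, hpV⟩ := by
      rw [← E.res_app hV hVU hW]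
      rfl
    rw [e1]
    refine Series.apply_coeff_eq_zero (E.app V hVU) (fun _ h => E.leibniz V hVU _ h)
      ((Pi.evalAlgHom K (fun _ : V => K) ⟨p.1, hpV⟩).comp (bodyFun 𝕜 K n r V).val)
      (fun b => h0 (toLex (Sum.inr b)) V hVU)
      (fun k => bodyCoord he V (Set.Subset.trans hVU hU) k - algebraMap K _ (z k)) g c
      ((Series.coeff_map _ _ _).trans hf)
      (fun k => ?_) (fun k => ?_) hgood fun b hb => ?_
    · rw [map_sub, map_sub, Series.C_algebraMap, E.app_algebraMap, sub_zero]
      exact h0 (toLex (Sum.inl k)) V hVU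
    · exact (congrArg (· - z k) (hz k hpV)).trans (sub_self _)
    · refine ih V hVU _ ⟨p.1, hpV⟩ _ ?_
      have hle : Finsupp.single b 1 ≤ w := by
        rw [Finsupp.single_le_iff]
        omega
      have h3 := congrArg Finsupp.degree (tsub_add_cancel_of_le hle)
      rw [map_add, Finsupp.degree_single] at h3
      omega

end ModelDerivation

end ModelLemmas

/-! ### Ordered monomials in a `ρ`-commutative algebra -/

section OrderedPower

variable {G K : Type*} [AddCommGroup G] [Field K] {ρ : CommutationFactor G K}
variable {A : Type*} [Ring A] [Algebra K A] {𝒜 : G → Submodule K A}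
variable {κ : Type*} [Fintype κ] [LinearOrder κ]

/-- The ordered monomial `Y ^ u`. -/
def orderedPow (Y : κ → A) (u : κ →₀ ℕ) : A :=
  (((Finset.univ : Finset κ).sort (· ≤ ·)).map fun a => Y a ^ u a).prod

@[simp] lemma orderedPow_zero (Y : κ → A) : orderedPow Y 0 = 1 := by
  simp [orderedPow]

/-- Along the list, `Y b ^ v b` is moved to the left across the later powers of the first product;
each crossing gives one factor of the pair product. -/
lemma list_prod_pow_mul (h : IsRhoComm ρ 𝒜) {D : κ → G} {Y : κ → A} (hY : ∀ a, Y a ∈ 𝒜 (D a))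
    (u v : κ → ℕ) (l : List κ) :
    (l.map fun a => Y a ^ u a).prod * (l.map fun a => Y a ^ v a).prod =
      listPairProd (fun b a => ρ (D a) (D b) ^ (u a * v b)) l •
        (l.map fun a => Y a ^ (u a + v a)).prod := by
  induction l with
  | nil => simp [listPairProd]
  | cons b l ih =>
    simp only [List.map_cons, List.prod_cons, listPairProd]
    have h1 : (l.map fun a => Y a ^ u a).prod ∈ 𝒜 (l.map fun a => u a • D a).sum :=
      h.list_prod_mem l _ _ fun a => h.pow_mem (hY a) _
    have h2 : (l.map fun a => Y a ^ u a).prod * Y b ^ v b =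
        (l.map fun a => ρ (D a) (D b) ^ (u a * v b)).prod •
          (Y b ^ v b * (l.map fun a => Y a ^ u a).prod) := by
      rw [h.comm h1 (h.pow_mem (hY b) _)]
      congr 1
      clear ih h1
      induction l with
      | nil => simp [ρ.zero_left]
      | cons c l ih =>
        rw [List.map_cons, List.map_cons, List.sum_cons, List.prod_cons, ρ.add_left, ih,
          ρ.nsmul_left, ρ.nsmul_right, ← pow_mul, mul_comm (v b)]
    rw [mul_assoc, ← mul_assoc _ (Y b ^ v b), h2, smul_mul_assoc, mul_smul_comm, mul_assoc,
      ih, mul_smul_comm, mul_smul_comm, smul_smul, pow_add, mul_assoc]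

/-- The scalar is the one in the definition of the local model: monomials in arbitrary elements of
the right degrees multiply like monomials in the indeterminates. This makes substitutions
multiplicative. -/
lemma orderedPow_mul (h : IsRhoComm ρ 𝒜) {D : κ → G} {Y : κ → A} (hY : ∀ a, Y a ∈ 𝒜 (D a))
    (u v : κ →₀ ℕ) : orderedPow Y u * orderedPow Y v = tw ρ D u v • orderedPow Y (u + v) := by
  unfold orderedPow
  rw [list_prod_pow_mul h hY u v, listPairProd_sort]
  rfl

lemma orderedPow_mem (h : IsRhoComm ρ 𝒜) {D : κ → G} {Y : κ → A} (hY : ∀ a, Y a ∈ 𝒜 (D a))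
    (u : κ →₀ ℕ) : orderedPow Y u ∈ 𝒜 (wdeg D u) := by
  have h1 := h.list_prod_mem ((Finset.univ : Finset κ).sort (· ≤ ·)) _ _
    fun a => h.pow_mem (hY a) (u a)
  refine h.mem_of_eq h1 ?_
  rw [← Multiset.sum_coe, ← Multiset.map_coe, Finset.sort_eq]
  rfl

/-- An odd element satisfies `y² = -y²`, so its square vanishes in characteristic zero. -/
lemma orderedPow_of_not_isGood [CharZero K] (h : IsRhoComm ρ 𝒜) {D : κ → G} {Y : κ → A}
    (hY : ∀ a, Y a ∈ 𝒜 (D a)) {u : κ →₀ ℕ} (hu : ¬ IsGood ρ D u) : orderedPow Y u = 0 := by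
  unfold IsGood at hu
  push Not at hu
  obtain ⟨b, hb, hub⟩ := hu
  have h1 : Y b * Y b = 0 := by
    have h2 := h.comm (hY b) (hY b)
    rw [hb, neg_smul, one_smul, eq_neg_iff_add_eq_zero, ← two_smul K] at h2
    exact (smul_eq_zero.1 h2).resolve_left two_ne_zero
  refine List.prod_eq_zero (List.mem_map.2 ⟨b, (Finset.mem_sort _).2 (Finset.mem_univ _), ?_⟩)
  rw [show u b = 2 + (u b - 2) by omega, pow_add, pow_two, h1, zero_mul]

lemma orderedPow_single (Y : κ → A) (b : κ) : orderedPow Y (Finsupp.single b 1) = Y b := by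
  classical
  unfold orderedPow
  have h : ∀ l : List κ, l.Nodup → (l.map fun a => Y a ^ Finsupp.single b 1 a).prod =
      if b ∈ l then Y b else 1 := fun l => by
    induction l with
    | nil => simp
    | cons c l ih =>
      intro hl
      rw [List.nodup_cons] at hl
      rw [List.map_cons, List.prod_cons, ih hl.2]
      by_cases hcb : c = b
      · subst hcb
        simp [hl.1]
      · rw [Finsupp.single_eq_of_ne hcb, pow_zero, one_mul]
        simp [Ne.symm hcb]
  rw [h _ (Finset.sort_nodup _ _), if_pos ((Finset.mem_sort _).2 (Finset.mem_univ _))]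

end OrderedPower

/-! ### Series on the cotangent bundle -/

section Slices

variable {G K : Type*} [AddCommGroup G] [RCLike K] {ρ : CommutationFactor G K}
variable {ι : Type*} [Fintype ι] [LinearOrder ι] {d : ι → G} {n : ℕ} {i : G}

/-- The degrees `|x_a^*|`. -/
def fibDeg (d : ι → G) (n : ℕ) (i : G) (a : CoordIdx n ι) : G := -coordDeg n d a - i

/-- The exponents of the linear coordinates. -/
def fibrePart (w : CotIdx n ι →₀ ℕ) : CoordIdx n ι →₀ ℕ :=
  Finsupp.equivFunOnFinite.symm fun a => w (toLex (Sum.inr a))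

/-- The exponents with given parts. -/
def joinExp (v : ι →₀ ℕ) (u : CoordIdx n ι →₀ ℕ) : CotIdx n ι →₀ ℕ :=
  Finsupp.equivFunOnFinite.symm fun b => Sum.elim v u (ofLex b)

@[simp] lemma joinExp_inl (v : ι →₀ ℕ) (u : CoordIdx n ι →₀ ℕ) (b : ι) :
    joinExp v u (toLex (Sum.inl b)) = v b := rfl

@[simp] lemma joinExp_inr (v : ι →₀ ℕ) (u : CoordIdx n ι →₀ ℕ) (a : CoordIdx n ι) :
    joinExp v u (toLex (Sum.inr a)) = u a := rfl

@[simp] lemma basePart_joinExp (v : ι →₀ ℕ) (u : CoordIdx n ι →₀ ℕ) : basePart (joinExp v u) = v :=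
  Finsupp.ext fun _ => rfl

@[simp] lemma fibrePart_joinExp (v : ι →₀ ℕ) (u : CoordIdx n ι →₀ ℕ) : fibrePart (joinExp v u) = u :=
  Finsupp.ext fun _ => rfl

@[simp] lemma joinExp_parts (w : CotIdx n ι →₀ ℕ) : joinExp (basePart w) (fibrePart w) = w :=
  Finsupp.ext fun b => by
    obtain ⟨b | b, rfl⟩ := toLex.surjective b <;> rfl

lemma joinExp_add (v v' : ι →₀ ℕ) (u u' : CoordIdx n ι →₀ ℕ) :
    joinExp (v + v') (u + u') = joinExp v u + joinExp v' u' := Finsupp.ext fun b => by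
  obtain ⟨b | b, rfl⟩ := toLex.surjective b <;> rfl

lemma basePart_add (w w' : CotIdx n ι →₀ ℕ) : basePart (w + w') = basePart w + basePart w' :=
  Finsupp.ext fun _ => rfl

lemma fibrePart_add (w w' : CotIdx n ι →₀ ℕ) : fibrePart (w + w') = fibrePart w + fibrePart w' :=
  Finsupp.ext fun _ => rfl

lemma noFibre_joinExp (v : ι →₀ ℕ) (u : CoordIdx n ι →₀ ℕ) : NoFibre (joinExp v u) ↔ u = 0 :=
  ⟨fun h => Finsupp.ext fun a => h a, fun h a => by rw [joinExp_inr, h]; rfl⟩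

lemma isGood_joinExp (v : ι →₀ ℕ) (u : CoordIdx n ι →₀ ℕ) :
    IsGood ρ (cotDeg d n i) (joinExp v u) ↔ IsGood ρ d v ∧ IsGood ρ (fibDeg d n i) u := by
  refine ⟨fun h => ⟨fun b hb => h (toLex (Sum.inl b)) hb, fun a ha => h (toLex (Sum.inr a)) ha⟩,
    fun h b hb => ?_⟩
  obtain ⟨b | b, rfl⟩ := toLex.surjective b
  · exact h.1 b hb
  · exact h.2 b hb

lemma wdeg_joinExp (v : ι →₀ ℕ) (u : CoordIdx n ι →₀ ℕ) :
    wdeg (cotDeg d n i) (joinExp v u) = wdeg d v + wdeg (fibDeg d n i) u := by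
  unfold wdeg
  rw [← Equiv.sum_comp (toLex : ι ⊕ CoordIdx n ι ≃ CotIdx n ι), Fintype.sum_sum_type]
  rfl

/-- Since the base indeterminates precede the linear ones, sorting takes place within each group,
apart from moving `(x^*) ^ u` across `x ^ v'`. -/
lemma tw_joinExp (v v' : ι →₀ ℕ) (u u' : CoordIdx n ι →₀ ℕ) :
    tw ρ (cotDeg d n i) (joinExp v u) (joinExp v' u') =
      tw ρ d v v' * tw ρ (fibDeg d n i) u u' * ρ (wdeg (fibDeg d n i) u) (wdeg d v') := by
  have h1 : ρ (wdeg (fibDeg d n i) u) (wdeg d v') =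
      ∏ b, ∏ a, ρ (fibDeg d n i a) (d b) ^ (u a * v' b) := by
    unfold wdeg
    rw [ρ.sum_right]
    refine Finset.prod_congr rfl fun b _ => ?_
    rw [ρ.sum_left]
    exact Finset.prod_congr rfl fun a _ => by
      rw [ρ.nsmul_left, ρ.nsmul_right, ← pow_mul, mul_comm]
  rw [h1]
  unfold tw
  rw [pairProd_eq, pairProd_eq, pairProd_eq,
    ← Equiv.prod_comp (toLex : ι ⊕ CoordIdx n ι ≃ CotIdx n ι), Fintype.prod_sum_type,
    mul_right_comm, ← Finset.prod_mul_distrib]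
  congr 1
  · refine Finset.prod_congr rfl fun b _ => ?_
    rw [← Equiv.prod_comp (toLex : ι ⊕ CoordIdx n ι ≃ CotIdx n ι), Fintype.prod_sum_type]
    congr 1
    · exact Finset.prod_congr rfl fun a _ => if_congr Sum.Lex.inl_lt_inl_iff rfl rfl
  · refine Finset.prod_congr rfl fun b _ => ?_
    rw [← Equiv.prod_comp (toLex : ι ⊕ CoordIdx n ι ≃ CotIdx n ι), Fintype.prod_sum_type]
    refine (congrArg₂ _ (Finset.prod_eq_one fun a _ => if_neg Sum.Lex.not_inr_lt_inl) ?_).trans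
      (one_mul _)
    exact Finset.prod_congr rfl fun a _ => if_congr Sum.Lex.inr_lt_inr_iff rfl rfl

namespace Series

variable {R : Type*} [CommRing R] [Algebra K R]

lemma ext_slices {f g : Series ρ (cotDeg d n i) R}
    (h : ∀ u v, f.coeff (joinExp v u) = g.coeff (joinExp v u)) : f = g := ext fun w => by
  rw [← joinExp_parts w]
  exact h _ _

/-- The coefficient of `(x^*) ^ u`. -/
def slice (u : CoordIdx n ι →₀ ℕ) : Series ρ (cotDeg d n i) R →ₗ[K] Series ρ d R where
  toFun f := ⟨fun v => f.coeff (joinExp v u), fun v hv =>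
      coeff_of_not_good f fun h => hv ((isGood_joinExp v u).1 h).1, by
    classical
    obtain ⟨S, hS⟩ := f.2.2
    refine ⟨S.image fun j => j - wdeg (fibDeg d n i) u, fun v hv => Finset.mem_image.2
      ⟨_, hS _ hv, ?_⟩⟩
    rw [wdeg_joinExp, add_sub_cancel_right]⟩
  map_add' f g := rfl
  map_smul' c f := rfl

lemma coeff_slice (u : CoordIdx n ι →₀ ℕ) (f : Series ρ (cotDeg d n i) R) (v : ι →₀ ℕ) :
    (slice u f).coeff v = f.coeff (joinExp v u) := rfl

lemma ext_slice {f g : Series ρ (cotDeg d n i) R} (h : ∀ u, slice u f = slice u g) : f = g :=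
  ext_slices fun u v => congrArg (fun f => coeff f v) (h u)

lemma slice_of_not_good {u : CoordIdx n ι →₀ ℕ} (hu : ¬ IsGood ρ (fibDeg d n i) u)
    (f : Series ρ (cotDeg d n i) R) : slice u f = 0 := ext fun v =>
  coeff_of_not_good f fun h => hu ((isGood_joinExp v u).1 h).2

lemma ext_slice_good {f g : Series ρ (cotDeg d n i) R}
    (h : ∀ u, IsGood ρ (fibDeg d n i) u → slice u f = slice u g) : f = g := ext_slice fun u => by
  by_cases hu : IsGood ρ (fibDeg d n i) u
  · exact h u hu
  · rw [slice_of_not_good hu, slice_of_not_good hu]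

lemma mem_grade_iff_slice {f : Series ρ (cotDeg d n i) R} {j : G} :
    f ∈ grade j ↔ ∀ u, slice u f ∈ grade (j - wdeg (fibDeg d n i) u) := by
  refine ⟨fun h u v hv => ?_, fun h w hw => ?_⟩
  · rw [eq_sub_iff_add_eq, ← wdeg_joinExp]
    exact h _ hv
  · rw [← joinExp_parts w] at hw ⊢
    rw [wdeg_joinExp, ← eq_sub_iff_add_eq]
    exact h _ _ hw

lemma coeff_theta (q : G) (f : Series ρ d R) (w : ι →₀ ℕ) :
    (theta q f).coeff w = ρ q (wdeg d w) • f.coeff w := rfl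

/-- The series are multiplied as polynomials in the `x^*` with coefficients on the left; `theta` is
the sign of moving `(x^*) ^ p.1` past the coefficient of the second factor. -/
lemma slice_mul {u : CoordIdx n ι →₀ ℕ} (hu : IsGood ρ (fibDeg d n i) u)
    (f g : Series ρ (cotDeg d n i) R) : slice u (f * g) =
      ∑ p ∈ Finset.HasAntidiagonal.antidiagonal u, tw ρ (fibDeg d n i) p.1 p.2 •
        (slice p.1 f * theta (wdeg (fibDeg d n i) p.1) (slice p.2 g)) := by
  refine ext_good fun v hv => ?_
  rw [coeff_slice, coeff_mul _ _ ((isGood_joinExp v u).2 ⟨hv, hu⟩), coeff_sum]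
  have e : ∀ p ∈ Finset.HasAntidiagonal.antidiagonal u, (tw ρ (fibDeg d n i) p.1 p.2 •
        (slice p.1 f * theta (wdeg (fibDeg d n i) p.1) (slice p.2 g))).coeff v =
      ∑ s ∈ Finset.HasAntidiagonal.antidiagonal v, tw ρ (cotDeg d n i) (joinExp s.1 p.1)
        (joinExp s.2 p.2) • (f.coeff (joinExp s.1 p.1) * g.coeff (joinExp s.2 p.2)) := fun p _ => by
    rw [coeff_smul, coeff_mul _ _ hv, Finset.smul_sum]
    refine Finset.sum_congr rfl fun s _ => ?_
    rw [coeff_theta, coeff_slice, coeff_slice, mul_smul_comm, smul_smul, smul_smul, tw_joinExp]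
    congr 1
    ring
  rw [Finset.sum_congr rfl e, Finset.sum_sigma']
  refine Finset.sum_nbij' (fun w => ⟨(fibrePart w.1, fibrePart w.2), (basePart w.1, basePart w.2)⟩)
    (fun x => (joinExp x.2.1 x.1.1, joinExp x.2.2 x.1.2)) ?_ ?_ ?_ ?_ ?_
  · rintro ⟨w, w'⟩ hw
    simp only [Finset.mem_sigma, Finset.HasAntidiagonal.mem_antidiagonal] at hw ⊢
    rw [← fibrePart_add, ← basePart_add, hw]
    simp
  · rintro ⟨⟨a, b⟩, ⟨c, e⟩⟩ hx
    simp only [Finset.mem_sigma, Finset.HasAntidiagonal.mem_antidiagonal] at hx ⊢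
    rw [← joinExp_add, hx.1, hx.2]
  · rintro ⟨w, w'⟩ _
    simp
  · rintro ⟨⟨a, b⟩, ⟨c, e⟩⟩ _
    simp
  · rintro ⟨w, w'⟩ _
    simp

open scoped Classical in
lemma slice_incl (u : CoordIdx n ι →₀ ℕ) (f : Series ρ d R) :
    slice u (incl (n := n) i f) = if u = 0 then f else 0 := ext fun v => by
  rw [coeff_slice, coeff_incl, basePart_joinExp]
  by_cases hu : u = 0
  · rw [if_pos ((noFibre_joinExp v u).2 hu), if_pos hu]
  · rw [if_neg fun h => hu ((noFibre_joinExp v u).1 h), if_neg hu, coeff_zero]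

lemma isGood_zero' : IsGood ρ (fibDeg d n i) 0 := fun _ _ => Nat.zero_le _

lemma slice_zero_incl (f : Series ρ d R) : slice 0 (incl (n := n) i f) = f := by
  rw [slice_incl, if_pos rfl]

lemma theta_zero (f : Series ρ d R) : theta 0 f = f := ext fun w => by
  rw [coeff_theta, ρ.zero_left, one_smul]

lemma slice_incl_mul (u : CoordIdx n ι →₀ ℕ) (f : Series ρ d R) (g : Series ρ (cotDeg d n i) R) :
    slice u (incl i f * g) = f * slice u g := by
  by_cases hu : IsGood ρ (fibDeg d n i) u
  · rw [slice_mul hu, Finset.sum_eq_single (0, u)]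
    · rw [tw_zero_left, one_smul, slice_zero_incl, wdeg_zero, theta_zero]
    · rintro ⟨a, b⟩ hp hne
      have : a ≠ 0 := by
        rintro rfl
        apply hne
        rw [Finset.HasAntidiagonal.mem_antidiagonal] at hp
        simpa using hp
      rw [slice_incl, if_neg this, zero_mul, smul_zero]
    · simp
  · rw [slice_of_not_good hu, slice_of_not_good hu, mul_zero]

/-- The inclusion as a homomorphism of algebras. -/
def inclHom (n : ℕ) (i : G) : Series ρ d R →ₐ[K] Series ρ (cotDeg d n i) R :=
  AlgHom.ofLinearMap (incl i)
    (ext_slice fun u => by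
      classical
      rw [slice_incl]
      refine ext fun v => ?_
      rw [coeff_slice, coeff_one]
      by_cases hu : u = 0
      · subst hu
        rw [if_pos rfl, coeff_one]
        refine if_congr ⟨fun h => ?_, fun h => ?_⟩ rfl rfl
        · rw [h]
          exact Finsupp.ext fun b => by obtain ⟨b | b, rfl⟩ := toLex.surjective b <;> rfl
        · rw [← basePart_joinExp v (0 : CoordIdx n ι →₀ ℕ), h]
          exact Finsupp.ext fun _ => rfl
      · rw [if_neg hu, coeff_zero, if_neg fun h => hu ?_]
        rw [← fibrePart_joinExp v u, h]
        exact Finsupp.ext fun _ => rfl)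
    (fun f g => ext_slice fun u => by
      rw [slice_incl_mul, slice_incl, slice_incl]
      split_ifs
      · rfl
      · rw [mul_zero])

lemma incl_mul (f g : Series ρ d R) : incl (n := n) i (f * g) = incl i f * incl i g :=
  map_mul (inclHom n i) f g

lemma incl_one : incl (n := n) i (1 : Series ρ d R) = 1 := map_one (inclHom n i)

lemma incl_mem {f : Series ρ d R} {j : G} (hf : f ∈ grade j) : incl (n := n) i f ∈ grade j := by
  rw [mem_grade_iff_slice]
  intro u
  rw [slice_incl]
  split_ifs with h
  · rw [h, wdeg_zero, sub_zero]
    exact hf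
  · exact zero_mem _

lemma map_incl {R' : Type*} [CommRing R'] [Algebra K R'] (φ : R →ₐ[K] R') (f : Series ρ d R) :
    map φ (incl (n := n) i f) = incl i (map φ f) := ext fun w => by
  rw [coeff_map, coeff_incl, coeff_incl, coeff_map]
  split_ifs
  · rfl
  · exact map_zero φ

open scoped Classical in
lemma slice_X (u : CoordIdx n ι →₀ ℕ) (a : CoordIdx n ι) :
    slice u (X (toLex (Sum.inr a)) : Series ρ (cotDeg d n i) R) =
      if u = Finsupp.single a 1 then 1 else 0 := ext fun v => by
  rw [coeff_slice, X, coeff_monomial]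
  have h : joinExp v u = Finsupp.single (toLex (Sum.inr a)) 1 ↔ v = 0 ∧ u = Finsupp.single a 1 := by
    have e : (Finsupp.single (toLex (Sum.inr a)) 1 : CotIdx n ι →₀ ℕ) =
        joinExp 0 (Finsupp.single a 1) := Finsupp.ext fun b => by
      obtain ⟨b | b, rfl⟩ := toLex.surjective b
      · rw [joinExp_inl, Finsupp.single_eq_of_ne (by simp)]
        rfl
      · simp [Finsupp.single_apply]
    rw [e]
    refine ⟨fun h => ⟨?_, ?_⟩, fun h => by rw [h.1, h.2]⟩
    · rw [← basePart_joinExp v u, h, basePart_joinExp]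
    · rw [← fibrePart_joinExp v u, h, fibrePart_joinExp]
  by_cases hu : u = Finsupp.single a 1
  · rw [if_pos hu, coeff_one]
    exact if_congr ⟨fun h' => (h.1 h'.1).1, fun hv => ⟨h.2 ⟨hv, hu⟩, isGood_single _⟩⟩ rfl rfl
  · rw [if_neg hu, coeff_zero, if_neg fun h' => hu (h.1 h'.1).2]

end Series

end Slices

/-! ### Substitutions in the linear coordinates -/

section Substitution

variable {G K : Type*} [AddCommGroup G] [RCLike K] {ρ : CommutationFactor G K}
variable {ι : Type*} [Fintype ι] [LinearOrder ι] {d : ι → G} {n : ℕ} {i : G}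
variable {R R' : Type*} [CommRing R] [Algebra K R] [CommRing R'] [Algebra K R']

/-- The exponents of degree `m`. -/
@[irreducible] def expsOf {κ : Type*} [Fintype κ] [DecidableEq κ] (m : ℕ) : Finset (κ →₀ ℕ) :=
  Finset.finsuppAntidiag Finset.univ m

lemma mem_expsOf {κ : Type*} [Fintype κ] [DecidableEq κ] {m : ℕ} {u : κ →₀ ℕ} :
    u ∈ expsOf m ↔ u.degree = m := by
  rw [expsOf, Finset.mem_finsuppAntidiag, Finsupp.degree_eq_sum]
  simp

/-- Pairs of exponents of total degree `m` are grouped either by their sum or by their two degrees.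
-/
lemma sum_expsOf {κ B : Type*} [Fintype κ] [DecidableEq κ] [AddCommMonoid B] (m : ℕ)
    (ψ : (κ →₀ ℕ) → (κ →₀ ℕ) → B) :
    ∑ u ∈ expsOf m, ∑ p ∈ Finset.HasAntidiagonal.antidiagonal u, ψ p.1 p.2 =
      ∑ s ∈ Finset.HasAntidiagonal.antidiagonal m, ∑ u ∈ expsOf s.1, ∑ v ∈ expsOf s.2, ψ u v := by
  have e : ∀ s ∈ Finset.HasAntidiagonal.antidiagonal m, ∑ u ∈ expsOf s.1, ∑ v ∈ expsOf s.2, ψ u v =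
      ∑ p ∈ (expsOf s.1 : Finset (κ →₀ ℕ)) ×ˢ (expsOf s.2 : Finset (κ →₀ ℕ)), ψ p.1 p.2 :=
    fun s _ => (Finset.sum_product (expsOf s.1) (expsOf s.2) fun p => ψ p.1 p.2).symm
  rw [Finset.sum_congr rfl e, Finset.sum_sigma', Finset.sum_sigma']
  refine Finset.sum_nbij' (fun x => (⟨(x.2.1.degree, x.2.2.degree), x.2⟩ : Σ _ : ℕ × ℕ, (κ →₀ ℕ) × (κ →₀ ℕ)))
    (fun x => (⟨x.2.1 + x.2.2, x.2⟩ : Σ _ : κ →₀ ℕ, (κ →₀ ℕ) × (κ →₀ ℕ))) ?_ ?_ ?_ ?_ ?_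
  · rintro ⟨u, ⟨a, b⟩⟩ h
    simp only [Finset.mem_sigma, Finset.HasAntidiagonal.mem_antidiagonal, Finset.mem_product,
      mem_expsOf] at h ⊢
    obtain ⟨h1, rfl⟩ := h
    rw [map_add] at h1
    exact ⟨h1, by simp⟩
  · rintro ⟨⟨k, l⟩, ⟨a, b⟩⟩ h
    simp only [Finset.mem_sigma, Finset.HasAntidiagonal.mem_antidiagonal, Finset.mem_product,
      mem_expsOf] at h ⊢
    obtain ⟨h1, rfl, rfl⟩ := h
    exact ⟨by rw [map_add, h1], trivial⟩
  · rintro ⟨u, ⟨a, b⟩⟩ h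
    simp only [Finset.mem_sigma, Finset.HasAntidiagonal.mem_antidiagonal] at h ⊢
    obtain ⟨h1, rfl⟩ := h
    rfl
  · rintro ⟨⟨k, l⟩, ⟨a, b⟩⟩ h
    simp only [Finset.mem_sigma, Finset.HasAntidiagonal.mem_antidiagonal, Finset.mem_product,
      mem_expsOf] at h ⊢
    obtain ⟨h1, rfl, rfl⟩ := h
    rfl
  · rintro ⟨u, ⟨a, b⟩⟩ _
    rfl

namespace Series

/-- `f` is homogeneous of degree `m` in the linear coordinates. -/
def FibreHomogeneous (m : ℕ) (f : Series ρ (cotDeg d n i) R) : Prop :=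
  ∀ u, u.degree ≠ m → slice u f = 0

namespace FibreHomogeneous

lemma mul {a b : ℕ} {f g : Series ρ (cotDeg d n i) R} (hf : FibreHomogeneous a f)
    (hg : FibreHomogeneous b g) : FibreHomogeneous (a + b) (f * g) := fun u hu => by
  by_cases hgood : IsGood ρ (fibDeg d n i) u
  · rw [slice_mul hgood]
    refine Finset.sum_eq_zero fun p hp => ?_
    rw [← Finset.HasAntidiagonal.mem_antidiagonal.1 hp, map_add] at hu
    by_cases h1 : p.1.degree = a
    · rw [hg p.2 (fun h2 => hu (by rw [h1, h2])), map_zero, mul_zero, smul_zero]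
    · rw [hf p.1 h1, zero_mul, smul_zero]
  · exact slice_of_not_good hgood _

lemma incl (f : Series ρ d R) : FibreHomogeneous 0 (Series.incl (n := n) i f) := fun u hu => by
  classical
  rw [slice_incl, if_neg]
  rintro rfl
  exact hu (map_zero _)

lemma one : FibreHomogeneous 0 (1 : Series ρ (cotDeg d n i) R) := by
  rw [← incl_one]
  exact incl 1

lemma sum {J : Type*} (s : Finset J) {m : ℕ} {f : J → Series ρ (cotDeg d n i) R}
    (h : ∀ k ∈ s, FibreHomogeneous m (f k)) : FibreHomogeneous m (∑ k ∈ s, f k) := fun u hu => by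
  rw [map_sum]
  exact Finset.sum_eq_zero fun k hk => h k hk u hu

lemma X (a : CoordIdx n ι) :
    FibreHomogeneous 1 (Series.X (toLex (Sum.inr a)) : Series ρ (cotDeg d n i) R) := fun u hu => by
  classical
  rw [slice_X, if_neg]
  rintro rfl
  exact hu (by simp)

lemma pow {m : ℕ} {f : Series ρ (cotDeg d n i) R} (hf : FibreHomogeneous m f) (k : ℕ) :
    FibreHomogeneous (k * m) (f ^ k) := by
  induction k with
  | zero =>
    rw [zero_mul, pow_zero]
    exact one
  | succ k ih =>
    rw [pow_succ, add_mul, one_mul]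
    exact ih.mul hf

lemma orderedPow {Y : CoordIdx n ι → Series ρ (cotDeg d n i) R} (hY : ∀ a, FibreHomogeneous 1 (Y a))
    (u : CoordIdx n ι →₀ ℕ) : FibreHomogeneous u.degree (RhoGeometry.orderedPow Y u) := by
  have h : ∀ l : List (CoordIdx n ι),
      FibreHomogeneous (l.map u).sum (l.map fun a => Y a ^ u a).prod := fun l => by
    induction l with
    | nil => exact one
    | cons a l ih =>
      rw [List.map_cons, List.map_cons, List.sum_cons, List.prod_cons]
      refine mul ?_ ih
      have := (hY a).pow (u a)
      rwa [mul_one] at this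
  have h1 := h ((Finset.univ : Finset (CoordIdx n ι)).sort (· ≤ ·))
  have e : (((Finset.univ : Finset (CoordIdx n ι)).sort (· ≤ ·)).map u).sum = u.degree := by
    rw [← Multiset.sum_coe, ← Multiset.map_coe, Finset.sort_eq, Finsupp.degree_eq_sum]
    rfl
  rwa [e] at h1

end FibreHomogeneous

/-- Preservation of the degrees. -/
def GradePreserving (φ : Series ρ d R →ₐ[K] Series ρ d R') : Prop :=
  ∀ j, ∀ f ∈ grade j, φ f ∈ grade j

lemma map_theta {φ : Series ρ d R →ₐ[K] Series ρ d R'} (hφ : GradePreserving φ)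
    (q : G) (f : Series ρ d R) : φ (theta q f) = theta q (φ f) :=
  linearMap_ext (φ := φ.toLinearMap ∘ₗ (theta q).toLinearMap)
    (ψ := (theta q).toLinearMap ∘ₗ φ.toLinearMap) (fun j f hf => by
      change φ (theta q f) = theta q (φ f)
      rw [theta_apply q hf, theta_apply q (hφ _ _ hf), map_smul]) f

/-- The sign of the commutation depends on the degree of `f`; for inhomogeneous `f` it is expressed
by `theta`. -/
lemma mul_incl {D : G} {g : Series ρ (cotDeg d n i) R} (hg : g ∈ grade D) (f : Series ρ d R) :
    g * incl i f = incl i (theta D f) * g :=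
  linearMap_ext (φ := LinearMap.mulLeft K g ∘ₗ incl i)
    (ψ := LinearMap.mulRight K g ∘ₗ incl i ∘ₗ (theta D).toLinearMap) (fun j f hf => by
      change g * incl i f = incl i (theta D f) * g
      rw [theta_apply D hf, map_smul, smul_mul_assoc, isRhoComm.comm hg (incl_mem hf)]) f

section Existence

variable (φ : Series ρ d R →ₐ[K] Series ρ d R') (Y : CoordIdx n ι → Series ρ (cotDeg d n i) R')

/-- The part of degree `m` of the result of a substitution. -/
def substPart (m : ℕ) : Series ρ (cotDeg d n i) R →ₗ[K] Series ρ (cotDeg d n i) R' :=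
  ∑ u ∈ expsOf m, LinearMap.mulRight K (orderedPow Y u) ∘ₗ incl i ∘ₗ φ.toLinearMap ∘ₗ slice u

lemma substPart_apply (m : ℕ) (f : Series ρ (cotDeg d n i) R) :
    substPart φ Y m f = ∑ u ∈ expsOf m, incl i (φ (slice u f)) * orderedPow Y u := by
  rw [substPart, LinearMap.sum_apply]
  rfl

attribute [irreducible] substPart

variable {φ Y}

lemma substPart_fibreHomogeneous (hY1 : ∀ a, FibreHomogeneous 1 (Y a)) (m : ℕ)
    (f : Series ρ (cotDeg d n i) R) : FibreHomogeneous m (substPart φ Y m f) := by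
  rw [substPart_apply]
  refine FibreHomogeneous.sum _ fun u hu => ?_
  have := (FibreHomogeneous.incl (n := n) (i := i) (φ (slice u f))).mul
    (FibreHomogeneous.orderedPow hY1 u)
  rwa [zero_add, mem_expsOf.1 hu] at this

variable (hφ : GradePreserving φ) (hY : ∀ a, Y a ∈ grade (fibDeg d n i a))

lemma substPart_mem (hφ : GradePreserving φ)
    (hY : ∀ a, Y a ∈ grade (fibDeg d n i a)) (m : ℕ) {j : G} {f : Series ρ (cotDeg d n i) R}
    (hf : f ∈ grade j) : substPart φ Y m f ∈ grade j := by
  rw [substPart_apply]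
  refine Submodule.sum_mem _ fun u _ => ?_
  have := mul_mem_grade (incl_mem (n := n) (i := i) (hφ _ _ (mem_grade_iff_slice.1 hf u)))
    (orderedPow_mem isRhoComm hY u)
  rwa [sub_add_cancel] at this

/-- The monomials in `Y` obey the product rule of the indeterminates, and `φ` commutes with `theta`.
Inadmissible exponents contribute nothing on either side, because the corresponding monomials in `Y`
vanish. -/
lemma sum_substPart_mul (hφ : GradePreserving φ)
    (hY : ∀ a, Y a ∈ grade (fibDeg d n i a)) (m : ℕ) (f g : Series ρ (cotDeg d n i) R) :
    substPart φ Y m (f * g) = ∑ s ∈ Finset.HasAntidiagonal.antidiagonal m,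
      substPart φ Y s.1 f * substPart φ Y s.2 g := by
  have e1 : ∀ u v, incl i (φ (slice u f)) * orderedPow Y u * (incl i (φ (slice v g)) * orderedPow Y v) =
      tw ρ (fibDeg d n i) u v • (incl i (φ (slice u f * theta (wdeg (fibDeg d n i) u) (slice v g))) *
        orderedPow Y (u + v)) := fun u v => by
    rw [mul_assoc, ← mul_assoc (orderedPow Y u), mul_incl (orderedPow_mem isRhoComm hY u), mul_assoc,
      orderedPow_mul isRhoComm hY, mul_smul_comm, mul_smul_comm, map_mul, incl_mul, map_theta hφ,
      mul_assoc]
  simp only [substPart_apply, Finset.sum_mul_sum, e1]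
  rw [← sum_expsOf m fun u v => tw ρ (fibDeg d n i) u v • (incl i (φ (slice u f *
    theta (wdeg (fibDeg d n i) u) (slice v g))) * orderedPow Y (u + v))]
  refine Finset.sum_congr rfl fun u _ => ?_
  by_cases hu : IsGood ρ (fibDeg d n i) u
  · rw [slice_mul hu, map_sum, map_sum, Finset.sum_mul]
    refine Finset.sum_congr rfl fun p hp => ?_
    rw [map_smul, map_smul, smul_mul_assoc, Finset.HasAntidiagonal.mem_antidiagonal.1 hp]
  · rw [orderedPow_of_not_isGood isRhoComm hY hu, mul_zero]
    refine (Finset.sum_eq_zero fun p hp => ?_).symm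
    rw [Finset.HasAntidiagonal.mem_antidiagonal.1 hp, orderedPow_of_not_isGood isRhoComm hY hu,
      mul_zero, smul_zero]

/-- The result of the substitution. -/
def substFun (hφ : GradePreserving φ)
    (hY : ∀ a, Y a ∈ grade (fibDeg d n i a)) (f : Series ρ (cotDeg d n i) R) :
    Series ρ (cotDeg d n i) R' :=
  -- For linear `Y` the part of degree `m` only has monomials of degree `m` in the `x^*`, so this
  -- coefficient is that of the sum of all parts. Taking it from a single part avoids an infinite
  -- sum.
  ⟨fun w => (substPart φ Y (fibrePart w).degree f).coeff w, fun w hw => coeff_of_not_good _ hw, by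
    obtain ⟨S, hS⟩ := f.2.2
    refine ⟨S, fun w hw => ?_⟩
    have e := sum_proj hS
    change (substPart φ Y (fibrePart w).degree f).coeff w ≠ 0 at hw
    rw [← e, map_sum, coeff_sum] at hw
    obtain ⟨j, hj, hne⟩ := Finset.exists_ne_zero_of_sum_ne_zero hw
    rw [substPart_mem hφ hY _ (proj_mem j f) w hne]
    exact hj⟩

lemma slice_substFun (u : CoordIdx n ι →₀ ℕ) (f : Series ρ (cotDeg d n i) R) :
    slice u (substFun hφ hY f) = slice u (substPart φ Y u.degree f) := ext fun v => by
  change (substPart φ Y (fibrePart (joinExp v u)).degree f).coeff (joinExp v u) = _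
  rw [fibrePart_joinExp]
  rfl

lemma substFun_mem {j : G} {f : Series ρ (cotDeg d n i) R} (hf : f ∈ grade j) :
    substFun hφ hY f ∈ grade j := fun w hw => substPart_mem hφ hY _ hf w hw

lemma substFun_incl (f : Series ρ d R) : substFun hφ hY (incl i f) = incl i (φ f) :=
  ext_slice fun u => by
    rw [slice_substFun, substPart_apply, map_sum]
    simp only [slice_incl_mul, slice_incl]
    rw [Finset.sum_eq_single 0]
    · rw [if_pos rfl, orderedPow_zero, ← incl_one, slice_incl]
      split_ifs
      · rw [mul_one]
      · rw [mul_zero]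
    · intro v _ hv
      rw [if_neg hv, map_zero, zero_mul]
    · intro hu
      rw [if_pos rfl, orderedPow_zero, ← incl_one, slice_incl, if_neg, mul_zero]
      rintro rfl
      exact hu (mem_expsOf.2 (by simp))

lemma substFun_X (hY1 : ∀ a, FibreHomogeneous 1 (Y a)) (a : CoordIdx n ι) :
    substFun hφ hY (X (toLex (Sum.inr a))) = Y a := ext_slice fun u => by
  rw [slice_substFun, substPart_apply, map_sum]
  simp only [slice_incl_mul, slice_X]
  rw [Finset.sum_eq_single (Finsupp.single a 1)]
  · rw [if_pos rfl, map_one, one_mul, orderedPow_single]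
  · intro v _ hv
    rw [if_neg hv, map_zero, zero_mul]
  · intro hu
    rw [orderedPow_single, hY1 a u, mul_zero]
    intro h
    exact hu (mem_expsOf.2 (by simp [h]))

/-- Of all splittings of the degree in the `x^*`, only the one given by the degrees of the two
exponents survives, by homogeneity of the parts. -/
lemma substFun_mul (hY1 : ∀ a, FibreHomogeneous 1 (Y a)) (f g : Series ρ (cotDeg d n i) R) :
    substFun hφ hY (f * g) = substFun hφ hY f * substFun hφ hY g := ext_slice_good fun u hu => by
  rw [slice_substFun, sum_substPart_mul hφ hY, map_sum, slice_mul hu]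
  simp only [slice_mul hu, slice_substFun]
  rw [Finset.sum_comm]
  refine Finset.sum_congr rfl fun p hp => ?_
  rw [Finset.sum_eq_single (p.1.degree, p.2.degree)]
  · rintro ⟨a, b⟩ _ hne
    by_cases h1 : p.1.degree = a
    · rw [substPart_fibreHomogeneous hY1 b g p.2 fun h2 => hne (by rw [h1, h2]), map_zero, mul_zero,
        smul_zero]
    · rw [substPart_fibreHomogeneous hY1 a f p.1 h1, zero_mul, smul_zero]
  · intro h
    refine absurd (Finset.HasAntidiagonal.mem_antidiagonal.2 ?_) h
    rw [← Finset.HasAntidiagonal.mem_antidiagonal.1 hp, map_add]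

/-- The homomorphism of algebras `f(x, x^*) ↦ (φ f)(x, Y)`. -/
def subst (hY1 : ∀ a, FibreHomogeneous 1 (Y a)) :
    Series ρ (cotDeg d n i) R →ₐ[K] Series ρ (cotDeg d n i) R' :=
  AlgHom.ofLinearMap
    { toFun := substFun hφ hY
      map_add' := fun f g => ext fun w => by
        change (substPart φ Y _ (f + g)).coeff w = _
        rw [map_add]
        rfl
      map_smul' := fun c f => ext fun w => by
        change (substPart φ Y _ (c • f)).coeff w = _
        rw [map_smul]
        rfl }
    (by
      change substFun hφ hY 1 = 1
      rw [← incl_one, substFun_incl, map_one, incl_one])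
    (substFun_mul hφ hY hY1)

end Existence

/-! #### Uniqueness -/

open scoped Classical in
/-- The quotient by `x_a^*` of the part of a series consisting of the multiples of `x_a^*` which do
not involve the `x_c^*` with `c > a`. -/
def fibreDiv (a : CoordIdx n ι) (f : Series ρ (cotDeg d n i) R) : Series ρ (cotDeg d n i) R :=
  ⟨fun w => if ∀ c > a, fibrePart w c = 0 then f.coeff (w + Finsupp.single (toLex (Sum.inr a)) 1) else 0,
    fun w hw => by
    have h0 : f.coeff (w + Finsupp.single (toLex (Sum.inr a)) 1) = 0 :=
      coeff_of_not_good f fun h => hw (h.mono le_self_add)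
    simp [h0], by
    obtain ⟨S, hS⟩ := f.2.2
    refine ⟨S.image fun j => j - cotDeg d n i (toLex (Sum.inr a)), fun w hw => ?_⟩
    have h1 := hS (w + Finsupp.single (toLex (Sum.inr a)) 1) fun h => hw (by simp [coeff, h])
    refine Finset.mem_image.2 ⟨_, h1, ?_⟩
    rw [wdeg_add, wdeg_single, one_smul, add_sub_cancel_right]⟩

lemma joinExp_add_single (v : ι →₀ ℕ) (u : CoordIdx n ι →₀ ℕ) (a : CoordIdx n ι) :
    joinExp v u + Finsupp.single (toLex (Sum.inr a)) 1 = joinExp v (u + Finsupp.single a 1) :=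
  Finsupp.ext fun b => by
    classical
    obtain ⟨b | b, rfl⟩ := toLex.surjective b
    · rw [Finsupp.add_apply, Finsupp.single_eq_of_ne (by simp), joinExp_inl, joinExp_inl, add_zero]
    · simp [Finsupp.single_apply]

open scoped Classical in
lemma slice_fibreDiv (a : CoordIdx n ι) (f : Series ρ (cotDeg d n i) R) (u : CoordIdx n ι →₀ ℕ) :
    slice u (fibreDiv a f) = if ∀ c > a, u c = 0 then slice (u + Finsupp.single a 1) f else 0 :=
  ext fun v => by
    change (if ∀ c > a, fibrePart (joinExp v u) c = 0 then
      f.coeff (joinExp v u + Finsupp.single (toLex (Sum.inr a)) 1) else 0) = _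
    rw [fibrePart_joinExp, joinExp_add_single]
    split_ifs <;> rfl

open scoped Classical in
lemma slice_mul_X (a : CoordIdx n ι) (f : Series ρ (cotDeg d n i) R) {u : CoordIdx n ι →₀ ℕ}
    (hu : IsGood ρ (fibDeg d n i) u) : slice u (f * X (toLex (Sum.inr a))) = if u a = 0 then 0 else
      tw ρ (fibDeg d n i) (u - Finsupp.single a 1) (Finsupp.single a 1) •
        slice (u - Finsupp.single a 1) f := by
  rw [slice_mul hu]
  have h0 : ∀ p ∈ Finset.HasAntidiagonal.antidiagonal u, p.2 ≠ Finsupp.single a 1 →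
      tw ρ (fibDeg d n i) p.1 p.2 • (slice p.1 f * theta (wdeg (fibDeg d n i) p.1)
        (slice p.2 (X (toLex (Sum.inr a)) : Series ρ (cotDeg d n i) R))) = 0 := by
    intro p _ hp
    rw [slice_X, if_neg hp, map_zero, mul_zero, smul_zero]
  split_ifs with hb
  · refine Finset.sum_eq_zero fun p hp => h0 p hp fun h => ?_
    rw [Finset.HasAntidiagonal.mem_antidiagonal] at hp
    have := DFunLike.congr_fun hp a
    rw [h, Finsupp.add_apply, Finsupp.single_eq_same] at this
    omega
  · have hle : Finsupp.single a 1 ≤ u := by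
      rw [Finsupp.single_le_iff]
      omega
    rw [Finset.sum_eq_single (u - Finsupp.single a 1, Finsupp.single a 1)]
    · rw [slice_X, if_pos rfl, map_one, mul_one]
    · rintro ⟨u', v⟩ hp hne
      refine h0 _ hp fun h => hne ?_
      rw [Finset.HasAntidiagonal.mem_antidiagonal] at hp
      dsimp only at h hp
      subst h
      rw [← hp, add_tsub_cancel_right]
    · intro h
      exact absurd (Finset.HasAntidiagonal.mem_antidiagonal.2 (tsub_add_cancel_of_le hle)) h

lemma tw_single_right_of_forall {κ : Type*} [Fintype κ] [LinearOrder κ] (D : κ → G) {a : κ}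
    {u : κ →₀ ℕ} (h : ∀ c > a, u c = 0) : tw ρ D u (Finsupp.single a 1) = 1 := by
  unfold tw
  rw [pairProd_eq]
  refine Finset.prod_eq_one fun b _ => Finset.prod_eq_one fun c _ => ?_
  split_ifs with hbc
  · by_cases hb : b = a
    · subst hb
      rw [h c hbc, zero_mul, pow_zero]
    · rw [Finsupp.single_eq_of_ne hb, mul_zero, pow_zero]
  · rfl

/-- Each monomial containing linear coordinates is divided on the right by the one of largest index,
so that it is counted once and without a sign. -/
lemma eq_incl_add_sum (f : Series ρ (cotDeg d n i) R) :
    f = incl i (slice 0 f) + ∑ a, fibreDiv a f * X (toLex (Sum.inr a)) := by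
  classical
  refine ext_slice_good fun u hu => ?_
  rw [map_add, map_sum, slice_incl]
  have key : ∀ a, slice u (fibreDiv a f * X (toLex (Sum.inr a))) =
      if u a ≠ 0 ∧ ∀ c > a, u c = 0 then slice u f else 0 := fun a => by
    rw [slice_mul_X a _ hu]
    by_cases hb : u a = 0
    · rw [if_pos hb, if_neg fun h => h.1 hb]
    · have hle : Finsupp.single a 1 ≤ u := by
        rw [Finsupp.single_le_iff]
        omega
      have hc : (∀ c > a, (u - Finsupp.single a 1 : CoordIdx n ι →₀ ℕ) c = 0) ↔ ∀ c > a, u c = 0 :=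
        forall₂_congr fun c hc => by
          rw [Finsupp.tsub_apply, Finsupp.single_eq_of_ne (ne_of_gt hc), tsub_zero]
      rw [if_neg hb, slice_fibreDiv, tsub_add_cancel_of_le hle]
      by_cases h : ∀ c > a, u c = 0
      · rw [if_pos (hc.2 h), if_pos ⟨hb, h⟩, tw_single_right_of_forall _ (hc.2 h), one_smul]
      · rw [if_neg fun h' => h (hc.1 h'), if_neg fun h' => h h'.2, smul_zero]
  rw [Finset.sum_congr rfl fun a _ => key a]
  by_cases h0 : u = 0
  · subst h0
    simp
  · rw [if_neg h0, zero_add]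
    have hne : (Finset.univ.filter fun b => u b ≠ 0).Nonempty := by
      by_contra h
      rw [Finset.not_nonempty_iff_eq_empty, Finset.filter_eq_empty_iff] at h
      exact h0 (Finsupp.ext fun b => by simpa using h (Finset.mem_univ b))
    set m := (Finset.univ.filter fun b => u b ≠ 0).max' hne
    have hm : u m ≠ 0 := (Finset.mem_filter.1 (Finset.max'_mem _ hne)).2
    have hlt : ∀ c > m, u c = 0 := fun c hc => by
      by_contra h
      exact (Finset.le_max' _ c (Finset.mem_filter.2 ⟨Finset.mem_univ _, h⟩)).not_gt hc
    rw [Finset.sum_eq_single m, if_pos ⟨hm, hlt⟩]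
    · intro b _ hb
      rw [if_neg]
      rintro ⟨h1, h2⟩
      rcases lt_or_gt_of_ne hb with h | h
      · exact hm (h2 m h)
      · exact h1 (hlt b h)
    · simp

/-- Two homomorphisms which agree on the functions on the base and on the linear coordinates, and
which map the linear coordinates to linear functions, are equal. -/
theorem algHom_ext_cot {τ τ' : Series ρ (cotDeg d n i) R →ₐ[K] Series ρ (cotDeg d n i) R'}
    (h0 : ∀ f, τ (incl i f) = τ' (incl i f))
    (h1 : ∀ a, τ (X (toLex (Sum.inr a))) = τ' (X (toLex (Sum.inr a))))
    (hY1 : ∀ a, FibreHomogeneous 1 (τ (X (toLex (Sum.inr a))))) : τ = τ' := by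
  -- Induction on the degree in the `x^*`. Dividing by the linear coordinates expresses `τ f - τ' f`
  -- by such differences times linear functions, which lowers the degree of the slice.
  suffices key : ∀ (N : ℕ) f u, u.degree < N → slice u (τ f - τ' f) = 0 from
    AlgHom.ext fun f => sub_eq_zero.1 (ext_slice fun u => by
      rw [key _ f u (Nat.lt_succ_self _), map_zero])
  intro N
  induction N with
  | zero => exact fun _ _ h => absurd h (Nat.not_lt_zero _)
  | succ N ih =>
    intro f u hu
    by_cases hgood : IsGood ρ (fibDeg d n i) u
    · have e : τ f - τ' f = ∑ a, (τ (fibreDiv a f) - τ' (fibreDiv a f)) *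
          τ (X (toLex (Sum.inr a))) := by
        conv_lhs => rw [eq_incl_add_sum f]
        rw [map_add, map_add, h0, add_sub_add_left_eq_sub, map_sum, map_sum,
          ← Finset.sum_sub_distrib]
        refine Finset.sum_congr rfl fun a _ => ?_
        rw [map_mul, map_mul, ← h1, sub_mul]
      rw [e, map_sum]
      refine Finset.sum_eq_zero fun a _ => ?_
      rw [slice_mul hgood]
      refine Finset.sum_eq_zero fun p hp => ?_
      have hp' := congrArg Finsupp.degree (Finset.HasAntidiagonal.mem_antidiagonal.1 hp)
      rw [map_add] at hp'
      by_cases h2 : p.2.degree = 1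
      · rw [ih _ p.1 (by omega), zero_mul, smul_zero]
      · rw [hY1 a p.2 h2, map_zero, mul_zero, smul_zero]
    · exact slice_of_not_good hgood _

end Series

end Substitution

/-! ### Shortcut instances -/

namespace SectionInstances

universe u v w

variable {G K : Type*} [AddCommGroup G] [RCLike K]
variable {𝕜 : Type*} [RCLike 𝕜] [NormedAlgebra 𝕜 K] {n : ℕ} {r : Regularity}
variable {X : Type u} [TopologicalSpace X] [ChartedSpace (EuclideanSpace 𝕜 (Fin n)) X]
variable {ρ : CommutationFactor G K}
variable {ι : Type*} [Fintype ι] [LinearOrder ι] {d : ι → G}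
variable {ι' : Type*} [Fintype ι'] [LinearOrder ι'] {d' : ι' → G} {M : RhoSpace.{u, v, w} 𝕜 n r X ρ d}
variable {V W : Opens X}

scoped instance instAlgebraModel : Algebra K (Model 𝕜 n r ρ d V) := inferInstance

scoped instance instCoeFunModel : CoeFun (Model 𝕜 n r ρ d V →ₐ[K] Model 𝕜 n r ρ d' W)
    (fun _ => Model 𝕜 n r ρ d V → Model 𝕜 n r ρ d' W) := ⟨fun f => DFunLike.coe f⟩

scoped instance instAlgebraSec : Algebra K (M.sec V) := M.algebra V

scoped instance instCoeFunSec : CoeFun (M.sec V →ₐ[K] M.sec W) (fun _ => M.sec V → M.sec W) :=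
  ⟨fun f => DFunLike.coe f⟩

scoped instance instCoeFunExpr : CoeFun (M.sec V →ₐ[K] Model 𝕜 n r ρ d W)
    (fun _ => M.sec V → Model 𝕜 n r ρ d W) := ⟨fun f => DFunLike.coe f⟩

end SectionInstances

open scoped SectionInstances

/-! ### Sections of a `ρ`-manifold -/

lemma exists_homogeneous_sum {G K A : Type*} [DecidableEq G] [Field K] [AddCommGroup A]
    [Module K A] {𝒜 : G → Submodule K A} (h : DirectSum.IsInternal 𝒜) (f : A) :
    ∃ (S : Finset G) (c : G → A), (∀ j, c j ∈ 𝒜 j) ∧ ∑ j ∈ S, c j = f := by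
  obtain ⟨x, rfl⟩ := h.2 f
  classical
  refine ⟨x.support, fun j => x j, fun j => (x j).2, ?_⟩
  conv_rhs => rw [← DirectSum.sum_support_of x, map_sum]
  exact Finset.sum_congr rfl fun j _ => (DirectSum.coeAddMonoidHom_of _ _ _).symm

namespace RhoSpace

universe u v w

variable {G K : Type*} [AddCommGroup G] [RCLike K]
variable {𝕜 : Type*} [RCLike 𝕜] [NormedAlgebra 𝕜 K] {n : ℕ} {r : Regularity}
variable {X : Type u} [TopologicalSpace X] [ChartedSpace (EuclideanSpace 𝕜 (Fin n)) X]
variable {ρ : CommutationFactor G K}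
variable {ι : Type*} [Fintype ι] [LinearOrder ι] {d : ι → G}
variable {M : RhoSpace.{u, v, w} 𝕜 n r X ρ d}

section Basic

/-- The sections over the open subsets of `U_α` are the elements of the local model. -/
def exprEquiv (hM : M.IsRhoManifold) (α : M.Idx) {V : Opens X} (hV : V ≤ M.dom α) : M.sec V ≃ₐ[K] Model 𝕜 n r ρ d V :=
  AlgEquiv.ofBijective (M.expr α V hV) (hM.bijective α V hV)

lemma expr_exprEquiv_symm (hM : M.IsRhoManifold) (α : M.Idx) {V : Opens X} (hV : V ≤ M.dom α) (f : Model 𝕜 n r ρ d V) :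
    M.expr α V hV ((exprEquiv hM α hV).symm f) = f := (exprEquiv hM α hV).apply_symm_apply f

lemma IsRhoManifold.linearMap_ext (hM : M.IsRhoManifold) {V : Opens X} {B : Type*} [AddCommGroup B] [Module K B]
    {φ ψ : M.sec V →ₗ[K] B} (h : ∀ j, ∀ f ∈ M.grade V j, φ f = ψ f) (f : M.sec V) : φ f = ψ f := by
  classical
  obtain ⟨S, c, hc, rfl⟩ := exists_homogeneous_sum (hM.isInternal V) f
  rw [map_sum, map_sum]
  exact Finset.sum_congr rfl fun j _ => h j _ (hc j)

/-- The uniqueness part of the gluing axiom, comparing `f` with zero on a cover indexed by the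
points of `V`. -/
lemma IsRhoManifold.eq_zero_of_res_grade (hM : M.IsRhoManifold) {V : Opens X} {j : G}
    {f : M.sec V} (hf : f ∈ M.grade V j)
    (h : ∀ p ∈ V, ∃ (W : Opens X) (hW : W ≤ V), p ∈ W ∧ M.res hW f = 0) : f = 0 := by
  choose! W hW hpW hfW using h
  let U : V → Opens X := fun p => W p.1
  have hU : ⨆ p, U p = V := le_antisymm (iSup_le fun p => hW _ p.2) fun p hp =>
    Opens.mem_iSup.2 ⟨⟨p, hp⟩, hpW _ hp⟩
  obtain ⟨g, -, hg⟩ := hM.glue j U (fun _ => 0) (fun _ => zero_mem _)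
    (fun s t => by rw [map_zero, map_zero])
  have h1 : M.res hU.le f = 0 := by
    rw [hg _ ⟨M.res_mem _ hf, fun p => ?_⟩, hg 0 ⟨zero_mem _, fun p => map_zero _⟩]
    rw [M.res_res]
    exact hfW _ p.2
  rw [← M.res_self le_rfl f, ← M.res_res hU.le hU.ge, h1, map_zero]

/-- The gluing axiom concerns homogeneous sections only. But if a finite sum of homogeneous sections
vanishes locally, so does each summand, by independence of the components over the smaller open set.
-/
lemma IsRhoManifold.eq_zero_of_res (hM : M.IsRhoManifold) {V : Opens X} {f : M.sec V}
    (h : ∀ p ∈ V, ∃ (W : Opens X) (hW : W ≤ V), p ∈ W ∧ M.res hW f = 0) : f = 0 := by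
  classical
  obtain ⟨S, c, hc, rfl⟩ := exists_homogeneous_sum (hM.isInternal V) f
  refine Finset.sum_eq_zero fun j hj => hM.eq_zero_of_res_grade (hc j) fun p hp => ?_
  obtain ⟨W, hW, hpW, h⟩ := h p hp
  exact ⟨W, hW, hpW, (iSupIndep_iff_finsetSum_eq_zero_imp_eq_zero _).1
    (hM.isInternal W).submodule_iSupIndep S (fun j => M.res hW (c j))
    (fun j _ => M.res_mem _ (hc j)) (by rw [← map_sum]; exact h) j hj⟩

/-- Two sections agree if they agree over the coordinate neighbourhoods. -/
lemma IsRhoManifold.ext_of_res (hM : M.IsRhoManifold) {V : Opens X} {f g : M.sec V}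
    (h : ∀ α, M.res (inf_le_left : V ⊓ M.dom α ≤ V) f = M.res inf_le_left g) : f = g :=
  sub_eq_zero.1 (hM.eq_zero_of_res fun p hp => by
    obtain ⟨α, hα⟩ := hM.cover p
    exact ⟨V ⊓ M.dom α, inf_le_left, ⟨hp, hα⟩, by rw [map_sub, h, sub_self]⟩)

lemma IsRhoManifold.ext_top (hM : M.IsRhoManifold) {f g : M.sec ⊤}
    (h : ∀ α, M.res (le_top : M.dom α ≤ ⊤) f = M.res le_top g) : f = g :=
  hM.ext_of_res fun α => by
    rw [← M.res_res le_top inf_le_right f, ← M.res_res le_top inf_le_right g, h]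

lemma IsRhoManifold.exists_glue (hM : M.IsRhoManifold) {j : G} (f : ∀ α, M.sec (M.dom α))
    (hf : ∀ α, f α ∈ M.grade _ j) (h : ∀ α β, M.res (inf_le_left : M.dom α ⊓ M.dom β ≤ M.dom α)
      (f α) = M.res inf_le_right (f β)) :
    ∃ g ∈ M.grade ⊤ j, ∀ α, M.res (le_top : M.dom α ≤ ⊤) g = f α := by
  -- The gluing axiom allows index sets in the universe of `X` only, and the atlas may live in
  -- another one; hence one chart is chosen for each point.
  choose α hα using hM.cover
  have hU : ⨆ p, M.dom (α p) = ⊤ := le_antisymm le_top fun p _ => Opens.mem_iSup.2 ⟨p, hα p⟩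
  obtain ⟨g, ⟨hg, hg'⟩, -⟩ := hM.glue j (fun p => M.dom (α p)) (fun p => f (α p))
    (fun _ => hf _) (fun s t => h _ _)
  refine ⟨M.res hU.ge g, M.res_mem _ hg, fun β => ?_⟩
  refine sub_eq_zero.1 (hM.eq_zero_of_res_grade (sub_mem (M.res_mem _ (M.res_mem _ hg)) (hf β))
    fun p hp => ⟨M.dom β ⊓ M.dom (α p), inf_le_left, ⟨hp, hα p⟩, ?_⟩)
  rw [map_sub, sub_eq_zero, h β (α p), ← hg' p, M.res_res, M.res_res, M.res_res]

lemma IsRhoManifold.isRhoComm_of_le (hM : M.IsRhoManifold) (α : M.Idx) {V : Opens X}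
    (hV : V ≤ M.dom α) : IsRhoComm ρ (M.grade V) where
  one_mem := M.one_mem V
  mul_mem := M.mul_mem
  comm {i j f g} hf hg := (hM.bijective α V hV).1 (by
    rw [map_smul, map_mul, map_mul]
    exact Series.isRhoComm.comm ((hM.expr_mem_iff α V hV i f).2 hf)
      ((hM.expr_mem_iff α V hV j g).2 hg))

lemma IsRhoManifold.isRhoComm (hM : M.IsRhoManifold) (V : Opens X) : IsRhoComm ρ (M.grade V) where
  one_mem := M.one_mem V
  mul_mem := M.mul_mem
  comm {i j f g} hf hg := hM.ext_of_res fun α => by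
    rw [map_smul, map_mul, map_mul]
    exact (hM.isRhoComm_of_le α inf_le_right).comm (M.res_mem _ hf) (M.res_mem _ hg)

/-! #### The coordinate functions and the partial derivatives -/

lemma expr_coordFn (hM : M.IsRhoManifold) (α : M.Idx) (a : CoordIdx n ι) :
    M.expr α (M.dom α) le_rfl (M.coordFn α a) = Model.coord (M.chart_mem α) _ subset_rfl a :=
  invFun_eq ((hM.bijective α _ le_rfl).2 _)

lemma expr_res_coordFn (hM : M.IsRhoManifold) (α : M.Idx) {V : Opens X} (hV : V ≤ M.dom α)
    (a : CoordIdx n ι) : M.expr α V hV (M.res hV (M.coordFn α a)) =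
      Model.coord (M.chart_mem α) V hV a := by
  rw [M.expr_res α hV le_rfl hV, expr_coordFn hM, Model.res_coord]

lemma expr_pd (hM : M.IsRhoManifold) (α : M.Idx) {V : Opens X} (hV : V ≤ M.dom α)
    (a : CoordIdx n ι) (f : M.sec V) :
    M.expr α V hV (M.pd α hV a f) = Model.pd (M.chart_mem α) hV a (M.expr α V hV f) :=
  invFun_eq ((hM.bijective α _ hV).2 _)

lemma coordFn_mem (hM : M.IsRhoManifold) (α : M.Idx) (a : CoordIdx n ι) :
    M.coordFn α a ∈ M.grade _ (coordDeg n d a) := by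
  rw [← hM.expr_mem_iff α _ le_rfl, expr_coordFn hM]
  exact Model.coord_mem _ _ _ _

lemma pd_mem (hM : M.IsRhoManifold) (α : M.Idx) {V : Opens X} (hV : V ≤ M.dom α)
    (a : CoordIdx n ι) {j : G} {f : M.sec V} (hf : f ∈ M.grade V j) :
    M.pd α hV a f ∈ M.grade V (-coordDeg n d a + j) := by
  rw [← hM.expr_mem_iff α _ hV, expr_pd hM]
  exact Model.pd_mem _ _ _ ((hM.expr_mem_iff α _ hV _ _).2 hf)

lemma pd_mul (hM : M.IsRhoManifold) (α : M.Idx) {V : Opens X} (hV : V ≤ M.dom α)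
    (a : CoordIdx n ι) {j : G} {f : M.sec V} (hf : f ∈ M.grade V j) (g : M.sec V) :
    M.pd α hV a (f * g) = M.pd α hV a f * g + ρ (-coordDeg n d a) j • (f * M.pd α hV a g) :=
  (hM.bijective α V hV).1 (by
    rw [map_add, map_mul, map_smul, map_mul, expr_pd hM, expr_pd hM, expr_pd hM, map_mul]
    exact Model.pd_mul _ _ _ ((hM.expr_mem_iff α _ hV _ _).2 hf) _)

/-- The partial derivative as a linear map. -/
def pdLin (hM : M.IsRhoManifold) (α : M.Idx) {V : Opens X} (hV : V ≤ M.dom α)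
    (a : CoordIdx n ι) : M.sec V →ₗ[K] M.sec V where
  toFun := M.pd α hV a
  map_add' f g := (hM.bijective α V hV).1 (by
    rw [map_add, expr_pd hM, expr_pd hM, expr_pd hM, map_add]
    exact map_add (Model.pdLin (M.chart_mem α) hV a) _ _)
  map_smul' c f := (hM.bijective α V hV).1 (by
    rw [RingHom.id_apply, map_smul, expr_pd hM, expr_pd hM, map_smul]
    exact map_smul (Model.pdLin (M.chart_mem α) hV a) _ _)

lemma pdLin_apply (hM : M.IsRhoManifold) (α : M.Idx) {V : Opens X} (hV : V ≤ M.dom α)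
    (a : CoordIdx n ι) (f : M.sec V) : pdLin hM α hV a f = M.pd α hV a f := rfl

lemma res_pd (hM : M.IsRhoManifold) (α : M.Idx) {V W : Opens X} (h : W ≤ V) (hV : V ≤ M.dom α)
    (hW : W ≤ M.dom α) (a : CoordIdx n ι) (f : M.sec V) :
    M.res h (M.pd α hV a f) = M.pd α hW a (M.res h f) :=
  (hM.bijective α W hW).1 (by
    rw [M.expr_res α h hV hW, expr_pd hM, expr_pd hM, M.expr_res α h hV hW]
    exact Model.res_pd _ _ _ _ _)

open scoped Classical in
lemma pd_coordFn (hM : M.IsRhoManifold) (α : M.Idx) {V : Opens X} (hV : V ≤ M.dom α)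
    (a b : CoordIdx n ι) : M.pd α hV a (M.res hV (M.coordFn α b)) = if b = a then 1 else 0 :=
  (hM.bijective α V hV).1 (by
    rw [expr_pd hM, expr_res_coordFn hM]
    refine (Model.pd_coord (M.chart_mem α) hV a b).trans ?_
    split_ifs
    · rw [map_one]
    · rw [map_zero])

end Basic

/-! #### Local derivations -/

/-- A `ρ`-derivation of degree `q` of the sheaf of functions over `U`. -/
structure LocalDerivation (M : RhoSpace.{u, v, w} 𝕜 n r X ρ d) (U : Opens X) (q : G) where
  app : ∀ W ≤ U, M.sec W →ₗ[K] M.sec W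
  res_app : ∀ {V W} (h : V ≤ W) (hV : V ≤ U) (hW : W ≤ U) f,
    M.res h (app W hW f) = app V hV (M.res h f)
  mem : ∀ W (hW : W ≤ U) {j} {f : M.sec W}, f ∈ M.grade W j → app W hW f ∈ M.grade W (q + j)
  leibniz : ∀ W (hW : W ≤ U) {j} {f : M.sec W} g, f ∈ M.grade W j →
    app W hW (f * g) = app W hW f * g + ρ q j • (f * app W hW g)

namespace LocalDerivation

variable {U : Opens X} {q q' : G}

/-- The partial derivatives of a coordinate system. -/
def ofPd (hM : M.IsRhoManifold) (α : M.Idx) (hU : U ≤ M.dom α) (a : CoordIdx n ι) :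
    M.LocalDerivation U (-coordDeg n d a) where
  app W hW := pdLin hM α (hW.trans hU) a
  res_app h hV hW f := res_pd hM α h _ _ a f
  mem W hW _ _ hf := pd_mem hM α _ a hf
  leibniz W hW _ _ g hf := pd_mul hM α _ a hf g

/-- The restriction of a vector field. -/
def ofVectorField (Q : M.VectorField q) (U : Opens X) : M.LocalDerivation U q where
  app W _ := Q.app W
  res_app h _ _ f := (Q.app_res h f).symm
  mem W _ _ _ hf := Q.app_mem W hf
  leibniz W _ _ _ g hf := Q.leibniz W g hf

/-- The commutator of two derivations. -/
def comm (D : M.LocalDerivation U q) (D' : M.LocalDerivation U q') :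
    M.LocalDerivation U (q + q') where
  app W hW := D.app W hW ∘ₗ D'.app W hW - ρ q q' • D'.app W hW ∘ₗ D.app W hW
  res_app {V W} h hV hW f := by
    simp only [LinearMap.sub_apply, LinearMap.smul_apply, LinearMap.comp_apply, map_sub, map_smul,
      D.res_app h hV hW, D'.res_app h hV hW]
  mem W hW j f hf := by
    refine sub_mem ?_ (Submodule.smul_mem _ _ ?_)
    · rw [add_assoc]
      exact D.mem W hW (D'.mem W hW hf)
    · rw [add_comm q, add_assoc]
      exact D'.mem W hW (D.mem W hW hf)
  leibniz W hW j f g hf := by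
    simp only [LinearMap.sub_apply, LinearMap.smul_apply, LinearMap.comp_apply, D.leibniz W hW g hf,
      D'.leibniz W hW g hf, map_add, map_smul, D.leibniz W hW _ hf, D'.leibniz W hW _ hf,
      D.leibniz W hW _ (D'.mem W hW hf), D'.leibniz W hW _ (D.mem W hW hf)]
    simp only [ρ.add_left, ρ.add_right, smul_add, smul_sub, sub_mul, mul_sub, smul_smul,
      smul_mul_assoc, mul_smul_comm]
    have h1 : ρ q q' * (ρ q' q * ρ q' j) = ρ q' j := by rw [← mul_assoc, ρ.mul_swap, one_mul]
    rw [h1]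
    match_scalars <;> ring

end LocalDerivation

end RhoSpace

/-! ### Expansion of derivations in partial derivatives, chain rule and commutators -/

namespace RhoSpace

universe u v w

variable {G K : Type*} [AddCommGroup G] [RCLike K]
variable {𝕜 : Type*} [RCLike 𝕜] [NormedAlgebra 𝕜 K] {n : ℕ} {r : Regularity}
variable {X : Type u} [TopologicalSpace X] [ChartedSpace (EuclideanSpace 𝕜 (Fin n)) X]
variable {ρ : CommutationFactor G K}
variable {ι : Type*} [Fintype ι] [LinearOrder ι] {d : ι → G}
variable {M : RhoSpace.{u, v, w} 𝕜 n r X ρ d}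

namespace LocalDerivation

variable {U : Opens X} {q q' : G}

/-- The difference of two derivations of the same degree. -/
def sub (D D' : M.LocalDerivation U q) : M.LocalDerivation U q where
  app W hW := D.app W hW - D'.app W hW
  res_app h hV hW f := by
    simp only [LinearMap.sub_apply, map_sub, D.res_app h hV hW, D'.res_app h hV hW]
  mem W hW _ _ hf := sub_mem (D.mem W hW hf) (D'.mem W hW hf)
  leibniz W hW j f g hf := by
    simp only [LinearMap.sub_apply, D.leibniz W hW g hf, D'.leibniz W hW g hf, sub_mul, mul_sub,
      smul_sub]
    abel

/-- The derivation with given components. -/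
def ofComponents (hM : M.IsRhoManifold) (α : M.Idx) (hU : U ≤ M.dom α) (c : CoordIdx n ι → M.sec U)
    (hc : ∀ a, c a ∈ M.grade U (q + coordDeg n d a)) : M.LocalDerivation U q where
  app W hW := ∑ a, LinearMap.mulLeft K (M.res hW (c a)) ∘ₗ pdLin hM α (hW.trans hU) a
  res_app {V W} h hV hW f := by
    simp only [LinearMap.sum_apply, LinearMap.comp_apply, LinearMap.mulLeft_apply, map_sum, map_mul,
      pdLin_apply, res_pd hM α h (hW.trans hU) (hV.trans hU), M.res_res]
  mem W hW j f hf := by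
    rw [LinearMap.sum_apply]
    refine Submodule.sum_mem _ fun a _ => ?_
    have h := M.mul_mem (M.res_mem hW (hc a)) (pd_mem hM α (hW.trans hU) a hf)
    rwa [show q + coordDeg n d a + (-coordDeg n d a + j) = q + j by abel] at h
  leibniz W hW j f g hf := by
    simp only [LinearMap.sum_apply, LinearMap.comp_apply, LinearMap.mulLeft_apply,
      pdLin_apply, Finset.sum_mul, Finset.mul_sum, Finset.smul_sum]
    rw [← Finset.sum_add_distrib]
    refine Finset.sum_congr rfl fun a _ => ?_
    rw [pd_mul hM α (hW.trans hU) a hf, mul_add, mul_assoc, mul_smul_comm, ← mul_assoc _ f,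
      (hM.isRhoComm W).comm (M.res_mem hW (hc a)) hf, smul_mul_assoc, smul_smul, mul_assoc,
      ρ.neg_left, ρ.add_left, mul_comm, mul_assoc, mul_inv_cancel₀ (ρ.ne_zero _ _), mul_one]

lemma ofComponents_app (hM : M.IsRhoManifold) (α : M.Idx) (hU : U ≤ M.dom α)
    (c : CoordIdx n ι → M.sec U) (hc : ∀ a, c a ∈ M.grade U (q + coordDeg n d a)) (W : Opens X)
    (hW : W ≤ U) (f : M.sec W) : (ofComponents hM α hU c hc).app W hW f =
      ∑ a, M.res hW (c a) * M.pd α (hW.trans hU) a f := by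
  rw [ofComponents, LinearMap.sum_apply]
  rfl

/-- Transport of structure along the coordinate expressions reduces this to the theorem on the local
model. -/
lemma app_eq_zero (hM : M.IsRhoManifold) (α : M.Idx) (hU : U ≤ M.dom α)
    (D : M.LocalDerivation U q) (h0 : ∀ a, D.app U le_rfl (M.res hU (M.coordFn α a)) = 0)
    (W : Opens X) (hW : W ≤ U) (f : M.sec W) : D.app W hW f = 0 := by
  let E : ModelDerivation 𝕜 n r ρ d U q :=
    { app := fun W hW => (M.expr α W (hW.trans hU)).toLinearMap ∘ₗ D.app W hW ∘ₗ
        (exprEquiv hM α (hW.trans hU)).symm.toLinearMap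
      res_app := fun {V W} hVW hV hW f => by
        change Model.res hVW (M.expr α W _ (D.app W hW ((exprEquiv hM α (hW.trans hU)).symm f))) =
          M.expr α V _ (D.app V hV ((exprEquiv hM α (hV.trans hU)).symm (Model.res hVW f)))
        rw [← M.expr_res α hVW (hW.trans hU) (hV.trans hU), D.res_app hVW hV hW]
        congr 2
        refine (hM.bijective α V (hV.trans hU)).1 ?_
        rw [expr_exprEquiv_symm hM, M.expr_res α hVW (hW.trans hU) (hV.trans hU),
          expr_exprEquiv_symm hM]
      leibniz := fun W hW j f g hf => by
        have hf' : (exprEquiv hM α (hW.trans hU)).symm f ∈ M.grade W j := by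
          rw [← hM.expr_mem_iff α W (hW.trans hU), expr_exprEquiv_symm hM]
          exact hf
        change M.expr α W _ (D.app W hW ((exprEquiv hM α (hW.trans hU)).symm (f * g))) =
          M.expr α W _ (D.app W hW ((exprEquiv hM α (hW.trans hU)).symm f)) * g +
          ρ q j • (f * M.expr α W _ (D.app W hW ((exprEquiv hM α (hW.trans hU)).symm g)))
        rw [map_mul, D.leibniz W hW _ hf', map_add, map_smul, map_mul, map_mul,
          expr_exprEquiv_symm hM, expr_exprEquiv_symm hM] }
  have h1 := E.app_eq_zero (M.chart_mem α) hU (fun a W hW => by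
    change M.expr α W _ (D.app W hW ((exprEquiv hM α (hW.trans hU)).symm _)) = 0
    have e : (exprEquiv hM α (hW.trans hU)).symm (Model.coord (M.chart_mem α) W (hW.trans hU) a) =
        M.res hW (M.res hU (M.coordFn α a)) := by
      refine (hM.bijective α W (hW.trans hU)).1 ?_
      rw [expr_exprEquiv_symm hM, M.res_res, expr_res_coordFn hM]
    rw [e, ← D.res_app hW hW le_rfl, h0, map_zero, map_zero]) W hW (M.expr α W (hW.trans hU) f)
  refine (hM.bijective α W (hW.trans hU)).1 ?_
  rw [map_zero, ← h1]
  change _ = M.expr α W _ (D.app W hW ((exprEquiv hM α (hW.trans hU)).symm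
    (exprEquiv hM α (hW.trans hU) f)))
  rw [AlgEquiv.symm_apply_apply]

/-- A derivation is determined by its values on the coordinate functions. -/
theorem app_eq_sum (hM : M.IsRhoManifold) (α : M.Idx) (hU : U ≤ M.dom α)
    (D : M.LocalDerivation U q) (W : Opens X) (hW : W ≤ U) (f : M.sec W) :
    D.app W hW f = ∑ a, M.res hW (D.app U le_rfl (M.res hU (M.coordFn α a))) *
      M.pd α (hW.trans hU) a f := by
  classical
  have hc : ∀ a, D.app U le_rfl (M.res hU (M.coordFn α a)) ∈ M.grade U (q + coordDeg n d a) :=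
    fun a => D.mem U le_rfl (M.res_mem hU (coordFn_mem hM α a))
  rw [← ofComponents_app hM α hU _ hc]
  refine sub_eq_zero.1 ((D.sub (ofComponents hM α hU _ hc)).app_eq_zero hM α hU (fun a => ?_) W hW f)
  change D.app U le_rfl (M.res hU (M.coordFn α a)) -
    (ofComponents hM α hU _ hc).app U le_rfl (M.res hU (M.coordFn α a)) = 0
  rw [ofComponents_app, sub_eq_zero, Finset.sum_eq_single a]
  · rw [M.res_self, pd_coordFn hM, if_pos rfl, mul_one]
  · intro b _ hb
    rw [pd_coordFn hM, if_neg hb.symm, mul_zero]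
  · simp

end LocalDerivation

section Consequences

lemma jacobian_apply (α β : M.Idx) {V : Opens X} (hα : V ≤ M.dom α) (hβ : V ≤ M.dom β)
    (b a : CoordIdx n ι) : M.jacobian α β hα hβ b a = M.pd α hα b (M.res hβ (M.coordFn β a)) := rfl

lemma res_jacobian (hM : M.IsRhoManifold) (α β : M.Idx) {V W : Opens X} (h : W ≤ V)
    (hα : V ≤ M.dom α) (hβ : V ≤ M.dom β) (b a : CoordIdx n ι) :
    M.res h (M.jacobian α β hα hβ b a) =
      M.jacobian α β (h.trans hα) (h.trans hβ) b a := by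
  rw [jacobian_apply, jacobian_apply, res_pd hM α h hα (h.trans hα), M.res_res]

lemma jacobian_mem (hM : M.IsRhoManifold) (α β : M.Idx) {V : Opens X} (hα : V ≤ M.dom α)
    (hβ : V ≤ M.dom β) (b a : CoordIdx n ι) :
    M.jacobian α β hα hβ b a ∈ M.grade V (-coordDeg n d b + coordDeg n d a) :=
  pd_mem hM α hα b (M.res_mem hβ (coordFn_mem hM β a))

/-- The chain rule. -/
lemma pd_eq_sum_jacobian (hM : M.IsRhoManifold) (α β : M.Idx) {V : Opens X} (hα : V ≤ M.dom α)
    (hβ : V ≤ M.dom β) (b : CoordIdx n ι) (f : M.sec V) :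
    M.pd α hα b f = ∑ a, M.jacobian α β hα hβ b a * M.pd β hβ a f := by
  have h := (LocalDerivation.ofPd hM α hα b).app_eq_sum hM β hβ V le_rfl f
  simp only [M.res_self] at h
  exact h

lemma jacobian_mul_jacobian (hM : M.IsRhoManifold) (α β γ : M.Idx) {V : Opens X}
    (hα : V ≤ M.dom α) (hβ : V ≤ M.dom β) (hγ : V ≤ M.dom γ) :
    M.jacobian α β hα hβ * M.jacobian β γ hβ hγ = M.jacobian α γ hα hγ :=
  Matrix.ext fun b c => (pd_eq_sum_jacobian hM α β hα hβ b _).symm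

lemma jacobian_self (hM : M.IsRhoManifold) (α : M.Idx) {V : Opens X}
    (hα hα' : V ≤ M.dom α) : M.jacobian α α hα hα' = 1 := by
  refine Matrix.ext fun b a => ?_
  rw [jacobian_apply, pd_coordFn hM, Matrix.one_apply]
  by_cases h : a = b
  · rw [if_pos h, if_pos h.symm]
  · rw [if_neg h, if_neg (Ne.symm h)]

variable {q : G}

lemma VectorField.comp_mem (hM : M.IsRhoManifold) (Q : M.VectorField q) (α : M.Idx)
    (a : CoordIdx n ι) : Q.comp α a ∈ M.grade _ (q + coordDeg n d a) :=
  Q.app_mem _ (coordFn_mem hM α a)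

lemma VectorField.app_eq_sum (hM : M.IsRhoManifold) (Q : M.VectorField q) (α : M.Idx)
    {V : Opens X} (hV : V ≤ M.dom α) (f : M.sec V) :
    Q.app V f = ∑ a, M.res hV (Q.comp α a) * M.pd α hV a f := by
  have h := (LocalDerivation.ofVectorField Q (M.dom α)).app_eq_sum hM α le_rfl V hV f
  simp only [M.res_self] at h
  exact h

lemma VectorField.res_comp (hM : M.IsRhoManifold) (Q : M.VectorField q) (α β : M.Idx)
    {V : Opens X} (hα : V ≤ M.dom α) (hβ : V ≤ M.dom β) (a : CoordIdx n ι) :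
    M.res hβ (Q.comp β a) = ∑ b, M.res hα (Q.comp α b) * M.jacobian α β hα hβ b a := by
  rw [VectorField.comp, ← Q.app_res, Q.app_eq_sum hM α hα]
  rfl

/-- The commutator of a vector field and a partial derivative. -/
lemma VectorField.app_pd (hM : M.IsRhoManifold) (Q : M.VectorField q) (α : M.Idx)
    {V : Opens X} (hV : V ≤ M.dom α) (a : CoordIdx n ι) (f : M.sec V) :
    Q.app V (M.pd α hV a f) = ρ q (-coordDeg n d a) • (M.pd α hV a (Q.app V f) -
      ∑ b, M.pd α hV a (M.res hV (Q.comp α b)) * M.pd α hV b f) := by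
  have h := ((LocalDerivation.ofVectorField Q V).comm
    (LocalDerivation.ofPd hM α hV a)).app_eq_sum hM α hV V le_rfl f
  -- The commutator of `Q` and `∂/∂x^a` on the coordinate `x^b`: its first term vanishes, since
  -- `∂x^b/∂x^a` is constant, and the second one is the derivative of `Q^b`.
  have e : ∀ b, Q.app V (M.pd α hV a (M.res hV (M.coordFn α b))) -
      ρ q (-coordDeg n d a) • M.pd α hV a (Q.app V (M.res hV (M.coordFn α b))) =
      -(ρ q (-coordDeg n d a) • M.pd α hV a (M.res hV (Q.comp α b))) := fun b => by
    classical
    have h1 : Q.app V (M.pd α hV a (M.res hV (M.coordFn α b))) = 0 := by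
      rw [pd_coordFn hM]
      split_ifs
      · have h := Q.leibniz V (f := 1) 1 (M.one_mem V)
        rw [mul_one, ρ.zero_right, one_smul, one_mul, mul_one] at h
        exact left_eq_add.1 h
      · exact map_zero _
    rw [h1, Q.app_res, zero_sub]
    rfl
  simp only [M.res_self] at h
  change Q.app V (M.pd α hV a f) - ρ q (-coordDeg n d a) • M.pd α hV a (Q.app V f) =
    ∑ b, (Q.app V (M.pd α hV a (M.res hV (M.coordFn α b))) -
      ρ q (-coordDeg n d a) • M.pd α hV a (Q.app V (M.res hV (M.coordFn α b)))) * M.pd α hV b f at h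
  simp only [e, neg_mul, smul_mul_assoc, Finset.sum_neg_distrib] at h
  rw [← Finset.smul_sum] at h
  rw [sub_eq_iff_eq_add'.1 h, smul_sub, sub_eq_add_neg]

end Consequences

end RhoSpace

/-! ### Degree-preserving homomorphisms -/

namespace Series

variable {G K : Type*} [AddCommGroup G] [RCLike K] {ρ : CommutationFactor G K}
variable {ι : Type*} [Fintype ι] [LinearOrder ι] {d : ι → G}
variable {R R' : Type*} [CommRing R] [Algebra K R] [CommRing R'] [Algebra K R']

lemma GradePreserving.proj {φ : Series ρ d R →ₐ[K] Series ρ d R'} (hφ : GradePreserving φ) (j : G)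
    (f : Series ρ d R) : φ (Series.proj j f) = Series.proj j (φ f) :=
  linearMap_ext (φ := φ.toLinearMap ∘ₗ Series.proj j) (ψ := Series.proj j ∘ₗ φ.toLinearMap)
    (fun k f hf => by
      change φ (Series.proj j f) = Series.proj j (φ f)
      by_cases h : j = k
      · subst h
        rw [proj_of_mem hf, proj_of_mem (hφ _ _ hf)]
      · rw [proj_of_mem_ne h hf, proj_of_mem_ne h (hφ _ _ hf), map_zero]) f

/-- The image of `f` is the sum of the images of its homogeneous components, so no new degrees
appear. -/
lemma GradePreserving.wdeg_mem {φ : Series ρ d R →ₐ[K] Series ρ d R'} (hφ : GradePreserving φ)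
    {S : Finset G} {f : Series ρ d R} (hS : ∀ w, f.coeff w ≠ 0 → wdeg d w ∈ S) {w : ι →₀ ℕ}
    (hw : (φ f).coeff w ≠ 0) : wdeg d w ∈ S := by
  rw [← sum_proj hS, map_sum, coeff_sum] at hw
  obtain ⟨j, hj, hne⟩ := Finset.exists_ne_zero_of_sum_ne_zero hw
  rw [hφ j _ (proj_mem j f) w hne]
  exact hj

lemma map_gradePreserving (φ : R →ₐ[K] R') :
    GradePreserving (map φ : Series ρ d R →ₐ[K] Series ρ d R') := fun _ _ hf => map_mem_grade φ hf

end Series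

/-! ### The changes of coordinates on the cotangent bundle -/

section CotangentSections

universe u v w

variable {G K : Type*} [AddCommGroup G] [RCLike K]
variable {𝕜 : Type*} [RCLike 𝕜] [NormedAlgebra 𝕜 K] {n : ℕ} {r : Regularity}
variable {X : Type u} [TopologicalSpace X] [ChartedSpace (EuclideanSpace 𝕜 (Fin n)) X]
variable {ρ : CommutationFactor G K}
variable {ι : Type*} [Fintype ι] [LinearOrder ι] {d : ι → G}

namespace Model

local notation "resM" => Model.res (𝕜 := 𝕜) (K := K) (n := n) (r := r) (ρ := ρ) (d := d)

/-- Homogeneous elements of the local model can be glued. -/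
lemma exists_glue {T : Type*} (U : T → Opens X) (j : G) (f : ∀ t, Model 𝕜 n r ρ d (U t))
    (hf : ∀ t, f t ∈ Series.grade j)
    (h : ∀ s t, resM (inf_le_left : U s ⊓ U t ≤ U s) (f s) = resM inf_le_right (f t)) :
    ∃ g : Model 𝕜 n r ρ d (⨆ t, U t), g ∈ Series.grade j ∧ ∀ t, resM (le_iSup U t) g = f t := by
  classical
  choose c hc using fun w => bodyFun_glue U (fun t => (f t).coeff w) (fun s t p hs ht =>
    congrFun (congrArg (fun g => (Series.coeff g w).1) (h s t)) ⟨p, hs, ht⟩)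
  refine ⟨⟨fun w => if wdeg d w = j ∧ IsGood ρ d w then c w else 0,
    fun w hw => if_neg fun h => hw h.2, {j}, fun w hw => ?_⟩, fun w hw => ?_,
    fun t => Series.ext fun w => ?_⟩
  · rw [Finset.mem_singleton]
    by_contra hne
    exact hw (if_neg fun h => hne h.1)
  · by_contra hne
    exact hw (if_neg fun h => hne h.1)
  · change bodyRes 𝕜 K n r _ (if wdeg d w = j ∧ IsGood ρ d w then c w else 0) = (f t).coeff w
    split_ifs with hw
    · exact hc w t
    · rw [map_zero]
      by_contra hne
      exact hw ⟨hf t w (Ne.symm hne), by_contra fun h' => hne (Series.coeff_of_not_good _ h').symm⟩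

end Model

namespace RhoSpace

variable {M : RhoSpace.{u, v, w} 𝕜 n r X ρ d} {i : G}

local notation "resC" => Model.res (𝕜 := 𝕜) (K := K) (n := n) (r := r) (ρ := ρ) (d := cotDeg d n i)

/-- The change of coordinates on `M` in the local models. -/
def exprTrans (hM : M.IsRhoManifold) (α β : M.Idx) {W : Opens X} (hα : W ≤ M.dom α)
    (hβ : W ≤ M.dom β) : Model 𝕜 n r ρ d W →ₐ[K] Model 𝕜 n r ρ d W :=
  (M.expr α W hα).comp (exprEquiv hM β hβ).symm.toAlgHom

lemma exprTrans_expr (hM : M.IsRhoManifold) (α β : M.Idx) {W : Opens X} (hα : W ≤ M.dom α)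
    (hβ : W ≤ M.dom β) (f : M.sec W) :
    exprTrans hM α β hα hβ (M.expr β W hβ f) = M.expr α W hα f :=
  congrArg (M.expr α W hα) ((exprEquiv hM β hβ).symm_apply_apply f)

lemma exprTrans_gradePreserving (hM : M.IsRhoManifold) (α β : M.Idx) {W : Opens X}
    (hα : W ≤ M.dom α) (hβ : W ≤ M.dom β) : Series.GradePreserving (exprTrans hM α β hα hβ) := by
  intro j f hf
  obtain ⟨g, rfl⟩ := (hM.bijective β W hβ).2 f
  rw [exprTrans_expr]
  exact (hM.expr_mem_iff α W hα j g).2 ((hM.expr_mem_iff β W hβ j g).1 hf)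

/-- The expression of `y_a^*` in the coordinates `(x, x^*)`. -/
def fibreImage (M : RhoSpace.{u, v, w} 𝕜 n r X ρ d) (i : G) (α β : M.Idx) {W : Opens X}
    (hα : W ≤ M.dom α) (hβ : W ≤ M.dom β) (a : CoordIdx n ι) : Model 𝕜 n r ρ (cotDeg d n i) W :=
  ∑ b : CoordIdx n ι, Series.incl i (M.expr α W hα (M.jacobian β α hβ hα a b)) *
    Series.X (toLex (Sum.inr b))

lemma fibreImage_mem (hM : M.IsRhoManifold) (α β : M.Idx) {W : Opens X} (hα : W ≤ M.dom α)
    (hβ : W ≤ M.dom β) (a : CoordIdx n ι) :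
    M.fibreImage i α β hα hβ a ∈ Series.grade (fibDeg d n i a) := by
  refine Submodule.sum_mem _ fun b _ => ?_
  have h := Series.mul_mem_grade (Series.incl_mem (n := n) (i := i) ((hM.expr_mem_iff α W hα _ _).2
    (jacobian_mem hM β α hβ hα a b))) (Series.X_mem (ρ := ρ) (d := cotDeg d n i)
    (R := bodyFun 𝕜 K n r W) (toLex (Sum.inr b)))
  refine Series.isRhoComm.mem_of_eq h ?_
  change _ + (-coordDeg n d b - i) = -coordDeg n d a - i
  abel

lemma fibreImage_fibreHomogeneous (α β : M.Idx) {W : Opens X} (hα : W ≤ M.dom α)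
    (hβ : W ≤ M.dom β) (a : CoordIdx n ι) :
    Series.FibreHomogeneous 1 (M.fibreImage i α β hα hβ a) :=
  Series.FibreHomogeneous.sum _ fun b _ => by
    have := (Series.FibreHomogeneous.incl (n := n) (i := i)
      (M.expr α W hα (M.jacobian β α hβ hα a b))).mul (Series.FibreHomogeneous.X b)
    rwa [zero_add] at this

/-- The change of coordinates on the cotangent bundle in the local models. -/
def transition (hM : M.IsRhoManifold) (i : G) (α β : M.Idx) {W : Opens X} (hα : W ≤ M.dom α)
    (hβ : W ≤ M.dom β) :
    Model 𝕜 n r ρ (cotDeg d n i) W →ₐ[K] Model 𝕜 n r ρ (cotDeg d n i) W :=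
  Series.subst (exprTrans_gradePreserving hM α β hα hβ) (fibreImage_mem hM α β hα hβ)
    (fibreImage_fibreHomogeneous α β hα hβ)

lemma transition_gradePreserving (hM : M.IsRhoManifold) (α β : M.Idx) {W : Opens X}
    (hα : W ≤ M.dom α) (hβ : W ≤ M.dom β) : Series.GradePreserving (transition hM i α β hα hβ) :=
  fun _ _ hf => Series.substFun_mem (exprTrans_gradePreserving hM α β hα hβ)
    (fibreImage_mem hM α β hα hβ) hf

lemma transition_incl (hM : M.IsRhoManifold) (α β : M.Idx) {W : Opens X} (hα : W ≤ M.dom α)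
    (hβ : W ≤ M.dom β) (f : M.sec W) : transition hM i α β hα hβ (Series.incl i (M.expr β W hβ f)) =
      Series.incl i (M.expr α W hα f) := by
  rw [← exprTrans_expr hM α β hα hβ f]
  exact Series.substFun_incl (exprTrans_gradePreserving hM α β hα hβ)
    (fibreImage_mem hM α β hα hβ) _

lemma transition_X (hM : M.IsRhoManifold) (α β : M.Idx) {W : Opens X} (hα : W ≤ M.dom α)
    (hβ : W ≤ M.dom β) (a : CoordIdx n ι) :
    transition hM i α β hα hβ (Series.X (toLex (Sum.inr a))) = M.fibreImage i α β hα hβ a :=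
  Series.substFun_X (exprTrans_gradePreserving hM α β hα hβ) (fibreImage_mem hM α β hα hβ)
    (fibreImage_fibreHomogeneous α β hα hβ) a

lemma isTransition_transition (hM : M.IsRhoManifold) (α β : M.Idx) {W : Opens X}
    (hα : W ≤ M.dom α) (hβ : W ≤ M.dom β) :
    M.IsTransition i α β hα hβ (transition hM i α β hα hβ) :=
  ⟨transition_incl hM α β hα hβ, transition_X hM α β hα hβ⟩

lemma algHom_eq_of_transition (hM : M.IsRhoManifold) (β : M.Idx) {W : Opens X}
    (hβ : W ≤ M.dom β) {R : Type*} [CommRing R] [Algebra K R]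
    {τ τ' : Model 𝕜 n r ρ (cotDeg d n i) W →ₐ[K] Series ρ (cotDeg d n i) R}
    (h0 : ∀ f : M.sec W, τ (Series.incl i (M.expr β W hβ f)) = τ' (Series.incl i (M.expr β W hβ f)))
    (h1 : ∀ a, τ (Series.X (toLex (Sum.inr a))) = τ' (Series.X (toLex (Sum.inr a))))
    (h2 : ∀ a, Series.FibreHomogeneous 1 (τ (Series.X (toLex (Sum.inr a))))) : τ = τ' :=
  Series.algHom_ext_cot (fun f => by
    obtain ⟨g, rfl⟩ := (hM.bijective β W hβ).2 f
    exact h0 g) h1 h2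

/-- The definition of `cotSec` asks for compatibility with every transition. There is only one, so
it amounts to compatibility with the constructed one. -/
lemma IsTransition.eq (hM : M.IsRhoManifold) {α β : M.Idx} {W : Opens X} {hα : W ≤ M.dom α}
    {hβ : W ≤ M.dom β} {τ : Model 𝕜 n r ρ (cotDeg d n i) W →ₐ[K] Model 𝕜 n r ρ (cotDeg d n i) W}
    (hτ : M.IsTransition i α β hα hβ τ) : τ = transition hM i α β hα hβ :=
  (algHom_eq_of_transition hM β hβ (fun f => by rw [transition_incl hM, hτ.1])
    (fun a => by
      rw [transition_X hM]
      exact (hτ.2 a).symm)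
    (fun a => by
      rw [transition_X hM]
      exact fibreImage_fibreHomogeneous α β hα hβ a)).symm

lemma res_fibreImage (hM : M.IsRhoManifold) (α β : M.Idx) {W W' : Opens X} (h : W' ≤ W)
    (hα : W ≤ M.dom α) (hβ : W ≤ M.dom β) (a : CoordIdx n ι) :
    resC h (M.fibreImage i α β hα hβ a) = M.fibreImage i α β (h.trans hα) (h.trans hβ) a := by
  unfold fibreImage
  rw [map_sum]
  refine Finset.sum_congr rfl fun b _ => ?_
  rw [map_mul, Series.map_X, Series.map_incl, ← res_jacobian hM β α h hβ hα,
    M.expr_res α h hα (h.trans hα)]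

lemma res_transition (hM : M.IsRhoManifold) (α β : M.Idx) {W W' : Opens X} (h : W' ≤ W)
    (hα : W ≤ M.dom α) (hβ : W ≤ M.dom β) (f : Model 𝕜 n r ρ (cotDeg d n i) W) :
    resC h (transition hM i α β hα hβ f) =
      transition hM i α β (h.trans hα) (h.trans hβ) (resC h f) := by
  have e : (resC h).comp (transition hM i α β hα hβ) =
      (transition hM i α β (h.trans hα) (h.trans hβ)).comp (resC h) := by
    refine algHom_eq_of_transition hM β hβ (fun f => ?_) (fun a => ?_) fun a => ?_
    · rw [AlgHom.comp_apply, AlgHom.comp_apply, transition_incl, Series.map_incl, Series.map_incl,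
        ← M.expr_res α h hα (h.trans hα), ← M.expr_res β h hβ (h.trans hβ), transition_incl]
    · rw [AlgHom.comp_apply, AlgHom.comp_apply, transition_X, Series.map_X, transition_X,
        res_fibreImage hM]
    · rw [AlgHom.comp_apply, transition_X, res_fibreImage hM]
      exact fibreImage_fibreHomogeneous α β _ _ a
  exact DFunLike.congr_fun e f

lemma transition_self (hM : M.IsRhoManifold) (α : M.Idx) {W : Opens X} (hα hα' : W ≤ M.dom α)
    (f : Model 𝕜 n r ρ (cotDeg d n i) W) : transition hM i α α hα hα' f = f := by
  classical
  have e : transition hM i α α hα hα' = AlgHom.id K _ := by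
    refine algHom_eq_of_transition hM α hα (fun f => ?_) (fun a => ?_) fun a => ?_
    · exact transition_incl hM α α hα hα' f
    · rw [transition_X, fibreImage, jacobian_self hM, Finset.sum_eq_single a]
      · rw [Matrix.one_apply_eq, map_one, Series.incl_one, one_mul]
        rfl
      · intro b _ hb
        rw [Matrix.one_apply_ne hb.symm, map_zero, map_zero, zero_mul]
      · simp
    · rw [transition_X]
      exact fibreImage_fibreHomogeneous α α _ _ a
  exact DFunLike.congr_fun e f

/-- By uniqueness it suffices to compare both sides on functions of the base, where the claim is
clear, and on the linear coordinates, where it is the chain rule for Jacobian matrices. -/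
lemma transition_transition (hM : M.IsRhoManifold) (α β γ : M.Idx) {W : Opens X}
    (hα : W ≤ M.dom α) (hβ : W ≤ M.dom β) (hγ : W ≤ M.dom γ)
    (f : Model 𝕜 n r ρ (cotDeg d n i) W) :
    transition hM i α β hα hβ (transition hM i β γ hβ hγ f) = transition hM i α γ hα hγ f := by
  have e : (transition hM i α β hα hβ).comp (transition hM i β γ hβ hγ) =
      transition hM i α γ hα hγ := by
    symm
    refine algHom_eq_of_transition hM γ hγ (fun f => ?_) (fun c => ?_) fun c => ?_
    · rw [AlgHom.comp_apply, transition_incl, transition_incl, transition_incl]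
    · rw [AlgHom.comp_apply, transition_X, transition_X, fibreImage, fibreImage, map_sum]
      simp only [map_mul, transition_incl, transition_X, fibreImage, Finset.mul_sum,
        ← jacobian_mul_jacobian hM γ β α hγ hβ hα, Matrix.mul_apply, map_sum, Finset.sum_mul,
        Series.incl_mul, mul_assoc]
      exact Finset.sum_comm
    · rw [transition_X]
      exact fibreImage_fibreHomogeneous α γ _ _ c
  exact DFunLike.congr_fun e f

end RhoSpace

end CotangentSections

/-! ### The cotangent bundle is a `ρ`-manifold -/

namespace RhoSpace

universe u v w

variable {G K : Type*} [AddCommGroup G] [RCLike K]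
variable {𝕜 : Type*} [RCLike 𝕜] [NormedAlgebra 𝕜 K] {n : ℕ} {r : Regularity}
variable {X : Type u} [TopologicalSpace X] [ChartedSpace (EuclideanSpace 𝕜 (Fin n)) X]
variable {ρ : CommutationFactor G K}
variable {ι : Type*} [Fintype ι] [LinearOrder ι] {d : ι → G}
variable {M : RhoSpace.{u, v, w} 𝕜 n r X ρ d} {i : G}

local notation "resC" => Model.res (𝕜 := 𝕜) (K := K) (n := n) (r := r) (ρ := ρ) (d := cotDeg d n i)

lemma transition_cotSec (hM : M.IsRhoManifold) {V : Opens X} (f : (M.cotangent i).sec V) (α β : M.Idx)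
    {W : Opens X} (hα : W ≤ V ⊓ M.dom α) (hβ : W ≤ V ⊓ M.dom β) :
    transition hM i α β (hα.trans inf_le_right) (hβ.trans inf_le_right) (resC hβ (f.1 β)) =
      resC hα (f.1 α) :=
  f.2.2 α β W hα hβ _ (isTransition_transition hM _ _ _ _)

/-- A compatible family of local functions. -/
def cotMk (hM : M.IsRhoManifold) {V : Opens X}
    (f : ∀ α : M.Idx, Model 𝕜 n r ρ (cotDeg d n i) (V ⊓ M.dom α)) (S : Finset G)
    (hS : ∀ α w, (f α).coeff w ≠ 0 → wdeg (cotDeg d n i) w ∈ S)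
    (h : ∀ α β (W : Opens X) (hα : W ≤ V ⊓ M.dom α) (hβ : W ≤ V ⊓ M.dom β),
      transition hM i α β (hα.trans inf_le_right) (hβ.trans inf_le_right) (resC hβ (f β)) =
        resC hα (f α)) : (M.cotangent i).sec V :=
  ⟨f, ⟨S, hS⟩, fun α β W hα hβ τ hτ => by
    rw [hτ.eq hM]
    exact h α β W hα hβ⟩

/-- The section over `V ⊆ U_α` with a given expression in the coordinates `(x_α, x_α^*)`. -/
def cotOfLocal (hM : M.IsRhoManifold) (α : M.Idx) {V : Opens X} (hV : V ≤ M.dom α)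
    (g : Model 𝕜 n r ρ (cotDeg d n i) V) : (M.cotangent i).sec V :=
  cotMk hM (fun β => transition hM i β α inf_le_right (inf_le_left.trans hV) (resC inf_le_left g))
    g.2.2.choose
    (fun β w hw => (transition_gradePreserving hM β α _ _).wdeg_mem (fun w hw =>
      g.2.2.choose_spec w fun h => hw (by
        rw [Series.coeff_map]
        change (bodyRes 𝕜 K n r _) (g.1 w) = 0
        rw [h, map_zero])) hw)
    (fun β γ W hβ hγ => by
      rw [res_transition hM, res_transition hM, transition_transition hM]
      rfl)

lemma expr_cotOfLocal (hM : M.IsRhoManifold) (α : M.Idx) {V : Opens X} (hV : V ≤ M.dom α)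
    (g : Model 𝕜 n r ρ (cotDeg d n i) V) :
    (M.cotangent i).expr α V hV (cotOfLocal hM α hV g) = g := by
  change resC _ (transition hM i α α _ _ (resC _ g)) = g
  rw [transition_self hM]
  rfl

/-- Inside one coordinate neighbourhood a compatible family is determined by a single member; this
makes the coordinate expression injective. -/
lemma cot_val_eq (hM : M.IsRhoManifold) (α : M.Idx) {V : Opens X} (hV : V ≤ M.dom α)
    (f : (M.cotangent i).sec V) (β : M.Idx) : f.1 β =
      transition hM i β α inf_le_right (inf_le_left.trans hV)
        (resC inf_le_left ((M.cotangent i).expr α V hV f)) :=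
  (transition_cotSec hM f β α (W := V ⊓ M.dom β) le_rfl
    (le_inf inf_le_left (inf_le_left.trans hV))).symm

lemma cot_bijective (hM : M.IsRhoManifold) (α : M.Idx) (V : Opens X) (hV : V ≤ M.dom α) :
    Bijective ((M.cotangent i).expr α V hV) :=
  ⟨fun f g h => Subtype.ext (funext fun β => by
    rw [cot_val_eq hM α hV f, cot_val_eq hM α hV g, h]),
    fun g => ⟨_, expr_cotOfLocal hM α hV g⟩⟩

lemma cot_expr_mem_iff (hM : M.IsRhoManifold) (α : M.Idx) (V : Opens X) (hV : V ≤ M.dom α) (j : G)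
    (f : (M.cotangent i).sec V) :
    (M.cotangent i).expr α V hV f ∈ Series.grade j ↔ f ∈ (M.cotangent i).grade V j := by
  constructor
  · intro h β
    rw [cot_val_eq hM α hV f]
    exact transition_gradePreserving hM _ _ _ _ _ _ (Series.map_mem_grade _ h)
  · intro h
    exact Series.map_mem_grade _ (h α)

/-- The projection to the homogeneous components. -/
def cotProj (hM : M.IsRhoManifold) (V : Opens X) (j : G) :
    (M.cotangent i).sec V →ₗ[K] (M.cotangent i).sec V where
  toFun f := cotMk hM (fun α => Series.proj j (f.1 α)) {j}
    (fun α w hw => Finset.mem_singleton.2 (Series.proj_mem j _ w hw))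
    (fun α β W hα hβ => by
      rw [(Series.map_gradePreserving _).proj, (Series.map_gradePreserving _).proj,
        (transition_gradePreserving hM α β _ _).proj, transition_cotSec hM])
  map_add' f g := Subtype.ext (funext fun α => map_add (Series.proj j) _ _)
  map_smul' c f := Subtype.ext (funext fun α => map_smul (Series.proj j) c _)

/-- The set of degrees in the definition of `cotSec` is uniform over all charts, so that finitely
many projections add up to the section. -/
lemma cot_isInternal [DecidableEq G] (hM : M.IsRhoManifold) (V : Opens X) :
    DirectSum.IsInternal ((M.cotangent i).grade V) := by
  refine isInternal_of_proj (cotProj hM V) (fun j f α => Series.proj_mem j _)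
    (fun j f hf => Subtype.ext (funext fun α => Series.proj_of_mem (hf α)))
    (fun j k hk f hf => Subtype.ext (funext fun α => Series.proj_of_mem_ne hk (hf α)))
    (fun f => ?_)
  obtain ⟨S, hS⟩ := f.2.1
  refine ⟨S, Subtype.ext (funext fun α => ?_)⟩
  have e := map_sum ((Pi.evalAlgHom K _ α).comp (M.cotSec i V).val) (fun j => cotProj hM V j f) S
  exact e.trans (Series.sum_proj (hS α))

lemma cot_glue (hM : M.IsRhoManifold) (j : G) {T : Type*} (U : T → Opens X)
    (f : ∀ t, (M.cotangent i).sec (U t)) (hf : ∀ t, f t ∈ (M.cotangent i).grade (U t) j)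
    (h : ∀ s t, (M.cotangent i).res (inf_le_left : U s ⊓ U t ≤ U s) (f s) =
      (M.cotangent i).res inf_le_right (f t)) :
    ∃! g : (M.cotangent i).sec (⨆ t, U t), g ∈ (M.cotangent i).grade (⨆ t, U t) j ∧
      ∀ t, (M.cotangent i).res (le_iSup U t) g = f t := by
  have hU : ∀ α, (⨆ t, U t) ⊓ M.dom α = ⨆ t, U t ⊓ M.dom α := fun α => iSup_inf_eq _ _
  have h' : ∀ α s t {W : Opens X} (h1 : W ≤ U s ⊓ M.dom α) (h2 : W ≤ U t ⊓ M.dom α),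
      resC h1 ((f s).1 α) = resC h2 ((f t).1 α) := fun α s t W h1 h2 =>
    congrArg (resC (le_inf (le_inf (h1.trans inf_le_left) (h2.trans inf_le_left))
      (h1.trans inf_le_right) : W ≤ U s ⊓ U t ⊓ M.dom α)) (congrArg (fun g => g.1 α) (h s t))
  -- Gluing is done in each chart separately; the compatibility of the results is then verified
  -- locally, where they coincide with some `f t`.
  choose g hg hgf using fun α => Model.exists_glue (fun t => U t ⊓ M.dom α) j (fun t => (f t).1 α)
    (fun t => hf t α) (fun s t => h' α s t _ _)
  have hgf' : ∀ α t {W : Opens X} (h1 : W ≤ U t ⊓ M.dom α)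
      (h2 : W ≤ (⨆ t, U t) ⊓ M.dom α),
      resC h2 (resC (hU α).le (g α)) = resC h1 ((f t).1 α) := fun α t W h1 h2 =>
    congrArg (resC h1) (hgf α t)
  refine ⟨cotMk hM (fun α => resC (hU α).le (g α)) {j} (fun α w hw => Finset.mem_singleton.2
    (Series.map_mem_grade _ (hg α) w hw)) (fun α β W hα hβ => Model.ext_of_res fun p hp => ?_),
    ⟨fun α => Series.map_mem_grade _ (hg α), fun t => Subtype.ext (funext fun α =>
      hgf' α t le_rfl _)⟩, fun g' hg' => Subtype.ext (funext fun α => Model.ext_of_res fun p hp => ?_)⟩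
  · obtain ⟨t, ht⟩ := Opens.mem_iSup.1 (hα hp).1
    refine ⟨W ⊓ U t, inf_le_left, ⟨hp, ht⟩, ?_⟩
    have hα' : W ⊓ U t ≤ U t ⊓ M.dom α :=
      le_inf inf_le_right (inf_le_left.trans (hα.trans inf_le_right))
    have hβ' : W ⊓ U t ≤ U t ⊓ M.dom β :=
      le_inf inf_le_right (inf_le_left.trans (hβ.trans inf_le_right))
    rw [res_transition hM]
    have e1 := hgf' β t hβ' (inf_le_left.trans hβ)
    have e2 := hgf' α t hα' (inf_le_left.trans hα)
    have e3 := transition_cotSec hM (f t) α β hα' hβ'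
    rw [← e1, ← e2] at e3
    exact e3
  · obtain ⟨t, ht⟩ := Opens.mem_iSup.1 hp.1
    refine ⟨U t ⊓ M.dom α, inf_le_inf_right _ (le_iSup U t), ⟨ht, hp.2⟩, ?_⟩
    exact (congrArg (fun g => g.1 α) (hg'.2 t)).trans (hgf' α t le_rfl _).symm

/-- The shifted cotangent bundle of a `ρ`-manifold is a `ρ`-manifold. -/
theorem isRhoManifold_cotangent (hM : M.IsRhoManifold) (i : G) :
    (M.cotangent i).IsRhoManifold where
  cover := hM.cover
  isInternal V := by
    classical
    exact cot_isInternal hM V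
  glue j _ U f hf h := cot_glue hM j U f hf h
  bijective := cot_bijective hM
  expr_mem_iff := cot_expr_mem_iff hM

end RhoSpace

/-! ### Calculus on the cotangent bundle -/

namespace Series

variable {G K : Type*} [AddCommGroup G] [RCLike K] {ρ : CommutationFactor G K}
variable {ι : Type*} [Fintype ι] [LinearOrder ι] {d : ι → G} {n : ℕ} {i : G}
variable {R : Type*} [CommRing R] [Algebra K R]

lemma incl_monomial (v : ι →₀ ℕ) (s : R) :
    incl (n := n) i (monomial v s : Series ρ d R) = monomial (joinExp v 0) s :=
  ext_slices fun u v' => by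
    classical
    rw [coeff_incl, coeff_monomial, basePart_joinExp, coeff_monomial, isGood_joinExp]
    by_cases hu : u = 0
    · subst hu
      rw [if_pos ((noFibre_joinExp v' 0).2 rfl)]
      by_cases h : v' = v
      · subst h
        by_cases hg : IsGood ρ d v'
        · rw [if_pos ⟨rfl, hg⟩, if_pos ⟨rfl, hg, isGood_zero'⟩]
        · rw [if_neg fun h => hg h.2, if_neg fun h => hg h.2.1]
      · rw [if_neg fun h' => h h'.1, if_neg]
        rintro ⟨h', -⟩
        exact h (by rw [← basePart_joinExp v' (0 : CoordIdx n ι →₀ ℕ), h', basePart_joinExp])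
    · rw [if_neg fun h => hu ((noFibre_joinExp v' u).1 h), if_neg]
      rintro ⟨h, -⟩
      exact hu (by rw [← fibrePart_joinExp v' u, h, fibrePart_joinExp])

lemma joinExp_single_zero (b : ι) : joinExp (Finsupp.single b 1) (0 : CoordIdx n ι →₀ ℕ) =
    Finsupp.single (toLex (Sum.inl b)) 1 := Finsupp.ext fun c => by
  classical
  obtain ⟨c | c, rfl⟩ := toLex.surjective c
  · simp [Finsupp.single_apply]
  · simp

lemma incl_X (b : ι) : incl (n := n) i (X b : Series ρ d R) = X (toLex (Sum.inl b)) := by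
  rw [X, incl_monomial, joinExp_single_zero]
  rfl

/-- The sign involves only the indeterminates before `x_b`, and the linear coordinates come after
the base ones. -/
lemma pdSign_joinExp (b : ι) (v : ι →₀ ℕ) :
    pdSign ρ (cotDeg d n i) (toLex (Sum.inl b)) (joinExp v 0) = pdSign ρ d b v := by
  unfold pdSign
  rw [← Equiv.prod_comp (toLex : ι ⊕ CoordIdx n ι ≃ CotIdx n ι), Fintype.prod_sum_type]
  have h1 : ∀ a : CoordIdx n ι, ¬ (toLex (Sum.inr a) : CotIdx n ι) < toLex (Sum.inl b) :=
    fun a => Sum.Lex.not_inr_lt_inl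
  simp only [h1, if_false, Finset.prod_const_one, mul_one, Sum.Lex.inl_lt_inl_iff, joinExp_inl]
  rfl

lemma pd_incl (b : ι) (f : Series ρ d R) :
    pd (toLex (Sum.inl b)) (incl (n := n) i f) = incl i (pd b f) := ext_slices fun u v => by
  classical
  have e : joinExp v u + Finsupp.single (toLex (Sum.inl b)) 1 =
      joinExp (v + Finsupp.single b 1) u := by
    rw [← joinExp_single_zero, ← joinExp_add, add_zero]
  rw [coeff_pd, e, coeff_incl, coeff_incl, basePart_joinExp, basePart_joinExp, coeff_pd]
  by_cases hu : u = 0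
  · subst hu
    rw [if_pos ((noFibre_joinExp _ _).2 rfl), if_pos ((noFibre_joinExp _ _).2 rfl), pdSign_joinExp]
    rfl
  · rw [if_neg fun h => hu ((noFibre_joinExp _ u).1 h), if_neg fun h => hu ((noFibre_joinExp _ u).1 h),
      smul_zero]

lemma pd_fibre_incl (a : CoordIdx n ι) (f : Series ρ d R) :
    pd (toLex (Sum.inr a)) (incl (n := n) i f) = 0 := ext fun w => by
  classical
  rw [coeff_pd, coeff_incl, if_neg, smul_zero, coeff_zero]
  intro h
  have := h a
  rw [Finsupp.add_apply, Finsupp.single_eq_same] at this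
  omega

end Series

/-! ### Coordinates, partial derivatives and pullback on the cotangent bundle -/

section Cotangent

universe u v w

variable {G K : Type*} [AddCommGroup G] [RCLike K]
variable {𝕜 : Type*} [RCLike 𝕜] [NormedAlgebra 𝕜 K] {n : ℕ} {r : Regularity}
variable {X : Type u} [TopologicalSpace X] [ChartedSpace (EuclideanSpace 𝕜 (Fin n)) X]
variable {ρ : CommutationFactor G K}
variable {ι : Type*} [Fintype ι] [LinearOrder ι] {d : ι → G}
variable {i : G}

lemma coordDeg_baseIdx (a : CoordIdx n ι) :
    coordDeg n (cotDeg d n i) (baseIdx a) = coordDeg n d a := by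
  obtain ⟨a | a, rfl⟩ := toLex.surjective a <;> rfl

lemma coordDeg_fibreIdx (a : CoordIdx n ι) :
    coordDeg n (cotDeg d n i) (fibreIdx a) = -coordDeg n d a - i := rfl

/-- The coordinates of the cotangent bundle. -/
def cotIdxEquiv : CoordIdx n ι ⊕ CoordIdx n ι ≃ CoordIdx n (CotIdx n ι) where
  toFun := Sum.elim baseIdx fibreIdx
  invFun c := Sum.elim (fun k => Sum.inl (toLex (Sum.inl k)))
    (fun b => Sum.map (fun b => toLex (Sum.inr b)) id (ofLex b)) (ofLex c)
  left_inv := by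
    rintro (a | a)
    · obtain ⟨a | a, rfl⟩ := toLex.surjective a <;> rfl
    · rfl
  right_inv c := by
    obtain ⟨c | c, rfl⟩ := toLex.surjective c
    · rfl
    · obtain ⟨c | c, rfl⟩ := toLex.surjective c <;> rfl

lemma sum_cotIdx {B : Type*} [AddCommMonoid B] (φ : CoordIdx n (CotIdx n ι) → B) :
    ∑ c, φ c = ∑ a, φ (baseIdx a) + ∑ a, φ (fibreIdx a) := by
  rw [← Equiv.sum_comp cotIdxEquiv, Fintype.sum_sum_type]
  rfl

lemma forall_cotIdx {P : CoordIdx n (CotIdx n ι) → Prop} (h0 : ∀ a, P (baseIdx a))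
    (h1 : ∀ a, P (fibreIdx a)) (c) : P c := by
  obtain ⟨c | c, rfl⟩ := cotIdxEquiv.surjective c
  · exact h0 c
  · exact h1 c

lemma fibreIdx_injective : Injective (fibreIdx : CoordIdx n ι → CoordIdx n (CotIdx n ι)) :=
  cotIdxEquiv.injective.comp Sum.inr_injective

lemma baseIdx_ne_fibreIdx (a b : CoordIdx n ι) :
    (baseIdx a : CoordIdx n (CotIdx n ι)) ≠ fibreIdx b :=
  fun h => Sum.inl_ne_inr (cotIdxEquiv.injective (a₁ := Sum.inl a) (a₂ := Sum.inr b) h)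

namespace Model

variable {e : OpenPartialHomeomorph X (EuclideanSpace 𝕜 (Fin n))}
variable (he : e ∈ IsManifold.maximalAtlas 𝓘(𝕜, EuclideanSpace 𝕜 (Fin n)) r.order X)

lemma incl_coord (W : Opens X) (hW : (W : Set X) ⊆ e.source) (a : CoordIdx n ι) :
    Series.incl i (coord he W hW a : Model 𝕜 n r ρ d W) = coord he W hW (baseIdx a) := by
  obtain ⟨a | a, rfl⟩ := toLex.surjective a
  · refine (Series.incl_monomial (ρ := ρ) (d := d) (n := n) (i := i) 0
      (bodyCoord he W hW a : bodyFun 𝕜 K n r W)).trans ?_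
    have e : joinExp (0 : ι →₀ ℕ) (0 : CoordIdx n ι →₀ ℕ) = 0 := Finsupp.ext fun c => by
      obtain ⟨c | c, rfl⟩ := toLex.surjective c <;> rfl
    rw [e]
    rfl
  · exact Series.incl_X a

lemma pd_incl {W : Opens X} (hW : (W : Set X) ⊆ e.source) (a : CoordIdx n ι)
    (f : Model 𝕜 n r ρ d W) :
    pd he hW (baseIdx a) (Series.incl (n := n) i f) = Series.incl i (pd he hW a f) := by
  classical
  obtain ⟨a | a, rfl⟩ := toLex.surjective a
  · refine Series.ext fun w => ?_
    change bodyPdLin he hW a ((Series.incl (n := n) i f).coeff w) = _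
    rw [Series.coeff_incl, Series.coeff_incl]
    split_ifs
    · rfl
    · rw [map_zero]
  · exact Series.pd_incl a f

lemma pd_fibre_incl {W : Opens X} (hW : (W : Set X) ⊆ e.source) (a : CoordIdx n ι)
    (f : Model 𝕜 n r ρ d W) : pd he hW (fibreIdx a) (Series.incl (n := n) i f) = 0 :=
  Series.pd_fibre_incl a f

end Model

namespace RhoSpace

variable {M : RhoSpace.{u, v, w} 𝕜 n r X ρ d}

lemma expr_pullback (hM : M.IsRhoManifold) (i : G) (α : M.Idx) {V : Opens X} (hV : V ≤ M.dom α)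
    (f : M.sec V) :
    (M.cotangent i).expr α V hV (pullback hM i V f) = Series.incl i (M.expr α V hV f) := by
  refine (res_pullbackFun i α (le_inf le_rfl hV) inf_le_right hV (M.res inf_le_left f)).trans ?_
  rw [M.res_res, M.res_self]
  rfl

lemma res_pullback (hM : M.IsRhoManifold) (i : G) {V W : Opens X} (h : W ≤ V) (f : M.sec V) :
    (M.cotangent i).res h (pullback hM i V f) = pullback hM i W (M.res h f) :=
  Subtype.ext (funext fun α => by
    refine (res_pullbackFun i α (inf_le_inf_right _ h) inf_le_right inf_le_right
      (M.res inf_le_left f)).trans ?_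
    rw [M.res_res]
    change M.pullbackFun i α _ _ = M.pullbackFun i α _ (M.res _ (M.res h f))
    rw [M.res_res])

lemma pullback_mul (hM : M.IsRhoManifold) (i : G) {V : Opens X} (f g : M.sec V) :
    pullback hM i V (f * g) = pullback hM i V f * pullback hM i V g :=
  Subtype.ext (funext fun α => by
    change Series.incl i (M.expr α _ _ (M.res _ (f * g))) =
      Series.incl i (M.expr α _ _ (M.res _ f)) * Series.incl i (M.expr α _ _ (M.res _ g))
    rw [map_mul, map_mul, Series.incl_mul])

lemma pullback_one (hM : M.IsRhoManifold) (i : G) {V : Opens X} :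
    pullback hM i V (1 : M.sec V) = 1 :=
  Subtype.ext (funext fun α => by
    change Series.incl i (M.expr α _ _ (M.res _ 1)) = 1
    rw [map_one, map_one, Series.incl_one])

/-- The pullback as a homomorphism of algebras. -/
def pullbackHom (hM : M.IsRhoManifold) (i : G) (V : Opens X) :
    M.sec V →ₐ[K] (M.cotangent i).sec V :=
  AlgHom.ofLinearMap (pullback hM i V) (pullback_one hM i) (pullback_mul hM i)

lemma coordFn_baseIdx (hM : M.IsRhoManifold) (i : G) (α : M.Idx) (a : CoordIdx n ι) :
    (M.cotangent i).coordFn α (baseIdx a) = pullback hM i (M.dom α) (M.coordFn α a) :=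
  (cot_bijective hM α (M.dom α) le_rfl).1 (by
    rw [expr_pullback, expr_coordFn hM, Model.incl_coord]
    exact expr_coordFn (isRhoManifold_cotangent hM i) α (baseIdx a))

lemma pdBase_pullback (hM : M.IsRhoManifold) (i : G) (α : M.Idx) {V : Opens X} (hV : V ≤ M.dom α)
    (a : CoordIdx n ι) (f : M.sec V) :
    (M.cotangent i).pd α hV (baseIdx a) (pullback hM i V f) = pullback hM i V (M.pd α hV a f) :=
  (cot_bijective hM α V hV).1 (by
    refine (expr_pd (isRhoManifold_cotangent hM i) α hV (baseIdx a) _).trans ?_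
    rw [expr_pullback, expr_pullback, expr_pd hM]
    exact Model.pd_incl _ _ _ _)

lemma pdFibre_pullback (hM : M.IsRhoManifold) (i : G) (α : M.Idx) {V : Opens X} (hV : V ≤ M.dom α)
    (a : CoordIdx n ι) (f : M.sec V) :
    (M.cotangent i).pd α hV (fibreIdx a) (pullback hM i V f) = 0 :=
  (cot_bijective hM α V hV).1 (by
    rw [map_zero]
    refine (expr_pd (isRhoManifold_cotangent hM i) α hV (fibreIdx a) _).trans ?_
    rw [expr_pullback]
    exact Model.pd_fibre_incl _ _ _ _)

lemma expr_res_fibreFn (hM : M.IsRhoManifold) (i : G) (α : M.Idx) {V : Opens X} (hV : V ≤ M.dom α)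
    (a : CoordIdx n ι) : (M.cotangent i).expr α V hV ((M.cotangent i).res hV (M.fibreFn i α a)) =
      Series.X (toLex (Sum.inr a)) :=
  expr_res_coordFn (isRhoManifold_cotangent hM i) α hV (fibreIdx a)

lemma fibreFn_mem (hM : M.IsRhoManifold) (i : G) (α : M.Idx) (a : CoordIdx n ι) :
    M.fibreFn i α a ∈ (M.cotangent i).grade (M.dom α) (-coordDeg n d a - i) :=
  coordFn_mem (isRhoManifold_cotangent hM i) α (fibreIdx a)

lemma transition_expr (hM : M.IsRhoManifold) (i : G) (α β : M.Idx) {V : Opens X}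
    (hα : V ≤ M.dom α) (hβ : V ≤ M.dom β) (f : (M.cotangent i).sec V) :
    transition hM i α β hα hβ ((M.cotangent i).expr β V hβ f) = (M.cotangent i).expr α V hα f :=
  transition_cotSec hM f α β (le_inf le_rfl hα) (le_inf le_rfl hβ)

/-- The transformation of the linear coordinates. -/
lemma res_fibreFn (hM : M.IsRhoManifold) (i : G) (α β : M.Idx) {V : Opens X} (hα : V ≤ M.dom α)
    (hβ : V ≤ M.dom β) (a : CoordIdx n ι) : (M.cotangent i).res hβ (M.fibreFn i β a) =
      ∑ b, pullback hM i V (M.jacobian β α hβ hα a b) * (M.cotangent i).res hα (M.fibreFn i α b) :=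
  (cot_bijective hM α V hα).1 (by
    rw [← transition_expr hM i α β hα hβ, expr_res_fibreFn hM, transition_X, map_sum]
    refine Finset.sum_congr rfl fun b _ => ?_
    rw [map_mul, expr_pullback, expr_res_fibreFn hM])

end RhoSpace

end Cotangent

/-! ### The symbol of a vector field -/

namespace RhoSpace

open scoped Matrix

universe u v w

variable {G K : Type*} [AddCommGroup G] [RCLike K]
variable {𝕜 : Type*} [RCLike 𝕜] [NormedAlgebra 𝕜 K] {n : ℕ} {r : Regularity}
variable {X : Type u} [TopologicalSpace X] [ChartedSpace (EuclideanSpace 𝕜 (Fin n)) X]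
variable {ρ : CommutationFactor G K}
variable {ι : Type*} [Fintype ι] [LinearOrder ι] {d : ι → G}
variable {M : RhoSpace.{u, v, w} 𝕜 n r X ρ d} {i q : G}

/-- The restriction of a derivation. -/
def LocalDerivation.restrict {U V : Opens X} (D : M.LocalDerivation U q) (h : V ≤ U) :
    M.LocalDerivation V q where
  app W hW := D.app W (hW.trans h)
  res_app h' hV hW f := D.res_app h' _ _ f
  mem W hW _ _ hf := D.mem W _ hf
  leibniz W hW _ _ g hf := D.leibniz W _ g hf

section

variable {α : M.Idx} {V : Opens X}

lemma pdBase_sum (hM : M.IsRhoManifold) (i : G) (α : M.Idx) (hV : V ≤ M.dom α) (f : CoordIdx n ι → M.sec V)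
    {e : G} (hf : ∀ b, f b ∈ M.grade V (e + coordDeg n d b)) (a : CoordIdx n ι) :
    (M.cotangent i).pd α hV (baseIdx a)
      (∑ b, pullback hM i V (f b) * (M.cotangent i).res hV (M.fibreFn i α b)) =
    ∑ b, pullback hM i V (M.pd α hV a (f b)) * (M.cotangent i).res hV (M.fibreFn i α b) := by
  have hC := isRhoManifold_cotangent hM i
  refine (map_sum (pdLin hC α hV (baseIdx a)) _ _).trans ?_
  refine Finset.sum_congr rfl fun b _ => ?_
  refine (pd_mul hC α hV (baseIdx a) (pullback_mem hM i (hf b)) _).trans ?_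
  have h0 : (M.cotangent i).pd α hV (baseIdx a) ((M.cotangent i).res hV (M.fibreFn i α b)) = 0 :=
    (pd_coordFn hC α hV (baseIdx a) (fibreIdx b)).trans (if_neg (baseIdx_ne_fibreIdx a b).symm)
  rw [h0, mul_zero, smul_zero, add_zero, pdBase_pullback hM]

/-- The sign arises from moving `∂/∂x_a^*`, of degree `|x^a| + i`, past the coefficient. The offset
`e` allows for components of vector fields, their derivatives and the rows of Jacobian matrices
alike. -/
lemma pdFibre_sum (hM : M.IsRhoManifold) (i : G) (α : M.Idx) (hV : V ≤ M.dom α) (f : CoordIdx n ι → M.sec V)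
    {e : G} (hf : ∀ b, f b ∈ M.grade V (e + coordDeg n d b)) (a : CoordIdx n ι) :
    (M.cotangent i).pd α hV (fibreIdx a)
      (∑ b, pullback hM i V (f b) * (M.cotangent i).res hV (M.fibreFn i α b)) =
    ρ (coordDeg n d a + i) (e + coordDeg n d a) • pullback hM i V (f a) := by
  classical
  have hC := isRhoManifold_cotangent hM i
  refine (map_sum (pdLin hC α hV (fibreIdx a)) _ _).trans ?_
  have h : ∀ b, pdLin hC α hV (fibreIdx a)
      (pullback hM i V (f b) * (M.cotangent i).res hV (M.fibreFn i α b)) =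
      if b = a then ρ (coordDeg n d a + i) (e + coordDeg n d a) • pullback hM i V (f a) else 0 := by
    intro b
    refine (pd_mul hC α hV (fibreIdx a) (pullback_mem hM i (hf b)) _).trans ?_
    have h0 : (M.cotangent i).pd α hV (fibreIdx a) ((M.cotangent i).res hV (M.fibreFn i α b)) =
        if fibreIdx b = fibreIdx a then 1 else 0 := pd_coordFn hC α hV (fibreIdx a) (fibreIdx b)
    rw [h0, pdFibre_pullback hM, zero_mul, zero_add]
    by_cases hb : b = a
    · subst hb
      rw [if_pos rfl, if_pos rfl, mul_one, coordDeg_fibreIdx,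
        show -(-coordDeg n d b - i) = coordDeg n d b + i by abel]
    · rw [if_neg hb, if_neg fun h => hb (fibreIdx_injective h), mul_zero, smul_zero]
  rw [Finset.sum_congr rfl fun b _ => h b, Finset.sum_ite_eq' Finset.univ a, if_pos (Finset.mem_univ _)]

end

lemma pullback_jacobian_mul (hM : M.IsRhoManifold) (i : G) (α β : M.Idx) {V : Opens X}
    (hα : V ≤ M.dom α) (hβ : V ≤ M.dom β) :
    (M.jacobian α β hα hβ).map (pullback hM i V) * (M.jacobian β α hβ hα).map (pullback hM i V) = 1 := by
  have h := jacobian_mul_jacobian hM α β α hα hβ hα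
  rw [jacobian_self hM] at h
  have h2 := congrArg (fun A => A.map (pullbackHom hM i V)) h
  simp only [Matrix.map_mul] at h2
  refine h2.trans (Matrix.map_one _ (map_zero _) (map_one _))

/-- The local expression of the symbol. -/
def symbolFun (hM : M.IsRhoManifold) (i : G) (Q : M.VectorField q) (α : M.Idx) :
    (M.cotangent i).sec (M.dom α) :=
  ∑ a, pullback hM i _ (Q.comp α a) * M.fibreFn i α a

lemma res_symbolFun (hM : M.IsRhoManifold) (i : G) (Q : M.VectorField q) (α : M.Idx) {V : Opens X}
    (hV : V ≤ M.dom α) : (M.cotangent i).res hV (symbolFun hM i Q α) =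
      ∑ a, pullback hM i _ (M.res hV (Q.comp α a)) * (M.cotangent i).res hV (M.fibreFn i α a) := by
  rw [symbolFun, map_sum]
  refine Finset.sum_congr rfl fun a _ => ?_
  rw [map_mul, res_pullback]

lemma symbolFun_mem (hM : M.IsRhoManifold) (i : G) (Q : M.VectorField q) (α : M.Idx) :
    symbolFun hM i Q α ∈ (M.cotangent i).grade (M.dom α) (q - i) :=
  Submodule.sum_mem _ fun a _ => by
    have h := (M.cotangent i).mul_mem (pullback_mem hM i (Q.comp_mem hM α a)) (fibreFn_mem hM i α a)
    rwa [show q + coordDeg n d a + (-coordDeg n d a - i) = q - i by abel] at h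

/-- The components transform by the Jacobian matrix and the `x_a^*` by its inverse, so the
contraction is invariant. -/
lemma symbolFun_compat (hM : M.IsRhoManifold) (i : G) (Q : M.VectorField q) (α β : M.Idx)
    {V : Opens X} (hα : V ≤ M.dom α) (hβ : V ≤ M.dom β) :
    (M.cotangent i).res hα (symbolFun hM i Q α) = (M.cotangent i).res hβ (symbolFun hM i Q β) := by
  classical
  rw [res_symbolFun, res_symbolFun]
  have e1 : ∀ a, pullback hM i V (M.res hβ (Q.comp β a)) =
      ((fun b => pullback hM i V (M.res hα (Q.comp α b))) ᵥ*
        (M.jacobian α β hα hβ).map (pullback hM i V)) a := fun a => by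
    rw [Q.res_comp hM α β hα hβ, map_sum]
    exact Finset.sum_congr rfl fun b _ => pullback_mul hM i _ _
  have e2 : ∀ a, (M.cotangent i).res hβ (M.fibreFn i β a) =
      ((M.jacobian β α hβ hα).map (pullback hM i V) *ᵥ
        fun b => (M.cotangent i).res hα (M.fibreFn i α b)) a := fun a =>
    res_fibreFn hM i α β hα hβ a
  simp only [e1, e2]
  change _ = (_ ᵥ* _) ⬝ᵥ (_ *ᵥ _)
  rw [← Matrix.dotProduct_mulVec, Matrix.mulVec_mulVec, pullback_jacobian_mul, Matrix.one_mulVec]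
  rfl

theorem existsUnique_isSymbol (hM : M.IsRhoManifold) (i : G) (Q : M.VectorField q) :
    ∃! F, IsSymbol hM i Q F := by
  have hC := isRhoManifold_cotangent hM i
  obtain ⟨F, hF, hF'⟩ := hC.exists_glue (symbolFun hM i Q) (symbolFun_mem hM i Q)
    (fun α β => symbolFun_compat hM i Q α β _ _)
  refine ⟨F, ⟨hF, hF'⟩, fun F' h => hC.ext_top fun α => ?_⟩
  exact (h.2 α).trans (hF' α).symm

/-! ### The Hamiltonian vector field of the symbol -/

/-- The components of the Hamiltonian vector field. -/
def hamComp (hM : M.IsRhoManifold) (i : G) (Q : M.VectorField q) (α : M.Idx)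
    (c : CoordIdx n (CotIdx n ι)) : (M.cotangent i).sec (M.dom α) :=
  Sum.elim (fun a => pullback hM i _ (Q.comp α a))
    (fun a => -(ρ (coordDeg n d a) q • ∑ b, pullback hM i _ (M.pd α le_rfl a (Q.comp α b)) *
      M.fibreFn i α b)) (cotIdxEquiv.symm c)

lemma hamComp_baseIdx (hM : M.IsRhoManifold) (i : G) (Q : M.VectorField q) (α : M.Idx)
    (a : CoordIdx n ι) : hamComp hM i Q α (baseIdx a) = pullback hM i _ (Q.comp α a) := by
  rw [hamComp, show cotIdxEquiv.symm (baseIdx a) = Sum.inl a from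
    cotIdxEquiv.symm_apply_apply (Sum.inl a)]
  rfl

lemma hamComp_fibreIdx (hM : M.IsRhoManifold) (i : G) (Q : M.VectorField q) (α : M.Idx)
    (a : CoordIdx n ι) : hamComp hM i Q α (fibreIdx a) = -(ρ (coordDeg n d a) q •
      ∑ b, pullback hM i _ (M.pd α le_rfl a (Q.comp α b)) * M.fibreFn i α b) := by
  rw [hamComp, show cotIdxEquiv.symm (fibreIdx a) = Sum.inr a from
    cotIdxEquiv.symm_apply_apply (Sum.inr a)]
  rfl

lemma hamComp_mem (hM : M.IsRhoManifold) (i : G) (Q : M.VectorField q) (α : M.Idx)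
    (c : CoordIdx n (CotIdx n ι)) : hamComp hM i Q α c ∈
      (M.cotangent i).grade (M.dom α) (q + coordDeg n (cotDeg d n i) c) := by
  refine forall_cotIdx (P := fun c => hamComp hM i Q α c ∈
    (M.cotangent i).grade (M.dom α) (q + coordDeg n (cotDeg d n i) c)) (fun a => ?_) (fun a => ?_) c
  · rw [hamComp_baseIdx, coordDeg_baseIdx]
    exact pullback_mem hM i (Q.comp_mem hM α a)
  · rw [hamComp_fibreIdx, coordDeg_fibreIdx]
    refine neg_mem (Submodule.smul_mem _ _ (Submodule.sum_mem _ fun b _ => ?_))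
    have h := (M.cotangent i).mul_mem (pullback_mem hM i (pd_mem hM α le_rfl a (Q.comp_mem hM α b)))
      (fibreFn_mem hM i α b)
    rwa [show -coordDeg n d a + (q + coordDeg n d b) + (-coordDeg n d b - i) =
      q + (-coordDeg n d a - i) by abel] at h

lemma res_hamComp_fibreIdx (hM : M.IsRhoManifold) (i : G) (Q : M.VectorField q) (α : M.Idx)
    {V : Opens X} (hV : V ≤ M.dom α) (a : CoordIdx n ι) :
    (M.cotangent i).res hV (hamComp hM i Q α (fibreIdx a)) = -(ρ (coordDeg n d a) q •
      ∑ b, pullback hM i V (M.pd α hV a (M.res hV (Q.comp α b))) *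
        (M.cotangent i).res hV (M.fibreFn i α b)) := by
  rw [hamComp_fibreIdx, map_neg, map_smul, map_sum]
  congr 2
  refine Finset.sum_congr rfl fun b _ => ?_
  rw [map_mul, res_pullback, res_pd hM α hV le_rfl hV]

/-- The Hamiltonian vector field over `U_α`. -/
def hamLocal (hM : M.IsRhoManifold) (i : G) (Q : M.VectorField q) (α : M.Idx) :
    (M.cotangent i).LocalDerivation (M.dom α) q :=
  LocalDerivation.ofComponents (isRhoManifold_cotangent hM i) α le_rfl (hamComp hM i Q α)
    (hamComp_mem hM i Q α)

lemma hamLocal_app (hM : M.IsRhoManifold) (i : G) (Q : M.VectorField q) (α : M.Idx) {V : Opens X}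
    (hV : V ≤ M.dom α) (g : (M.cotangent i).sec V) : (hamLocal hM i Q α).app V hV g =
      ∑ a, pullback hM i V (M.res hV (Q.comp α a)) * (M.cotangent i).pd α hV (baseIdx a) g -
      ∑ a, ρ (coordDeg n d a) q • ((∑ b, pullback hM i V (M.pd α hV a (M.res hV (Q.comp α b))) *
        (M.cotangent i).res hV (M.fibreFn i α b)) * (M.cotangent i).pd α hV (fibreIdx a) g) := by
  refine (LocalDerivation.ofComponents_app (isRhoManifold_cotangent hM i) α le_rfl
    (hamComp hM i Q α) (hamComp_mem hM i Q α) V hV g).trans ?_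
  rw [sum_cotIdx, sub_eq_add_neg, ← Finset.sum_neg_distrib]
  refine congrArg₂ _ (Finset.sum_congr rfl fun a _ => ?_) (Finset.sum_congr rfl fun a _ => ?_)
  · exact congrArg (· * _) ((congrArg _ (hamComp_baseIdx hM i Q α a)).trans (res_pullback hM i hV _))
  · refine (congrArg (· * _) (res_hamComp_fibreIdx hM i Q α hV a)).trans ?_
    exact (neg_mul _ _).trans (congrArg Neg.neg (smul_mul_assoc _ _ _))

/-- The Schouten bracket with the symbol. -/
lemma schouten_symbol (hM : M.IsRhoManifold) {Q : M.VectorField q} {F : (M.cotangent i).sec ⊤}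
    (hF : IsSymbol hM i Q F) (α : M.Idx) {V : Opens X} (hV : V ≤ M.dom α)
    (g : (M.cotangent i).sec V) : M.schouten i α hV (q - i) ((M.cotangent i).res le_top F) g =
      (hamLocal hM i Q α).app V hV g := by
  have e : (M.cotangent i).res (le_top : V ≤ ⊤) F = ∑ b, pullback hM i V (M.res hV (Q.comp α b)) *
      (M.cotangent i).res hV (M.fibreFn i α b) := by
    rw [← res_symbolFun hM i Q α hV, symbolFun, ← hF.2 α, (M.cotangent i).res_res]
  have hm : ∀ b, M.res hV (Q.comp α b) ∈ M.grade V (q + coordDeg n d b) :=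
    fun b => M.res_mem hV (Q.comp_mem hM α b)
  rw [hamLocal_app, schouten, ← Finset.sum_sub_distrib, e]
  refine Finset.sum_congr rfl fun a _ => ?_
  -- The sign in the Schouten bracket is inverse to that of `pdFibre_sum`, and the second sign
  -- becomes `ρ(|x^a|, q)`.
  rw [pdFibre, pdBase, pdBase, pdFibre, pdFibre_sum hM i α hV _ hm, pdBase_sum hM i α hV _ hm,
    smul_mul_assoc, smul_smul, sub_add_cancel,
    show q - i + coordDeg n d a + i = q + coordDeg n d a by abel, ρ.mul_swap, one_smul]

section

variable {V : Opens X}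

lemma hamLocal_pullback (hM : M.IsRhoManifold) (i : G) (Q : M.VectorField q) (α : M.Idx)
    (hV : V ≤ M.dom α) (f : M.sec V) :
    (hamLocal hM i Q α).app V hV (pullback hM i V f) = pullback hM i V (Q.app V f) := by
  rw [hamLocal_app, Q.app_eq_sum hM α hV, map_sum, sub_eq_self.2]
  · refine Finset.sum_congr rfl fun a _ => ?_
    rw [pdBase_pullback, pullback_mul]
  · refine Finset.sum_eq_zero fun a _ => ?_
    rw [pdFibre_pullback, mul_zero, smul_zero]

lemma hamLocal_fibreFn (hM : M.IsRhoManifold) (i : G) (Q : M.VectorField q) (α : M.Idx)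
    (hV : V ≤ M.dom α) (a : CoordIdx n ι) :
    (hamLocal hM i Q α).app V hV ((M.cotangent i).res hV (M.fibreFn i α a)) =
      -(ρ (coordDeg n d a) q • ∑ b, pullback hM i V (M.pd α hV a (M.res hV (Q.comp α b))) *
        (M.cotangent i).res hV (M.fibreFn i α b)) := by
  classical
  have hC := isRhoManifold_cotangent hM i
  have h0 : ∀ b, (M.cotangent i).pd α hV (baseIdx b) ((M.cotangent i).res hV (M.fibreFn i α a)) = 0 :=
    fun b => (pd_coordFn hC α hV (baseIdx b) (fibreIdx a)).trans (if_neg (baseIdx_ne_fibreIdx b a).symm)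
  have h1 : ∀ b, (M.cotangent i).pd α hV (fibreIdx b) ((M.cotangent i).res hV (M.fibreFn i α a)) =
      if fibreIdx a = fibreIdx b then 1 else 0 :=
    fun b => pd_coordFn hC α hV (fibreIdx b) (fibreIdx a)
  rw [hamLocal_app, Finset.sum_eq_zero fun b _ => by rw [h0, mul_zero], zero_sub,
    Finset.sum_eq_single a]
  · rw [h1, if_pos rfl, mul_one]
  · intro b _ hb
    rw [h1, if_neg fun h => hb (fibreIdx_injective h).symm, mul_zero, smul_zero]
  · simp

/-- A linear function `∑ f_b x_b^*` stands for the vector field `∑ f_b ∂_b`, and the coefficients on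
the right are the components of its commutator with `Q`. Changes of coordinates and the square of
the Hamiltonian field are both computed from this. -/
lemma hamLocal_sum (hM : M.IsRhoManifold) (i : G) (Q : M.VectorField q) (α : M.Idx)
    (hV : V ≤ M.dom α) (f : CoordIdx n ι → M.sec V) {e : G}
    (hf : ∀ b, f b ∈ M.grade V (e + coordDeg n d b)) :
    (hamLocal hM i Q α).app V hV
      (∑ b, pullback hM i V (f b) * (M.cotangent i).res hV (M.fibreFn i α b)) =
    ∑ c, pullback hM i V (Q.app V (f c) -
      ρ q e • ∑ b, f b * M.pd α hV b (M.res hV (Q.comp α c))) *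
        (M.cotangent i).res hV (M.fibreFn i α c) := by
  rw [map_sum]
  have h : ∀ b, (hamLocal hM i Q α).app V hV
      (pullback hM i V (f b) * (M.cotangent i).res hV (M.fibreFn i α b)) =
      pullback hM i V (Q.app V (f b)) * (M.cotangent i).res hV (M.fibreFn i α b) -
        ρ q e • ∑ c, pullback hM i V (f b * M.pd α hV b (M.res hV (Q.comp α c))) *
          (M.cotangent i).res hV (M.fibreFn i α c) := fun b => by
    rw [(hamLocal hM i Q α).leibniz V hV _ (pullback_mem hM i (hf b)), hamLocal_pullback,
      hamLocal_fibreFn, mul_neg, smul_neg, ← sub_eq_add_neg, mul_smul_comm, smul_smul,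
      ρ.add_right, mul_assoc, ρ.mul_swap, mul_one, Finset.mul_sum]
    congr 2
    refine Finset.sum_congr rfl fun c _ => ?_
    rw [pullback_mul, mul_assoc]
  rw [Finset.sum_congr rfl fun b _ => h b, Finset.sum_sub_distrib, ← Finset.smul_sum,
    Finset.sum_comm]
  simp only [map_sub, map_smul, map_sum, sub_mul, smul_mul_assoc, Finset.sum_mul,
    Finset.sum_sub_distrib, Finset.smul_sum]

/-- The local vector fields agree on the overlaps. -/
lemma hamLocal_compat (hM : M.IsRhoManifold) (i : G) (Q : M.VectorField q) (α β : M.Idx)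
    (hα : V ≤ M.dom α) (hβ : V ≤ M.dom β) (f : (M.cotangent i).sec V) :
    (hamLocal hM i Q α).app V hα f = (hamLocal hM i Q β).app V hβ f := by
  have hC := isRhoManifold_cotangent hM i
  have h := (((hamLocal hM i Q α).restrict hα).sub ((hamLocal hM i Q β).restrict hβ)).app_eq_zero
    hC β hβ (forall_cotIdx (fun a => ?_) (fun a => ?_)) V le_rfl f
  · exact sub_eq_zero.1 h
  · have e : (M.cotangent i).res hβ ((M.cotangent i).coordFn β (baseIdx a)) =
        pullback hM i V (M.res hβ (M.coordFn β a)) := by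
      rw [coordFn_baseIdx hM, res_pullback]
    exact sub_eq_zero.2 ((congrArg ((hamLocal hM i Q α).app V hα) e).trans
      ((hamLocal_pullback hM i Q α hα _).trans ((hamLocal_pullback hM i Q β hβ _).symm.trans
        (congrArg ((hamLocal hM i Q β).app V hβ) e.symm))))
  · refine sub_eq_zero.2 ?_
    change (hamLocal hM i Q α).app V hα ((M.cotangent i).res hβ (M.fibreFn i β a)) =
      (hamLocal hM i Q β).app V hβ ((M.cotangent i).res hβ (M.fibreFn i β a))
    rw [hamLocal_fibreFn, res_fibreFn hM i α β hα hβ, hamLocal_sum hM i Q α hα _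
      (fun b => jacobian_mem hM β α hβ hα a b)]
    -- Both sides are the component along `∂/∂x^c` of the commutator of `Q` and `∂/∂y^a`, computed
    -- in the coordinates `x` and in the coordinates `y`.
    have e : ∀ c, Q.app V (M.jacobian β α hβ hα a c) - ρ q (-coordDeg n d a) •
        ∑ b, M.jacobian β α hβ hα a b * M.pd α hα b (M.res hα (Q.comp α c)) =
        -(ρ (coordDeg n d a) q • ∑ b, M.pd β hβ a (M.res hβ (Q.comp β b)) *
          M.jacobian β α hβ hα b c) := fun c => by
      rw [← pd_eq_sum_jacobian hM β α hβ hα a, jacobian_apply, Q.app_pd hM β hβ, Q.app_res,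
        smul_sub, show M.res hα (Q.app _ (M.coordFn α c)) = M.res hα (Q.comp α c) from rfl,
        sub_sub_cancel_left, ρ.neg_right, ← ρ.swap q]
      rfl
    rw [Finset.sum_congr rfl fun c _ => by rw [e c]]
    simp only [res_fibreFn hM i α β hα hβ, map_neg, map_smul, map_sum, neg_mul, smul_mul_assoc,
      Finset.sum_mul, Finset.mul_sum, Finset.sum_neg_distrib, Finset.smul_sum, pullback_mul, mul_assoc]
    rw [Finset.sum_comm]

end

end RhoSpace

/-! ### Gluing local derivations; existence and square of the Hamiltonian field -/

namespace RhoSpace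

universe u v w

variable {G K : Type*} [AddCommGroup G] [RCLike K]
variable {𝕜 : Type*} [RCLike 𝕜] [NormedAlgebra 𝕜 K] {n : ℕ} {r : Regularity}
variable {X : Type u} [TopologicalSpace X] [ChartedSpace (EuclideanSpace 𝕜 (Fin n)) X]
variable {ρ : CommutationFactor G K}
variable {ι : Type*} [Fintype ι] [LinearOrder ι] {d : ι → G}
variable {M : RhoSpace.{u, v, w} 𝕜 n r X ρ d} {i q : G}

section Glue

variable (D : ∀ α : M.Idx, (M.cotangent i).LocalDerivation (M.dom α) q)

lemma sum_cotProj (hM : M.IsRhoManifold) {V : Opens X} (f : (M.cotangent i).sec V) {S : Finset G}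
    (hS : ∀ α w, (f.1 α).coeff w ≠ 0 → wdeg (cotDeg d n i) w ∈ S) :
    ∑ j ∈ S, cotProj hM V j f = f := Subtype.ext (funext fun α => by
  have e := map_sum ((Pi.evalAlgHom K _ α).comp (M.cotSec i V).val) (fun j => cotProj hM V j f) S
  exact e.trans (Series.sum_proj (hS α)))

lemma cotProj_mem (hM : M.IsRhoManifold) {V : Opens X} (f : (M.cotangent i).sec V) (j : G) :
    cotProj hM V j f ∈ (M.cotangent i).grade V j := fun α => Series.proj_mem j _

/-- The expression of the derivative of a section. -/
def glueFun {V : Opens X} (f : (M.cotangent i).sec V) (α : M.Idx) :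
    Model 𝕜 n r ρ (cotDeg d n i) (V ⊓ M.dom α) :=
  (M.cotangent i).expr α (V ⊓ M.dom α) inf_le_right
    ((D α).app (V ⊓ M.dom α) inf_le_right ((M.cotangent i).res inf_le_left f))

variable {D}

/-- The local derivations all raise degrees by `q`, so the finite set of degrees of the section,
shifted by `q`, works in every chart. -/
lemma exists_glueFun_degrees (hM : M.IsRhoManifold) {V : Opens X} (f : (M.cotangent i).sec V) :
    ∃ T : Finset G, ∀ (α : M.Idx) (w : CotIdx n ι →₀ ℕ), (glueFun D f α).coeff w ≠ 0 →
      wdeg (cotDeg d n i) w ∈ T := by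
  classical
  obtain ⟨S, hS⟩ := f.2.1
  refine ⟨S.image (q + ·), fun α w hw => ?_⟩
  have e : glueFun D f α = ∑ j ∈ S, glueFun D (cotProj hM V j f) α := by
    conv_lhs => rw [← sum_cotProj hM f hS]
    simp only [glueFun, map_sum]
  rw [e, Series.coeff_sum] at hw
  obtain ⟨j, hj, hne⟩ := Finset.exists_ne_zero_of_sum_ne_zero hw
  have hmem : glueFun D (cotProj hM V j f) α ∈ Series.grade (q + j) :=
    (cot_expr_mem_iff hM α _ _ _ _).2 ((D α).mem _ _ ((M.cotangent i).res_mem _ (cotProj_mem hM f j)))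
  exact Finset.mem_image.2 ⟨j, hj, (hmem w hne).symm⟩

lemma res_glueFun {V W : Opens X} (f : (M.cotangent i).sec V) (α : M.Idx) (hα : W ≤ V ⊓ M.dom α) :
    Series.map (bodyRes 𝕜 K n r hα) (glueFun D f α) =
      (M.cotangent i).expr α W (hα.trans inf_le_right) ((D α).app W (hα.trans inf_le_right)
        ((M.cotangent i).res (hα.trans inf_le_left) f)) := by
  refine ((M.cotangent i).expr_res α hα inf_le_right (hα.trans inf_le_right) _).symm.trans ?_
  rw [(D α).res_app hα (hα.trans inf_le_right) inf_le_right, (M.cotangent i).res_res]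

lemma glueFun_res {V W : Opens X} (h : W ≤ V) (f : (M.cotangent i).sec V) (α : M.Idx) :
    glueFun D ((M.cotangent i).res h f) α =
      Series.map (bodyRes 𝕜 K n r (inf_le_inf_right _ h)) (glueFun D f α) := by
  rw [res_glueFun, glueFun, (M.cotangent i).res_res]

lemma glueFun_mul {V : Opens X} {j : G} {f : (M.cotangent i).sec V} (g : (M.cotangent i).sec V)
    (hf : f ∈ (M.cotangent i).grade V j) (α : M.Idx) : glueFun D (f * g) α =
      glueFun D f α * (M.cotangent i).expr α (V ⊓ M.dom α) inf_le_right ((M.cotangent i).res inf_le_left g) +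
      ρ q j • ((M.cotangent i).expr α (V ⊓ M.dom α) inf_le_right ((M.cotangent i).res inf_le_left f) *
        glueFun D g α) := by
  have h := (D α).leibniz (V ⊓ M.dom α) inf_le_right ((M.cotangent i).res inf_le_left g)
    ((M.cotangent i).res_mem inf_le_left hf)
  unfold glueFun
  rw [map_mul, h, map_add, map_smul, map_mul, map_mul]

/-- The vector field on the cotangent bundle obtained by gluing local derivations. -/
def glueDerivations (hM : M.IsRhoManifold) (D : ∀ α : M.Idx, (M.cotangent i).LocalDerivation (M.dom α) q)
    (hD : ∀ α β (V : Opens X) (hα : V ≤ M.dom α) (hβ : V ≤ M.dom β) f,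
      (D α).app V hα f = (D β).app V hβ f) : (M.cotangent i).VectorField q where
  app V :=
    { toFun := fun f => cotMk hM (glueFun D f) (exists_glueFun_degrees hM f).choose
        (exists_glueFun_degrees hM f).choose_spec (fun α β W hα hβ => by
          rw [res_glueFun, res_glueFun, transition_expr, hD α β])
      map_add' := fun f g => Subtype.ext (funext fun α =>
        ((congrArg _ ((congrArg _ (map_add _ _ _)).trans (map_add _ _ _))).trans (map_add _ _ _)))
      map_smul' := fun c f => Subtype.ext (funext fun α =>
        ((congrArg _ ((congrArg _ (map_smul _ _ _)).trans (map_smul _ _ _))).trans (map_smul _ _ _))) }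
  app_res {U V} h f := Subtype.ext (funext fun α =>
    glueFun_res h f α)
  app_mem V {j f} hf α := (cot_expr_mem_iff hM α _ _ _ _).2
    ((D α).mem _ _ ((M.cotangent i).res_mem _ hf))
  leibniz V {j f} g hf := Subtype.ext (funext fun α => glueFun_mul g hf α)

lemma glueDerivations_app (hM : M.IsRhoManifold)
    (hD : ∀ α β (V : Opens X) (hα : V ≤ M.dom α) (hβ : V ≤ M.dom β) f,
      (D α).app V hα f = (D β).app V hβ f) (α : M.Idx) {V : Opens X} (hV : V ≤ M.dom α)
    (f : (M.cotangent i).sec V) : (glueDerivations hM D hD).app V f = (D α).app V hV f := by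
  refine (cot_bijective hM α V hV).1 ?_
  refine (res_glueFun f α (le_inf le_rfl hV)).trans ?_
  rw [(M.cotangent i).res_self]

end Glue

lemma IsHamiltonian.app_eq (hM : M.IsRhoManifold) {Q : M.VectorField q}
    {F : (M.cotangent i).sec ⊤} (hF : IsSymbol hM i Q F) {Q' : (M.cotangent i).VectorField q}
    (hQ' : IsHamiltonian i F Q') (α : M.Idx) {V : Opens X} (hV : V ≤ M.dom α)
    (f : (M.cotangent i).sec V) : Q'.app V f = (hamLocal hM i Q α).app V hV f := by
  rw [hQ' α V hV, schouten_symbol hM hF]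

lemma VectorField.ext_of_le (hM : M.IsRhoManifold) {Q Q' : M.VectorField q}
    (h : ∀ (α : M.Idx) (V : Opens X) (hV : V ≤ M.dom α) f, Q.app V f = Q'.app V f) : Q = Q' :=
  VectorField.ext (funext fun V => LinearMap.ext fun f => hM.ext_of_res fun α => by
    rw [← Q.app_res, ← Q'.app_res, h α _ inf_le_right])

theorem existsUnique_isHamiltonian (hM : M.IsRhoManifold) {Q : M.VectorField q}
    {F : (M.cotangent i).sec ⊤} (hF : IsSymbol hM i Q F) :
    ∃! Q' : (M.cotangent i).VectorField q, IsHamiltonian i F Q' := by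
  refine ⟨glueDerivations hM (hamLocal hM i Q) (fun α β V hα hβ f => hamLocal_compat hM i Q α β hα hβ f),
    fun α V hV g => ?_, fun Q' h => VectorField.ext_of_le (isRhoManifold_cotangent hM i)
      fun α V hV f => ?_⟩
  · rw [schouten_symbol hM hF]
    exact glueDerivations_app hM _ α hV g
  · exact (h.app_eq hM hF α hV f).trans (glueDerivations_app hM _ α hV f).symm

lemma IsHamiltonian.app_pullback (hM : M.IsRhoManifold) {Q : M.VectorField q}
    {F : (M.cotangent i).sec ⊤} (hF : IsSymbol hM i Q F) {Q' : (M.cotangent i).VectorField q}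
    (hQ' : IsHamiltonian i F Q') (V : Opens X) (f : M.sec V) :
    Q'.app V (pullback hM i V f) = pullback hM i V (Q.app V f) :=
  (isRhoManifold_cotangent hM i).ext_of_res fun α => by
    refine (Q'.app_res inf_le_left _).symm.trans ?_
    refine (congrArg _ (res_pullback hM i _ f)).trans ?_
    refine (hQ'.app_eq hM hF α inf_le_right _).trans ?_
    exact (hamLocal_pullback hM i Q α _ _).trans ((congrArg _ (Q.app_res _ _)).trans
      (res_pullback hM i _ _).symm)

lemma VectorField.IsHomological.app_app {Q : M.VectorField q} (hQ : Q.IsHomological) (V : Opens X)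
    (f : M.sec V) : Q.app V (Q.app V f) = 0 := by
  have h := hQ.2 V f
  rw [hQ.1, neg_one_smul, sub_neg_eq_add, ← two_smul K] at h
  exact (smul_eq_zero.1 h).resolve_left two_ne_zero

/-- The commutator of `Q'` with itself is a derivation, so it is enough that `Q' ∘ Q'` kills the
coordinates. On pulled back functions this is `Q ∘ Q = 0`, and on `x_a^*` it follows from
differentiating `Q(Q^c) = 0` with respect to `x^a`. -/
theorem IsHamiltonian.isHomological (hM : M.IsRhoManifold) {Q : M.VectorField q}
    (hQ : Q.IsHomological) {F : (M.cotangent i).sec ⊤} (hF : IsSymbol hM i Q F)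
    {Q' : (M.cotangent i).VectorField q} (hQ' : IsHamiltonian i F Q') : Q'.IsHomological := by
  have hC := isRhoManifold_cotangent hM i
  have key : ∀ (α : M.Idx) (V : Opens X) (hV : V ≤ M.dom α) (f : (M.cotangent i).sec V),
      Q'.app V (Q'.app V f) - ρ q q • Q'.app V (Q'.app V f) = 0 := by
    intro α V hV f
    refine ((LocalDerivation.ofVectorField Q' V).comm (LocalDerivation.ofVectorField Q' V)).app_eq_zero
      hC α hV (forall_cotIdx (fun a => ?_) (fun a => ?_)) V le_rfl f
    · have h0 : Q'.app V (Q'.app V ((M.cotangent i).res hV ((M.cotangent i).coordFn α (baseIdx a)))) =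
          0 := by
        rw [coordFn_baseIdx hM, res_pullback hM, hQ'.app_pullback hM hF, hQ'.app_pullback hM hF,
          hQ.app_app, map_zero]
      refine (congrArg₂ (fun x y => x - ρ q q • y) h0 h0).trans ?_
      rw [smul_zero, sub_zero]
    · have h0 : Q'.app V (Q'.app V ((M.cotangent i).res hV (M.fibreFn i α a))) = 0 := by
        rw [hQ'.app_eq hM hF α hV, hQ'.app_eq hM hF α hV, hamLocal_fibreFn, map_neg, map_smul,
          hamLocal_sum hM i Q α hV _ (e := -coordDeg n d a + q) (fun b => by
            rw [add_assoc]
            exact pd_mem hM α hV a (M.res_mem hV (Q.comp_mem hM α b)))]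
        refine neg_eq_zero.2 (smul_eq_zero_of_right _ (Finset.sum_eq_zero fun c _ => ?_))
        have h1 : Q.app V (M.res hV (Q.comp α c)) = 0 := by
          rw [Q.app_res, VectorField.comp, hQ.app_app, map_zero]
        have h2 : M.pd α hV a (0 : M.sec V) = 0 := map_zero (pdLin hM α hV a)
        rw [Q.app_pd hM α hV, h1, h2, zero_sub, ρ.add_right, hQ.1, mul_neg, mul_one, smul_neg, neg_smul,
          sub_neg_eq_add, neg_add_cancel, map_zero, zero_mul]
      refine (congrArg₂ (fun x y => x - ρ q q • y) h0 h0).trans ?_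
      rw [smul_zero, sub_zero]
  refine ⟨hQ.1, fun V f => hC.ext_of_res fun α => ?_⟩
  rw [map_sub, map_smul, ← Q'.app_res, ← Q'.app_res, map_zero]
  exact key α _ inf_le_right _

end RhoSpace

/-! ### The `ρ`-Berezinian of block triangular matrices and of transposes -/

section BerTranspose

variable {G K : Type*} [AddCommGroup G] [Field K] {ρ : CommutationFactor G K}
variable {A : Type*} [Ring A] [Algebra K A] {𝒜 : G → Submodule K A}

section Blocks

variable {L L' : Type*} [Fintype L] [Fintype L'] [DecidableEq L] [DecidableEq L']
variable {a a' : Matrix L L A} {b b' : Matrix L L' A} {c c' : Matrix L' L A} {d d' V : Matrix L' L' A}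

/-- Block elimination: in a matrix with an inverse, the Schur complement of one diagonal block and
the opposite diagonal block of the inverse matrix are inverse to each other. This lemma and the two
after it give the parts used for Berezinians. -/
lemma schur_mul_eq_one (h1 : a * a' + b * c' = 1) (h2 : c * a' + d * c' = 0) (hV : V * d = 1) :
    (a - b * V * c) * a' = 1 := by
  rw [Matrix.sub_mul, Matrix.mul_assoc, eq_neg_of_add_eq_zero_left h2, Matrix.mul_neg, sub_neg_eq_add,
    Matrix.mul_assoc, ← Matrix.mul_assoc V, hV, Matrix.one_mul, h1]

lemma mul_schur_eq_one (h1 : a' * a + b' * c = 1) (h2 : a' * b + b' * d = 0) (hV : d * V = 1) :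
    a' * (a - b * V * c) = 1 := by
  rw [Matrix.mul_sub, Matrix.mul_assoc b, ← Matrix.mul_assoc a' b, eq_neg_of_add_eq_zero_left h2,
    Matrix.neg_mul, sub_neg_eq_add, Matrix.mul_assoc, ← Matrix.mul_assoc d, hV, Matrix.one_mul, h1]

lemma sub_schur_eq (h1 : c * b' + d * d' = 1) (h2 : c' * a + d' * c = 0) (h3 : c' * b + d' * d = 1)
    (hV : V * d = 1) (hV' : d * V = 1) : d' - c' * (a - b * V * c) * b' = V := by
  have e : c' * (a - b * V * c) = -(V * c) := by
    rw [Matrix.mul_sub, Matrix.mul_assoc b, ← Matrix.mul_assoc c' b, eq_sub_of_add_eq h3,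
      Matrix.sub_mul, Matrix.one_mul, Matrix.mul_assoc d', ← Matrix.mul_assoc d, hV', Matrix.one_mul,
      eq_neg_of_add_eq_zero_left h2]
    abel
  rw [e, Matrix.neg_mul, sub_neg_eq_add, Matrix.mul_assoc, eq_sub_of_add_eq h1, Matrix.mul_sub,
    Matrix.mul_one, ← Matrix.mul_assoc, hV, Matrix.one_mul, add_sub_cancel]

end Blocks

section Transpose

variable {J J' J'' : Type*} {I : J → G} {I' : J' → G} {I'' : J'' → G} {i : G}

/-- The `ρ`-transpose of a graded matrix, with respect to shifted degrees. -/
def rhoTranspose (ρ : CommutationFactor G K) (i : G) (I : J → G) (I' : J' → G) (F : Matrix J J' A) :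
    Matrix J' J A := Matrix.of fun b a => ρ (i - I' b) (I a - I' b) • F a b

lemma rhoTranspose_apply (F : Matrix J J' A) (a : J) (b : J') :
    rhoTranspose ρ i I I' F b a = ρ (i - I' b) (I a - I' b) • F a b := rfl

lemma rhoTranspose_graded (h : IsRhoComm ρ 𝒜) {F : Matrix J J' A} (hF : GradedMatrix 𝒜 I I' F) :
    GradedMatrix 𝒜 (fun b => i - I' b) (fun a => i - I a) (rhoTranspose ρ i I I' F) := fun b a =>
  Submodule.smul_mem _ _ (h.mem_of_eq (hF a b) (sub_sub_sub_cancel_left _ _ _).symm)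

lemma rhoTranspose_sub (F F' : Matrix J J' A) :
    rhoTranspose ρ i I I' (F - F') = rhoTranspose ρ i I I' F - rhoTranspose ρ i I I' F' :=
  Matrix.ext fun b a => smul_sub (ρ (i - I' b) (I a - I' b)) (F a b) (F' a b)

lemma rhoTranspose_one [DecidableEq J] : rhoTranspose ρ i I I (1 : Matrix J J A) = 1 :=
  Matrix.ext fun b a => by
    rw [rhoTranspose_apply]
    by_cases hab : a = b
    · subst hab
      rw [sub_self, ρ.zero_right, one_smul]
    · rw [Matrix.one_apply_ne hab, Matrix.one_apply_ne (Ne.symm hab), smul_zero]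

/-- The sign of the `ρ`-transpose is such that commuting two entries is compensated, whatever the
shift `i`; hence transposition is an anti-homomorphism without further signs. -/
lemma rhoTranspose_mul [Fintype J'] (h : IsRhoComm ρ 𝒜) {F : Matrix J J' A} {F' : Matrix J' J'' A}
    (hF : GradedMatrix 𝒜 I I' F) (hF' : GradedMatrix 𝒜 I' I'' F') :
    rhoTranspose ρ i I I'' (F * F') = rhoTranspose ρ i I' I'' F' * rhoTranspose ρ i I I' F :=
  Matrix.ext fun b a => by
    rw [rhoTranspose_apply, Matrix.mul_apply, Matrix.mul_apply, Finset.smul_sum]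
    refine Finset.sum_congr rfl fun c _ => ?_
    rw [rhoTranspose_apply, rhoTranspose_apply, smul_mul_smul_comm, h.comm (hF a c) (hF' c b), smul_smul]
    congr 1
    rw [← sub_add_sub_cancel (I a) (I' c) (I'' b), ρ.add_right,
      show i - I'' b = (i - I' c) + (I' c - I'' b) by abel, ρ.add_left _ _ (I a - I' c),
      mul_right_comm, mul_assoc (ρ (i - I' c) (I a - I' c)),  ρ.mul_swap, mul_one, mul_comm]

end Transpose

variable {J : Type*} [Fintype J] [LinearOrder J] {I : J → G}

-- The parity classes are given by arbitrary equivalent predicates, so that the blocks for the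
-- shifted degrees `i - I k` can be indexed by the parities of the `I k`.
open scoped Classical in
lemma rhoBer_eq' (h : IsRhoComm ρ 𝒜) {F : Matrix J J A} (hF : GradedMatrix 𝒜 I I F)
    {p₀ p₁ : J → Prop} [inst₀ : Fintype {k // p₀ k}] [inst₁ : Fintype {k // p₁ k}] (hp₀ : ∀ k, ¬ ρ.IsOdd (I k) ↔ p₀ k) (hp₁ : ∀ k, ρ.IsOdd (I k) ↔ p₁ k)
    {E : Matrix {k // p₀ k} {k // p₀ k} A} {V : Matrix {k // p₁ k} {k // p₁ k} A}
    (hE1 : F.submatrix (Subtype.val : {k // p₀ k} → J) (Subtype.val : {k // p₀ k} → J) * E = 1)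
    (hE2 : E * F.submatrix (Subtype.val : {k // p₀ k} → J) (Subtype.val : {k // p₀ k} → J) = 1)
    (hV : GradedMatrix 𝒜 (fun k : {k // p₁ k} => I k.1) (fun k : {k // p₁ k} => I k.1) V)
    (hV1 : F.submatrix (Subtype.val : {k // p₁ k} → J) (Subtype.val : {k // p₁ k} → J) * V = 1)
    (hV2 : V * F.submatrix (Subtype.val : {k // p₁ k} → J) (Subtype.val : {k // p₁ k} → J) = 1) :
    rhoBer ρ I F = rhoDet ρ (fun k : {k // p₀ k} => I k.1)
      (F.submatrix (Subtype.val : {k // p₀ k} → J) (Subtype.val : {k // p₀ k} → J) -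
        F.submatrix (Subtype.val : {k // p₀ k} → J) (Subtype.val : {k // p₁ k} → J) * V *
          F.submatrix (Subtype.val : {k // p₁ k} → J) (Subtype.val : {k // p₀ k} → J)) *
      rhoDet ρ (fun k : {k // p₁ k} => I k.1) V := by
  obtain rfl : (fun k => ¬ ρ.IsOdd (I k)) = p₀ := funext fun k => propext (hp₀ k)
  obtain rfl : (fun k => ρ.IsOdd (I k)) = p₁ := funext fun k => propext (hp₁ k)
  obtain rfl : inst₀ = Subtype.fintype (fun k => ¬ ρ.IsOdd (I k)) := Subsingleton.elim _ _
  obtain rfl : inst₁ = Subtype.fintype (fun k => ρ.IsOdd (I k)) := Subsingleton.elim _ _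
  exact rhoBer_eq h hF hE1 hE2 hV hV1 hV2

lemma sub_isOdd_of_not_isOdd {i : G} (hi : ¬ ρ.IsOdd i) (j : G) : ρ.IsOdd (i - j) ↔ ρ.IsOdd j := by
  have h := ρ.self_of_not_isOdd hi
  unfold CommutationFactor.IsOdd
  rw [ρ.sub_left, ρ.sub_right, ρ.sub_right, h, ρ.swap i j]
  have h2 := ρ.self_inv j
  have n1 := ρ.ne_zero i j
  rw [mul_inv, inv_inv, inv_inv, one_mul, ← mul_assoc, inv_mul_cancel₀ n1, one_mul]

lemma sub_isOdd_of_isOdd {i : G} (hi : ρ.IsOdd i) (h2 : (2 : K) ≠ 0) (j : G) :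
    ρ.IsOdd (i - j) ↔ ¬ ρ.IsOdd j := by
  have e : ρ (i - j) (i - j) = -ρ j j := by
    have n1 := ρ.ne_zero i j
    rw [ρ.sub_left, ρ.sub_right, ρ.sub_right, hi, ρ.swap i j, mul_inv, inv_inv, inv_inv]
    field_simp
  have h3 := ρ.self_mul_self j
  unfold CommutationFactor.IsOdd
  rw [e]
  rcases mul_self_eq_one_iff.1 h3 with h | h <;> rw [h]
  · refine iff_of_true rfl fun h' => h2 ?_
    rw [← one_add_one_eq_two]
    nth_rewrite 1 [h']
    rw [neg_add_cancel]
  · rw [neg_neg]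
    refine iff_of_false (fun h' => h2 ?_) (not_not_intro rfl)
    rw [← one_add_one_eq_two]
    nth_rewrite 1 [h']
    rw [neg_add_cancel]

open scoped Classical in
/-- If `F` has the inverse `F'` and invertible even and odd blocks, so has `F'`. -/
lemma exists_block_inverse {F F' : Matrix J J A} (hFF' : F * F' = 1) (hF'F : F' * F = 1)
    {E : Matrix (EvIdx ρ I) (EvIdx ρ I) A} {V : Matrix (OdIdx ρ I) (OdIdx ρ I) A}
    (hE1 : F.submatrix (evVal ρ I) (evVal ρ I) * E = 1)
    (hE2 : E * F.submatrix (evVal ρ I) (evVal ρ I) = 1)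
    (hV1 : F.submatrix (odVal ρ I) (odVal ρ I) * V = 1)
    (hV2 : V * F.submatrix (odVal ρ I) (odVal ρ I) = 1) :
    ∃ (E' : Matrix (EvIdx ρ I) (EvIdx ρ I) A) (V' : Matrix (OdIdx ρ I) (OdIdx ρ I) A),
      (F'.submatrix (evVal ρ I) (evVal ρ I) * E' = 1 ∧ E' * F'.submatrix (evVal ρ I) (evVal ρ I) = 1) ∧
      (F'.submatrix (odVal ρ I) (odVal ρ I) * V' = 1 ∧ V' * F'.submatrix (odVal ρ I) (odVal ρ I) = 1) ∧
      E' = F.submatrix (evVal ρ I) (evVal ρ I) -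
        F.submatrix (evVal ρ I) (odVal ρ I) * V * F.submatrix (odVal ρ I) (evVal ρ I) ∧
      F'.submatrix (odVal ρ I) (odVal ρ I) -
        F'.submatrix (odVal ρ I) (evVal ρ I) * E' * F'.submatrix (evVal ρ I) (odVal ρ I) = V := by
  have e1 : ∀ {F F' : Matrix J J A}, F * F' = 1 →
      F.submatrix (evVal ρ I) (evVal ρ I) * F'.submatrix (evVal ρ I) (evVal ρ I) +
        F.submatrix (evVal ρ I) (odVal ρ I) * F'.submatrix (odVal ρ I) (evVal ρ I) = 1 := fun h => by
    rw [← submatrix_mul_blocks, h, Matrix.submatrix_one _ Subtype.val_injective]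
  have e2 : ∀ {F F' : Matrix J J A}, F * F' = 1 →
      F.submatrix (odVal ρ I) (evVal ρ I) * F'.submatrix (evVal ρ I) (odVal ρ I) +
        F.submatrix (odVal ρ I) (odVal ρ I) * F'.submatrix (odVal ρ I) (odVal ρ I) = 1 := fun h => by
    rw [← submatrix_mul_blocks, h, Matrix.submatrix_one _ Subtype.val_injective]
  have e3 : ∀ {F F' : Matrix J J A}, F * F' = 1 →
      F.submatrix (odVal ρ I) (evVal ρ I) * F'.submatrix (evVal ρ I) (evVal ρ I) +
        F.submatrix (odVal ρ I) (odVal ρ I) * F'.submatrix (odVal ρ I) (evVal ρ I) = 0 := fun h => by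
    rw [← submatrix_mul_blocks, h]
    exact Matrix.ext fun k l => Matrix.one_apply_ne fun e : k.1 = l.1 => (l.2 : ¬ _) (e ▸ k.2)
  have e4 : ∀ {F F' : Matrix J J A}, F * F' = 1 →
      F.submatrix (evVal ρ I) (evVal ρ I) * F'.submatrix (evVal ρ I) (odVal ρ I) +
        F.submatrix (evVal ρ I) (odVal ρ I) * F'.submatrix (odVal ρ I) (odVal ρ I) = 0 := fun h => by
    rw [← submatrix_mul_blocks, h]
    exact Matrix.ext fun k l => Matrix.one_apply_ne fun e : k.1 = l.1 => (k.2 : ¬ _) (e ▸ l.2)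
  refine ⟨_, F.submatrix (odVal ρ I) (odVal ρ I) -
    F.submatrix (odVal ρ I) (evVal ρ I) * E * F.submatrix (evVal ρ I) (odVal ρ I),
    ⟨mul_schur_eq_one (e1 hF'F) (e4 hF'F) hV1, schur_mul_eq_one (e1 hFF') (e3 hFF') hV2⟩,
    ⟨mul_schur_eq_one (by rw [add_comm]; exact e2 hF'F) (by rw [add_comm]; exact e3 hF'F) hE1,
      schur_mul_eq_one (by rw [add_comm]; exact e2 hFF') (by rw [add_comm]; exact e4 hFF') hE2⟩,
    rfl, sub_schur_eq (e2 hFF') (e3 hF'F) (e2 hF'F) hV2 hV1⟩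

open scoped Classical in
/-- The `ρ`-Berezinian of the `ρ`-transpose, with respect to degrees shifted by an even degree. -/
lemma rhoBer_transpose_even (h : IsRhoComm ρ 𝒜) {i : G} (hi : ¬ ρ.IsOdd i) {F : Matrix J J A}
    (hF : GradedMatrix 𝒜 I I F)
    {E : Matrix (EvIdx ρ I) (EvIdx ρ I) A} {V : Matrix (OdIdx ρ I) (OdIdx ρ I) A}
    (hE : GradedMatrix 𝒜 (I ∘ evVal ρ I) (I ∘ evVal ρ I) E)
    (hE1 : F.submatrix (evVal ρ I) (evVal ρ I) * E = 1)
    (hE2 : E * F.submatrix (evVal ρ I) (evVal ρ I) = 1)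
    (hV : GradedMatrix 𝒜 (I ∘ odVal ρ I) (I ∘ odVal ρ I) V)
    (hV1 : F.submatrix (odVal ρ I) (odVal ρ I) * V = 1)
    (hV2 : V * F.submatrix (odVal ρ I) (odVal ρ I) = 1) :
    rhoBer ρ (fun k => i - I k) (rhoTranspose ρ i I I F) = rhoBer ρ I F := by
  have f00 := hF.submatrix (evVal ρ I) (evVal ρ I)
  have f01 := hF.submatrix (evVal ρ I) (odVal ρ I)
  have f10 := hF.submatrix (odVal ρ I) (evVal ρ I)
  have f11 := hF.submatrix (odVal ρ I) (odVal ρ I)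
  have tE1 : rhoTranspose ρ i (I ∘ evVal ρ I) (I ∘ evVal ρ I) (F.submatrix (evVal ρ I) (evVal ρ I)) *
      rhoTranspose ρ i (I ∘ evVal ρ I) (I ∘ evVal ρ I) E = 1 := by
    rw [← rhoTranspose_mul h hE f00, hE2, rhoTranspose_one]
  have tE2 : rhoTranspose ρ i (I ∘ evVal ρ I) (I ∘ evVal ρ I) E *
      rhoTranspose ρ i (I ∘ evVal ρ I) (I ∘ evVal ρ I) (F.submatrix (evVal ρ I) (evVal ρ I)) = 1 := by
    rw [← rhoTranspose_mul h f00 hE, hE1, rhoTranspose_one]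
  have tV1 : rhoTranspose ρ i (I ∘ odVal ρ I) (I ∘ odVal ρ I) (F.submatrix (odVal ρ I) (odVal ρ I)) *
      rhoTranspose ρ i (I ∘ odVal ρ I) (I ∘ odVal ρ I) V = 1 := by
    rw [← rhoTranspose_mul h hV f11, hV2, rhoTranspose_one]
  have tV2 : rhoTranspose ρ i (I ∘ odVal ρ I) (I ∘ odVal ρ I) V *
      rhoTranspose ρ i (I ∘ odVal ρ I) (I ∘ odVal ρ I) (F.submatrix (odVal ρ I) (odVal ρ I)) = 1 := by
    rw [← rhoTranspose_mul h f11 hV, hV1, rhoTranspose_one]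
  refine (rhoBer_eq' h (rhoTranspose_graded h hF) (p₀ := fun k => ¬ ρ.IsOdd (I k))
      (p₁ := fun k => ρ.IsOdd (I k)) (fun k => not_congr (sub_isOdd_of_not_isOdd hi _))
      (fun k => sub_isOdd_of_not_isOdd hi _) tE1 tE2 (rhoTranspose_graded h hV) tV1 tV2).trans
    (Eq.trans ?_ (rhoBer_eq h hF hE1 hE2 hV hV1 hV2).symm)
  refine congrArg₂ _ ?_ (rhoDet_transpose h sameParity_od hV i fun _ _ => rfl)
  refine Eq.trans ?_ (rhoDet_transpose h sameParity_ev (f00.sub ((f01.mul h hV).mul h f10)) i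
    (F' := rhoTranspose ρ i (I ∘ evVal ρ I) (I ∘ evVal ρ I) (F.submatrix (evVal ρ I) (evVal ρ I) -
      F.submatrix (evVal ρ I) (odVal ρ I) * V * F.submatrix (odVal ρ I) (evVal ρ I))) fun _ _ => rfl)
  rw [rhoTranspose_sub, rhoTranspose_mul h (f01.mul h hV) f10, rhoTranspose_mul h f01 hV,
    ← Matrix.mul_assoc]
  rfl

open scoped Classical in
/-- The `ρ`-Berezinian of the `ρ`-transpose of the inverse of `F`, with respect to degrees shifted by
an odd degree. -/
lemma rhoBer_transpose_odd [DecidableEq G] (h : IsRhoComm ρ 𝒜) (hint : DirectSum.IsInternal 𝒜) {i : G} (hi : ρ.IsOdd i) (h2 : (2 : K) ≠ 0)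
    {F F' : Matrix J J A} (hF : GradedMatrix 𝒜 I I F) (hF' : GradedMatrix 𝒜 I I F')
    (hFF' : F * F' = 1) (hF'F : F' * F = 1)
    {E : Matrix (EvIdx ρ I) (EvIdx ρ I) A} {V : Matrix (OdIdx ρ I) (OdIdx ρ I) A}
    (hE1 : F.submatrix (evVal ρ I) (evVal ρ I) * E = 1)
    (hE2 : E * F.submatrix (evVal ρ I) (evVal ρ I) = 1)
    (hV : GradedMatrix 𝒜 (I ∘ odVal ρ I) (I ∘ odVal ρ I) V)
    (hV1 : F.submatrix (odVal ρ I) (odVal ρ I) * V = 1)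
    (hV2 : V * F.submatrix (odVal ρ I) (odVal ρ I) = 1) :
    rhoBer ρ (fun k => i - I k) (rhoTranspose ρ i I I F') = rhoBer ρ I F := by
  have f00 := hF'.submatrix (evVal ρ I) (evVal ρ I)
  have f01 := hF'.submatrix (evVal ρ I) (odVal ρ I)
  have f10 := hF'.submatrix (odVal ρ I) (evVal ρ I)
  have f11 := hF'.submatrix (odVal ρ I) (odVal ρ I)
  obtain ⟨E', V', ⟨a1, a2⟩, ⟨b1, b2⟩, hE', c⟩ := exists_block_inverse hFF' hF'F hE1 hE2 hV1 hV2
  have gE' : GradedMatrix 𝒜 (I ∘ evVal ρ I) (I ∘ evVal ρ I) E' := by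
    rw [hE']
    exact (hF.submatrix (evVal ρ I) (evVal ρ I)).sub
      (((hF.submatrix (evVal ρ I) (odVal ρ I)).mul h hV).mul h
        (hF.submatrix (odVal ρ I) (evVal ρ I)))
  have gV' : GradedMatrix 𝒜 (I ∘ odVal ρ I) (I ∘ odVal ρ I) V' := f11.of_mul_eq_one h hint b1 b2
  have tE1 : rhoTranspose ρ i (I ∘ evVal ρ I) (I ∘ evVal ρ I) (F'.submatrix (evVal ρ I) (evVal ρ I)) *
      rhoTranspose ρ i (I ∘ evVal ρ I) (I ∘ evVal ρ I) E' = 1 := by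
    rw [← rhoTranspose_mul h gE' f00, a2, rhoTranspose_one]
  have tE2 : rhoTranspose ρ i (I ∘ evVal ρ I) (I ∘ evVal ρ I) E' *
      rhoTranspose ρ i (I ∘ evVal ρ I) (I ∘ evVal ρ I) (F'.submatrix (evVal ρ I) (evVal ρ I)) = 1 := by
    rw [← rhoTranspose_mul h f00 gE', a1, rhoTranspose_one]
  have tV1 : rhoTranspose ρ i (I ∘ odVal ρ I) (I ∘ odVal ρ I) (F'.submatrix (odVal ρ I) (odVal ρ I)) *
      rhoTranspose ρ i (I ∘ odVal ρ I) (I ∘ odVal ρ I) V' = 1 := by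
    rw [← rhoTranspose_mul h gV' f11, b2, rhoTranspose_one]
  have tV2 : rhoTranspose ρ i (I ∘ odVal ρ I) (I ∘ odVal ρ I) V' *
      rhoTranspose ρ i (I ∘ odVal ρ I) (I ∘ odVal ρ I) (F'.submatrix (odVal ρ I) (odVal ρ I)) = 1 := by
    rw [← rhoTranspose_mul h f11 gV', b1, rhoTranspose_one]
  -- An odd shift exchanges the even and the odd block. The Schur complement is now taken with
  -- respect to the even block of `F'`: it equals `V`, and the inverse of that block is the Schur
  -- complement `E'` of `F`. So the same two determinants appear in the opposite order.
  refine (rhoBer_eq' h (rhoTranspose_graded h hF') (p₀ := fun k => ρ.IsOdd (I k))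
      (p₁ := fun k => ¬ ρ.IsOdd (I k))
      (fun k => (not_congr (sub_isOdd_of_isOdd hi h2 _)).trans not_not)
      (fun k => sub_isOdd_of_isOdd hi h2 _) tV1 tV2 (rhoTranspose_graded h gE') tE1 tE2).trans
    (Eq.trans ?_ ((rhoBer_eq h hF hE1 hE2 hV hV1 hV2).trans
      (h.commute_zero (rhoDet_mem h (hE' ▸ gE')) (rhoDet_mem h hV))).symm)
  refine congrArg₂ _ ?_ ((rhoDet_transpose h sameParity_ev gE' i fun _ _ => rfl).trans
    (congrArg _ hE'))
  refine Eq.trans ?_ (rhoDet_transpose h sameParity_od hV i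
    (F' := rhoTranspose ρ i (I ∘ odVal ρ I) (I ∘ odVal ρ I) V) fun _ _ => rfl)
  rw [← c, rhoTranspose_sub, rhoTranspose_mul h (f10.mul h gE') f01, rhoTranspose_mul h f10 gE',
    ← Matrix.mul_assoc]
  rfl

end BerTranspose

/-! ### Berezinians of block triangular matrices -/

section BerTriangular

variable {G K : Type*} [AddCommGroup G] [Field K] {ρ : CommutationFactor G K}
  {A : Type*} [Ring A] [Algebra K A] {𝒜 : G → Submodule K A}

/-- The decomposition of a subtype of a disjoint union. -/
def subtypeSumEquiv {J J' C : Type*} (e : J ⊕ J' ≃ C) (p : C → Prop) :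
    {k : J // p (e (Sum.inl k))} ⊕ {k : J' // p (e (Sum.inr k))} ≃ {c // p c} :=
  Equiv.subtypeSum.symm.trans (e.subtypeEquivOfSubtype (p := p))

lemma submatrix_eq_fromBlocks {J J' C L L' L'' L''' : Type*} {e : J ⊕ J' → C} {F : Matrix C C A}
    (h0 : ∀ a b, F (e (Sum.inr a)) (e (Sum.inl b)) = 0) (s : L → J) (s' : L' → J') (t : L'' → J)
    (t' : L''' → J') {f : L ⊕ L' → C} {g : L'' ⊕ L''' → C} (hf : ∀ x, f x = e (Sum.map s s' x))
    (hg : ∀ x, g x = e (Sum.map t t' x)) :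
    F.submatrix f g = Matrix.fromBlocks
      (F.submatrix (fun k => e (Sum.inl (s k))) fun k => e (Sum.inl (t k)))
      (F.submatrix (fun k => e (Sum.inl (s k))) fun k => e (Sum.inr (t' k))) 0
      (F.submatrix (fun k => e (Sum.inr (s' k))) fun k => e (Sum.inr (t' k))) := by
  refine Matrix.ext fun x y => ?_
  rw [Matrix.submatrix_apply, hf, hg]
  rcases x with x | x <;> rcases y with y | y
  · rfl
  · rfl
  · exact h0 _ _
  · rfl

lemma exists_inverse_of_fromBlocks {L L' N : Type*} [Fintype L] [Fintype L'] [Fintype N] [DecidableEq L]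
    [DecidableEq L'] [DecidableEq N] (e : L ⊕ L' ≃ N) {F : Matrix N N A} {a a' : Matrix L L A}
    {b : Matrix L L' A} {d d' : Matrix L' L' A} (hF : F.submatrix e e = Matrix.fromBlocks a b 0 d)
    (ha : a * a' = 1) (ha' : a' * a = 1) (hd : d * d' = 1) (hd' : d' * d = 1) :
    ∃ F' : Matrix N N A, F'.submatrix e e = Matrix.fromBlocks a' (-(a' * b * d')) 0 d' ∧
      F * F' = 1 ∧ F' * F = 1 := by
  obtain rfl : F = (Matrix.fromBlocks a b 0 d).submatrix e.symm e.symm := by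
    rw [← hF]
    simp
  refine ⟨(Matrix.fromBlocks a' (-(a' * b * d')) 0 d').submatrix e.symm e.symm, by simp, ?_, ?_⟩
  · rw [Matrix.submatrix_mul_equiv, Matrix.fromBlocks_multiply, Matrix.mul_neg, ← Matrix.mul_assoc,
      ← Matrix.mul_assoc, ha]
    simp [hd]
  · rw [Matrix.submatrix_mul_equiv, Matrix.fromBlocks_multiply, Matrix.neg_mul,
      Matrix.neg_mul, Matrix.mul_assoc _ d' d, hd', Matrix.mul_one, add_neg_cancel]
    simp [ha']

variable {J J' C : Type*} [Fintype J] [LinearOrder J] [Fintype J'] [LinearOrder J'] [Fintype C]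
  [LinearOrder C]

open scoped Classical in
/-- The `ρ`-Berezinian of a block triangular matrix. -/
lemma rhoBer_of_blockTriangular (h : IsRhoComm ρ 𝒜) {I : C → G} {F : Matrix C C A}
    (hF : GradedMatrix 𝒜 I I F) (e : J ⊕ J' ≃ C)
    (h0 : ∀ a b, F (e (Sum.inr a)) (e (Sum.inl b)) = 0)
    {I₁ : J → G} {I₂ : J' → G} (hI₁ : ∀ k, I (e (Sum.inl k)) = I₁ k) (hI₂ : ∀ k, I (e (Sum.inr k)) = I₂ k)
    {P : Matrix J J A} {R : Matrix J' J' A}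
    (hP : F.submatrix (fun k => e (Sum.inl k)) (fun k => e (Sum.inl k)) = P)
    (hR : F.submatrix (fun k => e (Sum.inr k)) (fun k => e (Sum.inr k)) = R)
    {E₁ : Matrix (EvIdx ρ I₁) (EvIdx ρ I₁) A} {V₁ : Matrix (OdIdx ρ I₁) (OdIdx ρ I₁) A}
    (hE1 : P.submatrix (evVal ρ I₁) (evVal ρ I₁) * E₁ = 1)
    (hE1' : E₁ * P.submatrix (evVal ρ I₁) (evVal ρ I₁) = 1)
    (hV : GradedMatrix 𝒜 (I₁ ∘ odVal ρ I₁) (I₁ ∘ odVal ρ I₁) V₁)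
    (hV1 : P.submatrix (odVal ρ I₁) (odVal ρ I₁) * V₁ = 1)
    (hV1' : V₁ * P.submatrix (odVal ρ I₁) (odVal ρ I₁) = 1)
    {E₂ : Matrix (EvIdx ρ I₂) (EvIdx ρ I₂) A} {V₂ : Matrix (OdIdx ρ I₂) (OdIdx ρ I₂) A}
    (hE2 : R.submatrix (evVal ρ I₂) (evVal ρ I₂) * E₂ = 1)
    (hE2' : E₂ * R.submatrix (evVal ρ I₂) (evVal ρ I₂) = 1)
    (hW : GradedMatrix 𝒜 (I₂ ∘ odVal ρ I₂) (I₂ ∘ odVal ρ I₂) V₂)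
    (hV2 : R.submatrix (odVal ρ I₂) (odVal ρ I₂) * V₂ = 1)
    (hV2' : V₂ * R.submatrix (odVal ρ I₂) (odVal ρ I₂) = 1) [DecidableEq G]
    (hint : DirectSum.IsInternal 𝒜) :
    rhoBer ρ I F = rhoBer ρ I₁ P * rhoBer ρ I₂ R := by
  obtain rfl : (fun k => I (e (Sum.inl k))) = I₁ := funext hI₁
  obtain rfl : (fun k => I (e (Sum.inr k))) = I₂ := funext hI₂
  subst hP hR
  let e₀ : EvIdx ρ (fun k => I (e (Sum.inl k))) ⊕ EvIdx ρ (fun k => I (e (Sum.inr k))) ≃ EvIdx ρ I :=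
    subtypeSumEquiv e fun c => ¬ ρ.IsOdd (I c)
  let e₁ : OdIdx ρ (fun k => I (e (Sum.inl k))) ⊕ OdIdx ρ (fun k => I (e (Sum.inr k))) ≃ OdIdx ρ I :=
    subtypeSumEquiv e fun c => ρ.IsOdd (I c)
  have he₀ : ∀ x, (evVal ρ I ∘ e₀) x = e (Sum.map (evVal ρ _) (evVal ρ _) x) := by
    rintro (x | x) <;> rfl
  have he₁ : ∀ x, (odVal ρ I ∘ e₁) x = e (Sum.map (odVal ρ _) (odVal ρ _) x) := by
    rintro (x | x) <;> rfl
  obtain ⟨E, -, a1, a2⟩ := exists_inverse_of_fromBlocks e₀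
    (F := F.submatrix (evVal ρ I) (evVal ρ I))
    (submatrix_eq_fromBlocks h0 _ _ _ _ he₀ he₀) hE1 hE1' hE2 hE2'
  obtain ⟨V, hVe, b1, b2⟩ := exists_inverse_of_fromBlocks e₁
    (F := F.submatrix (odVal ρ I) (odVal ρ I))
    (submatrix_eq_fromBlocks h0 _ _ _ _ he₁ he₁) hV1 hV1' hV2 hV2'
  have gV : GradedMatrix 𝒜 (I ∘ odVal ρ I) (I ∘ odVal ρ I) V :=
    (hF.submatrix (odVal ρ I) (odVal ρ I)).of_mul_eq_one h hint b1 b2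
  have gS : GradedMatrix 𝒜 (I ∘ evVal ρ I) (I ∘ evVal ρ I) (F.submatrix (evVal ρ I) (evVal ρ I) -
      F.submatrix (evVal ρ I) (odVal ρ I) * V * F.submatrix (odVal ρ I) (evVal ρ I)) :=
    (hF.submatrix (evVal ρ I) (evVal ρ I)).sub
      (((hF.submatrix (evVal ρ I) (odVal ρ I)).mul h gV).mul h
        (hF.submatrix (odVal ρ I) (evVal ρ I)))
  -- The Schur complement of a block triangular matrix is block triangular, with the Schur
  -- complements of the diagonal blocks on its diagonal.
  have hS : ∀ Y, Y = (F.submatrix (evVal ρ I) (evVal ρ I) -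
      F.submatrix (evVal ρ I) (odVal ρ I) * V * F.submatrix (odVal ρ I) (evVal ρ I)).submatrix e₀ e₀ →
      Y.toBlocks₁₁ = (F.submatrix (fun k => e (Sum.inl k)) fun k => e (Sum.inl k)).submatrix
            (evVal ρ fun k => I (e (Sum.inl k))) (evVal ρ fun k => I (e (Sum.inl k))) -
          (F.submatrix (fun k => e (Sum.inl k)) fun k => e (Sum.inl k)).submatrix
            (evVal ρ fun k => I (e (Sum.inl k))) (odVal ρ fun k => I (e (Sum.inl k))) * V₁ *
          (F.submatrix (fun k => e (Sum.inl k)) fun k => e (Sum.inl k)).submatrix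
            (odVal ρ fun k => I (e (Sum.inl k))) (evVal ρ fun k => I (e (Sum.inl k))) ∧ Y.toBlocks₂₁ = 0 ∧ Y.toBlocks₂₂ =
        (F.submatrix (fun k => e (Sum.inr k)) fun k => e (Sum.inr k)).submatrix
            (evVal ρ fun k => I (e (Sum.inr k))) (evVal ρ fun k => I (e (Sum.inr k))) -
          (F.submatrix (fun k => e (Sum.inr k)) fun k => e (Sum.inr k)).submatrix
            (evVal ρ fun k => I (e (Sum.inr k))) (odVal ρ fun k => I (e (Sum.inr k))) * V₂ *
          (F.submatrix (fun k => e (Sum.inr k)) fun k => e (Sum.inr k)).submatrix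
            (odVal ρ fun k => I (e (Sum.inr k))) (evVal ρ fun k => I (e (Sum.inr k))) := by
    intro Y hY
    rw [Matrix.submatrix_sub, Pi.sub_apply, Pi.sub_apply, ← Matrix.submatrix_mul_equiv _ _ e₀ e₁ e₀,
      ← Matrix.submatrix_mul_equiv _ _ e₀ e₁ e₁, hVe, Matrix.submatrix_submatrix,
      Matrix.submatrix_submatrix, Matrix.submatrix_submatrix,
      submatrix_eq_fromBlocks h0 _ _ _ _ he₀ he₀, submatrix_eq_fromBlocks h0 _ _ _ _ he₀ he₁,
      submatrix_eq_fromBlocks h0 _ _ _ _ he₁ he₀, Matrix.fromBlocks_multiply,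
      Matrix.fromBlocks_multiply, sub_eq_add_neg, Matrix.fromBlocks_neg, Matrix.fromBlocks_add] at hY
    simp only [Matrix.zero_mul, Matrix.mul_zero, add_zero, zero_add, neg_zero, ← sub_eq_add_neg] at hY
    subst hY
    exact ⟨rfl, rfl, rfl⟩
  obtain ⟨S₁, S₀, S₂⟩ := hS _ rfl
  have s1 := rhoDet_of_blockTriangular h sameParity_ev gS e₀
    fun a b => congrFun (congrFun S₀ a) b
  have s2 := rhoDet_of_blockTriangular h sameParity_od gV e₁
    fun a b => congrFun (congrFun hVe (Sum.inr a)) (Sum.inl b)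
  have q1 : ∀ {L L' N : Type _} {F : Matrix N N A} {e : L ⊕ L' → N} {a b d}, 
      F.submatrix e e = Matrix.fromBlocks a b 0 d →
      F.submatrix (e ∘ Sum.inl) (e ∘ Sum.inl) = a ∧ F.submatrix (e ∘ Sum.inr) (e ∘ Sum.inr) = d :=
    fun h => ⟨Matrix.ext fun x y => congrFun (congrFun h (Sum.inl x)) (Sum.inl y),
      Matrix.ext fun x y => congrFun (congrFun h (Sum.inr x)) (Sum.inr y)⟩
  have s1' := s1.trans (congrArg₂ (fun x y => rhoDet ρ _ x * rhoDet ρ _ y) S₁ S₂)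
  rw [(q1 hVe).1, (q1 hVe).2] at s2
  have gP := hF.submatrix (fun k => e (Sum.inl k)) (fun k => e (Sum.inl k))
  have gR := hF.submatrix (fun k => e (Sum.inr k)) (fun k => e (Sum.inr k))
  have r := rhoBer_eq h hF a1 a2 gV b1 b2
  have r1 := rhoBer_eq h gP hE1 hE1' hV hV1 hV1'
  have r2 := rhoBer_eq h gR hE2 hE2' hW hV2 hV2'
  rw [s1', s2] at r
  have g2 : rhoDet ρ ((fun k => I (e (Sum.inr k))) ∘ evVal ρ _)
      ((F.submatrix (fun k => e (Sum.inr k)) fun k => e (Sum.inr k)).submatrix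
            (evVal ρ fun k => I (e (Sum.inr k))) (evVal ρ fun k => I (e (Sum.inr k))) -
          (F.submatrix (fun k => e (Sum.inr k)) fun k => e (Sum.inr k)).submatrix
            (evVal ρ fun k => I (e (Sum.inr k))) (odVal ρ fun k => I (e (Sum.inr k))) * V₂ *
          (F.submatrix (fun k => e (Sum.inr k)) fun k => e (Sum.inr k)).submatrix
            (odVal ρ fun k => I (e (Sum.inr k))) (evVal ρ fun k => I (e (Sum.inr k)))) ∈ 𝒜 0 :=
    rhoDet_mem h ((gR.submatrix (evVal ρ _) (evVal ρ _)).sub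
      (((gR.submatrix (evVal ρ _) (odVal ρ _)).mul h hW).mul h
        (gR.submatrix (odVal ρ _) (evVal ρ _))))
  refine r.trans (Eq.trans ?_ (congrArg₂ _ r1 r2).symm)
  have c := h.commute_zero g2 (rhoDet_mem h hV)
  refine (mul_assoc _ _ _).trans (Eq.trans ?_ (mul_assoc _ _ _).symm)
  refine congrArg _ ?_
  refine (mul_assoc _ _ _).symm.trans (Eq.trans ?_ (mul_assoc _ _ _))
  exact congrArg (· * _) c

end BerTriangular

/-! ### Invertible blocks and the Berezinian of a change of coordinates on the cotangent bundle -/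

section UnitBlocks

variable {G K : Type*} [AddCommGroup G] [Field K] {ρ : CommutationFactor G K}
  {A : Type*} [Ring A] [Algebra K A] {𝒜 : G → Submodule K A}
variable {J : Type*} [Fintype J] [LinearOrder J] {I : J → G}

open scoped Classical in
/-- The even and the odd block of the matrix are invertible. -/
def HasUnitBlocks (ρ : CommutationFactor G K) (I : J → G) (F : Matrix J J A) : Prop :=
  IsUnit (F.submatrix (evVal ρ I) (evVal ρ I)) ∧ IsUnit (F.submatrix (odVal ρ I) (odVal ρ I))

-- Otherwise the Berezinian has the default value zero, which is a unit in the zero ring only, and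
-- there every matrix is invertible.
open scoped Classical in
lemma hasUnitBlocks_of_isUnit_rhoBer {F : Matrix J J A} (hu : IsUnit (rhoBer ρ I F)) :
    HasUnitBlocks ρ I F := by
  by_cases hF : HasUnitBlocks ρ I F
  · exact hF
  · have h0 : rhoBer ρ I F = 0 := if_neg hF
    rw [h0, isUnit_zero_iff] at hu
    have := subsingleton_of_zero_eq_one hu
    exact ⟨isUnit_of_subsingleton _, isUnit_of_subsingleton _⟩

open scoped Classical in
lemma HasUnitBlocks.exists_inverse [DecidableEq G] (h : IsRhoComm ρ 𝒜) (hint : DirectSum.IsInternal 𝒜)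
    {F : Matrix J J A} (hF : GradedMatrix 𝒜 I I F) (hu : HasUnitBlocks ρ I F) :
    ∃ (E : Matrix (EvIdx ρ I) (EvIdx ρ I) A) (V : Matrix (OdIdx ρ I) (OdIdx ρ I) A),
      (GradedMatrix 𝒜 (I ∘ evVal ρ I) (I ∘ evVal ρ I) E ∧
        F.submatrix (evVal ρ I) (evVal ρ I) * E = 1 ∧ E * F.submatrix (evVal ρ I) (evVal ρ I) = 1) ∧
      GradedMatrix 𝒜 (I ∘ odVal ρ I) (I ∘ odVal ρ I) V ∧
        F.submatrix (odVal ρ I) (odVal ρ I) * V = 1 ∧ V * F.submatrix (odVal ρ I) (odVal ρ I) = 1 := by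
  obtain ⟨⟨u, hu⟩, ⟨v, hv⟩⟩ := hu
  have h1 : F.submatrix (evVal ρ I) (evVal ρ I) * u.inv = 1 := hu ▸ u.val_inv
  have h2 : u.inv * F.submatrix (evVal ρ I) (evVal ρ I) = 1 := hu ▸ u.inv_val
  have h3 : F.submatrix (odVal ρ I) (odVal ρ I) * v.inv = 1 := hv ▸ v.val_inv
  have h4 : v.inv * F.submatrix (odVal ρ I) (odVal ρ I) = 1 := hv ▸ v.inv_val
  exact ⟨u.inv, v.inv, ⟨(hF.submatrix (evVal ρ I) (evVal ρ I)).of_mul_eq_one h hint h1 h2, h1, h2⟩,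
    (hF.submatrix (odVal ρ I) (odVal ρ I)).of_mul_eq_one h hint h3 h4, h3, h4⟩

open scoped Classical in
lemma HasUnitBlocks.inverse [DecidableEq G] (h : IsRhoComm ρ 𝒜) (hint : DirectSum.IsInternal 𝒜)
    {F F' : Matrix J J A} (hF : GradedMatrix 𝒜 I I F) (hFF' : F * F' = 1) (hF'F : F' * F = 1)
    (hu : HasUnitBlocks ρ I F) : HasUnitBlocks ρ I F' := by
  obtain ⟨E, V, ⟨-, hE1, hE2⟩, -, hV1, hV2⟩ := hu.exists_inverse h hint hF
  obtain ⟨E', V', ⟨a1, a2⟩, ⟨b1, b2⟩, -, -⟩ := exists_block_inverse hFF' hF'F hE1 hE2 hV1 hV2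
  exact ⟨⟨⟨_, E', a1, a2⟩, rfl⟩, ⟨⟨_, V', b1, b2⟩, rfl⟩⟩

open scoped Classical in
lemma HasUnitBlocks.map {B : Type*} [Ring B] [Algebra K B] (f : A →ₐ[K] B) {F : Matrix J J A}
    (hu : HasUnitBlocks ρ I F) : HasUnitBlocks ρ I (F.map f) :=
  ⟨hu.1.map f.mapMatrix, hu.2.map f.mapMatrix⟩

-- Invertible blocks are assumed because a homomorphism may make a block invertible, whereas the
-- Berezinian of the original matrix would be the default value zero.
open scoped Classical in
lemma map_rhoBer [DecidableEq G] (h : IsRhoComm ρ 𝒜) (hint : DirectSum.IsInternal 𝒜) {B : Type*} [Ring B]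
    [Algebra K B] {ℬ : G → Submodule K B} (hB : IsRhoComm ρ ℬ) (f : A →ₐ[K] B)
    (hf : ∀ j a, a ∈ 𝒜 j → f a ∈ ℬ j) {F : Matrix J J A} (hF : GradedMatrix 𝒜 I I F)
    (hu : HasUnitBlocks ρ I F) : f (rhoBer ρ I F) = rhoBer ρ I (F.map f) := by
  obtain ⟨E, V, ⟨-, hE1, hE2⟩, gV, hV1, hV2⟩ := hu.exists_inverse h hint hF
  have e : ∀ {L L' L'' : Type _} [Fintype L'] (a : Matrix L L' A) (b : Matrix L' L'' A),
      (a * b).map f = a.map f * b.map f := fun a b => Matrix.map_mul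
  have e1 : ∀ {L : Type _} [DecidableEq L], (1 : Matrix L L A).map f = 1 := fun {L} _ =>
    Matrix.map_one f (map_zero f) (map_one f)
  refine Eq.trans ?_ (rhoBer_eq hB (F := F.map f) (E := E.map f) (V := V.map f)
    (fun a b => hf _ _ (hF a b))
    ((e _ _).symm.trans ((congrArg (Matrix.map · f) hE1).trans e1))
    ((e _ _).symm.trans ((congrArg (Matrix.map · f) hE2).trans e1))
    (fun a b => hf _ _ (gV a b))
    ((e _ _).symm.trans ((congrArg (Matrix.map · f) hV1).trans e1))
    ((e _ _).symm.trans ((congrArg (Matrix.map · f) hV2).trans e1))).symm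
  rw [rhoBer_eq h hF hE1 hE2 gV hV1 hV2, map_mul, map_rhoDet, map_rhoDet, Matrix.map_sub f (map_sub f),
    e, e]
  rfl

open scoped Classical in
lemma rhoBer_mem [DecidableEq G] (h : IsRhoComm ρ 𝒜) (hint : DirectSum.IsInternal 𝒜) {F : Matrix J J A}
    (hF : GradedMatrix 𝒜 I I F) (hu : HasUnitBlocks ρ I F) : rhoBer ρ I F ∈ 𝒜 0 := by
  obtain ⟨E, V, ⟨-, hE1, hE2⟩, gV, hV1, hV2⟩ := hu.exists_inverse h hint hF
  rw [rhoBer_eq h hF hE1 hE2 gV hV1 hV2, ← add_zero (0 : G)]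
  exact h.mul_mem (rhoDet_mem h ((hF.submatrix (evVal ρ I) (evVal ρ I)).sub
    (((hF.submatrix (evVal ρ I) (odVal ρ I)).mul h gV).mul h
        (hF.submatrix (odVal ρ I) (evVal ρ I))))) (rhoDet_mem h gV)

lemma isUnit_submatrix_of_iff {p p' : J → Prop} (hp : ∀ k, p k ↔ p' k) [inst : Fintype {k // p k}]
    [inst' : Fintype {k // p' k}] [dec : DecidableEq {k // p k}] [dec' : DecidableEq {k // p' k}]
    {F : Matrix J J A}
    (hu : IsUnit (F.submatrix (Subtype.val : {k // p k} → J) (Subtype.val : {k // p k} → J))) :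
    IsUnit (F.submatrix (Subtype.val : {k // p' k} → J) (Subtype.val : {k // p' k} → J)) := by
  obtain rfl : p = p' := funext fun k => propext (hp k)
  obtain rfl : inst = inst' := Subsingleton.elim _ _
  obtain rfl : dec = dec' := Subsingleton.elim _ _
  exact hu

open scoped Classical in
lemma HasUnitBlocks.transpose [DecidableEq G] (h : IsRhoComm ρ 𝒜) (hint : DirectSum.IsInternal 𝒜)
    (h2 : (2 : K) ≠ 0) (i : G) {F : Matrix J J A} (hF : GradedMatrix 𝒜 I I F)
    (hu : HasUnitBlocks ρ I F) : HasUnitBlocks ρ (fun k => i - I k) (rhoTranspose ρ i I I F) := by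
  obtain ⟨E, V, ⟨gE, hE1, hE2⟩, gV, hV1, hV2⟩ := hu.exists_inverse h hint hF
  have f00 := hF.submatrix (evVal ρ I) (evVal ρ I)
  have f11 := hF.submatrix (odVal ρ I) (odVal ρ I)
  have tE : IsUnit ((rhoTranspose ρ i I I F).submatrix (evVal ρ I) (evVal ρ I)) := by
    refine ⟨⟨_, rhoTranspose ρ i (I ∘ evVal ρ I) (I ∘ evVal ρ I) E, ?_, ?_⟩, rfl⟩
    · exact (rhoTranspose_mul h gE f00).symm.trans ((congrArg _ hE2).trans rhoTranspose_one)
    · exact (rhoTranspose_mul h f00 gE).symm.trans ((congrArg _ hE1).trans rhoTranspose_one)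
  have tV : IsUnit ((rhoTranspose ρ i I I F).submatrix (odVal ρ I) (odVal ρ I)) := by
    refine ⟨⟨_, rhoTranspose ρ i (I ∘ odVal ρ I) (I ∘ odVal ρ I) V, ?_, ?_⟩, rfl⟩
    · exact (rhoTranspose_mul h gV f11).symm.trans ((congrArg _ hV2).trans rhoTranspose_one)
    · exact (rhoTranspose_mul h f11 gV).symm.trans ((congrArg _ hV1).trans rhoTranspose_one)
  by_cases hi : ρ.IsOdd i
  · exact ⟨isUnit_submatrix_of_iff (fun k => (not_congr (sub_isOdd_of_isOdd hi h2 (I k))).trans not_not |>.symm) tV,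
      isUnit_submatrix_of_iff (fun k => (sub_isOdd_of_isOdd hi h2 (I k)).symm) tE⟩
  · exact ⟨isUnit_submatrix_of_iff (fun k => (not_congr (sub_isOdd_of_not_isOdd hi (I k))).symm) tE,
      isUnit_submatrix_of_iff (fun k => (sub_isOdd_of_not_isOdd hi (I k)).symm) tV⟩

variable {C : Type*} [Fintype C] [LinearOrder C]

open scoped Classical in
/-- The `ρ`-Berezinian of the Jacobian matrix of a change of coordinates on a shifted cotangent
bundle. -/
lemma rhoBer_cotangent [DecidableEq G] (h : IsRhoComm ρ 𝒜) (hint : DirectSum.IsInternal 𝒜)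
    (h2 : (2 : K) ≠ 0) (i : G) {I' : C → G} {F : Matrix C C A}
    (hF : GradedMatrix 𝒜 I' I' F) (e : J ⊕ J ≃ C)
    (h0 : ∀ a b, F (e (Sum.inr a)) (e (Sum.inl b)) = 0)
    (hI₁ : ∀ k, I' (e (Sum.inl k)) = I k) (hI₂ : ∀ k, I' (e (Sum.inr k)) = i - I k)
    {P R : Matrix J J A} (hP : ∀ k l, F (e (Sum.inl k)) (e (Sum.inl l)) = P k l)
    (hR : ∀ k l, F (e (Sum.inr k)) (e (Sum.inr l)) = rhoTranspose ρ i I I R k l)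
    (gP : GradedMatrix 𝒜 I I P) (gR : GradedMatrix 𝒜 I I R) (hPR : P * R = 1) (hRP : R * P = 1)
    (hu : HasUnitBlocks ρ I P) :
    rhoBer ρ I' F = rhoBer ρ I P * if ρ.IsOdd i then rhoBer ρ I P else rhoBer ρ I R := by
  have uR := hu.inverse h hint gP hPR hRP
  obtain ⟨E, V, ⟨-, hE1, hE2⟩, gV, hV1, hV2⟩ := hu.exists_inverse h hint gP
  obtain ⟨E₂, V₂, ⟨-, a1, a2⟩, gV₂, b1, b2⟩ := (uR.transpose h hint h2 i gR).exists_inverse h hint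
    (rhoTranspose_graded h gR)
  rw [rhoBer_of_blockTriangular h hF e h0 hI₁ hI₂ (Matrix.ext hP) (Matrix.ext hR) hE1 hE2 gV hV1 hV2
    a1 a2 gV₂ b1 b2 hint]
  congr 1
  split_ifs with hi
  · exact rhoBer_transpose_odd h hint hi h2 gP gR hPR hRP hE1 hE2 gV hV1 hV2
  · obtain ⟨E₃, V₃, ⟨g1, c1, c2⟩, gV₃, d1, d2⟩ := uR.exists_inverse h hint gR
    exact rhoBer_transpose_even h hi gR g1 c1 c2 gV₃ d1 d2

end UnitBlocks

/-! ### The induced volume form -/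

namespace RhoSpace

universe u v w

variable {G K : Type*} [AddCommGroup G] [RCLike K]
variable {𝕜 : Type*} [RCLike 𝕜] [NormedAlgebra 𝕜 K] {n : ℕ} {r : Regularity}
variable {X : Type u} [TopologicalSpace X] [ChartedSpace (EuclideanSpace 𝕜 (Fin n)) X]
variable {ρ : CommutationFactor G K}
variable {ι : Type*} [Fintype ι] [LinearOrder ι] {d : ι → G}
variable {M : RhoSpace.{u, v, w} 𝕜 n r X ρ d} {i q : G}

lemma jacobian_graded (hM : M.IsRhoManifold) (α β : M.Idx) {V : Opens X} (hα : V ≤ M.dom α)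
    (hβ : V ≤ M.dom β) :
    GradedMatrix (M.grade V) (fun b => -coordDeg n d b) (fun b => -coordDeg n d b)
      (M.jacobian α β hα hβ) := fun b a =>
  (hM.isRhoComm V).mem_of_eq (jacobian_mem hM α β hα hβ b a) (sub_neg_eq_add _ _).symm

lemma jacobian_map_res (hM : M.IsRhoManifold) (α β : M.Idx) {V W : Opens X} (h : W ≤ V)
    (hα : V ≤ M.dom α) (hβ : V ≤ M.dom β) :
    (M.jacobian α β hα hβ).map (M.res h) = M.jacobian α β (h.trans hα) (h.trans hβ) :=
  Matrix.ext fun b a => res_jacobian hM α β h hα hβ b a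

lemma jacobian_mul_jacobian_swap (hM : M.IsRhoManifold) (α β : M.Idx) {V : Opens X}
    (hα : V ≤ M.dom α) (hβ : V ≤ M.dom β) :
    M.jacobian α β hα hβ * M.jacobian β α hβ hα = 1 := by
  rw [jacobian_mul_jacobian hM, jacobian_self hM]

/-- The `ρ`-Berezinian of the Jacobian matrix. -/
def jacobianBer (M : RhoSpace.{u, v, w} 𝕜 n r X ρ d) (α β : M.Idx) {V : Opens X} (hα : V ≤ M.dom α)
    (hβ : V ≤ M.dom β) : M.sec V :=
  rhoBer ρ (fun b => -coordDeg n d b) (M.jacobian α β hα hβ)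

namespace VolumeForm

lemma isUnit_res (vol : M.VolumeForm) (α : M.Idx) {V : Opens X} (hα : V ≤ M.dom α) : IsUnit (M.res hα (vol.s α)) :=
  (vol.isUnit α).map (M.res hα)

/-- The existence of a volume form forces this: its invertible local functions differ by the
Berezinian, which is therefore a unit and not the default value. -/
lemma hasUnitBlocks (vol : M.VolumeForm) (hM : M.IsRhoManifold) (α β : M.Idx) {V : Opens X} (hα : V ≤ M.dom α)
    (hβ : V ≤ M.dom β) :
    HasUnitBlocks ρ (fun b => -coordDeg n d b) (M.jacobian α β hα hβ) := by
  have h1 : IsUnit (rhoBer ρ (fun b => -coordDeg n d b)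
      (M.jacobian α β (inf_le_left : M.dom α ⊓ M.dom β ≤ _) inf_le_right)) := by
    obtain ⟨u, hu⟩ := vol.isUnit_res β (inf_le_right : M.dom α ⊓ M.dom β ≤ _)
    have h2 := vol.isUnit_res α (inf_le_left : M.dom α ⊓ M.dom β ≤ _)
    rw [vol.compat α β, ← hu] at h2
    exact (Units.isUnit_mul_units _ u).1 h2
  have h2 := (hasUnitBlocks_of_isUnit_rhoBer h1).map (M.res (le_inf hα hβ))
  rwa [jacobian_map_res hM] at h2

lemma res_jacobianBer (vol : M.VolumeForm) (hM : M.IsRhoManifold) (α β : M.Idx) {V W : Opens X} (h : W ≤ V)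
    (hα : V ≤ M.dom α) (hβ : V ≤ M.dom β) :
    M.res h (M.jacobianBer α β hα hβ) = M.jacobianBer α β (h.trans hα) (h.trans hβ) := by
  classical
  refine (map_rhoBer (hM.isRhoComm V) (hM.isInternal V) (hM.isRhoComm W) (M.res h)
    (fun _ _ => M.res_mem h) (jacobian_graded hM α β hα hβ) (vol.hasUnitBlocks hM α β hα hβ)).trans ?_
  rw [jacobian_map_res hM]
  rfl

lemma res_eq (vol : M.VolumeForm) (hM : M.IsRhoManifold) (α β : M.Idx) {V : Opens X} (hα : V ≤ M.dom α)
    (hβ : V ≤ M.dom β) : M.res hα (vol.s α) = M.jacobianBer α β hα hβ * M.res hβ (vol.s β) := by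
  have h := congrArg (M.res (le_inf hα hβ)) (vol.compat α β)
  rw [map_mul, M.res_res, M.res_res] at h
  exact h.trans (congrArg (· * _) (vol.res_jacobianBer hM α β (le_inf hα hβ) inf_le_left inf_le_right))

lemma jacobianBer_mem (vol : M.VolumeForm) (hM : M.IsRhoManifold) (α β : M.Idx) {V : Opens X} (hα : V ≤ M.dom α)
    (hβ : V ≤ M.dom β) : M.jacobianBer α β hα hβ ∈ M.grade V 0 := by
  classical
  exact rhoBer_mem (hM.isRhoComm V) (hM.isInternal V) (jacobian_graded hM α β hα hβ)
    (vol.hasUnitBlocks hM α β hα hβ)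

/-- The volume form is transformed back and forth. This special case of multiplicativity is all that
is needed of the Berezinian, and it comes for free from the invertible local functions. -/
lemma jacobianBer_mul_swap (vol : M.VolumeForm) (hM : M.IsRhoManifold) (α β : M.Idx) {V : Opens X} (hα : V ≤ M.dom α)
    (hβ : V ≤ M.dom β) : M.jacobianBer α β hα hβ * M.jacobianBer β α hβ hα = 1 := by
  have h := vol.res_eq hM α β hα hβ
  rw [vol.res_eq hM β α hβ hα, ← mul_assoc] at h
  exact (vol.isUnit_res α hα).mul_right_cancel (h.symm.trans (one_mul _).symm)

end VolumeForm

section Cotangent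

lemma cot_jacobian_baseIdx (hM : M.IsRhoManifold) (i : G) (α β : M.Idx) {V : Opens X}
    (hα : V ≤ M.dom α) (hβ : V ≤ M.dom β) (b a : CoordIdx n ι) :
    (M.cotangent i).jacobian α β hα hβ (baseIdx b) (baseIdx a) =
      pullback hM i V (M.jacobian α β hα hβ b a) := by
  refine (congrArg (fun f => (M.cotangent i).pd α hα (baseIdx b) ((M.cotangent i).res hβ f))
    (coordFn_baseIdx hM i β a)).trans ?_
  refine (congrArg ((M.cotangent i).pd α hα (baseIdx b)) (res_pullback hM i hβ _)).trans ?_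
  exact pdBase_pullback hM i α hα b _

lemma cot_jacobian_fibreIdx_baseIdx (hM : M.IsRhoManifold) (i : G) (α β : M.Idx) {V : Opens X}
    (hα : V ≤ M.dom α) (hβ : V ≤ M.dom β) (b a : CoordIdx n ι) :
    (M.cotangent i).jacobian α β hα hβ (fibreIdx b) (baseIdx a) = 0 := by
  refine (congrArg (fun f => (M.cotangent i).pd α hα (fibreIdx b) ((M.cotangent i).res hβ f))
    (coordFn_baseIdx hM i β a)).trans ?_
  refine (congrArg ((M.cotangent i).pd α hα (fibreIdx b)) (res_pullback hM i hβ _)).trans ?_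
  exact pdFibre_pullback hM i α hα b _

/-- The new linear coordinates have the coefficients `∂x^b/∂y^a`, so the fibre block comes from the
inverse Jacobian matrix, and the sign of `∂/∂x_b^*` moving past them is that of the `ρ`-transpose.
-/
lemma cot_jacobian_fibreIdx (hM : M.IsRhoManifold) (i : G) (α β : M.Idx) {V : Opens X}
    (hα : V ≤ M.dom α) (hβ : V ≤ M.dom β) (b a : CoordIdx n ι) :
    (M.cotangent i).jacobian α β hα hβ (fibreIdx b) (fibreIdx a) =
      rhoTranspose ρ i (fun b => -coordDeg n d b) (fun b => -coordDeg n d b)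
        ((M.jacobian β α hβ hα).map (pullbackHom hM i V)) b a := by
  refine (congrArg ((M.cotangent i).pd α hα (fibreIdx b)) (res_fibreFn hM i α β hα hβ a)).trans ?_
  refine (pdFibre_sum hM i α hα (fun b => M.jacobian β α hβ hα a b)
    (fun b => jacobian_mem hM β α hβ hα a b) b).trans ?_
  rw [rhoTranspose_apply, sub_neg_eq_add, sub_neg_eq_add, add_comm i]
  rfl

open scoped Classical in
/-- The `ρ`-Berezinian of a change of coordinates on the cotangent bundle. -/
lemma cot_jacobianBer (hM : M.IsRhoManifold) (vol : M.VolumeForm) (i : G) (α β : M.Idx) {V : Opens X}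
    (hα : V ≤ M.dom α) (hβ : V ≤ M.dom β) :
    (M.cotangent i).jacobianBer α β hα hβ = pullback hM i V (M.jacobianBer α β hα hβ) *
      if ρ.IsOdd i then pullback hM i V (M.jacobianBer α β hα hβ)
      else pullback hM i V (M.jacobianBer β α hβ hα) := by
  have hC := isRhoManifold_cotangent hM i
  have m := fun (γ δ : M.Idx) (hγ : V ≤ M.dom γ) (hδ : V ≤ M.dom δ) =>
    map_rhoBer (hM.isRhoComm V) (hM.isInternal V) (hC.isRhoComm V) (pullbackHom hM i V)
      (fun _ _ => pullback_mem hM i) (jacobian_graded hM γ δ hγ hδ) (vol.hasUnitBlocks hM γ δ hγ hδ)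
  have g := fun (γ δ : M.Idx) (hγ : V ≤ M.dom γ) (hδ : V ≤ M.dom δ) (b a : CoordIdx n ι) =>
    pullback_mem hM i (jacobian_graded hM γ δ hγ hδ b a)
  have r := rhoBer_cotangent (hC.isRhoComm V) (hC.isInternal V) two_ne_zero i
    (I := fun b => -coordDeg n d b) (jacobian_graded hC α β hα hβ) cotIdxEquiv
    (fun a b => cot_jacobian_fibreIdx_baseIdx hM i α β hα hβ a b)
    (fun k => congrArg Neg.neg (coordDeg_baseIdx k))
    (fun k => (congrArg Neg.neg (coordDeg_fibreIdx k)).trans (by abel))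
    (P := (M.jacobian α β hα hβ).map (pullbackHom hM i V))
    (R := (M.jacobian β α hβ hα).map (pullbackHom hM i V))
    (fun k l => cot_jacobian_baseIdx hM i α β hα hβ k l)
    (fun k l => cot_jacobian_fibreIdx hM i α β hα hβ k l)
    (g α β hα hβ) (g β α hβ hα) (pullback_jacobian_mul hM i α β hα hβ)
    (pullback_jacobian_mul hM i β α hβ hα) ((vol.hasUnitBlocks hM α β hα hβ).map (pullbackHom hM i V))
  rw [← m α β hα hβ, ← m β α hβ hα] at r
  exact r

open scoped Classical in
/-- The local functions of the induced volume form. -/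
def inducedVolumeFun (hM : M.IsRhoManifold) (i : G) (vol : M.VolumeForm) (α : M.Idx) :
    (M.cotangent i).sec (M.dom α) :=
  if ρ.IsOdd i then pullback hM i (M.dom α) (vol.s α) ^ 2 else 1

lemma inducedVolumeFun_eq (hM : M.IsRhoManifold) (i : G) (vol : M.VolumeForm) (α : M.Idx) :
    ∃ t ∈ M.grade (M.dom α) 0, IsUnit t ∧
      M.inducedVolumeFun hM i vol α = pullback hM i (M.dom α) t := by
  unfold inducedVolumeFun
  split_ifs
  · refine ⟨vol.s α * vol.s α, ?_, (vol.isUnit α).mul (vol.isUnit α), ?_⟩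
    · rw [← add_zero (0 : G)]
      exact M.mul_mem (vol.mem α) (vol.mem α)
    · rw [pullback_mul, sq]
  · exact ⟨1, M.one_mem _, isUnit_one, (pullback_one hM i).symm⟩

-- For odd `i` the Berezinian on the cotangent bundle is the square of the Berezinian of the base,
-- as required by `s²`. For even `i` it is the product of the Berezinians of a change of coordinates
-- and its inverse, which is `1`.
open scoped Classical in
lemma res_inducedVolumeFun (hM : M.IsRhoManifold) (i : G) (vol : M.VolumeForm) (α β : M.Idx)
    {V : Opens X} (hα : V ≤ M.dom α) (hβ : V ≤ M.dom β) :
    (M.cotangent i).res hα (M.inducedVolumeFun hM i vol α) =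
      (M.cotangent i).jacobianBer α β hα hβ *
        (M.cotangent i).res hβ (M.inducedVolumeFun hM i vol β) := by
  have h0 := vol.res_eq hM α β hα hβ
  have hc := (hM.isRhoComm V).commute_zero
    (vol.jacobianBer_mem hM α β hα hβ) (M.res_mem hβ (vol.mem β))
  have hs := vol.jacobianBer_mul_swap hM α β hα hβ
  refine Eq.trans ?_ (congrArg (· * _) (cot_jacobianBer hM vol i α β hα hβ)).symm
  generalize M.jacobianBer α β hα hβ = B at *
  generalize M.jacobianBer β α hβ hα = B' at *
  unfold inducedVolumeFun
  split_ifs with hi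
  · rw [sq, sq, ← pullback_mul, ← pullback_mul, ← pullback_mul]
    refine (res_pullback hM i _ _).trans (Eq.trans ?_ (congrArg _ (res_pullback hM i _ _)).symm)
    rw [← pullback_mul, map_mul (M.res hα), map_mul (M.res hβ), h0]
    refine congrArg _ ?_
    rw [mul_assoc, ← mul_assoc (M.res _ _) B, ← hc, mul_assoc, mul_assoc]
  · rw [← pullback_mul, hs, pullback_one, map_one, map_one, one_mul]

theorem existsUnique_isInducedVolume (hM : M.IsRhoManifold) (i : G) (vol : M.VolumeForm) :
    ∃! vol', IsInducedVolume hM i vol vol' := by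
  classical
  refine ⟨⟨M.inducedVolumeFun hM i vol, fun α => ?_, fun α => ?_, fun α β => ?_⟩, fun α => rfl,
    fun vol' h => VolumeForm.ext (funext h)⟩
  · obtain ⟨t, ht, -, e⟩ := inducedVolumeFun_eq hM i vol α
    rw [e]
    exact pullback_mem hM i ht
  · obtain ⟨t, -, ht, e⟩ := inducedVolumeFun_eq hM i vol α
    rw [e]
    exact ht.map (pullbackHom hM i (M.dom α))
  · exact res_inducedVolumeFun hM i vol α β _ _

end Cotangent

end RhoSpace

/-! ### The divergence -/

namespace CommutationFactor

variable {G K : Type*} [AddCommGroup G] [Field K] (ρ : CommutationFactor G K)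

lemma self_add_mul_neg (a q : G) : ρ a (a + q) * ρ (-a) (q + a) = 1 := by
  rw [ρ.neg_left, add_comm q a, mul_inv_cancel₀ (ρ.ne_zero _ _)]

lemma neg_self_mul (a b q : G) : ρ (-a) (-a) * (ρ q (-a - -b) * ρ q (-b)) = ρ a (a + q) := by
  rw [ρ.sub_right, inv_mul_cancel_right₀ (ρ.ne_zero _ _), ρ.neg_left, ρ.neg_right, ρ.neg_right, inv_inv,
    ← ρ.swap, ← ρ.add_right]

lemma self_add_mul_jacobian (a b q : G) :
    ρ a (a + q) * ρ (-a + (q + b)) (-b + a) = ρ b (b + q) := by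
  have n1 := ρ.ne_zero a b
  have n2 := ρ.ne_zero a q
  have n3 := ρ.ne_zero b q
  have n4 := ρ.ne_zero a a
  have n5 := ρ.ne_zero b b
  have e := ρ.self_mul_self b
  simp only [ρ.add_left, ρ.add_right, ρ.neg_left, ρ.neg_right, ρ.swap a b, ρ.swap a q, ρ.swap b q]
  field_simp
  linear_combination -e

lemma self_add_mul_comm {q : G} (hq : ρ q q = -1) (a b : G) :
    ρ a (a + q) * ρ q (-a) * ρ (-a + (q + b)) (-b + (q + a)) = -(ρ b (b + q) * ρ q (-b)) := by
  have n1 := ρ.ne_zero a b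
  have n2 := ρ.ne_zero a q
  have n3 := ρ.ne_zero b q
  have n4 := ρ.ne_zero a a
  have n5 := ρ.ne_zero b b
  have e := ρ.self_mul_self b
  simp only [ρ.add_left, ρ.add_right, ρ.neg_left, ρ.neg_right, ρ.swap a b, ρ.swap a q, ρ.swap b q, hq]
  field_simp
  linear_combination e

/-- The sign identity behind the factor `1 - ρ(i,i)`: relative to the base coordinate, the fibre
coordinate contributes exactly `ρ(i,i)`, up to the minus sign in the Hamiltonian field. -/
lemma self_fibre (a i q : G) :
    ρ (-a - i) (-a - i + q) * (ρ a q * ρ (a + i) (-a + q + a)) = ρ i i * ρ a (a + q) := by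
  have n1 := ρ.ne_zero a i
  have n2 := ρ.ne_zero a q
  have n3 := ρ.ne_zero i q
  rw [show -a - i = -(a + i) by abel, show -a + q + a = q by abel]
  simp only [ρ.add_left, ρ.add_right, ρ.neg_left, ρ.neg_right, ρ.swap a i]
  field_simp

end CommutationFactor

namespace RhoSpace

universe u v w

variable {G K : Type*} [AddCommGroup G] [RCLike K]
variable {𝕜 : Type*} [RCLike 𝕜] [NormedAlgebra 𝕜 K] {n : ℕ} {r : Regularity}
variable {X : Type u} [TopologicalSpace X] [ChartedSpace (EuclideanSpace 𝕜 (Fin n)) X]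
variable {ρ : CommutationFactor G K}
variable {ι : Type*} [Fintype ι] [LinearOrder ι] {d : ι → G}
variable {M : RhoSpace.{u, v, w} 𝕜 n r X ρ d} {i q : G}

namespace VectorField

/-- The divergence with respect to the coordinate volume form. -/
def coordDiv (Q : M.VectorField q) (α : M.Idx) {V : Opens X} (hV : V ≤ M.dom α) : M.sec V :=
  ∑ a, ρ (coordDeg n d a) (coordDeg n d a + q) • M.pd α hV a (M.res hV (Q.comp α a))

variable (Q : M.VectorField q)

lemma res_comp_mem (hM : M.IsRhoManifold) (Q : M.VectorField q) (α : M.Idx) {V : Opens X}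
    (hV : V ≤ M.dom α) (a : CoordIdx n ι) :
    M.res hV (Q.comp α a) ∈ M.grade V (q + coordDeg n d a) := M.res_mem hV (Q.comp_mem hM α a)

lemma pd_comp_mem (hM : M.IsRhoManifold) (Q : M.VectorField q) (α β : M.Idx) {V : Opens X}
    (hα : V ≤ M.dom α) (hβ : V ≤ M.dom β) (a b : CoordIdx n ι) :
    M.pd α hα a (M.res hβ (Q.comp β b)) ∈ M.grade V (-coordDeg n d a + (q + coordDeg n d b)) :=
  pd_mem hM α hα a (Q.res_comp_mem hM β hβ b)

lemma coordDiv_mem (hM : M.IsRhoManifold) (Q : M.VectorField q) (α : M.Idx) {V : Opens X}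
    (hV : V ≤ M.dom α) : Q.coordDiv α hV ∈ M.grade V q :=
  Submodule.sum_mem _ fun a _ => Submodule.smul_mem _ _
    ((hM.isRhoComm V).mem_of_eq (Q.pd_comp_mem hM α α hV hV a a) (by abel))

lemma res_coordDiv (hM : M.IsRhoManifold) (Q : M.VectorField q) (α : M.Idx) {V W : Opens X}
    (h : W ≤ V) (hV : V ≤ M.dom α) : M.res h (Q.coordDiv α hV) = Q.coordDiv α (h.trans hV) := by
  rw [coordDiv, map_sum]
  refine Finset.sum_congr rfl fun a _ => ?_
  rw [map_smul, res_pd hM α h hV (h.trans hV), M.res_res]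

lemma app_mul_of_mem_zero (Q : M.VectorField q) {V : Opens X} {s : M.sec V}
    (hs : s ∈ M.grade V 0) (f : M.sec V) : Q.app V (s * f) = Q.app V s * f + s * Q.app V f := by
  rw [Q.leibniz V f hs, ρ.zero_right, one_smul]

/-- The Leibniz rule for `∂_a(Q^a s)`. The sign in the Lie derivative cancels the one from moving
`∂_a` past `Q^a`, so that the second part adds up to `Q(s)`. -/
lemma lie_eq (hM : M.IsRhoManifold) (Q : M.VectorField q) (α : M.Idx) (s : M.sec (M.dom α)) :
    Q.lie α s = Q.coordDiv α le_rfl * s + Q.app _ s := by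
  rw [lie, coordDiv, Finset.sum_mul, Q.app_eq_sum hM α le_rfl, ← Finset.sum_add_distrib]
  refine Finset.sum_congr rfl fun a _ => ?_
  rw [M.res_self, pd_mul hM α le_rfl a (Q.comp_mem hM α a), smul_add, smul_smul, ρ.self_add_mul_neg,
    one_smul, smul_mul_assoc]

/-- A vector field as a `ρ`-derivation of the algebra of functions over a coordinate
neighbourhood. -/
def toRhoDerivation (hM : M.IsRhoManifold) (Q : M.VectorField q) (α : M.Idx) {V : Opens X}
    (hV : V ≤ M.dom α) : RhoDerivation ρ (M.grade V) q where
  D := Q.app V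
  θ := ((exprEquiv hM α hV).symm.toAlgHom.comp (Series.theta q)).comp (M.expr α V hV)
  θ_apply {j f} hf := by
    refine (exprEquiv hM α hV).injective ?_
    rw [map_smul]
    refine ((exprEquiv hM α hV).apply_symm_apply _).trans ?_
    exact Series.theta_apply q ((hM.expr_mem_iff α V hV j f).2 hf)
  mem := Q.app_mem V
  leibniz f g := by
    let T : M.sec V →ₐ[K] M.sec V :=
      ((exprEquiv hM α hV).symm.toAlgHom.comp (Series.theta q)).comp (M.expr α V hV)
    refine hM.linearMap_ext (φ := (Q.app V).comp (LinearMap.mulRight K g))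
      (ψ := (LinearMap.mulRight K g).comp (Q.app V) +
        (LinearMap.mulRight K (Q.app V g)).comp T.toLinearMap) (fun j f hf => ?_) f
    have hT : T f = ρ q j • f := by
      refine (exprEquiv hM α hV).injective ?_
      rw [map_smul]
      refine ((exprEquiv hM α hV).apply_symm_apply _).trans ?_
      exact Series.theta_apply q ((hM.expr_mem_iff α V hV j f).2 hf)
    change Q.app V (f * g) = Q.app V f * g + T f * Q.app V g
    rw [hT, Q.leibniz V g hf, smul_mul_assoc]

/-- The logarithmic derivative of the `ρ`-Berezinian of a change of coordinates. -/
lemma app_jacobianBer (hM : M.IsRhoManifold) (Q : M.VectorField q) (vol : M.VolumeForm) (α β : M.Idx)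
    {V : Opens X} (hα : V ≤ M.dom α) (hβ : V ≤ M.dom β) :
    Q.app V (M.jacobianBer α β hα hβ) =
      M.jacobianBer α β hα hβ * (Q.coordDiv β hβ - Q.coordDiv α hα) := by
  classical
  have h := hM.isRhoComm V
  obtain ⟨E, V', ⟨-, hE1, hE2⟩, gV, hV1, hV2⟩ := (vol.hasUnitBlocks hM α β hα hβ).exists_inverse h
    (hM.isInternal V) (jacobian_graded hM α β hα hβ)
  refine ((Q.toRhoDerivation hM α hα).apply_rhoBer h (jacobian_graded hM α β hα hβ)
    (jacobian_graded hM β α hβ hα) (jacobian_mul_jacobian_swap hM α β hα hβ) hE1 hE2 gV hV1 hV2).trans ?_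
  refine congrArg (M.jacobianBer α β hα hβ * ·) ?_
  have e1 : ∀ k l, M.jacobian β α hβ hα k l * Q.app V (M.jacobian α β hα hβ l k) =
      ρ q (-coordDeg n d l) • (M.jacobian β α hβ hα k l * (M.pd α hα l (M.res hβ (Q.comp β k)) -
        ∑ b, M.pd α hα l (M.res hα (Q.comp α b)) * M.jacobian α β hα hβ b k)) := fun k l => by
    rw [jacobian_apply α β hα hβ l k, Q.app_pd hM α hα, mul_smul_comm, Q.app_res]
    rfl
  -- The chain rule turns contractions of the Jacobian matrix with `∂/∂x` into `∂/∂y`. Thus the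
  -- supertrace is the coordinate divergence in `y` minus a term which, by the chain rule in the
  -- other direction, is that in `x`.
  have e2 : ∀ k, ∑ l, M.jacobian β α hβ hα k l * (M.pd α hα l (M.res hβ (Q.comp β k)) -
        ∑ b, M.pd α hα l (M.res hα (Q.comp α b)) * M.jacobian α β hα hβ b k) =
      M.pd β hβ k (M.res hβ (Q.comp β k)) -
        ∑ b, M.pd β hβ k (M.res hα (Q.comp α b)) * M.jacobian α β hα hβ b k := fun k => by
    simp only [mul_sub, Finset.sum_sub_distrib, Finset.mul_sum, ← mul_assoc]
    rw [Finset.sum_comm, ← pd_eq_sum_jacobian hM β α hβ hα]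
    refine congrArg _ (Finset.sum_congr rfl fun b _ => ?_)
    rw [← Finset.sum_mul, ← pd_eq_sum_jacobian hM β α hβ hα]
  have e3 : ∀ k, ρ (-coordDeg n d k) (-coordDeg n d k) •
      ∑ l, ρ q (-coordDeg n d k - -coordDeg n d l) •
        (M.jacobian β α hβ hα k l * Q.app V (M.jacobian α β hα hβ l k)) =
      ρ (coordDeg n d k) (coordDeg n d k + q) • (M.pd β hβ k (M.res hβ (Q.comp β k)) -
        ∑ b, M.pd β hβ k (M.res hα (Q.comp α b)) * M.jacobian α β hα hβ b k) := fun k => by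
    rw [← e2, Finset.smul_sum, Finset.smul_sum]
    refine Finset.sum_congr rfl fun l _ => ?_
    rw [e1, smul_smul, smul_smul, mul_assoc, ρ.neg_self_mul]
  refine (Finset.sum_congr rfl fun k _ => e3 k).trans ?_
  simp only [smul_sub, Finset.sum_sub_distrib]
  refine congrArg₂ _ rfl ?_
  have e4 : ∀ b, M.pd α hα b (M.res hα (Q.comp α b)) =
      ∑ k, M.jacobian α β hα hβ b k * M.pd β hβ k (M.res hα (Q.comp α b)) := fun b =>
    pd_eq_sum_jacobian hM α β hα hβ b _
  simp only [coordDiv, e4, Finset.smul_sum]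
  rw [Finset.sum_comm]
  refine Finset.sum_congr rfl fun b _ => Finset.sum_congr rfl fun k _ => ?_
  rw [h.comm (Q.pd_comp_mem hM β α hβ hα k b) (jacobian_mem hM α β hα hβ b k), smul_smul,
    ρ.self_add_mul_jacobian]

/-- A homological vector field annihilates its coordinate divergence. -/
lemma IsHomological.app_coordDiv (hM : M.IsRhoManifold) {Q : M.VectorField q} (hQ : Q.IsHomological)
    (α : M.Idx) {V : Opens X} (hV : V ≤ M.dom α) : Q.app V (Q.coordDiv α hV) = 0 := by
  have h := hM.isRhoComm V
  have e : Q.app V (Q.coordDiv α hV) = -∑ a, ∑ b, (ρ (coordDeg n d a) (coordDeg n d a + q) *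
      ρ q (-coordDeg n d a)) • (M.pd α hV a (M.res hV (Q.comp α b)) *
        M.pd α hV b (M.res hV (Q.comp α a))) := by
    rw [coordDiv, map_sum, ← Finset.sum_neg_distrib]
    refine Finset.sum_congr rfl fun a _ => ?_
    have h0 : M.pd α hV a (Q.app V (M.res hV (Q.comp α a))) = 0 := by
      rw [Q.app_res]
      refine (congrArg (fun f => M.pd α hV a (M.res hV f)) (hQ.app_app _ (M.coordFn α a))).trans ?_
      rw [map_zero]
      exact map_zero (pdLin hM α hV a)
    rw [map_smul, Q.app_pd hM α hV, h0, zero_sub, smul_neg, smul_neg, smul_smul, Finset.smul_sum]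
  -- For odd `Q` exchanging `a` and `b` reverses the sign of the summand, so the double sum is its
  -- own negative.
  have e' : ∑ a, ∑ b, (ρ (coordDeg n d a) (coordDeg n d a + q) *
      ρ q (-coordDeg n d a)) • (M.pd α hV a (M.res hV (Q.comp α b)) *
        M.pd α hV b (M.res hV (Q.comp α a))) =
      -∑ a, ∑ b, (ρ (coordDeg n d a) (coordDeg n d a + q) *
      ρ q (-coordDeg n d a)) • (M.pd α hV a (M.res hV (Q.comp α b)) *
        M.pd α hV b (M.res hV (Q.comp α a))) := by
    conv_rhs => rw [Finset.sum_comm]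
    rw [← Finset.sum_neg_distrib]
    refine Finset.sum_congr rfl fun a _ => ?_
    rw [← Finset.sum_neg_distrib]
    refine Finset.sum_congr rfl fun b _ => ?_
    rw [h.comm (Q.pd_comp_mem hM α α hV hV a b) (Q.pd_comp_mem hM α α hV hV b a), smul_smul,
      ρ.self_add_mul_comm hQ.1, neg_smul]
  rw [e, neg_eq_zero]
  have e2 := eq_neg_iff_add_eq_zero.1 e'
  rw [← two_smul K] at e2
  exact (smul_eq_zero.1 e2).resolve_left two_ne_zero

end VectorField

end RhoSpace

/-! ### Divergences and modular classes -/

namespace RhoSpace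

universe u v w

variable {G K : Type*} [AddCommGroup G] [RCLike K]
variable {𝕜 : Type*} [RCLike 𝕜] [NormedAlgebra 𝕜 K] {n : ℕ} {r : Regularity}
variable {X : Type u} [TopologicalSpace X] [ChartedSpace (EuclideanSpace 𝕜 (Fin n)) X]
variable {ρ : CommutationFactor G K}
variable {ι : Type*} [Fintype ι] [LinearOrder ι] {d : ι → G}
variable {M : RhoSpace.{u, v, w} 𝕜 n r X ρ d} {i q : G}

lemma isDivergence_iff (hM : M.IsRhoManifold) {vol : M.VolumeForm} {Q : M.VectorField q}
    {D : M.sec ⊤} : IsDivergence vol Q D ↔ ∀ α, vol.s α * M.res le_top D =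
      Q.coordDiv α le_rfl * vol.s α + Q.app _ (vol.s α) :=
  forall_congr' fun α => by rw [Q.lie_eq hM]

lemma IsDivergence.unique (hM : M.IsRhoManifold) {vol : M.VolumeForm} {Q : M.VectorField q}
    {D D' : M.sec ⊤} (h : IsDivergence vol Q D) (h' : IsDivergence vol Q D') : D = D' :=
  hM.ext_top fun α => (vol.isUnit α).mul_left_cancel ((h α).trans (h' α).symm)

/-- The statement on inverses of graded matrices, applied to matrices of size one. -/
lemma mem_grade_zero_of_mul_eq_one (hM : M.IsRhoManifold) {V : Opens X} {s t : M.sec V}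
    (hs : s ∈ M.grade V 0) (h1 : s * t = 1) (h2 : t * s = 1) : t ∈ M.grade V 0 := by
  classical
  have h := GradedMatrix.of_mul_eq_one (hM.isRhoComm V) (hM.isInternal V) (J := Unit)
    (I := fun _ => (0 : G)) (F := Matrix.of fun _ _ => s) (V := Matrix.of fun _ _ => t)
    (fun _ _ => (hM.isRhoComm V).mem_of_eq hs (sub_self _).symm)
    (Matrix.ext fun _ _ => by simp [Matrix.mul_apply, h1])
    (Matrix.ext fun _ _ => by simp [Matrix.mul_apply, h2])
  exact (hM.isRhoComm V).mem_of_eq (h () ()) (sub_self _)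

/-- The local candidates are the coordinate divergence plus `s⁻¹ Q(s)`. On overlaps the change of
`s` by the Berezinian is compensated, because the logarithmic derivative of the Berezinian is the
difference of the coordinate divergences. -/
theorem exists_isDivergence (hM : M.IsRhoManifold) (vol : M.VolumeForm) (Q : M.VectorField q) :
    ∃ D ∈ M.grade ⊤ q, IsDivergence vol Q D := by
  have ht : ∀ α, ∃ t, vol.s α * t = 1 ∧ t * vol.s α = 1 := fun α => by
    obtain ⟨u, hu⟩ := vol.isUnit α
    exact ⟨u.inv, hu ▸ u.val_inv, hu ▸ u.inv_val⟩
  choose t ht1 ht2 using ht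
  have tmem : ∀ α, t α ∈ M.grade _ 0 := fun α => mem_grade_zero_of_mul_eq_one hM (vol.mem α) (ht1 α) (ht2 α)
  let D : ∀ α, M.sec (M.dom α) := fun α => Q.coordDiv α le_rfl + t α * Q.app _ (vol.s α)
  have hs : ∀ α, vol.s α * D α = Q.coordDiv α le_rfl * vol.s α + Q.app _ (vol.s α) := fun α => by
    change vol.s α * (_ + _) = _
    rw [mul_add, ← mul_assoc, ht1, one_mul,
      (hM.isRhoComm _).commute_zero (vol.mem α) (Q.coordDiv_mem hM α le_rfl)]
  have Dmem : ∀ α, D α ∈ M.grade _ q := fun α => by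
    refine add_mem (Q.coordDiv_mem hM α le_rfl) ?_
    have h := M.mul_mem (tmem α) (Q.app_mem _ (vol.mem α))
    rwa [zero_add, add_zero] at h
  obtain ⟨g, hg, hg'⟩ := hM.exists_glue D Dmem fun α β => by
    have hα : M.dom α ⊓ M.dom β ≤ M.dom α := inf_le_left
    have hβ : M.dom α ⊓ M.dom β ≤ M.dom β := inf_le_right
    have h := hM.isRhoComm (M.dom α ⊓ M.dom β)
    refine (vol.isUnit_res α hα).mul_left_cancel ?_
    have a1 : M.res hα (vol.s α) * M.res hα (D α) = Q.coordDiv α hα * M.res hα (vol.s α) +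
        Q.app _ (M.res hα (vol.s α)) := by
      rw [← map_mul, hs, map_add, map_mul, Q.res_coordDiv hM, Q.app_res]
    have b1 : M.res hβ (vol.s β) * M.res hβ (D β) = Q.coordDiv β hβ * M.res hβ (vol.s β) +
        Q.app _ (M.res hβ (vol.s β)) := by
      rw [← map_mul, hs, map_add, map_mul, Q.res_coordDiv hM, Q.app_res]
    refine a1.trans ?_
    have hB := vol.jacobianBer_mem hM α β hα hβ
    have c := h.commute_zero hB (Q.coordDiv_mem hM α hα)
    rw [vol.res_eq hM α β hα hβ, mul_assoc _ _ (M.res _ (D β)), b1, Q.app_mul_of_mem_zero hB,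
      Q.app_jacobianBer hM vol, ← mul_assoc, ← c, mul_sub, sub_mul, mul_add, ← mul_assoc]
    abel
  exact ⟨g, hg, fun α => by rw [hg', hs, Q.lie_eq hM]⟩

theorem existsUnique_isDivergence (hM : M.IsRhoManifold) (vol : M.VolumeForm) (Q : M.VectorField q) :
    ∃! D, IsDivergence vol Q D := by
  obtain ⟨D, -, hD⟩ := exists_isDivergence hM vol Q
  exact ⟨D, hD, fun D' h => h.unique hM hD⟩

lemma IsDivergence.mem (hM : M.IsRhoManifold) {vol : M.VolumeForm} {Q : M.VectorField q}
    {D : M.sec ⊤} (h : IsDivergence vol Q D) : D ∈ M.grade ⊤ q := by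
  obtain ⟨D', h', hD'⟩ := exists_isDivergence hM vol Q
  rwa [h.unique hM hD']

/-- Let `d` be the coordinate divergence. Applying `Q` to `s D = d s + Q(s)`, with `Q(d) = 0` and
`Q(Q(s)) = 0`, gives `Q(s) D + s Q(D) = -d Q(s)`. Since `Q(s)` is odd with square zero, also `Q(s) D
= -d Q(s)`, so `s Q(D) = 0` with `s` invertible. -/
lemma IsDivergence.app_eq_zero (hM : M.IsRhoManifold) {vol : M.VolumeForm} {Q : M.VectorField q}
    (hQ : Q.IsHomological) {D : M.sec ⊤} (h : IsDivergence vol Q D) : Q.app ⊤ D = 0 := by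
  refine hM.ext_top fun α => ?_
  rw [map_zero, ← Q.app_res]
  have c := hM.isRhoComm (M.dom α)
  have hD := M.res_mem (le_top : M.dom α ≤ ⊤) (h.mem hM)
  have e := (isDivergence_iff hM).1 h α
  have hs := vol.mem α
  have hd := Q.coordDiv_mem hM α (le_refl (M.dom α))
  have hQd := hQ.app_coordDiv hM α (le_refl (M.dom α))
  have hQQ := hQ.app_app _ (vol.s α)
  have hQs := Q.app_mem _ hs
  have u := vol.isUnit α
  generalize M.res (le_top : M.dom α ≤ ⊤) D = D₀ at *
  generalize Q.coordDiv α (le_refl (M.dom α)) = d₀ at *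
  generalize vol.s α = s at *
  rw [add_zero] at hQs
  have hq := hQ.1
  -- the square of the odd section `Q s` vanishes
  have e1 : Q.app _ s * Q.app _ s = 0 := by
    have h1 := c.comm hQs hQs
    rw [hq, neg_one_smul, eq_neg_iff_add_eq_zero, ← two_smul K] at h1
    exact (smul_eq_zero.1 h1).resolve_left two_ne_zero
  have e2 : Q.app _ s * D₀ = -(d₀ * Q.app _ s) := by
    refine u.mul_left_cancel ?_
    rw [← mul_assoc, c.commute_zero hs hQs, mul_assoc, e, mul_add, e1, add_zero, ← mul_assoc,
      c.comm hQs hd, hq, neg_one_smul, neg_mul, mul_neg, mul_assoc, ← c.commute_zero hs hQs,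
      ← mul_assoc, ← mul_assoc, c.commute_zero hs hd]
  have e3 := congrArg (Q.app _) e
  rw [Q.app_mul_of_mem_zero hs, map_add, hQQ, Q.leibniz _ s hd, hQd, zero_mul, hq, neg_one_smul,
    e2, zero_add, add_zero, add_eq_left] at e3
  exact u.mul_left_cancel (e3.trans (mul_zero _).symm)

lemma IsDivergence.mem_cocycles (hM : M.IsRhoManifold) {vol : M.VolumeForm} {Q : M.VectorField q}
    (hQ : Q.IsHomological) {D : M.sec ⊤} (h : IsDivergence vol Q D) : D ∈ Q.cocycles 1 :=
  ⟨by rw [one_zsmul]; exact h.mem hM, LinearMap.mem_ker.2 (h.app_eq_zero hM hQ)⟩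

theorem existsUnique_isModularClass (hM : M.IsRhoManifold) (vol : M.VolumeForm) {Q : M.VectorField q}
    (hQ : Q.IsHomological) : ∃! μ, IsModularClass vol Q μ := by
  obtain ⟨D, -, hD⟩ := exists_isDivergence hM vol Q
  refine ⟨Submodule.Quotient.mk ⟨D, hD.mem_cocycles hM hQ⟩, ⟨D, hD.mem_cocycles hM hQ, hD, rfl⟩, ?_⟩
  rintro μ ⟨D', hD', h', rfl⟩
  obtain rfl := h'.unique hM hD
  rfl

/-! ### The divergence of the Hamiltonian vector field -/

/-- The coordinates `x^a` contribute the coordinate divergence of `Q`. In the fibre component along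
`x_a^*` only the term with `b = a` survives `∂/∂x_a^*`, and by `self_fibre` it contributes `-ρ(i,i)`
times the same summand. -/
lemma IsHamiltonian.coordDiv (hM : M.IsRhoManifold) {Q : M.VectorField q}
    {F : (M.cotangent i).sec ⊤} (hF : IsSymbol hM i Q F) {Q' : (M.cotangent i).VectorField q}
    (hQ' : IsHamiltonian i F Q') (α : M.Idx) :
    Q'.coordDiv α (le_refl (M.dom α)) = (1 - ρ i i) • pullback hM i _ (Q.coordDiv α le_rfl) := by
  have hC := isRhoManifold_cotangent hM i
  have eb : ∀ a, (M.cotangent i).pd α (le_refl (M.dom α)) (baseIdx a)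
      ((M.cotangent i).res le_rfl (Q'.comp α (baseIdx a))) =
        pullback hM i _ (M.pd α le_rfl a (Q.comp α a)) := fun a => by
    refine (congrArg ((M.cotangent i).pd α (le_refl (M.dom α)) (baseIdx a))
      ((M.cotangent i).res_self (le_refl (M.dom α)) _)).trans ?_
    refine Eq.trans (congrArg _ ?_) (pdBase_pullback hM i α le_rfl a (Q.comp α a))
    exact (congrArg (Q'.app _) (coordFn_baseIdx hM i α a)).trans (hQ'.app_pullback hM hF _ _)
  have ef : ∀ a, (M.cotangent i).pd α (le_refl (M.dom α)) (fibreIdx a)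
      ((M.cotangent i).res le_rfl (Q'.comp α (fibreIdx a))) =
        -((ρ (coordDeg n d a) q * ρ (coordDeg n d a + i) (-coordDeg n d a + q + coordDeg n d a)) •
          pullback hM i _ (M.pd α le_rfl a (Q.comp α a))) := fun a => by
    have e1 : (M.cotangent i).res le_rfl (Q'.comp α (fibreIdx a)) = -(ρ (coordDeg n d a) q •
        ∑ b, pullback hM i _ (M.pd α le_rfl a (M.res le_rfl (Q.comp α b))) *
          (M.cotangent i).res le_rfl (M.fibreFn i α b)) :=
      ((Q'.app_res _ _).symm.trans (hQ'.app_eq hM hF α le_rfl _)).trans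
        (hamLocal_fibreFn hM i Q α le_rfl a)
    refine (congrArg ((M.cotangent i).pd α (le_refl (M.dom α)) (fibreIdx a)) e1).trans ?_
    refine (map_neg (pdLin hC α (le_refl (M.dom α)) (fibreIdx a)) _).trans (congrArg Neg.neg ?_)
    refine (map_smul (pdLin hC α (le_refl (M.dom α)) (fibreIdx a)) _ _).trans ?_
    refine (congrArg (ρ (coordDeg n d a) q • ·) (pdFibre_sum hM i α le_rfl
      (fun b => M.pd α le_rfl a (M.res le_rfl (Q.comp α b))) (e := -coordDeg n d a + q)
      (fun b => (hM.isRhoComm _).mem_of_eq (Q.pd_comp_mem hM α α le_rfl le_rfl a b)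
        (add_assoc _ _ _).symm) a)).trans ?_
    rw [smul_smul, M.res_self]
  refine (sum_cotIdx _).trans ?_
  rw [VectorField.coordDiv, map_sum, Finset.smul_sum, ← Finset.sum_add_distrib]
  refine Finset.sum_congr rfl fun a _ => ?_
  refine (congrArg₂ (fun x y => _ • x + _ • y) (eb a) (ef a)).trans ?_
  rw [coordDeg_baseIdx, coordDeg_fibreIdx, smul_neg, smul_smul, ρ.self_fibre, map_smul, M.res_self,
    smul_smul, sub_mul, one_mul, sub_smul, sub_eq_add_neg]

/-- The induced density is pulled back from a function `t` on the base, `s²` or `1`, whose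
logarithmic derivative is `1 - ρ(i,i)` times that of `s` in either case. So the whole comparison
takes place on the base and is then pulled back. -/
lemma IsInducedVolume.exists_eq (hM : M.IsRhoManifold) {Q : M.VectorField q} {vol : M.VolumeForm}
    {vol' : (M.cotangent i).VolumeForm} (hvol : IsInducedVolume hM i vol vol') {D : M.sec ⊤}
    (hD : IsDivergence vol Q D) (α : M.Idx) :
    ∃ t : M.sec (M.dom α), vol'.s α = pullback hM i (M.dom α) t ∧
      t * ((1 - ρ i i) • M.res le_top D) = (1 - ρ i i) • (Q.coordDiv α le_rfl * t) + Q.app _ t := by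
  have e := (isDivergence_iff hM).1 hD α
  by_cases hi : ρ.IsOdd i
  · refine ⟨vol.s α * vol.s α, ?_, ?_⟩
    · rw [hvol α, if_pos hi]
      exact (sq _).trans (pullback_mul hM i _ _).symm
    · have c := (hM.isRhoComm _).commute_zero (vol.mem α) (Q.app_mem _ (vol.mem α))
      have c' := (hM.isRhoComm _).commute_zero (vol.mem α) (Q.coordDiv_mem hM α (le_refl (M.dom α)))
      rw [Q.app_mul_of_mem_zero (vol.mem α), ← c, show ρ i i = -1 from hi, sub_neg_eq_add,
        one_add_one_eq_two, ← two_smul K, mul_smul_comm, ← smul_add, mul_assoc, e, mul_add, ← mul_assoc,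
        ← mul_assoc, c']
  · refine ⟨1, ?_, ?_⟩
    · rw [hvol α, if_neg hi]
      exact (pullback_one hM i).symm
    · have h1 := Q.app_mul_of_mem_zero (M.one_mem (M.dom α)) 1
      rw [mul_one, mul_one, one_mul] at h1
      rw [ρ.self_of_not_isOdd hi, sub_self, zero_smul, zero_smul, mul_zero, zero_add,
        left_eq_add.1 h1]

theorem IsDivergence.hamiltonian (hM : M.IsRhoManifold) {Q : M.VectorField q}
    {F : (M.cotangent i).sec ⊤} (hF : IsSymbol hM i Q F) {Q' : (M.cotangent i).VectorField q}
    (hQ' : IsHamiltonian i F Q') {vol : M.VolumeForm} {vol' : (M.cotangent i).VolumeForm}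
    (hvol : IsInducedVolume hM i vol vol') {D : M.sec ⊤} (hD : IsDivergence vol Q D) :
    IsDivergence vol' Q' ((1 - ρ i i) • pullback hM i ⊤ D) := by
  refine (isDivergence_iff (isRhoManifold_cotangent hM i)).2 fun α => ?_
  obtain ⟨t, ht, e2⟩ := hvol.exists_eq hM hD α
  have e3 := congrArg (pullback hM i (M.dom α)) e2
  rw [pullback_mul, map_smul, map_add, map_smul, pullback_mul, ← smul_mul_assoc] at e3
  have r1 : (M.cotangent i).res (le_top : M.dom α ≤ ⊤) ((1 - ρ i i) • pullback hM i ⊤ D) =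
      (1 - ρ i i) • pullback hM i _ (M.res le_top D) :=
    (map_smul _ _ _).trans (congrArg _ (res_pullback hM i _ _))
  refine (congrArg₂ (fun x y : (M.cotangent i).sec (M.dom α) => x * y) ht r1).trans (e3.trans ?_)
  exact (congrArg₂ (fun x y : (M.cotangent i).sec (M.dom α) => x + y)
    (congrArg₂ (fun x y : (M.cotangent i).sec (M.dom α) => x * y) (hQ'.coordDiv hM hF α) ht)
    ((congrArg (Q'.app (M.dom α)) ht).trans (hQ'.app_pullback hM hF _ t))).symm

end RhoSpace

end RhoGeometry

end

/-! ### The theorem -/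

open RhoGeometry RhoGeometry.RhoSpace in
theorem mainTheorem3
    {𝕜 K : Type*} [RCLike 𝕜] [RCLike K] [NormedAlgebra 𝕜 K] {n : ℕ} {r : Regularity}
    {X : Type*} [TopologicalSpace X] [ConnectedSpace X]
    [ChartedSpace (EuclideanSpace 𝕜 (Fin n)) X]
    [IsManifold 𝓘(𝕜, EuclideanSpace 𝕜 (Fin n)) r.order X]
    {G : Type*} [AddCommGroup G] {ρ : CommutationFactor G K}
    {ι : Type*} [Fintype ι] [LinearOrder ι] {d : ι → G}
    (M : RhoSpace 𝕜 n r X ρ d) (hM : M.IsRhoManifold)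
    {q : G} (Q : M.VectorField q) (hQ : Q.IsHomological)
    (vol : M.VolumeForm) (i : G) :
    -- the degree-`i` shifted cotangent bundle is a `ρ`-manifold, on which `f_Q`, the homological
    -- vector field `⟦f_Q, -⟧` and the induced volume form are well defined
    (M.cotangent i).IsRhoManifold ∧
    (∃! F, IsSymbol hM i Q F) ∧
    (∀ F, IsSymbol hM i Q F → ∃! Q' : (M.cotangent i).VectorField q, IsHamiltonian i F Q') ∧
    (∃! vol', IsInducedVolume hM i vol vol') ∧
    ∀ (F : (M.cotangent i).sec ⊤) (Q' : (M.cotangent i).VectorField q)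
      (vol' : (M.cotangent i).VolumeForm),
      IsSymbol hM i Q F → IsHamiltonian i F Q' → IsInducedVolume hM i vol vol' →
      Q'.IsHomological ∧
      -- the divergences
      (∃! D, IsDivergence vol Q D) ∧ (∃! D', IsDivergence vol' Q' D') ∧
      (∀ D D', IsDivergence vol Q D → IsDivergence vol' Q' D' →
        D' = (1 - ρ i i) • pullback hM i ⊤ D) ∧
      -- the modular classes
      (∃! μ, IsModularClass vol Q μ) ∧ (∃! μ', IsModularClass vol' Q' μ') ∧
      ∃ h : ∀ f, Q'.app ⊤ (pullback hM i ⊤ f) = pullback hM i ⊤ (Q.app ⊤ f),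
        ∀ μ μ', IsModularClass vol Q μ → IsModularClass vol' Q' μ' →
          μ' = (1 - ρ i i) • cohomologyPullback hM i Q Q' h 1 μ := by
  refine ⟨isRhoManifold_cotangent hM i, existsUnique_isSymbol hM i Q,
    fun F hF => existsUnique_isHamiltonian hM hF, existsUnique_isInducedVolume hM i vol,
    fun F Q' vol' hF hQ' hvol => ?_⟩
  have hC := isRhoManifold_cotangent hM i
  have hQ'' := hQ'.isHomological hM hQ hF
  have key : ∀ D D', IsDivergence vol Q D → IsDivergence vol' Q' D' →
      D' = (1 - ρ i i) • pullback hM i ⊤ D := fun D D' hD hD' =>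
    hD'.unique hC (hD.hamiltonian hM hF hQ' hvol)
  refine ⟨hQ'', existsUnique_isDivergence hM vol Q, existsUnique_isDivergence hC vol' Q', key,
    existsUnique_isModularClass hM vol hQ, existsUnique_isModularClass hC vol' hQ'',
    hQ'.app_pullback hM hF ⊤, ?_⟩
  -- Both classes are represented by divergences, so the relation between these suffices; the
  -- induced map on classes is computed on representatives by definition.
  rintro μ μ' ⟨D, hD, hDiv, rfl⟩ ⟨D', hD', hDiv', rfl⟩
  obtain rfl := key D D' hDiv hDiv'
  rfl
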